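/- **Setting and notation.** $\|\cdot\|$ is the Euclidean norm on $\mathbb R^p$ and the spectral norm on $\mathcal M_p(\mathbb R)$; $\|\cdot\|_F$ is the Frobenius norm. * A random vector $Z$ of a normed space $E$ is *convexly $\alpha$-concentrated*, $Z\propto_c\alpha$, if for every quasiconvex $1$-Lipschitz $f:E\to\mathbb R$ and every independent copy $Z'$ of $Z$ one has $\mathbb P(|f(Z)-f(Z')|\ge t)\le\alpha(t)$ for all $t>0$. * For a deterministic $\tilde Z\in E$ we write $Z\in\tilde Z\pm\alpha$ in $(E,\|\cdot\|)$ if for every linear form $u$ on $E$ with $|u(\cdot)|\le\|\cdot\|$ one has $\mathbb P(|u(Z)-u(\tilde Z)|\ge t)\le\alpha(t)$ for all $t>0$. **Hypotheses.** Fix $C_0\ge e$, $c_0>0$, $q>0$, $M\in\mathbb R$, $K\in\mathbb N$ and $\kappa>0$. Let $p\ge 0$, $n\ge1$, $k\le K$ be integers and let $\mu_1,\dots,\mu_k$ be probability measures on $\mathbb R^p$ such that: 1. for all $m\in\mathbb N$, $1\le l\le k$ and independent $y_1,\dots,y_m\sim\mu_l$, $(y_1,\dots,y_m)\propto_c C_0e^{-(\cdot)^q/c_0}$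 in $(\mathcal M_{p,m},\|\cdot\|_F)$; 2. either $\mathbb E\|y_l\|\le M\sqrt p$ for every $l$, where $y_l\sim\mu_l$; or $q\ge2$ and $\|\mathbb E y_l\|\le M\sqrt p$ for every $l$. Let $x_1,\dots,x_n$ be independent random vectors, each $x_i$ having one of the laws $\mu_1,\dots,\mu_k$; let $n_l\ge1$ be the number of indices $i$ in class $l$ (those assigned the law $\mu_l$), and suppose $n_l\ge\kappa\sqrt n$ for every $l$. (This holds in particular if all proportions $n_l/n$ are at least $\kappa$.) Put $X=[x_1,\dots,x_n]$ and let $0<z_0<1$, $z\ge z_0$. Define $$Q=\Big(\tfrac1nXX^T+zI_p\Big)^{-1},\qquad \Sigma_l=\mathbb E[y_ly_l^T]\ \ (y_l\sim\mu_l),\qquad \bar\gamma=1+\frac pn .$$ For each $l$ let $Q_{-y_l}=\big(\tfrac1nXX^T-\tfrac1nx_ix_i^T+zI_p\big)^{-1}$, where $x_i$ is any one of the columns in class $l$ (the law of $Q_{-y_l}$ does not depend on which), and put $$\delta_l=\frac1n\operatorname{tr}\big(\Sigma_l\,\mathbb E Q_{-y_l}\big),\qquad \tilde Q_\delta=\Big(\sum_{l=1}^k\frac{n_l}{n}\frac{\Sigma_l}{1+\delta_l}+zI_p\Big)^{-1}.$$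 **Proposition.** There are constants $C\ge e$ and $c>0$, depending only on $C_0,c_0,q,M,K,\kappa$ (and not on $p,n,k$, the laws, the class sizes, $z_0$ or $z$), such that in the above setting $$\big\|\mathbb E Q-\tilde Q_\delta\big\|\le\frac{C\,\bar\gamma^2}{z_0^4\sqrt n},$$ and $$Q\in\tilde Q_\delta\pm C\exp\!\Big(-\frac1c\Big(\frac{z_0^4\sqrt n\;\cdot\;}{\bar\gamma^2}\Big)^q\Big)\quad\text{in }(\mathcal M_p,\|\cdot\|).$$ -/

import Mathlib

open MeasureTheory ProbabilityTheory
open scoped Matrix Matrix.Norms.L2Operator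

noncomputable section

namespace SampleCov

/-! ### Concentration of random vectors

The scoped norm on matrices opened above is the spectral norm `‖M‖ = sup_{‖u‖ ≤ 1} ‖M u‖`. -/

/-- Convex concentration `Z ∝_c α`, for a random vector `Z` of law `ν`: for every `1`-Lipschitz and
quasiconvex `f` and every independent copy `Z'` of `Z`, `P(|f(Z) - f(Z')| ≥ t) ≤ α(t)` for all
`t > 0`. -/
def ConvexlyConcentrated {E : Type*} [NormedAddCommGroup E] [NormedSpace ℝ E] [MeasurableSpace E]
    (ν : Measure E) (α : ℝ → ℝ) : Prop :=
  ∀ f : E → ℝ, LipschitzWith 1 f → QuasiconvexOn ℝ Set.univ f →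
    ∀ t : ℝ, 0 < t → (ν.prod ν) {x | t ≤ |f x.1 - f x.2|} ≤ ENNReal.ofReal (α t)

/-- Linear concentration `Z ∈ Ztilde ± α` in `(E, ‖·‖)`: for every linear form `u` of operator norm
at most one, `P(|u(Z) - u(Ztilde)| ≥ t) ≤ α(t)` for all `t > 0`. -/
def LinearlyConcentrated {Ω E : Type*} [MeasurableSpace Ω] [NormedAddCommGroup E] [NormedSpace ℝ E]
    (P : Measure Ω) (Z : Ω → E) (Ztilde : E) (α : ℝ → ℝ) : Prop :=
  ∀ u : E →L[ℝ] ℝ, ‖u‖ ≤ 1 →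
    ∀ t : ℝ, 0 < t → P {ω | t ≤ |u (Z ω) - u Ztilde|} ≤ ENNReal.ofReal (α t)

/-- The law of a `p × m` matrix `(y_1, …, y_m)` with independent columns of law `μ`. A matrix is
given by its columns, and the `ℓ²` norm of the columns' Euclidean norms is the Frobenius norm. -/
def iidMatrixLaw {p : ℕ} (μ : Measure (EuclideanSpace ℝ (Fin p))) (m : ℕ) :
    Measure (PiLp 2 fun _ : Fin m => EuclideanSpace ℝ (Fin p)) :=
  (Measure.pi fun _ : Fin m => μ).map (WithLp.toLp 2)

/-! ### Sample covariance and resolvents -/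

variable {p n k : ℕ}

/-- The matrix `M_{ab} = E[y_a y_b]`, that is `E[y yᵀ]` for `y` of law `μ`. -/
def secondMoment (μ : Measure (EuclideanSpace ℝ (Fin p))) : Matrix (Fin p) (Fin p) ℝ :=
  Matrix.of fun a b => ∫ y, y a * y b ∂μ

/-- The resolvent `Q_M(z) = (M + z I)⁻¹`. -/
def resolvent (M : Matrix (Fin p) (Fin p) ℝ) (z : ℝ) : Matrix (Fin p) (Fin p) ℝ :=
  (M + z • (1 : Matrix (Fin p) (Fin p) ℝ))⁻¹

/-- The matrix `X = [x_1, …, x_n]`. -/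
def dataMatrix (x : Fin n → EuclideanSpace ℝ (Fin p)) : Matrix (Fin p) (Fin n) ℝ :=
  Matrix.of fun a i => x i a

/-- The sample covariance `S = X Xᵀ / n`. -/
def sampleCov (x : Fin n → EuclideanSpace ℝ (Fin p)) : Matrix (Fin p) (Fin p) ℝ :=
  (n : ℝ)⁻¹ • (dataMatrix x * (dataMatrix x)ᵀ)

/-- The sample covariance deprived of the contribution of `x_i`: `S - x_i x_iᵀ / n`. -/
def sampleCovWithout (x : Fin n → EuclideanSpace ℝ (Fin p)) (i : Fin n) :
    Matrix (Fin p) (Fin p) ℝ :=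
  sampleCov x - (n : ℝ)⁻¹ • Matrix.of fun a b => x i a * x i b

/-- Entrywise expectation of a random matrix. -/
def matrixExpectation {Ω : Type*} [MeasurableSpace Ω] (P : Measure Ω)
    (M : Ω → Matrix (Fin p) (Fin p) ℝ) : Matrix (Fin p) (Fin p) ℝ :=
  Matrix.of fun a b => ∫ ω, M ω a b ∂P

/-- The number `n_l` of columns in the class `l`. -/
def classSize (cls : Fin n → Fin k) (l : Fin k) : ℕ :=
  (Finset.univ.filter fun i => cls i = l).card

/-- `δ_l = (1/n) tr(Σ_l E[Q_{-y_l}])`, where `y_l` is the column `x_{rep l}` and `Σ_l` is the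
second moment matrix of `μ_l`. -/
def delta {Ω : Type*} [MeasurableSpace Ω] (P : Measure Ω)
    (μ : Fin k → Measure (EuclideanSpace ℝ (Fin p)))
    (x : Fin n → Ω → EuclideanSpace ℝ (Fin p)) (rep : Fin k → Fin n) (z : ℝ) (l : Fin k) : ℝ :=
  (n : ℝ)⁻¹ * (secondMoment (μ l) *
    matrixExpectation P fun ω => resolvent (sampleCovWithout (fun i => x i ω) (rep l)) z).trace

/-- `Σ_δ = ∑_l (n_l / n) Σ_l / (1 + δ_l)`. -/
def weightedCov (μ : Fin k → Measure (EuclideanSpace ℝ (Fin p))) (cls : Fin n → Fin k)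
    (δ : Fin k → ℝ) : Matrix (Fin p) (Fin p) ℝ :=
  ∑ l, ((classSize cls l : ℝ) / n / (1 + δ l)) • secondMoment (μ l)

end SampleCov

end

/-! Both claims reduce to scalar ones. For the bias it suffices to bound ⟨u, (E Q − Q̃) v⟩ for u, v
in the unit ball, where Q̃ is the deterministic equivalent. For the concentration, a linear form of
norm at most one acts on symmetric matrices as ∑ⱼ wⱼ ⟨eⱼ, · eⱼ⟩ with ∑ |wⱼ| ≤ 1
(`exists_linear_form_eq_sum_inner`), so only quadratic forms ⟨e, Q e⟩ have to be concentrated around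
their expectations; the bias then moves the centre to Q̃.

Given the other columns, put A = Q_{-i}. Sherman–Morrison expresses Q through A and through two
kinds of observables of the column y = x_i: linear forms ⟨w, y⟩ and the root √⟨y, A y⟩. The root is
a seminorm dominated by z^{-1/2} ‖·‖, so both kinds are convex and Lipschitz and concentrate at a
scale free of the dimension. The obstacle is that the class means b may have norm of order √p, so
that Σ_l is not bounded. It is overcome by writing b as the average of the columns of its class up
to a centred sum: the resolvent tames the columns, since n⁻¹ ∑ⱼ ⟨xⱼ, A u⟩² ≤ ⟨u, A u⟩, and the
concentration of m i.i.d. columns controls the centred sum. Thus ⟨u, A b⟩² costs n/n_l instead of p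
(`IsGramResolvent.card_sq_mul_inner_sq_le`, `integral_looRes_mean_sq_le`).

Bias. With g = Q̃ v, the resolvent identity gives ⟨u, (Q − Q̃) v⟩ = −n⁻¹ ∑ᵢ Tᵢ, where Tᵢ = ⟨xᵢ, Q
u⟩⟨g, xᵢ⟩ − ⟨Q u, Σ g⟩/(1 + δ). By Sherman–Morrison, Tᵢ is a term of zero conditional mean plus a
remainder carrying n⁻¹⟨xᵢ, A xᵢ⟩ − δ and a rank-one correction (`abs_integral_column_bias_le`). The
fluctuation of the normalised trace comes from Efron–Stein for the covariance part and from the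
control of the mean for the rest (`integral_sub_looTrace_sq_le`); the hypothesis n_l ≥ κ√n makes the
latter of variance 1/n. A column of class l contributes (n/n_l)/√n, and there are n_l of them, so
every class costs the same.

Concentration. Integrating the coordinates one after another decomposes ⟨u, Q u⟩ into martingale
increments. The increment of column i is bounded, and on a typical event it is of size n⁻¹(√(n/n_l)
T + T²), where T has exponential moments of order q. For q ≤ 2 the increments are truncated at T² ≤
s√n and weighted by an exponent of order s^{q−1}√n; a column then costs s^q/n_l, the total cost is k
s^q, and the part cut off is of order exp(−ε (s√n)^{q/2}) up to polynomial factors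
(`exists_expApprox`, `exists_weighted_tail_le`). Exponential moments pass to convex combinations, so
the decomposition of a linear form costs no power of p. For q > 2 the hypothesis forces the columns
to be almost surely constant (`ConcLaw.ae_eq_mean`). -/

open scoped RealInnerProductSpace

namespace SampleCov

/-! ### Resolvents of Gram operators -/

section GramResolvent

variable {ι V : Type*} [Fintype ι] [NormedAddCommGroup V] [InnerProductSpace ℝ V]

/-- `A` is the inverse of `c ∑ᵢ xᵢ xᵢᵀ + z`. -/
def IsGramResolvent (c z : ℝ) (x : ι → V) (A : V →L[ℝ] V) : Prop :=
  ∀ v, c • ∑ i, ⟪x i, A v⟫ • x i + z • A v = v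

variable {c z : ℝ} {x : ι → V} {A : V →L[ℝ] V}

namespace IsGramResolvent

/-- Expanding u by the defining identity yields an expression symmetric in u and v. Symmetry and
positivity of A are both read off from it, without matrices or finite dimension. -/
lemma inner_left (h : IsGramResolvent c z x A) (u v : V) :
    ⟪u, A v⟫ = c * ∑ i, ⟪x i, A u⟫ * ⟪x i, A v⟫ + z * ⟪A u, A v⟫ := by
  conv_lhs => rw [← h u]
  simp [inner_add_left, inner_smul_left, sum_inner]

lemma symm (h : IsGramResolvent c z x A) (u v : V) : ⟪A u, v⟫ = ⟪u, A v⟫ := by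
  rw [real_inner_comm, h.inner_left v u, h.inner_left u v, real_inner_comm (A v)]
  simp only [mul_comm]

lemma inner_self (h : IsGramResolvent c z x A) (v : V) :
    ⟪v, A v⟫ = c * ∑ i, ⟪x i, A v⟫ ^ 2 + z * ‖A v‖ ^ 2 := by
  rw [h.inner_left v v, real_inner_self_eq_norm_sq]
  simp only [pow_two]

lemma sum_sq_le (h : IsGramResolvent c z x A) (hz : 0 < z) (v : V) :
    c * ∑ i, ⟪x i, A v⟫ ^ 2 ≤ ⟪v, A v⟫ := by
  rw [h.inner_self]; nlinarith [sq_nonneg ‖A v‖]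

lemma norm_sq_le (h : IsGramResolvent c z x A) (hc : 0 ≤ c) (v : V) :
    z * ‖A v‖ ^ 2 ≤ ⟪v, A v⟫ := by
  rw [h.inner_self]
  have : 0 ≤ c * ∑ i, ⟪x i, A v⟫ ^ 2 := by positivity
  linarith

lemma inner_nonneg (h : IsGramResolvent c z x A) (hc : 0 ≤ c) (hz : 0 < z) (v : V) :
    0 ≤ ⟪v, A v⟫ := le_trans (by positivity) (h.norm_sq_le hc v)

lemma norm_le (h : IsGramResolvent c z x A) (hc : 0 ≤ c) (hz : 0 < z) (v : V) :
    ‖A v‖ ≤ ‖v‖ / z := by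
  rw [le_div_iff₀ hz]
  have h1 := h.norm_sq_le hc v
  have h2 := real_inner_le_norm v (A v)
  by_cases h0 : ‖A v‖ = 0
  · rw [h0]; simp
  · have : 0 < ‖A v‖ := lt_of_le_of_ne (norm_nonneg _) (Ne.symm h0)
    nlinarith

lemma inner_le (h : IsGramResolvent c z x A) (hc : 0 ≤ c) (hz : 0 < z) (v : V) :
    ⟪v, A v⟫ ≤ ‖v‖ ^ 2 / z := by
  calc ⟪v, A v⟫ ≤ ‖v‖ * ‖A v‖ := real_inner_le_norm _ _
    _ ≤ ‖v‖ * (‖v‖ / z) := by gcongr; exact h.norm_le hc hz v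
    _ = ‖v‖ ^ 2 / z := by ring

lemma inner_sq_le (h : IsGramResolvent c z x A) (hc : 0 ≤ c) (hz : 0 < z) (u v : V) :
    ⟪u, A v⟫ ^ 2 ≤ ⟪u, A u⟫ * ⟪v, A v⟫ := by
  have key : ∀ t : ℝ, 0 ≤ ⟪v, A v⟫ * (t * t) + 2 * ⟪u, A v⟫ * t + ⟪u, A u⟫ := by
    intro t
    have := h.inner_nonneg hc hz (u + t • v)
    have h2 : ⟪v, A u⟫ = ⟪u, A v⟫ := by rw [← h.symm, real_inner_comm]
    simp only [map_add, map_smul, inner_add_left, inner_add_right, inner_smul_left,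
      inner_smul_right, h2] at this
    simp at this
    linarith
  have := discrim_le_zero key
  unfold discrim at this
  nlinarith

/-- The seminorm `v ↦ √⟪v, A v⟫` is subadditive. -/
lemma sqrt_inner_add_le (h : IsGramResolvent c z x A) (hc : 0 ≤ c) (hz : 0 < z) (u v : V) :
    √⟪u + v, A (u + v)⟫ ≤ √⟪u, A u⟫ + √⟪v, A v⟫ := by
  have hu := h.inner_nonneg hc hz u
  have hv := h.inner_nonneg hc hz v
  apply Real.sqrt_le_iff.2 ⟨by positivity, ?_⟩
  have h1 : ⟪u, A v⟫ ≤ √⟪u, A u⟫ * √⟪v, A v⟫ := by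
    rw [← Real.sqrt_mul hu]
    exact Real.le_sqrt_of_sq_le (h.inner_sq_le hc hz u v)
  have h2 : ⟪v, A u⟫ = ⟪u, A v⟫ := by rw [← h.symm, real_inner_comm]
  rw [map_add, inner_add_left, inner_add_right, inner_add_right, h2, add_sq, Real.sq_sqrt hu,
    Real.sq_sqrt hv]
  linarith

variable [DecidableEq ι]

/-- If M' denotes the operator without x_i, the identity for A says that M' (A v) = v − c⟨x_i, A v⟩
x_i, and it remains to apply A'. That A' is also a left inverse of M' comes from pairing with w and
using the symmetry of A'. -/
lemma sub_apply {A' : V →L[ℝ] V} {i : ι} (h : IsGramResolvent c z x A)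
    (h' : IsGramResolvent c z (Function.update x i 0) A') (v : V) :
    A' v - A v = (c * ⟪x i, A v⟫) • A' (x i) := by
  have e : c • ∑ j, ⟪Function.update x i 0 j, A v⟫ • Function.update x i 0 j + z • A v
      = v - (c * ⟪x i, A v⟫) • x i := by
    have h1 := h v
    rw [← Finset.add_sum_erase _ _ (Finset.mem_univ i)] at h1 ⊢
    have h2 : ∑ j ∈ Finset.univ.erase i,
        ⟪Function.update x i 0 j, A v⟫ • Function.update x i 0 j
        = ∑ j ∈ Finset.univ.erase i, ⟪x j, A v⟫ • x j := by
      refine Finset.sum_congr rfl fun j hj => ?_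
      rw [Function.update_of_ne (Finset.ne_of_mem_erase hj)]
    rw [h2, Function.update_self, smul_zero, zero_add]
    rw [smul_add] at h1
    rw [eq_sub_iff_add_eq, mul_smul]
    exact (by abel : _ = _).trans h1
  have key : ∀ w : V, ⟪w, A v⟫ = ⟪w, A' v - (c * ⟪x i, A v⟫) • A' (x i)⟫ := by
    intro w
    have h3 : ⟪A' w, v - (c * ⟪x i, A v⟫) • x i⟫ = ⟪w, A v⟫ := by
      rw [← e]
      conv_rhs => rw [← h' w]
      simp only [inner_add_left, inner_add_right, inner_smul_left, inner_smul_right, sum_inner,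
        inner_sum, conj_trivial]
      congr 2
      refine Finset.sum_congr rfl fun j _ => ?_
      rw [real_inner_comm (A' w)]; ring
    rw [← h3, h'.symm, map_sub, map_smul]
  rw [sub_eq_iff_eq_add, ← sub_eq_iff_eq_add']
  exact (ext_inner_left ℝ key).symm

lemma inner_apply_self {A' : V →L[ℝ] V} {i : ι} (h : IsGramResolvent c z x A)
    (h' : IsGramResolvent c z (Function.update x i 0) A') (hc : 0 ≤ c) (hz : 0 < z) (v : V) :
    ⟪x i, A v⟫ = ⟪x i, A' v⟫ / (1 + c * ⟪x i, A' (x i)⟫) := by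
  have h1 := congrArg (fun w => ⟪x i, w⟫) (h.sub_apply h' v)
  simp only [inner_sub_right, inner_smul_right] at h1
  have := mul_nonneg hc (h'.inner_nonneg hc hz (x i))
  rw [eq_div_iff (by positivity)]
  linarith

/-- The Sherman–Morrison formula. -/
lemma apply_eq {A' : V →L[ℝ] V} {i : ι} (h : IsGramResolvent c z x A)
    (h' : IsGramResolvent c z (Function.update x i 0) A') (hc : 0 ≤ c) (hz : 0 < z) (v : V) :
    A v = A' v - (c * (⟪x i, A' v⟫ / (1 + c * ⟪x i, A' (x i)⟫))) • A' (x i) := by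
  rw [← h.inner_apply_self h' hc hz v, ← h.sub_apply h' v]; abel

end IsGramResolvent

end GramResolvent

/-! ### The resolvent of the sample covariance as an operator -/

variable {p n k : ℕ}

/-- The operator on Euclidean space given by a matrix. -/
noncomputable abbrev matOp (M : Matrix (Fin p) (Fin p) ℝ) :
    EuclideanSpace ℝ (Fin p) →L[ℝ] EuclideanSpace ℝ (Fin p) :=
  Matrix.toEuclideanCLM (𝕜 := ℝ) (n := Fin p) M

lemma matOp_apply (M : Matrix (Fin p) (Fin p) ℝ) (v : EuclideanSpace ℝ (Fin p)) (a : Fin p) :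
    matOp M v a = ∑ b, M a b * v b := by
  rw [matOp, ← WithLp.toLp_ofLp (p := 2) v, Matrix.toEuclideanCLM_toLp]
  simp [Matrix.mulVec, dotProduct]

lemma inner_matOp (M : Matrix (Fin p) (Fin p) ℝ) (u v : EuclideanSpace ℝ (Fin p)) :
    ⟪u, matOp M v⟫ = ∑ a, ∑ b, u a * M a b * v b := by
  rw [PiLp.inner_apply]
  refine Finset.sum_congr rfl fun a _ => ?_
  rw [matOp_apply]
  simp only [RCLike.inner_apply, conj_trivial, Finset.sum_mul]
  exact Finset.sum_congr rfl fun b _ => by ring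

lemma posDef_add_smul_one {M : Matrix (Fin p) (Fin p) ℝ} (hM : M.PosSemidef) {z : ℝ}
    (hz : 0 < z) : (M + z • (1 : Matrix (Fin p) (Fin p) ℝ)).PosDef :=
  Matrix.PosDef.posSemidef_add hM (Matrix.PosDef.one.smul hz)

lemma matOp_resolvent {M : Matrix (Fin p) (Fin p) ℝ} (hM : M.PosSemidef) {z : ℝ} (hz : 0 < z)
    (v : EuclideanSpace ℝ (Fin p)) :
    matOp M (matOp (resolvent M z) v) + z • matOp (resolvent M z) v = v := by
  have h : (M + z • (1 : Matrix (Fin p) (Fin p) ℝ)) * resolvent M z = 1 :=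
    Matrix.mul_nonsing_inv _ ((Matrix.isUnit_iff_isUnit_det _).1 (posDef_add_smul_one hM hz).isUnit)
  have h2 := congrArg (fun N => Matrix.toEuclideanCLM (𝕜 := ℝ) (n := Fin p) N v) h
  simpa [add_mul] using h2

lemma sampleCov_posSemidef (x : Fin n → EuclideanSpace ℝ (Fin p)) :
    (sampleCov x).PosSemidef := by
  unfold sampleCov
  refine Matrix.PosSemidef.smul ?_ (by positivity)
  simpa using Matrix.posSemidef_self_mul_conjTranspose (dataMatrix x)

lemma matOp_sampleCov (x : Fin n → EuclideanSpace ℝ (Fin p)) (v : EuclideanSpace ℝ (Fin p)) :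
    matOp (sampleCov x) v = (n : ℝ)⁻¹ • ∑ i, ⟪x i, v⟫ • x i := by
  ext a
  rw [matOp_apply]
  simp only [sampleCov, dataMatrix, Matrix.smul_apply, Matrix.mul_apply, Matrix.transpose_apply,
    Matrix.of_apply, smul_eq_mul, PiLp.smul_apply, WithLp.ofLp_sum, Finset.sum_apply,
    PiLp.inner_apply, RCLike.inner_apply, conj_trivial, WithLp.ofLp_smul, Pi.smul_apply]
  simp only [Finset.mul_sum, Finset.sum_mul]
  rw [Finset.sum_comm]
  refine Finset.sum_congr rfl fun i _ => Finset.sum_congr rfl fun b _ => ?_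
  ring

/-- The operator `Q(x) = (n⁻¹ ∑ᵢ xᵢ xᵢᵀ + z)⁻¹`. -/
noncomputable def covRes (z : ℝ) (x : Fin n → EuclideanSpace ℝ (Fin p)) :
    EuclideanSpace ℝ (Fin p) →L[ℝ] EuclideanSpace ℝ (Fin p) :=
  matOp (resolvent (sampleCov x) z)

lemma isGramResolvent_covRes {z : ℝ} (hz : 0 < z) (x : Fin n → EuclideanSpace ℝ (Fin p)) :
    IsGramResolvent (n : ℝ)⁻¹ z x (covRes z x) := by
  intro v
  rw [← matOp_sampleCov]
  exact matOp_resolvent (sampleCov_posSemidef x) hz v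

lemma sampleCovWithout_eq (x : Fin n → EuclideanSpace ℝ (Fin p)) (i : Fin n) :
    sampleCovWithout x i = sampleCov (Function.update x i 0) := by
  ext a b
  simp only [sampleCovWithout, sampleCov, dataMatrix, Matrix.sub_apply, Matrix.smul_apply,
    Matrix.mul_apply, Matrix.of_apply, Matrix.transpose_apply, smul_eq_mul, ← mul_sub]
  congr 1
  rw [← Finset.add_sum_erase _ _ (Finset.mem_univ i),
    ← Finset.add_sum_erase _ _ (Finset.mem_univ i)]
  simp only [Function.update_self, add_sub_cancel_left]
  simp only [PiLp.zero_apply, mul_zero, zero_add]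
  refine Finset.sum_congr rfl fun j hj => ?_
  rw [Function.update_of_ne (Finset.ne_of_mem_erase hj)]

lemma continuous_resolvent_sampleCov {z : ℝ} (hz : 0 < z) :
    Continuous fun x : Fin n → EuclideanSpace ℝ (Fin p) => resolvent (sampleCov x) z := by
  have hM : Continuous fun x : Fin n → EuclideanSpace ℝ (Fin p) =>
      sampleCov x + z • (1 : Matrix (Fin p) (Fin p) ℝ) := by
    have h1 : Continuous fun x : Fin n → EuclideanSpace ℝ (Fin p) => dataMatrix x :=
      continuous_matrix fun a i => by simp only [dataMatrix, Matrix.of_apply]; fun_prop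
    have h2 : Continuous fun x : Fin n → EuclideanSpace ℝ (Fin p) => sampleCov x :=
      (h1.matrix_mul h1.matrix_transpose).const_smul ((n : ℝ)⁻¹)
    exact h2.add continuous_const
  have e : (fun x : Fin n → EuclideanSpace ℝ (Fin p) => resolvent (sampleCov x) z) = fun x =>
      ((sampleCov x + z • (1 : Matrix (Fin p) (Fin p) ℝ)).det)⁻¹ •
        (sampleCov x + z • (1 : Matrix (Fin p) (Fin p) ℝ)).adjugate := by
    ext x : 1
    rw [resolvent, Matrix.inv_def, Ring.inverse_eq_inv']
  rw [e]
  refine Continuous.smul (Continuous.inv₀ hM.matrix_det fun x => ?_) hM.matrix_adjugate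
  exact (posDef_add_smul_one (sampleCov_posSemidef x) hz).det_pos.ne'

lemma continuous_covRes {z : ℝ} (hz : 0 < z) :
    Continuous fun x : Fin n → EuclideanSpace ℝ (Fin p) => covRes z x := by
  have : Continuous fun M : Matrix (Fin p) (Fin p) ℝ => matOp M :=
    LinearMap.continuous_of_finiteDimensional
      ((Matrix.toEuclideanCLM (𝕜 := ℝ) (n := Fin p)).toAlgEquiv.toLinearMap)
  exact this.comp (continuous_resolvent_sampleCov hz)

end SampleCov

namespace SampleCov

/-! ### Exponential moments of concentrated observables -/

lemma exists_pow_le_exp_rpow (j : ℕ) {ε q : ℝ} (hε : 0 < ε) (hq : 0 < q) :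
    ∃ B : ℝ, 1 ≤ B ∧ ∀ t : ℝ, 0 ≤ t → t ^ j ≤ B * Real.exp (ε * t ^ q) := by
  obtain ⟨N, hN⟩ := exists_nat_ge ((j : ℝ) / q)
  refine ⟨1 + N.factorial / ε ^ N, by linarith [show 0 ≤ N.factorial / ε ^ N by positivity],
    fun t ht => ?_⟩
  have hx : 0 ≤ ε * t ^ q := by positivity
  have h1 : 1 ≤ Real.exp (ε * t ^ q) := Real.one_le_exp hx
  have h2 : 0 ≤ N.factorial / ε ^ N := by positivity
  rcases le_total t 1 with h | h
  · calc t ^ j ≤ 1 := pow_le_one₀ ht h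
      _ ≤ (1 + N.factorial / ε ^ N) * Real.exp (ε * t ^ q) := by nlinarith
  · have h3 : t ^ j ≤ (t ^ q) ^ N := by
      rw [← Real.rpow_natCast, ← Real.rpow_natCast, ← Real.rpow_mul ht]
      apply Real.rpow_le_rpow_of_exponent_le h
      rw [div_le_iff₀ hq] at hN
      linarith
    have h4 := Real.pow_div_factorial_le_exp _ hx N
    have h5 : (t ^ q) ^ N ≤ N.factorial / ε ^ N * Real.exp (ε * t ^ q) := by
      rw [mul_pow, div_le_iff₀ (by positivity)] at h4
      rw [div_mul_eq_mul_div, le_div_iff₀ (by positivity)]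
      linarith
    nlinarith

lemma add_rpow_le_two_rpow_mul {a b q : ℝ} (ha : 0 ≤ a) (hb : 0 ≤ b) (hq : 0 < q) :
    (a + b) ^ q ≤ 2 ^ q * (a ^ q + b ^ q) := by
  have h1 : a + b ≤ 2 * max a b := by linarith [le_max_left a b, le_max_right a b]
  calc (a + b) ^ q ≤ (2 * max a b) ^ q := Real.rpow_le_rpow (by positivity) h1 hq.le
    _ = 2 ^ q * (max a b) ^ q := Real.mul_rpow (by norm_num) (le_max_of_le_left ha)
    _ ≤ 2 ^ q * (a ^ q + b ^ q) := by
      gcongr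
      rcases max_choice a b with h | h <;> rw [h]
      · linarith [Real.rpow_nonneg hb q]
      · linarith [Real.rpow_nonneg ha q]

/-- Layer-cake formula. Giving up half of the rate makes exp(T^q/(2c₀)) exceed a level t > 1 with
probability at most C₀ t⁻², which is integrable; the levels below 1 contribute at most 1. -/
lemma lintegral_exp_le_of_tail {α : Type*} [MeasurableSpace α] (ρ : Measure α)
    [IsProbabilityMeasure ρ] {T : α → ℝ} (hT : Measurable T) {C₀ c₀ q : ℝ} (hC : 0 ≤ C₀)
    (hc : 0 < c₀) (hq : 0 < q)
    (h : ∀ t, 0 < t → ρ {ω | t ≤ T ω} ≤ ENNReal.ofReal (C₀ * Real.exp (-(t ^ q / c₀))))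
    (hT0 : ∀ ω, 0 ≤ T ω) :
    ∫⁻ ω, ENNReal.ofReal (Real.exp (T ω ^ q / (2 * c₀))) ∂ρ ≤ ENNReal.ofReal (1 + C₀) := by
  rw [lintegral_eq_lintegral_meas_le ρ (Filter.Eventually.of_forall fun ω => (Real.exp_pos _).le)
    (by fun_prop)]
  have hsplit : Set.Ioi (0 : ℝ) = Set.Ioc 0 1 ∪ Set.Ioi 1 :=
    (Set.Ioc_union_Ioi_eq_Ioi zero_le_one).symm
  have h1 : ∫⁻ t in Set.Ioc (0 : ℝ) 1, ρ {ω | t ≤ Real.exp (T ω ^ q / (2 * c₀))} ≤ 1 := by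
    calc _ ≤ ∫⁻ t in Set.Ioc (0 : ℝ) 1, 1 := lintegral_mono fun t => prob_le_one
      _ = 1 := by simp
  have h2 : ∫⁻ t in Set.Ioi (1 : ℝ), ρ {ω | t ≤ Real.exp (T ω ^ q / (2 * c₀))}
      ≤ ENNReal.ofReal C₀ := by
    have hi : IntegrableOn (fun t : ℝ => C₀ * t ^ (-2 : ℝ)) (Set.Ioi 1) :=
      (integrableOn_Ioi_rpow_of_lt (by norm_num) one_pos).const_mul _
    have hval : ∫ t in Set.Ioi (1 : ℝ), C₀ * t ^ (-2 : ℝ) = C₀ := by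
      rw [integral_const_mul, integral_Ioi_rpow_of_lt (by norm_num) one_pos]
      norm_num
    calc _ ≤ ∫⁻ t in Set.Ioi (1 : ℝ), ENNReal.ofReal (C₀ * t ^ (-2 : ℝ)) := by
          refine setLIntegral_mono' measurableSet_Ioi fun t (ht : 1 < t) => ?_
          have hl : 0 < Real.log t := Real.log_pos ht
          have hs : 0 < (2 * c₀ * Real.log t) ^ q⁻¹ := by positivity
          have hsub : {ω | t ≤ Real.exp (T ω ^ q / (2 * c₀))} ⊆
              {ω | (2 * c₀ * Real.log t) ^ q⁻¹ ≤ T ω} := by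
            intro ω hω
            simp only [Set.mem_ofPred_eq] at hω ⊢
            have := (Real.log_le_iff_le_exp (by linarith)).2 hω
            rw [le_div_iff₀ (by positivity)] at this
            calc (2 * c₀ * Real.log t) ^ q⁻¹ ≤ (T ω ^ q) ^ q⁻¹ :=
                  Real.rpow_le_rpow (by positivity) (by linarith) (by positivity)
              _ = T ω := Real.rpow_rpow_inv (hT0 ω) hq.ne'
          refine (measure_mono hsub).trans ((h _ hs).trans ?_)
          rw [Real.rpow_inv_rpow (by positivity) hq.ne']
          apply ENNReal.ofReal_le_ofReal
          apply mul_le_mul_of_nonneg_left _ hC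
          rw [Real.rpow_def_of_pos (by linarith)]
          apply Real.exp_le_exp.2
          apply le_of_eq
          field_simp
      _ = ENNReal.ofReal C₀ := by
          rw [← ofReal_integral_eq_lintegral_ofReal hi, hval]
          refine (ae_restrict_iff' measurableSet_Ioi).2 (Filter.Eventually.of_forall fun t ht => ?_)
          have : (0 : ℝ) < t := lt_trans one_pos ht
          show 0 ≤ C₀ * t ^ (-2 : ℝ)
          positivity
  rw [hsplit, lintegral_union measurableSet_Ioi
    (Set.disjoint_left.2 fun t ht h' => not_lt.2 ht.2 h')]
  rw [ENNReal.ofReal_add zero_le_one hC, ENNReal.ofReal_one]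
  exact add_le_add h1 h2

/-- The observable `f` has exponential moments of order `q` around its mean. -/
def ExpConc {α : Type*} [MeasurableSpace α] (ν : Measure α) (f : α → ℝ) (q ε B : ℝ) : Prop :=
  Integrable f ν ∧ Integrable (fun x => Real.exp (ε * |f x - ∫ y, f y ∂ν| ^ q)) ν ∧
    ∫ x, Real.exp (ε * |f x - ∫ y, f y ∂ν| ^ q) ∂ν ≤ B

/-- By Fubini the exponential moment of |f(x) − f(y)| over pairs is an average over y, so that some
value f(y) can serve as a centre. -/
lemma exists_center {α : Type*} [MeasurableSpace α] (ν : Measure α)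
    [IsProbabilityMeasure ν] {f : α → ℝ} (hf : Measurable f) {C₀ c₀ q : ℝ} (hC : 0 ≤ C₀)
    (hc : 0 < c₀) (hq : 0 < q)
    (h : ∀ t, 0 < t → (ν.prod ν) {x | t ≤ |f x.1 - f x.2|} ≤
      ENNReal.ofReal (C₀ * Real.exp (-(t ^ q / c₀)))) :
    ∃ c : ℝ, Integrable (fun x => Real.exp (|f x - c| ^ q / (2 * c₀))) ν ∧
      ∫ x, Real.exp (|f x - c| ^ q / (2 * c₀)) ∂ν ≤ 1 + C₀ := by
  have h1 := lintegral_exp_le_of_tail (ν.prod ν) (T := fun x => |f x.1 - f x.2|) (by fun_prop)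
    hC hc hq h (fun _ => abs_nonneg _)
  rw [lintegral_prod_symm _ (by fun_prop)] at h1
  obtain ⟨y, hy⟩ := exists_le_lintegral (μ := ν)
    (f := fun y => ∫⁻ x, ENNReal.ofReal (Real.exp (|f x - f y| ^ q / (2 * c₀))) ∂ν)
    (Measurable.aemeasurable (by fun_prop))
  have hy2 := hy.trans h1
  have hm : Measurable fun x => Real.exp (|f x - f y| ^ q / (2 * c₀)) := by fun_prop
  refine ⟨f y, ⟨hm.aestronglyMeasurable, ?_⟩, ?_⟩
  · rw [hasFiniteIntegral_iff_ofReal (Filter.Eventually.of_forall fun _ => (Real.exp_pos _).le)]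
    exact lt_of_le_of_lt hy2 ENNReal.ofReal_lt_top
  · rw [integral_eq_lintegral_of_nonneg_ae
      (Filter.Eventually.of_forall fun _ => (Real.exp_pos _).le) hm.aestronglyMeasurable]
    exact ENNReal.toReal_le_of_le_ofReal (by linarith) hy2

/-- The mean replaces the centre of `exists_center`: their distance is at most a first moment,
itself dominated by the exponential one, and the quasi-triangle inequality for t^q costs 2^q in the
rate. -/
lemma exists_expConc_const {C₀ c₀ q : ℝ} (hC : 0 ≤ C₀) (hc : 0 < c₀) (hq : 0 < q) :
    ∃ ε B : ℝ, 0 < ε ∧ 1 ≤ B ∧ ∀ {α : Type} [MeasurableSpace α] (ν : Measure α)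
      [IsProbabilityMeasure ν] (f : α → ℝ), Measurable f →
      (∀ t, 0 < t → (ν.prod ν) {x | t ≤ |f x.1 - f x.2|} ≤
        ENNReal.ofReal (C₀ * Real.exp (-(t ^ q / c₀)))) → ExpConc ν f q ε B := by
  obtain ⟨D, hD1, hD⟩ := exists_pow_le_exp_rpow 1 (ε := 1 / (2 * c₀)) (by positivity) hq
  set a : ℝ := D * (1 + C₀) with ha
  have ha0 : 0 ≤ a := by positivity
  refine ⟨1 / (2 * c₀) / 2 ^ q, (1 + C₀) * Real.exp (1 / (2 * c₀) * a ^ q), by positivity, ?_, ?_⟩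
  · have : 1 ≤ Real.exp (1 / (2 * c₀) * a ^ q) := Real.one_le_exp (by positivity)
    nlinarith
  intro α _ ν _ f hf h
  obtain ⟨c, hi, hc'⟩ := exists_center ν hf hC hc hq h
  have hif : Integrable (fun x => f x - c) ν := by
    refine Integrable.mono' (hi.const_mul D) (by fun_prop)
      (Filter.Eventually.of_forall fun x => ?_)
    have := hD |f x - c| (abs_nonneg _)
    rw [Real.norm_eq_abs]
    simpa [div_eq_inv_mul] using this
  have hif' : Integrable f ν := by
    have := hif.add (integrable_const c)
    refine this.congr (Filter.Eventually.of_forall fun x => by simp)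
  have hmean : |c - ∫ y, f y ∂ν| ≤ a := by
    have e : (∫ y, f y ∂ν) - c = ∫ y, (f y - c) ∂ν := by
      rw [integral_sub hif' (integrable_const c)]; simp
    rw [abs_sub_comm, e]
    calc |∫ y, (f y - c) ∂ν| ≤ ∫ y, |f y - c| ∂ν := abs_integral_le_integral_abs
      _ ≤ ∫ y, D * Real.exp (|f y - c| ^ q / (2 * c₀)) ∂ν := by
        refine integral_mono hif.abs (hi.const_mul D) fun x => ?_
        have := hD |f x - c| (abs_nonneg _)
        simpa [div_eq_inv_mul] using this
      _ ≤ a := by rw [integral_const_mul]; exact mul_le_mul_of_nonneg_left hc' (by linarith)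
  have hpt : ∀ x, Real.exp (1 / (2 * c₀) / 2 ^ q * |f x - ∫ y, f y ∂ν| ^ q) ≤
      Real.exp (1 / (2 * c₀) * a ^ q) * Real.exp (|f x - c| ^ q / (2 * c₀)) := by
    intro x
    rw [← Real.exp_add]
    apply Real.exp_le_exp.2
    have h1 : |f x - ∫ y, f y ∂ν| ≤ |f x - c| + a :=
      (abs_sub_le _ c _).trans (by linarith)
    have h2 : |f x - ∫ y, f y ∂ν| ^ q ≤ 2 ^ q * (|f x - c| ^ q + a ^ q) :=
      (Real.rpow_le_rpow (abs_nonneg _) h1 hq.le).trans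
        (add_rpow_le_two_rpow_mul (abs_nonneg _) ha0 hq)
    calc 1 / (2 * c₀) / 2 ^ q * |f x - ∫ y, f y ∂ν| ^ q
        ≤ 1 / (2 * c₀) / 2 ^ q * (2 ^ q * (|f x - c| ^ q + a ^ q)) := by gcongr
      _ = _ := by field_simp; ring
  have hint : Integrable (fun x => Real.exp (1 / (2 * c₀) / 2 ^ q * |f x - ∫ y, f y ∂ν| ^ q)) ν :=
    Integrable.mono' (hi.const_mul _) (Measurable.aestronglyMeasurable (by fun_prop)) (Filter.Eventually.of_forall fun x => by
      rw [Real.norm_eq_abs, abs_of_pos (Real.exp_pos _)]; exact hpt x)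
  refine ⟨hif', hint, ?_⟩
  calc _ ≤ ∫ x, Real.exp (1 / (2 * c₀) * a ^ q) * Real.exp (|f x - c| ^ q / (2 * c₀)) ∂ν :=
        integral_mono hint (hi.const_mul _) hpt
    _ ≤ (1 + C₀) * Real.exp (1 / (2 * c₀) * a ^ q) := by
      rw [integral_const_mul, mul_comm]; gcongr

/-- Every convex observable of `m` independent columns of law `μ` that is `1`-Lipschitz for the
Frobenius norm has exponential moments around its mean. -/
def ColumnConc {p : ℕ} (μ : Measure (EuclideanSpace ℝ (Fin p))) (m : ℕ) (q ε B : ℝ) : Prop :=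
  ∀ f : (Fin m → EuclideanSpace ℝ (Fin p)) → ℝ,
    LipschitzWith 1 (fun y : PiLp 2 fun _ : Fin m => EuclideanSpace ℝ (Fin p) => f y.ofLp) →
    ConvexOn ℝ Set.univ f → ExpConc (Measure.pi fun _ => μ) f q ε B

lemma exists_columnConc_const {C₀ c₀ q : ℝ} (hC : 0 ≤ C₀) (hc : 0 < c₀) (hq : 0 < q) :
    ∃ ε B : ℝ, 0 < ε ∧ 1 ≤ B ∧ ∀ {p : ℕ} (μ : Measure (EuclideanSpace ℝ (Fin p)))
      [IsProbabilityMeasure μ] (m : ℕ), ConvexlyConcentrated (iidMatrixLaw μ m)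
        (fun t => C₀ * Real.exp (-(t ^ q / c₀))) → ColumnConc μ m q ε B := by
  obtain ⟨ε, B, hε, hB, H⟩ := exists_expConc_const hC hc hq
  refine ⟨ε, B, hε, hB, fun {p} μ _ m h f hf hconv => ?_⟩
  have hcont : Continuous f := by
    have := hf.continuous.comp (PiLp.continuous_toLp 2 (fun _ : Fin m => EuclideanSpace ℝ (Fin p)))
    exact this
  refine H _ f hcont.measurable fun t ht => ?_
  have hq' : QuasiconvexOn ℝ Set.univ
      (fun y : PiLp 2 fun _ : Fin m => EuclideanSpace ℝ (Fin p) => f y.ofLp) := by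
    have : ConvexOn ℝ Set.univ
      (fun y : PiLp 2 fun _ : Fin m => EuclideanSpace ℝ (Fin p) => f y.ofLp) :=
      ⟨convex_univ, fun x _ y _ a b ha hb hab => by
        simpa using hconv.2 (Set.mem_univ x.ofLp) (Set.mem_univ y.ofLp) ha hb hab⟩
    exact this.quasiconvexOn
  have h1 := h _ hf hq' t ht
  refine le_trans (le_of_eq ?_) h1
  have hm := WithLp.measurable_toLp 2 (Fin m → EuclideanSpace ℝ (Fin p))
  have hmf : Measurable (fun y : PiLp 2 fun _ : Fin m => EuclideanSpace ℝ (Fin p) => f y.ofLp) :=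
    hf.continuous.measurable
  have e : (iidMatrixLaw μ m).prod (iidMatrixLaw μ m) =
      ((Measure.pi fun _ : Fin m => μ).prod (Measure.pi fun _ : Fin m => μ)).map
        (Prod.map (WithLp.toLp 2) (WithLp.toLp 2)) := Measure.map_prod_map _ _ hm hm
  rw [e, Measure.map_apply (by fun_prop)]
  · rfl
  · exact measurableSet_le measurable_const (by fun_prop)

lemma ExpConc.moment {α : Type*} [MeasurableSpace α] {ν : Measure α} {f : α → ℝ}
    {q ε B D : ℝ} (h : ExpConc ν f q ε B) (hf : AEStronglyMeasurable f ν) {j : ℕ} (hD0 : 0 ≤ D)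
    (hD : ∀ t : ℝ, 0 ≤ t → t ^ j ≤ D * Real.exp (ε * t ^ q)) :
    Integrable (fun x => |f x - ∫ y, f y ∂ν| ^ j) ν ∧
      ∫ x, |f x - ∫ y, f y ∂ν| ^ j ∂ν ≤ D * B := by
  have hi : Integrable (fun x => |f x - ∫ y, f y ∂ν| ^ j) ν :=
    Integrable.mono' (h.2.1.const_mul D) (by fun_prop) (Filter.Eventually.of_forall fun x => by
      rw [Real.norm_eq_abs, abs_of_nonneg (by positivity)]; exact hD _ (abs_nonneg _))
  refine ⟨hi, ?_⟩
  calc _ ≤ ∫ x, D * Real.exp (ε * |f x - ∫ y, f y ∂ν| ^ q) ∂ν :=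
        integral_mono hi (h.2.1.const_mul D) fun x => hD _ (abs_nonneg _)
    _ ≤ D * B := by rw [integral_const_mul]; exact mul_le_mul_of_nonneg_left h.2.2 hD0

end SampleCov

namespace SampleCov

/-! ### Partial integration on product spaces -/

section Product

variable {ι V : Type*} [Fintype ι] [DecidableEq ι] [MeasurableSpace V] {m : ι → Measure V}

/-- Integration of `f` with respect to the coordinate `i`. -/
noncomputable def condInt (m : ι → Measure V) (i : ι) (f : (ι → V) → ℝ) (x : ι → V) : ℝ :=
  ∫ y, f (Function.update x i y) ∂(m i)

omit [Fintype ι] in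
lemma measurable_update_prod (i : ι) :
    Measurable fun q : (ι → V) × V => Function.update q.1 i q.2 := by
  refine measurable_pi_lambda _ fun j => ?_
  by_cases h : j = i
  · subst h; simpa using measurable_snd
  · simp only [Function.update_of_ne h]; fun_prop

lemma map_update_prod (m : ι → Measure V) [∀ i, IsProbabilityMeasure (m i)] (i : ι) :
    ((Measure.pi m).prod (m i)).map (fun q : (ι → V) × V => Function.update q.1 i q.2) =
      Measure.pi m := by
  symm
  refine Measure.pi_eq fun s hs => ?_
  rw [Measure.map_apply (measurable_update_prod i) (MeasurableSet.univ_pi hs)]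
  have : (fun q : (ι → V) × V => Function.update q.1 i q.2) ⁻¹' Set.univ.pi s =
      (Set.univ.pi (Function.update s i Set.univ)) ×ˢ s i := by
    ext ⟨x, y⟩
    simp only [Set.mem_preimage, Set.mem_univ_pi, Set.mem_prod]
    constructor
    · intro h
      refine ⟨fun j => ?_, by simpa using h i⟩
      by_cases hj : j = i
      · subst hj; simp
      · simpa [Function.update_of_ne hj] using h j
    · rintro ⟨h, h'⟩ j
      by_cases hj : j = i
      · subst hj; simpa using h'
      · simpa [Function.update_of_ne hj] using h j
  rw [this, Measure.prod_prod, Measure.pi_pi, ← Finset.mul_prod_erase _ _ (Finset.mem_univ i),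
    ← Finset.mul_prod_erase _ (fun j => m j (s j)) (Finset.mem_univ i)]
  simp only [Function.update_self, measure_univ, one_mul]
  rw [mul_comm]
  congr 1
  refine Finset.prod_congr rfl fun j hj => ?_
  rw [Function.update_of_ne (Finset.ne_of_mem_erase hj)]

variable [∀ i, IsProbabilityMeasure (m i)]

lemma measurePreserving_update (i : ι) : MeasurePreserving
    (fun q : (ι → V) × V => Function.update q.1 i q.2) ((Measure.pi m).prod (m i))
    (Measure.pi m) := ⟨measurable_update_prod i, map_update_prod m i⟩

lemma integrable_comp_update {f : (ι → V) → ℝ} (i : ι) (hf : Integrable f (Measure.pi m)) :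
    Integrable (fun q : (ι → V) × V => f (Function.update q.1 i q.2))
      ((Measure.pi m).prod (m i)) :=
  (measurePreserving_update i).integrable_comp_of_integrable hf

lemma integrable_condInt {f : (ι → V) → ℝ} (i : ι) (hf : Integrable f (Measure.pi m)) :
    Integrable (condInt m i f) (Measure.pi m) :=
  (integrable_comp_update i hf).integral_prod_left

lemma integral_condInt {f : (ι → V) → ℝ} (i : ι) (hf : Integrable f (Measure.pi m)) :
    ∫ x, condInt m i f x ∂(Measure.pi m) = ∫ x, f x ∂(Measure.pi m) := by
  have h1 := integral_prod _ (integrable_comp_update i hf)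
  have h2 : ∫ q : (ι → V) × V, f (Function.update q.1 i q.2) ∂((Measure.pi m).prod (m i)) =
      ∫ x, f x ∂(Measure.pi m) := by
    conv_rhs => rw [← map_update_prod m i]
    rw [integral_map (measurable_update_prod i).aemeasurable]
    rw [map_update_prod]; exact hf.aestronglyMeasurable
  rw [← h2, h1]; rfl

/-- Bounded measurable functions. -/
def BddMeas {α : Type*} [MeasurableSpace α] (f : α → ℝ) : Prop :=
  Measurable f ∧ ∃ C : ℝ, ∀ x, |f x| ≤ C

namespace BddMeas

variable {α : Type*} [MeasurableSpace α] {f g : α → ℝ}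

lemma integrable (hf : BddMeas f) (ρ : Measure α) [IsFiniteMeasure ρ] : Integrable f ρ :=
  let ⟨C, hC⟩ := hf.2
  Integrable.of_bound hf.1.aestronglyMeasurable C (Filter.Eventually.of_forall hC)

lemma comp {β : Type*} [MeasurableSpace β] (hf : BddMeas f) {u : β → α} (hu : Measurable u) :
    BddMeas fun x => f (u x) := ⟨hf.1.comp hu, hf.2.imp fun _ hC _ => hC _⟩

lemma add (hf : BddMeas f) (hg : BddMeas g) : BddMeas fun x => f x + g x :=
  let ⟨C, hC⟩ := hf.2
  let ⟨D, hD⟩ := hg.2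
  ⟨hf.1.add hg.1, C + D, fun x => (abs_add_le _ _).trans (add_le_add (hC x) (hD x))⟩

lemma neg (hf : BddMeas f) : BddMeas fun x => -f x :=
  ⟨hf.1.neg, hf.2.imp fun _ hC x => by rw [abs_neg]; exact hC x⟩

lemma sub (hf : BddMeas f) (hg : BddMeas g) : BddMeas fun x => f x - g x := by
  simpa only [sub_eq_add_neg] using hf.add hg.neg

lemma mul (hf : BddMeas f) (hg : BddMeas g) : BddMeas fun x => f x * g x :=
  let ⟨C, hC⟩ := hf.2
  let ⟨D, hD⟩ := hg.2
  ⟨hf.1.mul hg.1, C * D, fun x => by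
    rw [abs_mul]
    exact mul_le_mul (hC x) (hD x) (abs_nonneg _) ((abs_nonneg _).trans (hC x))⟩

lemma exp (hf : BddMeas f) : BddMeas fun x => Real.exp (f x) :=
  let ⟨C, hC⟩ := hf.2
  ⟨hf.1.exp, Real.exp C, fun x => by
    rw [abs_of_pos (Real.exp_pos _)]
    exact Real.exp_le_exp.2 ((le_abs_self _).trans (hC x))⟩

lemma abs (hf : BddMeas f) : BddMeas fun x => |f x| :=
  ⟨hf.1.abs, hf.2.imp fun _ hC x => by rw [abs_abs]; exact hC x⟩

lemma const (c : ℝ) : BddMeas fun _ : α => c := ⟨measurable_const, |c|, fun _ => le_rfl⟩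

lemma const_mul (hf : BddMeas f) (c : ℝ) : BddMeas fun x => c * f x := (const c).mul hf

omit [Fintype ι] in
lemma update {f : (ι → V) → ℝ} (hf : BddMeas f) (x : ι → V) (i : ι) :
    BddMeas fun y => f (Function.update x i y) := hf.comp (measurable_update x)

omit [Fintype ι] in
lemma condInt {f : (ι → V) → ℝ} (hf : BddMeas f) (i : ι) : BddMeas (condInt m i f) := by
  obtain ⟨C, hC⟩ := hf.2
  refine ⟨?_, C, fun x => ?_⟩
  · have : StronglyMeasurable fun q : (ι → V) × V => f (Function.update q.1 i q.2) :=
      (hf.1.comp (measurable_update_prod i)).stronglyMeasurable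
    exact (this.integral_prod_right (ν := m i)).measurable
  · have := norm_integral_le_of_norm_le_const (μ := m i)
      (f := fun y => f (Function.update x i y)) (Filter.Eventually.of_forall fun y => hC _)
    simpa [SampleCov.condInt] using this

end BddMeas

/-- The sum `h_{i₁} + A_{i₁} h_{i₂} + A_{i₁} A_{i₂} h_{i₃} + ⋯` with `A_i = condInt m i`. -/
noncomputable def telescope (m : ι → Measure V) (h : ι → (ι → V) → ℝ) :
    List ι → (ι → V) → ℝ
  | [] => fun _ => 0
  | i :: l => fun x => h i x + condInt m i (telescope m h l) x

variable {h : ι → (ι → V) → ℝ}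

omit [Fintype ι] in
lemma BddMeas.telescope (hh : ∀ i, BddMeas (h i)) (l : List ι) : BddMeas (telescope m h l) := by
  induction l with
  | nil => exact BddMeas.const 0
  | cons i l ih => exact (hh i).add (ih.condInt i)

/-- The part of the telescope after h i does not depend on coordinate i, so integrating this
coordinate splits off a factor at most exp (c i); Jensen's inequality then takes A_i out of the
exponential and the induction proceeds. No filtration is needed, only a bound on each increment
uniform in the other coordinates. -/
lemma integral_exp_telescope_le (hh : ∀ i, BddMeas (h i)) {c : ι → ℝ}
    (hc : ∀ i x, ∫ y, Real.exp (h i (Function.update x i y)) ∂(m i) ≤ Real.exp (c i))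
    (l : List ι) :
    ∫ x, Real.exp (telescope m h l x) ∂(Measure.pi m) ≤ Real.exp (l.map c).sum := by
  induction l with
  | nil => simp [telescope]
  | cons i l ih =>
    have hl := BddMeas.telescope (m := m) hh l
    have hb := (BddMeas.telescope (m := m) hh (i :: l)).exp
    rw [← integral_condInt i (hb.integrable _)]
    have key : ∀ x, condInt m i (fun x => Real.exp (telescope m h (i :: l) x)) x ≤
        Real.exp (c i) * condInt m i (fun x => Real.exp (telescope m h l x)) x := by
      intro x
      have e : condInt m i (fun x => Real.exp (telescope m h (i :: l) x)) x =
          (∫ y, Real.exp (h i (Function.update x i y)) ∂(m i)) *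
            Real.exp (condInt m i (telescope m h l) x) := by
        rw [condInt, ← integral_mul_const]
        refine integral_congr_ae (Filter.Eventually.of_forall fun y => ?_)
        simp [telescope, Real.exp_add, condInt]
      rw [e]
      have hJ : Real.exp (condInt m i (telescope m h l) x) ≤
          condInt m i (fun x => Real.exp (telescope m h l x)) x :=
        convexOn_exp.map_integral_le Real.continuous_exp.continuousOn isClosed_univ
          (Filter.Eventually.of_forall fun _ => Set.mem_univ _)
          ((hl.update x i).integrable _) ((hl.exp.update x i).integrable _)
      exact mul_le_mul (hc i x) hJ (Real.exp_pos _).le (Real.exp_pos _).le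
    calc _ ≤ ∫ x, Real.exp (c i) * condInt m i (fun x => Real.exp (telescope m h l x)) x
          ∂(Measure.pi m) :=
          integral_mono ((hb.condInt i).integrable _)
            (((hl.exp.condInt i).const_mul _).integrable _) key
      _ = Real.exp (c i) * ∫ x, Real.exp (telescope m h l x) ∂(Measure.pi m) := by
          rw [integral_const_mul, integral_condInt i (hl.exp.integrable _)]
      _ ≤ _ := by
          rw [List.map_cons, List.sum_cons, Real.exp_add]
          exact mul_le_mul_of_nonneg_left ih (Real.exp_pos _).le

/-- Orthogonality of the increments: h i has zero mean in coordinate i while the rest a is constant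
in it, so the cross term vanishes. The square a² is at most the partial integral of the square
because a variance is nonnegative. -/
lemma integral_sq_telescope_le (hh : ∀ i, BddMeas (h i)) {b : ι → ℝ}
    (hb : ∀ i x, |h i x| ≤ b i)
    (h0 : ∀ i x, ∫ y, h i (Function.update x i y) ∂(m i) = 0) (l : List ι) :
    ∫ x, telescope m h l x ^ 2 ∂(Measure.pi m) ≤ (l.map fun i => b i ^ 2).sum := by
  induction l with
  | nil => simp [telescope]
  | cons i l ih =>
    have hl := BddMeas.telescope (m := m) hh l
    have hl' := BddMeas.telescope (m := m) hh (i :: l)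
    have hsq := hl.mul hl
    have hsq' := hl'.mul hl'
    simp only [pow_two] at ih ⊢
    rw [← integral_condInt i (hsq'.integrable _)]
    have key : ∀ x, condInt m i (fun x => telescope m h (i :: l) x * telescope m h (i :: l) x) x ≤
        b i * b i + condInt m i (fun x => telescope m h l x * telescope m h l x) x := by
      intro x
      set a := condInt m i (telescope m h l) x with ha
      have e : ∀ y, telescope m h (i :: l) (Function.update x i y) =
          h i (Function.update x i y) + a := by
        intro y; simp [telescope, condInt, ha]
      have h1 : condInt m i (fun x => telescope m h (i :: l) x * telescope m h (i :: l) x) x =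
          (∫ y, h i (Function.update x i y) * h i (Function.update x i y) ∂(m i)) + a * a := by
        have : ∀ y, telescope m h (i :: l) (Function.update x i y) *
            telescope m h (i :: l) (Function.update x i y) =
            h i (Function.update x i y) * h i (Function.update x i y) +
              (2 * a * h i (Function.update x i y) + a * a) := by
          intro y; rw [e]; ring
        simp only [condInt, this]
        rw [integral_add ((((hh i).mul (hh i)).update x i).integrable _)
          (((((hh i).update x i).const_mul _).add (BddMeas.const _)).integrable _),
          integral_add ((((hh i).update x i).const_mul _).integrable _)
          ((BddMeas.const _).integrable _), integral_const_mul, h0]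
        simp
      have h2 : ∫ y, h i (Function.update x i y) * h i (Function.update x i y) ∂(m i) ≤
          b i * b i := by
        calc _ ≤ ∫ _, b i * b i ∂(m i) :=
              integral_mono ((((hh i).mul (hh i)).update x i).integrable _)
                ((BddMeas.const _).integrable _) fun y => by
                  have := hb i (Function.update x i y)
                  rw [← abs_mul_abs_self (h i _)]
                  exact mul_self_le_mul_self (abs_nonneg _) this
          _ = _ := by simp
      have h3 : a * a ≤ condInt m i (fun x => telescope m h l x * telescope m h l x) x := by
        have e3 : 0 ≤ ∫ y, (telescope m h l (Function.update x i y) - a) *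
            (telescope m h l (Function.update x i y) - a) ∂(m i) :=
          integral_nonneg fun y => mul_self_nonneg _
        have e4 : ∀ y, (telescope m h l (Function.update x i y) - a) *
            (telescope m h l (Function.update x i y) - a) =
            telescope m h l (Function.update x i y) * telescope m h l (Function.update x i y) -
              (2 * a * telescope m h l (Function.update x i y) - a * a) := by intro y; ring
        simp only [e4] at e3
        rw [integral_sub ((hsq.update x i).integrable _)
          ((((hl.update x i).const_mul _).sub (BddMeas.const _)).integrable _),
          integral_sub (((hl.update x i).const_mul _).integrable _)
          ((BddMeas.const _).integrable _), integral_const_mul] at e3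
        have e5 : ∫ y, telescope m h l (Function.update x i y) ∂(m i) = a := rfl
        rw [e5] at e3
        simp only [integral_const, probReal_univ, smul_eq_mul, one_mul] at e3
        have e6 : condInt m i (fun x => telescope m h l x * telescope m h l x) x =
          ∫ y, telescope m h l (Function.update x i y) * telescope m h l (Function.update x i y)
            ∂(m i) := rfl
        rw [e6]; linarith
      linarith
    calc _ ≤ ∫ x, (b i * b i + condInt m i (fun x => telescope m h l x * telescope m h l x) x)
          ∂(Measure.pi m) :=
          integral_mono ((hsq'.condInt i).integrable _)
            (((BddMeas.const _).add (hsq.condInt i)).integrable _) key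
      _ = b i * b i + ∫ x, telescope m h l x * telescope m h l x ∂(Measure.pi m) := by
          rw [integral_add ((BddMeas.const _).integrable _) ((hsq.condInt i).integrable _),
            integral_condInt i (hsq.integrable _)]
          simp
      _ ≤ _ := by rw [List.map_cons, List.sum_cons]; linarith

omit [Fintype ι] [∀ i, IsProbabilityMeasure (m i)] in
lemma condInt_abs_le (i : ι) (f : (ι → V) → ℝ) (x : ι → V) :
    |condInt m i f x| ≤ condInt m i (fun x => |f x|) x := abs_integral_le_integral_abs

/-- Partial integration contracts L¹. This controls what the truncation of the increments discards.
-/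
lemma integral_abs_telescope_le (hh : ∀ i, BddMeas (h i)) (l : List ι) :
    ∫ x, |telescope m h l x| ∂(Measure.pi m) ≤
      (l.map fun i => ∫ x, |h i x| ∂(Measure.pi m)).sum := by
  induction l with
  | nil => simp [telescope]
  | cons i l ih =>
    have hl := BddMeas.telescope (m := m) hh l
    calc _ ≤ ∫ x, (|h i x| + condInt m i (fun x => |telescope m h l x|) x) ∂(Measure.pi m) := by
          refine integral_mono ((BddMeas.telescope (m := m) hh (i :: l)).abs.integrable _)
            (((hh i).abs.add (hl.abs.condInt i)).integrable _) fun x => ?_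
          exact (abs_add_le _ _).trans (add_le_add le_rfl (condInt_abs_le _ _ _))
      _ = (∫ x, |h i x| ∂(Measure.pi m)) + ∫ x, |telescope m h l x| ∂(Measure.pi m) := by
          rw [integral_add ((hh i).abs.integrable _) ((hl.abs.condInt i).integrable _),
            integral_condInt i (hl.abs.integrable _)]
      _ ≤ _ := by rw [List.map_cons, List.sum_cons]; linarith

omit [Fintype ι] in
lemma telescope_add {h' : ι → (ι → V) → ℝ} (hh : ∀ i, BddMeas (h i)) (hh' : ∀ i, BddMeas (h' i))
    (l : List ι) (x : ι → V) :
    telescope m (fun i x => h i x + h' i x) l x = telescope m h l x + telescope m h' l x := by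
  induction l generalizing x with
  | nil => simp [telescope]
  | cons i l ih =>
    have hl := BddMeas.telescope (m := m) hh l
    have hl' := BddMeas.telescope (m := m) hh' l
    have : condInt m i (telescope m (fun i x => h i x + h' i x) l) x =
        condInt m i (telescope m h l) x + condInt m i (telescope m h' l) x := by
      simp only [condInt, ih]
      rw [integral_add ((hl.update x i).integrable _) ((hl'.update x i).integrable _)]
    simp only [telescope, this]; ring

/-- Successive integration of the coordinates in a list. -/
noncomputable def condIntList (m : ι → Measure V) (f : (ι → V) → ℝ) : List ι → (ι → V) → ℝ
  | [] => f
  | i :: l => condInt m i (condIntList m f l)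

omit [Fintype ι] in
lemma BddMeas.condIntList {f : (ι → V) → ℝ} (hf : BddMeas f) (l : List ι) :
    BddMeas (condIntList m f l) := by
  induction l with
  | nil => exact hf
  | cons i l ih => exact ih.condInt i

omit [Fintype ι] in
-- The j-th term is A₁⋯A_{j−1} f − A₁⋯A_j f, so the sum collapses.
lemma telescope_sub_condInt {f : (ι → V) → ℝ} (hf : BddMeas f) (l : List ι) (x : ι → V) :
    telescope m (fun i x => f x - condInt m i f x) l x = f x - condIntList m f l x := by
  induction l generalizing x with
  | nil => simp [telescope, condIntList]
  | cons i l ih =>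
    simp only [telescope, condIntList]
    have : condInt m i (telescope m (fun i x => f x - condInt m i f x) l) x =
        condInt m i f x - condInt m i (condIntList m f l) x := by
      have e : condInt m i (telescope m (fun i x => f x - condInt m i f x) l) x =
          ∫ y, (f (Function.update x i y) - condIntList m f l (Function.update x i y)) ∂(m i) :=
        integral_congr_ae (Filter.Eventually.of_forall fun y => ih _)
      rw [e]
      exact integral_sub ((hf.update x i).integrable _)
        (((hf.condIntList l).update x i).integrable _)
    rw [this]; ring

omit [Fintype ι] [∀ i, IsProbabilityMeasure (m i)] in
lemma condIntList_update {f : (ι → V) → ℝ} {l : List ι} {j : ι} (hj : j ∈ l) (x : ι → V) (y : V) :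
    condIntList m f l (Function.update x j y) = condIntList m f l x := by
  induction l generalizing x with
  | nil => simp at hj
  | cons i l ih =>
    simp only [condIntList, condInt]
    by_cases hij : j = i
    · subst hij; simp
    · have : j ∈ l := by simpa [hij] using hj
      refine integral_congr_ae (Filter.Eventually.of_forall fun w => ?_)
      show condIntList m f l _ = condIntList m f l _
      rw [Function.update_comm hij, ih this]

lemma integral_condIntList {f : (ι → V) → ℝ} (hf : BddMeas f) (l : List ι) :
    ∫ x, condIntList m f l x ∂(Measure.pi m) = ∫ x, f x ∂(Measure.pi m) := by
  induction l with
  | nil => rfl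
  | cons i l ih =>
    rw [← ih]; exact integral_condInt i ((hf.condIntList l).integrable _)

/-- Once all coordinates are integrated, changing them one at a time has no effect; the function is
constant and thus equal to its integral, which partial integration preserves. -/
lemma condIntList_univ {f : (ι → V) → ℝ} (hf : BddMeas f) (x : ι → V) :
    condIntList m f Finset.univ.toList x = ∫ x, f x ∂(Measure.pi m) := by
  have hconst : ∀ x x', condIntList m f Finset.univ.toList x =
      condIntList m f Finset.univ.toList x' := by
    intro x x'
    have : ∀ s : Finset ι, condIntList m f Finset.univ.toList (s.piecewise x x') =
        condIntList m f Finset.univ.toList x' := by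
      intro s
      induction s using Finset.induction_on with
      | empty => simp
      | insert i s _ ih =>
        rw [Finset.piecewise_insert, condIntList_update (by simp), ih]
    have h := this Finset.univ
    rwa [Finset.piecewise_univ] at h
  rw [← integral_condIntList hf Finset.univ.toList]
  simp only [fun x' => hconst x' x]
  simp

/-- The martingale decomposition of a bounded function on a product space. -/
lemma sub_integral_eq_telescope {f : (ι → V) → ℝ} (hf : BddMeas f) (x : ι → V) :
    f x - ∫ x, f x ∂(Measure.pi m) =
      telescope m (fun i x => f x - condInt m i f x) Finset.univ.toList x := by
  rw [telescope_sub_condInt hf, condIntList_univ hf]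

/-- An Efron–Stein inequality for functions with bounded differences. -/
lemma integral_sub_sq_le {f : (ι → V) → ℝ} (hf : BddMeas f) {b : ι → ℝ}
    (hb : ∀ i x y, |f x - f (Function.update x i y)| ≤ b i) :
    ∫ x, (f x - ∫ x, f x ∂(Measure.pi m)) ^ 2 ∂(Measure.pi m) ≤ ∑ i, b i ^ 2 := by
  simp only [sub_integral_eq_telescope (m := m) hf]
  refine (integral_sq_telescope_le (b := b) (fun i => hf.sub (hf.condInt i)) (fun i x => ?_)
    (fun i x => ?_) _).trans_eq (by simp)
  · have e : f x - condInt m i f x = ∫ y, (f x - f (Function.update x i y)) ∂(m i) := by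
      rw [integral_sub ((BddMeas.const _).integrable _) ((hf.update x i).integrable _)]
      simp [condInt]
    rw [e]
    have := norm_integral_le_of_norm_le_const (μ := m i)
      (f := fun y => f x - f (Function.update x i y)) (Filter.Eventually.of_forall fun y => hb i x y)
    simpa using this
  · have e : ∀ y, condInt m i f (Function.update x i y) = condInt m i f x := by
      intro y; simp [condInt]
    simp only [e]
    rw [integral_sub ((hf.update x i).integrable _) ((BddMeas.const _).integrable _)]
    simp [condInt]

end Product

end SampleCov

namespace SampleCov

/-! ### Moments of observables of one column -/

variable {p : ℕ}

lemma ColumnConc.scaled {μ : Measure (EuclideanSpace ℝ (Fin p))} {m : ℕ} {q ε B : ℝ}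
    (H : ColumnConc μ m q ε B) {f : (Fin m → EuclideanSpace ℝ (Fin p)) → ℝ} {L : ℝ} (hL : 0 < L)
    (hf : ∀ y y', |f y - f y'| ≤ L * √(∑ j, ‖y j - y' j‖ ^ 2)) (hc : ConvexOn ℝ Set.univ f) :
    ExpConc (Measure.pi fun _ => μ) (fun y => L⁻¹ * f y) q ε B := by
  refine H _ (LipschitzWith.of_dist_le_mul fun y y' => ?_) ?_
  · rw [Real.dist_eq, ← mul_sub, abs_mul, abs_of_pos (inv_pos.2 hL), NNReal.coe_one, one_mul,
      inv_mul_le_iff₀ hL, PiLp.dist_eq_of_L2]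
    simpa only [dist_eq_norm] using hf y.ofLp y'.ofLp
  · exact hc.smul (inv_pos.2 hL).le

lemma ColumnConc.single {μ : Measure (EuclideanSpace ℝ (Fin p))} [IsProbabilityMeasure μ]
    {q ε B : ℝ} (H : ColumnConc μ 1 q ε B) {f : EuclideanSpace ℝ (Fin p) → ℝ} {L : ℝ} (hL : 0 < L)
    (hf : ∀ y y', |f y - f y'| ≤ L * ‖y - y'‖) (hc : ConvexOn ℝ Set.univ f) :
    ExpConc μ (fun y => L⁻¹ * f y) q ε B := by
  have h1 := H.scaled (f := fun y => f (y 0)) hL (fun y y' => by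
    simpa [Real.sqrt_sq (norm_nonneg _)] using hf (y 0) (y' 0))
    ⟨convex_univ, fun x _ y _ a b ha hb hab => by
      simpa using hc.2 (Set.mem_univ (x 0)) (Set.mem_univ (y 0)) ha hb hab⟩
  have hcont : Continuous f := by
    have : LipschitzWith L.toNNReal f := LipschitzWith.of_dist_le_mul fun y y' => by
      rw [Real.dist_eq, dist_eq_norm, Real.coe_toNNReal _ hL.le]; exact hf y y'
    exact this.continuous
  have hmp : MeasurePreserving (fun y : Fin 1 → EuclideanSpace ℝ (Fin p) => y 0)
      (Measure.pi fun _ => μ) μ := measurePreserving_eval (fun _ : Fin 1 => μ) 0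
  have hI : ∀ g : EuclideanSpace ℝ (Fin p) → ℝ, Measurable g →
      ∫ y, g (y 0) ∂(Measure.pi fun _ : Fin 1 => μ) = ∫ y, g y ∂μ := fun g hg => by
    have := integral_map (μ := Measure.pi fun _ : Fin 1 => μ) (f := g)
      hmp.measurable.aemeasurable hg.aestronglyMeasurable
    rw [hmp.map_eq] at this
    exact this.symm
  have hJ : ∀ g : EuclideanSpace ℝ (Fin p) → ℝ, Measurable g →
      Integrable (fun y => g (y 0)) (Measure.pi fun _ : Fin 1 => μ) → Integrable g μ :=
    fun g hg hi => (hmp.integrable_comp hg.aestronglyMeasurable).1 hi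
  obtain ⟨i1, i2, i3⟩ := h1
  rw [hI (fun y => L⁻¹ * f y) (hcont.measurable.const_mul _)] at i2 i3
  have hm : Measurable fun y => Real.exp (ε * |L⁻¹ * f y - ∫ y, L⁻¹ * f y ∂μ| ^ q) := by
    have := hcont.measurable
    fun_prop
  refine ⟨hJ _ (hcont.measurable.const_mul _) i1, hJ _ hm i2, ?_⟩
  exact (hI _ hm).symm.trans_le i3

/-- Convex Lipschitz observables of a vector of law `μ` have moments controlled by `K` up to the
order `8`, and the mean has norm of order `√p`. -/
structure ColumnMoments (μ : Measure (EuclideanSpace ℝ (Fin p))) (K : ℝ) : Prop where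
  one_le : 1 ≤ K
  lip : ∀ (f : EuclideanSpace ℝ (Fin p) → ℝ) (L : ℝ), 0 < L →
    (∀ y y', |f y - f y'| ≤ L * ‖y - y'‖) → ConvexOn ℝ Set.univ f →
    Integrable f μ ∧ ∀ j ≤ 8, Integrable (fun y => |f y - ∫ y, f y ∂μ| ^ j) μ ∧
      ∫ y, |f y - ∫ y, f y ∂μ| ^ j ∂μ ≤ K * L ^ j
  mean : ‖∫ y, y ∂μ‖ ^ 2 ≤ K * p

/-- Order 8 suffices: the fourth moment of a quadratic form ⟨y, A y⟩ is an eighth moment of its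
square root. -/
lemma exists_pow_le_exp_rpow_uniform {ε q : ℝ} (hε : 0 < ε) (hq : 0 < q) :
    ∃ D : ℝ, 1 ≤ D ∧ ∀ j ≤ 8, ∀ t : ℝ, 0 ≤ t → t ^ j ≤ D * Real.exp (ε * t ^ q) := by
  obtain ⟨D, hD1, hD⟩ := exists_pow_le_exp_rpow 8 hε hq
  refine ⟨D + 1, by linarith, fun j hj t ht => ?_⟩
  have h1 : t ^ j ≤ 1 + t ^ 8 := by
    rcases le_total t 1 with h | h
    · have := pow_le_one₀ (n := j) ht h
      have : 0 ≤ t ^ 8 := by positivity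
      linarith
    · have := pow_le_pow_right₀ h hj
      linarith
  have h2 := hD t ht
  have h3 : 1 ≤ Real.exp (ε * t ^ q) := Real.one_le_exp (by positivity)
  nlinarith

lemma ColumnConc.columnMoments {μ : Measure (EuclideanSpace ℝ (Fin p))} [IsProbabilityMeasure μ]
    {q ε B D K : ℝ} (H : ColumnConc μ 1 q ε B) (hD1 : 1 ≤ D)
    (hD : ∀ j ≤ 8, ∀ t : ℝ, 0 ≤ t → t ^ j ≤ D * Real.exp (ε * t ^ q)) (hK : 1 ≤ K)
    (hDK : D * B ≤ K) (hmean : ‖∫ y, y ∂μ‖ ^ 2 ≤ K * p) : ColumnMoments μ K := by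
  refine ⟨hK, fun f L hL hf hc => ?_, hmean⟩
  have h := H.single hL hf hc
  have hi : Integrable f μ := by
    refine (h.1.const_mul L).congr (Filter.Eventually.of_forall fun y => ?_)
    show L * (L⁻¹ * f y) = f y
    field_simp
  refine ⟨hi, fun j hj => ?_⟩
  obtain ⟨h1, h2⟩ := h.moment (h.1.aestronglyMeasurable) (by linarith) (hD j hj)
  have e : ∀ y, |f y - ∫ y, f y ∂μ| ^ j = L ^ j * |L⁻¹ * f y - ∫ y, L⁻¹ * f y ∂μ| ^ j := by
    intro y
    rw [integral_const_mul, ← mul_sub, abs_mul, abs_of_pos (inv_pos.2 hL), ← mul_pow, ← mul_assoc,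
      mul_inv_cancel₀ hL.ne', one_mul]
  simp only [e]
  refine ⟨h1.const_mul _, ?_⟩
  rw [integral_const_mul, mul_comm]
  exact mul_le_mul_of_nonneg_right (h2.trans hDK) (by positivity)

namespace ColumnMoments

variable {μ : Measure (EuclideanSpace ℝ (Fin p))} [IsProbabilityMeasure μ] {K : ℝ}

omit [IsProbabilityMeasure μ] in
lemma pos (h : ColumnMoments μ K) : 0 < K := lt_of_lt_of_le one_pos h.one_le

lemma integrable_norm_pow (h : ColumnMoments μ K) {j : ℕ} (hj : j ≤ 8) :
    Integrable (fun y => ‖y‖ ^ j) μ := by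
  obtain ⟨h1, h2⟩ := h.lip (fun y => ‖y‖) 1 one_pos
    (fun y y' => by rw [one_mul]; exact abs_norm_sub_norm_le _ _) (convexOn_norm convex_univ)
  set c := ∫ y, ‖y‖ ∂μ
  have hc : 0 ≤ c := integral_nonneg fun y => norm_nonneg _
  refine Integrable.mono' (((h2 j hj).1.add (integrable_const (c ^ j))).const_mul (2 ^ (j - 1)))
    (by fun_prop) (Filter.Eventually.of_forall fun y => ?_)
  have h3 : ‖y‖ ≤ |‖y‖ - c| + c := by linarith [le_abs_self (‖y‖ - c)]
  rw [Real.norm_eq_abs, abs_of_nonneg (by positivity)]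
  exact (pow_le_pow_left₀ (norm_nonneg _) h3 j).trans (add_pow_le (abs_nonneg _) hc j)

lemma integrable_id (h : ColumnMoments μ K) : Integrable (fun y => y) μ := by
  have := h.integrable_norm_pow (j := 1) (by norm_num)
  simp only [pow_one] at this
  exact (integrable_norm_iff (by fun_prop)).1 this

lemma integral_inner (h : ColumnMoments μ K) (w : EuclideanSpace ℝ (Fin p)) :
    ∫ y, ⟪w, y⟫ ∂μ = ⟪w, ∫ y, y ∂μ⟫ := _root_.integral_inner h.integrable_id w

/-- A measurable function bounded by a polynomial of degree `8` in the norm is integrable. -/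
lemma integrable_of_le (h : ColumnMoments μ K) {f : EuclideanSpace ℝ (Fin p) → ℝ}
    (hf : AEStronglyMeasurable f μ) {C : ℝ} (hC : ∀ y, |f y| ≤ C * (1 + ‖y‖ ^ 8)) :
    Integrable f μ :=
  Integrable.mono' (((integrable_const 1).add (h.integrable_norm_pow le_rfl)).const_mul C) hf
    (Filter.Eventually.of_forall hC)

lemma pow_le_one_add (t : ℝ) (ht : 0 ≤ t) {j : ℕ} (hj : j ≤ 8) : t ^ j ≤ 1 + t ^ 8 := by
  rcases le_total t 1 with h | h
  · have := pow_le_one₀ (n := j) ht h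
    have : 0 ≤ t ^ 8 := by positivity
    linarith
  · have := pow_le_pow_right₀ h hj
    linarith

lemma inner_moment (h : ColumnMoments μ K) (w : EuclideanSpace ℝ (Fin p)) {j : ℕ} (hj : j ≤ 8)
    (hj0 : j ≠ 0) :
    Integrable (fun y => |⟪w, y⟫ - ⟪w, ∫ y, y ∂μ⟫| ^ j) μ ∧
      ∫ y, |⟪w, y⟫ - ⟪w, ∫ y, y ∂μ⟫| ^ j ∂μ ≤ K * ‖w‖ ^ j := by
  by_cases hw : w = 0
  · subst hw; simp [hj0]
  · have := (h.lip (fun y => ⟪w, y⟫) ‖w‖ (norm_pos_iff.2 hw) (fun y y' => by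
      rw [← inner_sub_right]; exact abs_real_inner_le_norm _ _)
      ⟨convex_univ, fun x _ y _ a b _ _ _ => by
        simp [inner_add_right, inner_smul_right]⟩).2 j hj
    rwa [h.integral_inner] at this

lemma integrable_inner (h : ColumnMoments μ K) (w : EuclideanSpace ℝ (Fin p)) :
    Integrable (fun y => ⟪w, y⟫) μ := h.integrable_id.const_inner w

lemma integrable_inner_mul (h : ColumnMoments μ K) (v w : EuclideanSpace ℝ (Fin p)) :
    Integrable (fun y => ⟪v, y⟫ * ⟪w, y⟫) μ := by
  refine h.integrable_of_le (by fun_prop) (C := ‖v‖ * ‖w‖) fun y => ?_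
  rw [abs_mul]
  calc _ ≤ (‖v‖ * ‖y‖) * (‖w‖ * ‖y‖) := by
        gcongr <;> exact abs_real_inner_le_norm _ _
    _ = ‖v‖ * ‖w‖ * ‖y‖ ^ 2 := by ring
    _ ≤ _ := by gcongr; exact pow_le_one_add _ (norm_nonneg _) (by norm_num)

lemma integrable_inner_sq (h : ColumnMoments μ K) (w : EuclideanSpace ℝ (Fin p)) :
    Integrable (fun y => ⟪w, y⟫ ^ 2) μ := by
  simpa only [pow_two] using h.integrable_inner_mul w w

lemma integral_inner_sq (h : ColumnMoments μ K) (w : EuclideanSpace ℝ (Fin p)) :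
    ∫ y, ⟪w, y⟫ ^ 2 ∂μ =
      ⟪w, ∫ y, y ∂μ⟫ ^ 2 + ∫ y, (⟪w, y⟫ - ⟪w, ∫ y, y ∂μ⟫) ^ 2 ∂μ := by
  set a := ⟪w, ∫ y, y ∂μ⟫ with ha
  have e : ∀ y, (⟪w, y⟫ - a) ^ 2 = ⟪w, y⟫ ^ 2 - (2 * a * ⟪w, y⟫ - a ^ 2) := fun y => by ring
  have hi : Integrable (fun y => 2 * a * ⟪w, y⟫ - a ^ 2) μ :=
    ((h.integrable_inner w).const_mul _).sub (integrable_const _)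
  simp only [e]
  rw [integral_sub (h.integrable_inner_sq w) hi,
    integral_sub ((h.integrable_inner w).const_mul _) (integrable_const _),
    integral_const_mul, h.integral_inner]
  simp only [integral_const, probReal_univ, smul_eq_mul, one_mul]
  rw [← ha]; ring

lemma integral_inner_sq_le (h : ColumnMoments μ K) (w : EuclideanSpace ℝ (Fin p)) :
    ∫ y, ⟪w, y⟫ ^ 2 ∂μ ≤ ⟪w, ∫ y, y ∂μ⟫ ^ 2 + K * ‖w‖ ^ 2 := by
  rw [h.integral_inner_sq]
  have := (h.inner_moment w (j := 2) (by norm_num) (by norm_num)).2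
  simp only [sq_abs] at this
  linarith

lemma integral_inner_pow_four_le (h : ColumnMoments μ K) (w : EuclideanSpace ℝ (Fin p)) :
    Integrable (fun y => ⟪w, y⟫ ^ 4) μ ∧
      ∫ y, ⟪w, y⟫ ^ 4 ∂μ ≤ 8 * (⟪w, ∫ y, y ∂μ⟫ ^ 4 + K * ‖w‖ ^ 4) := by
  obtain ⟨h1, h2⟩ := h.inner_moment w (j := 4) (by norm_num) (by norm_num)
  set a := ⟪w, ∫ y, y ∂μ⟫ with ha
  have e : ∀ y : EuclideanSpace ℝ (Fin p), ⟪w, y⟫ ^ 4 ≤ 8 * (a ^ 4 + |⟪w, y⟫ - a| ^ 4) := by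
    intro y
    have h3 : |⟪w, y⟫| ≤ |a| + |⟪w, y⟫ - a| := by
      have := abs_add_le a (⟪w, y⟫ - a); rwa [add_sub_cancel] at this
    have h4 := (pow_le_pow_left₀ (abs_nonneg _) h3 4).trans
      (add_pow_le (abs_nonneg _) (abs_nonneg _) 4)
    rw [Even.pow_abs (by decide), Even.pow_abs (by decide : Even 4) a] at h4
    norm_num at h4
    exact h4
  have hi : Integrable (fun y => 8 * (a ^ 4 + |⟪w, y⟫ - a| ^ 4)) μ :=
    ((integrable_const _).add h1).const_mul 8
  have hi' : Integrable (fun y => ⟪w, y⟫ ^ 4) μ :=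
    hi.mono' (by fun_prop) (Filter.Eventually.of_forall fun y => by
      rw [Real.norm_eq_abs, abs_of_nonneg (by positivity)]; exact e y)
  refine ⟨hi', ?_⟩
  calc _ ≤ ∫ y, 8 * (a ^ 4 + |⟪w, y⟫ - a| ^ 4) ∂μ := integral_mono hi' hi e
    _ ≤ _ := by
      rw [integral_const_mul, integral_add (integrable_const _) h1]
      simp only [integral_const, probReal_univ, smul_eq_mul, one_mul]
      linarith

/-- Each of the p coordinates has variance at most K, and the mean has squared norm at most K p. -/
lemma integral_norm_sq_le (h : ColumnMoments μ K) : ∫ y, ‖y‖ ^ 2 ∂μ ≤ 2 * K * p := by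
  have e : ∀ y : EuclideanSpace ℝ (Fin p), ‖y‖ ^ 2 =
      ∑ a, ⟪EuclideanSpace.single a (1 : ℝ), y⟫ ^ 2 := by
    intro y; simp [EuclideanSpace.norm_sq_eq, EuclideanSpace.inner_single_left]
  have h1 : ∫ y, ‖y‖ ^ 2 ∂μ ≤ ∑ a : Fin p,
      (⟪EuclideanSpace.single a (1 : ℝ), ∫ y, y ∂μ⟫ ^ 2 + K) := by
    simp only [e]
    rw [integral_finsetSum _ fun a _ => h.integrable_inner_sq _]
    refine Finset.sum_le_sum fun a _ => ?_
    simpa using h.integral_inner_sq_le (EuclideanSpace.single a (1 : ℝ))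
  rw [Finset.sum_add_distrib, ← e] at h1
  have := h.mean
  simp at h1
  linarith

section Quadratic

variable {ι : Type*} [Fintype ι] {c z : ℝ} {x : ι → EuclideanSpace ℝ (Fin p)}
  {A : EuclideanSpace ℝ (Fin p) →L[ℝ] EuclideanSpace ℝ (Fin p)}

omit [IsProbabilityMeasure μ] in
-- A quadratic form is not Lipschitz, but its root is a seminorm dominated by z^{-1/2} ‖·‖. It is
-- therefore both Lipschitz and convex, and convex concentration applies to the root.
lemma _root_.SampleCov.IsGramResolvent.sqrt_lipschitz (hA : IsGramResolvent c z x A) (hc : 0 ≤ c)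
    (hz : 0 < z) (y y' : EuclideanSpace ℝ (Fin p)) :
    |√⟪y, A y⟫ - √⟪y', A y'⟫| ≤ (√z)⁻¹ * ‖y - y'‖ := by
  have key : ∀ y y', √⟪y, A y⟫ - √⟪y', A y'⟫ ≤ (√z)⁻¹ * ‖y - y'‖ := by
    intro y y'
    have h1 := hA.sqrt_inner_add_le hc hz (y - y') y'
    rw [sub_add_cancel] at h1
    have h2 : √⟪y - y', A (y - y')⟫ ≤ (√z)⁻¹ * ‖y - y'‖ := by
      apply Real.sqrt_le_iff.2 ⟨by positivity, ?_⟩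
      refine (hA.inner_le hc hz _).trans (le_of_eq ?_)
      rw [mul_pow, inv_pow, Real.sq_sqrt hz.le]; field_simp
    linarith
  rw [abs_sub_le_iff]
  exact ⟨key y y', by rw [norm_sub_rev]; exact key y' y⟩

omit [IsProbabilityMeasure μ] in
lemma _root_.SampleCov.IsGramResolvent.sqrt_convexOn (hA : IsGramResolvent c z x A) (hc : 0 ≤ c)
    (hz : 0 < z) : ConvexOn ℝ Set.univ fun y => √⟪y, A y⟫ := by
  refine ⟨convex_univ, fun y _ y' _ a b ha hb _ => ?_⟩
  refine (hA.sqrt_inner_add_le hc hz _ _).trans ?_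
  have e : ∀ (t : ℝ) (v : EuclideanSpace ℝ (Fin p)), 0 ≤ t → √⟪t • v, A (t • v)⟫ = t * √⟪v, A v⟫ := by
    intro t v ht
    rw [map_smul, inner_smul_left, inner_smul_right, ← mul_assoc]
    simp only [conj_trivial]
    rw [Real.sqrt_mul (mul_self_nonneg t), Real.sqrt_mul_self ht]
  simp only [e a y ha, e b y' hb, smul_eq_mul, le_refl]

lemma integrable_inner_apply (h : ColumnMoments μ K)
    (A : EuclideanSpace ℝ (Fin p) →L[ℝ] EuclideanSpace ℝ (Fin p)) :
    Integrable (fun y => ⟪y, A y⟫) μ := by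
  refine h.integrable_of_le (by fun_prop) (C := ‖A‖) fun y => ?_
  calc |⟪y, A y⟫| ≤ ‖y‖ * ‖A y‖ := abs_real_inner_le_norm _ _
    _ ≤ ‖y‖ * (‖A‖ * ‖y‖) := by gcongr; exact A.le_opNorm y
    _ = ‖A‖ * ‖y‖ ^ 2 := by ring
    _ ≤ _ := by gcongr; exact pow_le_one_add _ (norm_nonneg _) (by norm_num)

lemma integral_inner_apply_le (h : ColumnMoments μ K) (hA : IsGramResolvent c z x A) (hc : 0 ≤ c)
    (hz : 0 < z) : ∫ y, ⟪y, A y⟫ ∂μ ≤ 2 * K * p / z := by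
  calc _ ≤ ∫ y, ‖y‖ ^ 2 / z ∂μ := integral_mono (h.integrable_inner_apply A)
        ((h.integrable_norm_pow (by norm_num)).div_const _) fun y => hA.inner_le hc hz y
    _ ≤ _ := by rw [integral_div]; gcongr; exact h.integral_norm_sq_le

lemma add_sub_pow_four_le (a b d : ℝ) : (a + b - d) ^ 4 ≤ 27 * (a ^ 4 + b ^ 4 + d ^ 4) := by
  have e1 : (a + b - d) ^ 2 ≤ 3 * (a ^ 2 + b ^ 2 + d ^ 2) := by
    nlinarith [sq_nonneg (a - b), sq_nonneg (a + d), sq_nonneg (b + d)]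
  have e2 : (a ^ 2 + b ^ 2 + d ^ 2) ^ 2 ≤ 3 * (a ^ 4 + b ^ 4 + d ^ 4) := by
    nlinarith [sq_nonneg (a ^ 2 - b ^ 2), sq_nonneg (a ^ 2 - d ^ 2), sq_nonneg (b ^ 2 - d ^ 2)]
  calc (a + b - d) ^ 4 = ((a + b - d) ^ 2) ^ 2 := by ring
    _ ≤ (3 * (a ^ 2 + b ^ 2 + d ^ 2)) ^ 2 := by gcongr
    _ ≤ _ := by nlinarith

lemma quadratic_moment_arith {K p w : ℝ} (hK : 1 ≤ K) (hp : 0 ≤ p) (hw : 0 ≤ w) :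
    27 * (64 * K ^ 3 * p ^ 2 * w + K * w + K ^ 4 * w) ≤ 2000 * K ^ 4 * (1 + p) ^ 2 * w := by
  have k1 : K ^ 3 ≤ K ^ 4 := pow_le_pow_right₀ hK (by norm_num)
  have k2 : K ≤ K ^ 4 := le_self_pow₀ hK (by norm_num)
  rw [← add_mul, ← add_mul, ← mul_assoc]
  apply mul_le_mul_of_nonneg_right _ hw
  have : K ^ 3 * p ^ 2 ≤ K ^ 4 * p ^ 2 := by gcongr
  have h5 : 0 ≤ K ^ 4 * p := by positivity
  have h6 : 0 ≤ K ^ 4 * p ^ 2 := by positivity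
  nlinarith

/-- Fluctuations of the quadratic form of a resolvent. -/
lemma integral_quadratic_pow_four_le (h : ColumnMoments μ K) (hA : IsGramResolvent c z x A)
    (hc : 0 ≤ c) (hz : 0 < z) :
    Integrable (fun y => (⟪y, A y⟫ - ∫ y, ⟪y, A y⟫ ∂μ) ^ 4) μ ∧
    ∫ y, (⟪y, A y⟫ - ∫ y, ⟪y, A y⟫ ∂μ) ^ 4 ∂μ ≤ 2000 * K ^ 4 * (1 + p) ^ 2 / z ^ 4 := by
  have hK := h.one_le
  have hs : 0 < (√z)⁻¹ := by positivity
  obtain ⟨i1, hj⟩ := h.lip (fun y => √⟪y, A y⟫) _ hs (hA.sqrt_lipschitz hc hz)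
    (hA.sqrt_convexOn hc hz)
  set r := ∫ y, √⟪y, A y⟫ ∂μ with hr
  have hr0 : 0 ≤ r := integral_nonneg fun y => Real.sqrt_nonneg _
  set τ := ∫ y, ⟪y, A y⟫ ∂μ with hτ
  obtain ⟨i2, b2⟩ := hj 2 (by norm_num)
  obtain ⟨i4, b4⟩ := hj 4 (by norm_num)
  obtain ⟨i8, b8⟩ := hj 8 (by norm_num)
  have z2 : (√z)⁻¹ ^ 2 = z⁻¹ := by rw [inv_pow, Real.sq_sqrt hz.le]
  have z4 : (√z)⁻¹ ^ 4 = z⁻¹ ^ 2 := by rw [← z2]; ring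
  have z8 : (√z)⁻¹ ^ 8 = z⁻¹ ^ 4 := by rw [← z2]; ring
  rw [z2] at b2; rw [z4] at b4; rw [z8] at b8
  -- With ζ the deviation of the root from its mean r, the centred form is 2 r ζ + ζ² − V. Since r²
  -- ≤ τ ≤ 2 K p / z, the leading term has a fourth moment of order p²/z⁴.
  have hq : ∀ y, ⟪y, A y⟫ = r ^ 2 + 2 * r * (√⟪y, A y⟫ - r) + |√⟪y, A y⟫ - r| ^ 2 := by
    intro y
    have := Real.sq_sqrt (hA.inner_nonneg hc hz y)
    rw [sq_abs]; nlinarith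
  set V := ∫ y, |√⟪y, A y⟫ - r| ^ 2 ∂μ with hV
  have hV0 : 0 ≤ V := integral_nonneg fun y => by positivity
  have hτV : τ = r ^ 2 + V := by
    have j1 : Integrable (fun y => 2 * r * (√⟪y, A y⟫ - r)) μ :=
      (i1.sub (integrable_const _)).const_mul _
    have j2 : Integrable (fun y => r ^ 2 + 2 * r * (√⟪y, A y⟫ - r)) μ :=
      (integrable_const _).add j1
    rw [hτ, integral_congr_ae (Filter.Eventually.of_forall hq), integral_add j2 i2,
      integral_add (integrable_const _) j1, integral_const_mul,
      integral_sub i1 (integrable_const _)]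
    simp [hr, hV]
  have hτle : τ ≤ 2 * K * p / z := h.integral_inner_apply_le hA hc hz
  have hr2 : r ^ 2 ≤ 2 * K * p / z := by linarith
  have hpt : ∀ y, (⟪y, A y⟫ - τ) ^ 4 ≤
      27 * (16 * (2 * K * p / z) ^ 2 * |√⟪y, A y⟫ - r| ^ 4 + |√⟪y, A y⟫ - r| ^ 8 + V ^ 4) := by
    intro y
    set ζ := √⟪y, A y⟫ - r with hζ
    have e : ⟪y, A y⟫ - τ = 2 * r * ζ + ζ ^ 2 - V := by
      rw [hq y, hτV, sq_abs, ← hζ]; ring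
    rw [e]
    refine (add_sub_pow_four_le _ _ _).trans ?_
    have e4 : |ζ| ^ 4 = ζ ^ 4 := Even.pow_abs (by decide) _
    have e8 : |ζ| ^ 8 = ζ ^ 8 := Even.pow_abs (by decide) _
    rw [e4, e8]
    have hr4 : r ^ 4 ≤ (2 * K * p / z) ^ 2 := by
      calc r ^ 4 = (r ^ 2) ^ 2 := by ring
        _ ≤ _ := by gcongr
    have : (2 * r * ζ) ^ 4 ≤ 16 * (2 * K * p / z) ^ 2 * ζ ^ 4 := by
      calc (2 * r * ζ) ^ 4 = 16 * r ^ 4 * ζ ^ 4 := by ring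
        _ ≤ _ := by gcongr
    have e9 : (ζ ^ 2) ^ 4 = ζ ^ 8 := by ring
    rw [e9]; linarith
  have i48 : Integrable (fun y => 16 * (2 * K * p / z) ^ 2 * |√⟪y, A y⟫ - r| ^ 4 +
      |√⟪y, A y⟫ - r| ^ 8) μ := (i4.const_mul _).add i8
  have hi : Integrable (fun y => 27 * (16 * (2 * K * p / z) ^ 2 * |√⟪y, A y⟫ - r| ^ 4 +
      |√⟪y, A y⟫ - r| ^ 8 + V ^ 4)) μ :=
    (((i4.const_mul _).add i8).add (integrable_const _)).const_mul _
  have hi' : Integrable (fun y => (⟪y, A y⟫ - τ) ^ 4) μ :=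
    hi.mono' (by fun_prop) (Filter.Eventually.of_forall fun y => by
      rw [Real.norm_eq_abs, abs_of_nonneg (by positivity)]; exact hpt y)
  refine ⟨hi', (integral_mono hi' hi hpt).trans ?_⟩
  rw [integral_const_mul, integral_add i48 (integrable_const _),
    integral_add (i4.const_mul _) i8, integral_const_mul]
  simp only [integral_const, probReal_univ, smul_eq_mul, one_mul]
  have hp : (0 : ℝ) ≤ p := by positivity
  have hz' : 0 < z⁻¹ := by positivity
  have hV4 : V ^ 4 ≤ K ^ 4 * z⁻¹ ^ 4 := by
    rw [← mul_pow]; exact pow_le_pow_left₀ hV0 b2 4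
  have hfirst : 16 * (2 * K * p / z) ^ 2 * ∫ y, |√⟪y, A y⟫ - r| ^ 4 ∂μ ≤
      64 * K ^ 3 * p ^ 2 * z⁻¹ ^ 4 := by
    calc _ ≤ 16 * (2 * K * p / z) ^ 2 * (K * z⁻¹ ^ 2) := by gcongr
      _ = _ := by field_simp; ring
  have hz4 : 0 ≤ z⁻¹ ^ 4 := by positivity
  have e : 2000 * K ^ 4 * (1 + p : ℝ) ^ 2 / z ^ 4 = 2000 * K ^ 4 * (1 + p) ^ 2 * z⁻¹ ^ 4 := by
    rw [inv_pow]; rfl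
  rw [e]
  exact le_trans (by linarith) (quadratic_moment_arith hK hp hz4)

/-- Second moment of `⟪y', A y⟫` for independent `y, y'`. -/
lemma integral_integral_inner_sq_le (h : ColumnMoments μ K) (hA : IsGramResolvent c z x A)
    (hc : 0 ≤ c) (hz : 0 < z) :
    Integrable (fun y => ∫ y', ⟪A y, y'⟫ ^ 2 ∂μ) μ ∧
    ∫ y, ∫ y', ⟪A y, y'⟫ ^ 2 ∂μ ∂μ ≤ ⟪∫ y, y ∂μ, A (∫ y, y ∂μ)⟫ ^ 2 + 3 * K ^ 2 * p / z ^ 2 := by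
  have hK := h.one_le
  set b := ∫ y, y ∂μ with hb
  -- The second-moment bound is applied to y' first; by symmetry of A its mean part becomes a linear
  -- form in y, to which the same bound applies again.
  have hpt : ∀ y, ∫ y', ⟪A y, y'⟫ ^ 2 ∂μ ≤ ⟪A b, y⟫ ^ 2 + K * (‖y‖ ^ 2 / z ^ 2) := by
    intro y
    refine (h.integral_inner_sq_le (A y)).trans ?_
    rw [← hb, hA.symm, real_inner_comm]
    have : ‖A y‖ ^ 2 ≤ ‖y‖ ^ 2 / z ^ 2 := by
      rw [← div_pow]; exact pow_le_pow_left₀ (norm_nonneg _) (hA.norm_le hc hz y) 2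
    nlinarith [h.pos]
  have hi : Integrable (fun y => ⟪A b, y⟫ ^ 2 + K * (‖y‖ ^ 2 / z ^ 2)) μ :=
    (h.integrable_inner_sq _).add
      (((h.integrable_norm_pow (j := 2) (by norm_num)).div_const _).const_mul _)
  have hm : AEStronglyMeasurable (fun y => ∫ y', ⟪A y, y'⟫ ^ 2 ∂μ) μ := by
    have : StronglyMeasurable fun q : EuclideanSpace ℝ (Fin p) × EuclideanSpace ℝ (Fin p) =>
        ⟪A q.1, q.2⟫ ^ 2 := Continuous.stronglyMeasurable (by fun_prop)
    exact this.integral_prod_right.aestronglyMeasurable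
  have hi' : Integrable (fun y => ∫ y', ⟪A y, y'⟫ ^ 2 ∂μ) μ :=
    hi.mono' hm (Filter.Eventually.of_forall fun y => by
      rw [Real.norm_eq_abs, abs_of_nonneg (integral_nonneg fun _ => by positivity)]; exact hpt y)
  refine ⟨hi', (integral_mono hi' hi hpt).trans ?_⟩
  rw [integral_add (h.integrable_inner_sq _)
      (((h.integrable_norm_pow (j := 2) (by norm_num)).div_const _).const_mul _),
    integral_const_mul, integral_div]
  have h1 := h.integral_inner_sq_le (A b)
  rw [← hb, hA.symm] at h1
  have h2 : ‖A b‖ ^ 2 ≤ K * p / z ^ 2 := by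
    calc ‖A b‖ ^ 2 ≤ (‖b‖ / z) ^ 2 := pow_le_pow_left₀ (norm_nonneg _) (hA.norm_le hc hz b) 2
      _ = ‖b‖ ^ 2 / z ^ 2 := by rw [div_pow]
      _ ≤ _ := by gcongr; exact h.mean
  have h3 : K * ((∫ y, ‖y‖ ^ 2 ∂μ) / z ^ 2) ≤ K * (2 * K * p / z ^ 2) := by
    have := h.integral_norm_sq_le
    have := h.pos
    gcongr
  have h4 : K * ‖A b‖ ^ 2 ≤ K * (K * p / z ^ 2) := mul_le_mul_of_nonneg_left h2 h.pos.le
  calc _ ≤ ⟪b, A b⟫ ^ 2 + K * (K * p / z ^ 2) + K * (2 * K * p / z ^ 2) := by linarith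
    _ = _ := by ring

end Quadratic

end ColumnMoments

end SampleCov

namespace SampleCov

/-! ### Resolvents applied to the mean of a class -/

section Deterministic

variable {ι V : Type*} [Fintype ι] [NormedAddCommGroup V] [InnerProductSpace ℝ V]
  {c z : ℝ} {x : ι → V} {A : V →L[ℝ] V}

/-- Cauchy–Schwarz over J, then the energy inequality c ∑ ⟨xⱼ, A u⟩² ≤ ⟨u, A u⟩: the resolvent damps
the directions of the sample, however long the columns are. -/
lemma IsGramResolvent.sq_sum_inner_le (h : IsGramResolvent c z x A) (hc : 0 < c) (hz : 0 < z)
    (J : Finset ι) (u : V) :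
    (∑ j ∈ J, ⟪x j, A u⟫) ^ 2 ≤ J.card / c * ⟪u, A u⟫ := by
  have h1 : (∑ j ∈ J, ⟪x j, A u⟫) ^ 2 ≤ J.card * ∑ j ∈ J, ⟪x j, A u⟫ ^ 2 := sq_sum_le_card_mul_sum_sq
  have h2 : ∑ j ∈ J, ⟪x j, A u⟫ ^ 2 ≤ ∑ j, ⟪x j, A u⟫ ^ 2 :=
    Finset.sum_le_sum_of_subset_of_nonneg (Finset.subset_univ _) fun _ _ _ => sq_nonneg _
  have h3 : ∑ j, ⟪x j, A u⟫ ^ 2 ≤ ⟪u, A u⟫ / c := by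
    rw [le_div_iff₀ hc, mul_comm]; exact h.sum_sq_le hz u
  calc _ ≤ (J.card : ℝ) * (⟪u, A u⟫ / c) := h1.trans (by gcongr; exact h2.trans h3)
    _ = _ := by ring

/-- |J| b is the sum of the columns in J minus the centred sum. The former is handled by
`sq_sum_inner_le`, so for c = 1/n the bound on ⟨u, A b⟩² is of order n/|J| plus the contribution of
the centred sum, whatever the norm of b. -/
lemma IsGramResolvent.card_sq_mul_inner_sq_le (h : IsGramResolvent c z x A) (hc : 0 < c)
    (hz : 0 < z) (J : Finset ι) (b u : V) :
    (J.card : ℝ) ^ 2 * ⟪u, A b⟫ ^ 2 ≤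
      2 * (J.card / c * ⟪u, A u⟫) + 2 * (‖∑ j ∈ J, (x j - b)‖ ^ 2 * ‖A u‖ ^ 2) := by
  set w := ∑ j ∈ J, (x j - b) with hw
  have e : (J.card : ℝ) * ⟪u, A b⟫ = ∑ j ∈ J, ⟪x j, A u⟫ - ⟪w, A u⟫ := by
    rw [← h.symm, hw, sum_inner, ← Finset.sum_sub_distrib]
    simp only [inner_sub_left, sub_sub_cancel, Finset.sum_const, nsmul_eq_mul]
    rw [real_inner_comm]
  have h1 := h.sq_sum_inner_le hc hz J u
  have h2 : ⟪w, A u⟫ ^ 2 ≤ ‖w‖ ^ 2 * ‖A u‖ ^ 2 := by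
    rw [← mul_pow, ← sq_abs]
    exact pow_le_pow_left₀ (abs_nonneg _) (abs_real_inner_le_norm _ _) 2
  rw [← mul_pow, e]
  nlinarith [sq_nonneg (∑ j ∈ J, ⟪x j, A u⟫ + ⟪w, A u⟫)]

lemma IsGramResolvent.card_sq_mul_inner_self_le (h : IsGramResolvent c z x A) (hc : 0 < c)
    (hz : 0 < z) (J : Finset ι) (b : V) :
    (J.card : ℝ) ^ 2 * ⟪b, A b⟫ ≤
      2 * (J.card / c) + 2 * (‖∑ j ∈ J, (x j - b)‖ ^ 2 / z) := by
  set w := ∑ j ∈ J, (x j - b) with hw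
  set s := ∑ j ∈ J, x j with hs
  have e : (J.card : ℝ) • b = s - w := by
    rw [hw, Finset.sum_sub_distrib, ← hs]; simp [Nat.cast_smul_eq_nsmul]
  have h0 : ⟪w, A s⟫ = ⟪s, A w⟫ := by rw [← h.symm, real_inner_comm]
  have e2 : (J.card : ℝ) ^ 2 * ⟪b, A b⟫ = ⟪s, A s⟫ + ⟪w, A w⟫ - 2 * ⟪s, A w⟫ := by
    have : ⟪(J.card : ℝ) • b, A ((J.card : ℝ) • b)⟫ = (J.card : ℝ) ^ 2 * ⟪b, A b⟫ := by
      rw [map_smul, inner_smul_left, inner_smul_right]; simp; ring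
    rw [← this, e]
    simp only [map_sub, inner_sub_left, inner_sub_right, h0]; ring
  -- The sum s is tested against itself: ⟨s, A s⟩² ≤ (|J|/c) ⟨s, A s⟩, and one factor cancels.
  have h1 : ⟪s, A s⟫ ≤ J.card / c := by
    have h2 := h.sq_sum_inner_le hc hz J s
    rw [← sum_inner, ← hs] at h2
    have h3 := h.inner_nonneg hc.le hz s
    by_contra hcon
    push Not at hcon
    have : 0 ≤ (J.card : ℝ) / c := by positivity
    nlinarith
  have h2 := h.inner_le hc.le hz w
  have h3 : 0 ≤ ⟪s, A s⟫ + ⟪w, A w⟫ + 2 * ⟪s, A w⟫ := by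
    have := h.inner_nonneg hc.le hz (s + w)
    simp only [map_add, inner_add_left, inner_add_right, h0] at this
    linarith
  linarith

end Deterministic

/-! ### Sums of the centred columns of a class -/

variable {p : ℕ}

/-- A law all of whose i.i.d. column matrices have convex observables with exponential moments,
together with the resulting bounds on moments. -/
structure ConcLaw (μ : Measure (EuclideanSpace ℝ (Fin p))) (q ε B K : ℝ) : Prop where
  moments : ColumnMoments μ K
  conc : ∀ m, ColumnConc μ m q ε B
  dom : ∃ D : ℝ, 0 ≤ D ∧ (∀ j ≤ 8, ∀ t : ℝ, 0 ≤ t → t ^ j ≤ D * Real.exp (ε * t ^ q)) ∧ D * B ≤ K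

section Columns

variable {μ : Measure (EuclideanSpace ℝ (Fin p))} [IsProbabilityMeasure μ] {q ε B K : ℝ} {m : ℕ}

omit [IsProbabilityMeasure μ] in
-- The constant √m, and not m, for the Frobenius norm is what makes the fluctuations of a centred
-- sum of m columns of order √m.
lemma norm_sum_sub_le (b : EuclideanSpace ℝ (Fin p))
    (y y' : Fin m → EuclideanSpace ℝ (Fin p)) :
    ‖∑ j, (y j - b) - ∑ j, (y' j - b)‖ ≤ √m * √(∑ j, ‖y j - y' j‖ ^ 2) := by
  rw [← Finset.sum_sub_distrib]
  simp only [sub_sub_sub_cancel_right]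
  refine (norm_sum_le _ _).trans ?_
  rw [← Real.sqrt_mul (by positivity)]
  apply Real.le_sqrt_of_sq_le
  simpa using sq_sum_le_card_mul_sum_sq (s := Finset.univ) (f := fun j => ‖y j - y' j‖)

lemma sum_sub_combo (b : EuclideanSpace ℝ (Fin p)) (y y' : Fin m → EuclideanSpace ℝ (Fin p))
    {s t : ℝ} (hst : s + t = 1) :
    ∑ j, ((s • y + t • y') j - b) = s • ∑ j, (y j - b) + t • ∑ j, (y' j - b) := by
  rw [Finset.smul_sum, Finset.smul_sum, ← Finset.sum_add_distrib]
  refine Finset.sum_congr rfl fun j _ => ?_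
  have : b = s • b + t • b := by rw [← add_smul, hst, one_smul]
  simp only [Pi.add_apply, Pi.smul_apply, smul_sub]
  nth_rewrite 1 [this]; abel

omit [IsProbabilityMeasure μ] in
lemma ConcLaw.expConc_norm_sum (h : ConcLaw μ q ε B K) (hm : 0 < m)
    (b : EuclideanSpace ℝ (Fin p)) :
    ExpConc (Measure.pi fun _ : Fin m => μ) (fun y => (√m)⁻¹ * ‖∑ j, (y j - b)‖) q ε B := by
  have hm' : (0 : ℝ) < √m := Real.sqrt_pos.2 (by exact_mod_cast hm)
  refine (h.conc m).scaled hm' (fun y y' =>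
    (abs_norm_sub_norm_le _ _).trans (norm_sum_sub_le b y y')) ?_
  refine ⟨convex_univ, fun y _ y' _ s t hs ht hst => ?_⟩
  simp only [sum_sub_combo b y y' hst]
  refine (norm_add_le _ _).trans ?_
  rw [norm_smul, norm_smul, Real.norm_of_nonneg hs, Real.norm_of_nonneg ht]
  rfl

/-- A linear form of the centred sum is √m-Lipschitz and has zero mean, so its variance is read off
from the concentration of m columns. -/
lemma ConcLaw.integral_inner_sum_sq_le (h : ConcLaw μ q ε B K) (hm : 0 < m)
    (v : EuclideanSpace ℝ (Fin p)) (hv : ‖v‖ = 1) :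
    Integrable (fun y : Fin m → EuclideanSpace ℝ (Fin p) => ⟪v, ∑ j, (y j - ∫ y, y ∂μ)⟫ ^ 2)
      (Measure.pi fun _ : Fin m => μ) ∧
    ∫ y, ⟪v, ∑ j, (y j - ∫ y, y ∂μ)⟫ ^ 2 ∂(Measure.pi fun _ : Fin m => μ) ≤ m * K := by
  set b := ∫ y, y ∂μ with hb
  have hm0 : (0 : ℝ) < m := by exact_mod_cast hm
  have hm' : (0 : ℝ) < √m := Real.sqrt_pos.2 hm0
  obtain ⟨D, hD0, hD, hDK⟩ := h.dom
  have h1 : ExpConc (Measure.pi fun _ : Fin m => μ)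
      (fun y => (√m)⁻¹ * ⟪v, ∑ j, (y j - b)⟫) q ε B := by
    refine (h.conc m).scaled hm' (fun y y' => ?_) ?_
    · rw [← inner_sub_right]
      refine (abs_real_inner_le_norm _ _).trans ?_
      rw [hv, one_mul]; exact norm_sum_sub_le b y y'
    · refine ⟨convex_univ, fun y _ y' _ s t hs ht hst => le_of_eq ?_⟩
      simp only [sum_sub_combo b y y' hst, inner_add_right, inner_smul_right]
      rfl
  have hmean : ∫ y, (√m)⁻¹ * ⟪v, ∑ j, (y j - b)⟫ ∂(Measure.pi fun _ : Fin m => μ) = 0 := by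
    have hmp : ∀ j : Fin m, MeasurePreserving
        (fun y : Fin m → EuclideanSpace ℝ (Fin p) => y j) (Measure.pi fun _ => μ) μ :=
      fun j => measurePreserving_eval (fun _ : Fin m => μ) j
    have hi : ∀ j : Fin m, Integrable
        (fun y : Fin m → EuclideanSpace ℝ (Fin p) => ⟪v, y j - b⟫) (Measure.pi fun _ => μ) :=
      fun j => (hmp j).integrable_comp_of_integrable (g := fun y => ⟪v, y - b⟫)
        ((h.moments.integrable_id.sub (integrable_const b)).const_inner v)
    simp only [inner_sum]
    rw [integral_const_mul, integral_finsetSum _ fun j _ => hi j]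
    have e : ∀ j : Fin m, ∫ y : Fin m → EuclideanSpace ℝ (Fin p), ⟪v, y j - b⟫
        ∂(Measure.pi fun _ => μ) = 0 := fun j => by
      have h2 := integral_map (μ := Measure.pi fun _ : Fin m => μ) (φ := fun y => y j)
        (f := fun y => ⟪v, y - b⟫) (hmp j).measurable.aemeasurable
        (Continuous.aestronglyMeasurable (by fun_prop))
      rw [(hmp j).map_eq] at h2
      have hib : Integrable (fun y => y - b) μ := h.moments.integrable_id.sub (integrable_const b)
      rw [← h2, _root_.integral_inner hib, integral_sub h.moments.integrable_id (integrable_const b), ← hb]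
      simp
    simp [e]
  obtain ⟨i2, b2⟩ := h1.moment (j := 2) h1.1.aestronglyMeasurable hD0 (hD 2 (by norm_num))
  rw [hmean] at i2 b2
  have e : ∀ y : Fin m → EuclideanSpace ℝ (Fin p), ⟪v, ∑ j, (y j - b)⟫ ^ 2 =
      m * |(√m)⁻¹ * ⟪v, ∑ j, (y j - b)⟫ - 0| ^ 2 := by
    intro y
    rw [sub_zero, sq_abs, mul_pow, inv_pow, Real.sq_sqrt hm0.le]; field_simp
  simp only [e]
  refine ⟨i2.const_mul _, ?_⟩
  rw [integral_const_mul]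
  exact mul_le_mul_of_nonneg_left (b2.trans hDK) hm0.le

lemma ConcLaw.integral_norm_sum_sq_le (h : ConcLaw μ q ε B K) (hm : 0 < m) :
    Integrable (fun y : Fin m → EuclideanSpace ℝ (Fin p) => ‖∑ j, (y j - ∫ y, y ∂μ)‖ ^ 2)
      (Measure.pi fun _ : Fin m => μ) ∧
    ∫ y, ‖∑ j, (y j - ∫ y, y ∂μ)‖ ^ 2 ∂(Measure.pi fun _ : Fin m => μ) ≤ m * K * p := by
  have e : ∀ v : EuclideanSpace ℝ (Fin p), ‖v‖ ^ 2 =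
      ∑ a, ⟪EuclideanSpace.single a (1 : ℝ), v⟫ ^ 2 := by
    intro y; simp [EuclideanSpace.norm_sq_eq, EuclideanSpace.inner_single_left]
  simp only [e]
  have h1 := fun a : Fin p => h.integral_inner_sum_sq_le hm (EuclideanSpace.single a (1 : ℝ))
    (by simp)
  refine ⟨integrable_finsetSum _ fun a _ => (h1 a).1, ?_⟩
  rw [integral_finsetSum _ fun a _ => (h1 a).1]
  calc _ ≤ ∑ a : Fin p, m * K := Finset.sum_le_sum fun a _ => (h1 a).2
    _ = _ := by simp; ring

lemma ConcLaw.integral_norm_sum_le (h : ConcLaw μ q ε B K) (hm : 0 < m) :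
    ∫ y, (√m)⁻¹ * ‖∑ j, (y j - ∫ y, y ∂μ)‖ ∂(Measure.pi fun _ : Fin m => μ) ≤ √(K * p) := by
  have hm0 : (0 : ℝ) < m := by exact_mod_cast hm
  have hi := (h.expConc_norm_sum hm (∫ y, y ∂μ)).1
  obtain ⟨i2, b2⟩ := h.integral_norm_sum_sq_le hm
  apply Real.le_sqrt_of_sq_le
  set f : (Fin m → EuclideanSpace ℝ (Fin p)) → ℝ := fun y =>
    (√m)⁻¹ * ‖∑ j, (y j - ∫ y, y ∂μ)‖ with hf
  have hsq : ∀ y, f y ^ 2 = (m : ℝ)⁻¹ * ‖∑ j, (y j - ∫ y, y ∂μ)‖ ^ 2 := fun y => by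
    rw [hf]; simp only; rw [mul_pow, inv_pow, Real.sq_sqrt hm0.le]
  have hi2 : Integrable (fun y => f y ^ 2) (Measure.pi fun _ : Fin m => μ) := by
    simp only [hsq]; exact i2.const_mul _
  have hJ := (even_two.convexOn_pow (𝕜 := ℝ)).map_integral_le
    (μ := Measure.pi fun _ : Fin m => μ) (f := f) (by fun_prop) isClosed_univ
    (Filter.Eventually.of_forall fun _ => Set.mem_univ _) hi hi2
  refine hJ.trans ?_
  show ∫ y, f y ^ 2 ∂_ ≤ _
  simp only [hsq]
  rw [integral_const_mul, inv_mul_le_iff₀ hm0]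
  linarith

/-- After division by √m the norm has mean at most √(K p) and fluctuations of order one. -/
lemma ConcLaw.integral_norm_sum_pow_four_le (h : ConcLaw μ q ε B K) (hm : 0 < m) :
    Integrable (fun y : Fin m → EuclideanSpace ℝ (Fin p) => ‖∑ j, (y j - ∫ y, y ∂μ)‖ ^ 4)
      (Measure.pi fun _ : Fin m => μ) ∧
    ∫ y, ‖∑ j, (y j - ∫ y, y ∂μ)‖ ^ 4 ∂(Measure.pi fun _ : Fin m => μ) ≤
      8 * K ^ 2 * m ^ 2 * (1 + p) ^ 2 := by
  have hm0 : (0 : ℝ) < m := by exact_mod_cast hm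
  have hm' : (0 : ℝ) < √m := Real.sqrt_pos.2 hm0
  have h1 := h.expConc_norm_sum hm (∫ y, y ∂μ)
  obtain ⟨D, hD0, hD, hDK⟩ := h.dom
  obtain ⟨i4, b4⟩ := h1.moment (j := 4) h1.1.aestronglyMeasurable hD0 (hD 4 (by norm_num))
  set f : (Fin m → EuclideanSpace ℝ (Fin p)) → ℝ := fun y =>
    (√m)⁻¹ * ‖∑ j, (y j - ∫ y, y ∂μ)‖ with hf
  set r := ∫ y, f y ∂(Measure.pi fun _ : Fin m => μ) with hr
  have hr0 : 0 ≤ r := integral_nonneg fun y => by positivity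
  have hr1 : r ≤ √(K * p) := h.integral_norm_sum_le hm
  have hK := h.moments.one_le
  have hr4 : r ^ 4 ≤ K ^ 2 * p ^ 2 := by
    calc r ^ 4 ≤ √(K * p) ^ 4 := pow_le_pow_left₀ hr0 hr1 4
      _ = (√(K * p) ^ 2) ^ 2 := by ring
      _ = _ := by rw [Real.sq_sqrt (by positivity)]; ring
  have hpt : ∀ y : Fin m → EuclideanSpace ℝ (Fin p), ‖∑ j, (y j - ∫ y, y ∂μ)‖ ^ 4 ≤
      m ^ 2 * (8 * (r ^ 4 + |f y - r| ^ 4)) := by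
    intro y
    have e : ‖∑ j, (y j - ∫ y, y ∂μ)‖ ^ 4 = (m : ℝ) ^ 2 * |f y| ^ 4 := by
      have : (√m) ^ 4 = (m : ℝ) ^ 2 := by
        calc (√m) ^ 4 = ((√m) ^ 2) ^ 2 := by ring
          _ = _ := by rw [Real.sq_sqrt hm0.le]
      rw [← this, ← mul_pow]
      congr 1
      rw [hf]; simp only
      rw [abs_of_nonneg (by positivity), ← mul_assoc, mul_inv_cancel₀ hm'.ne', one_mul]
    rw [e]
    gcongr
    have h3 : |f y| ≤ |r| + |f y - r| := by
      have := abs_add_le r (f y - r); rwa [add_sub_cancel] at this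
    have h4 := (pow_le_pow_left₀ (abs_nonneg _) h3 4).trans
      (add_pow_le (abs_nonneg _) (abs_nonneg _) 4)
    rw [abs_of_nonneg hr0] at h4
    norm_num at h4 ⊢
    exact h4
  have hi : Integrable (fun y => (m : ℝ) ^ 2 * (8 * (r ^ 4 + |f y - r| ^ 4)))
      (Measure.pi fun _ : Fin m => μ) := (((integrable_const _).add i4).const_mul 8).const_mul _
  have hi' : Integrable (fun y : Fin m → EuclideanSpace ℝ (Fin p) =>
      ‖∑ j, (y j - ∫ y, y ∂μ)‖ ^ 4) (Measure.pi fun _ : Fin m => μ) :=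
    hi.mono' (Continuous.aestronglyMeasurable (by fun_prop))
      (Filter.Eventually.of_forall fun y => by
        rw [Real.norm_eq_abs, abs_of_nonneg (by positivity)]; exact hpt y)
  refine ⟨hi', (integral_mono hi' hi hpt).trans ?_⟩
  rw [integral_const_mul, integral_const_mul, integral_add (integrable_const _) i4]
  simp only [integral_const, probReal_univ, smul_eq_mul, one_mul]
  have hp : (0 : ℝ) ≤ p := by positivity
  have h5 : r ^ 4 + ∫ y, |f y - r| ^ 4 ∂(Measure.pi fun _ : Fin m => μ) ≤ K ^ 2 * (1 + p) ^ 2 := by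
    have h6 : K ≤ K ^ 2 := le_self_pow₀ hK (by norm_num)
    have h7 : 0 ≤ K ^ 2 * (p : ℝ) := by positivity
    have := b4.trans hDK
    nlinarith
  calc _ ≤ (m : ℝ) ^ 2 * (8 * (K ^ 2 * (1 + p) ^ 2)) := by gcongr
    _ = _ := by ring

/-- Chebyshev's exponential inequality. -/
lemma ExpConc.measureReal_le {α : Type*} [MeasurableSpace α] {ν : Measure α}
    [IsProbabilityMeasure ν] {f : α → ℝ} (h : ExpConc ν f q ε B) (hq : 0 < q)
    (hε : 0 < ε) {t : ℝ} (ht : 0 ≤ t) :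
    ν.real {x | t ≤ |f x - ∫ y, f y ∂ν|} ≤ B * Real.exp (-(ε * t ^ q)) := by
  have h1 := mul_meas_ge_le_integral_of_nonneg
    (Filter.Eventually.of_forall fun x => (Real.exp_pos _).le) h.2.1 (Real.exp (ε * t ^ q))
  have h2 : ν.real {x | t ≤ |f x - ∫ y, f y ∂ν|} ≤
      ν.real {x | Real.exp (ε * t ^ q) ≤ Real.exp (ε * |f x - ∫ y, f y ∂ν| ^ q)} := by
    refine measureReal_mono fun x (hx : t ≤ _) => ?_
    show Real.exp _ ≤ Real.exp _
    exact Real.exp_le_exp.2 (by gcongr)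
  rw [Real.exp_neg, ← div_eq_mul_inv, le_div_iff₀ (Real.exp_pos _), mul_comm]
  exact (mul_le_mul_of_nonneg_left h2 (Real.exp_pos _).le).trans (h1.trans h.2.2)

lemma ConcLaw.measureReal_norm_sum_le (h : ConcLaw μ q ε B K) (hq : 0 < q) (hε : 0 < ε)
    (hB : 1 ≤ B) {t : ℝ} (ht : 0 ≤ t) :
    (Measure.pi fun _ : Fin m => μ).real
      {y | √m * (√(K * p) + t) < ‖∑ j, (y j - ∫ y, y ∂μ)‖} ≤ B * Real.exp (-(ε * t ^ q)) := by
  rcases Nat.eq_zero_or_pos m with hm | hm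
  · subst hm
    simp only [Nat.cast_zero, Real.sqrt_zero, zero_mul, Finset.univ_eq_empty, Finset.sum_empty,
      norm_zero, lt_irrefl]
    have : 0 ≤ B * Real.exp (-(ε * t ^ q)) := by positivity
    simpa using this
  have hm0 : (0 : ℝ) < m := by exact_mod_cast hm
  have hm' : (0 : ℝ) < √m := Real.sqrt_pos.2 hm0
  refine (measureReal_mono fun y hy => ?_).trans
    ((h.expConc_norm_sum hm (∫ y, y ∂μ)).measureReal_le hq hε ht)
  rw [Set.mem_ofPred_eq] at hy ⊢
  have h1 := h.integral_norm_sum_le hm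
  have h2 : √(K * p) + t < (√m)⁻¹ * ‖∑ j, (y j - ∫ y, y ∂μ)‖ := by
    rw [lt_inv_mul_iff₀ hm']; exact hy
  refine le_trans ?_ (le_abs_self _)
  linarith

end Columns

section Product

variable {n : ℕ} {m : Fin n → Measure (EuclideanSpace ℝ (Fin p))} [∀ i, IsProbabilityMeasure (m i)]
  {μ : Measure (EuclideanSpace ℝ (Fin p))} [IsProbabilityMeasure μ] {q ε B K : ℝ}

omit [IsProbabilityMeasure μ] in
-- Concentration is available for families indexed by `Fin m`, so the columns of J are relabelled by
-- `Fin J.card`; independence passes to the subfamily.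
lemma map_restrict_class (J : Finset (Fin n)) (hJ : ∀ j ∈ J, m j = μ) :
    (Measure.pi m).map (fun x (j : Fin J.card) => x (J.equivFin.symm j)) =
      Measure.pi fun _ => μ := by
  have hind : iIndepFun (fun (i : Fin n) (x : Fin n → EuclideanSpace ℝ (Fin p)) => x i)
      (Measure.pi m) := by
    have := iIndepFun_pi (μ := m) (X := fun _ => id) (fun _ => aemeasurable_id)
    exact this
  have h2 := hind.precomp (g := fun j : Fin J.card => (J.equivFin.symm j : Fin n))
    (fun a b hab => J.equivFin.symm.injective (Subtype.ext hab))
  rw [iIndepFun_iff_map_fun_eq_pi_map (fun j => (measurable_pi_apply _).aemeasurable)] at h2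
  refine h2.trans ?_
  congr 1
  funext j
  have := (measurePreserving_eval m (J.equivFin.symm j : Fin n)).map_eq
  rw [hJ _ (J.equivFin.symm j).2] at this
  exact this

lemma sum_class_eq (J : Finset (Fin n)) (x : Fin n → EuclideanSpace ℝ (Fin p))
    (b : EuclideanSpace ℝ (Fin p)) :
    ∑ j ∈ J, (x j - b) = ∑ j : Fin J.card, (x (J.equivFin.symm j) - b) := by
  rw [← Finset.sum_coe_sort J fun j => x j - b]
  exact (Equiv.sum_comp J.equivFin.symm fun j : J => x j - b).symm

omit [IsProbabilityMeasure μ] in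
lemma measurePreserving_class (J : Finset (Fin n)) (hJ : ∀ j ∈ J, m j = μ) :
    MeasurePreserving (fun (x : Fin n → EuclideanSpace ℝ (Fin p)) (j : Fin J.card) =>
      x (J.equivFin.symm j)) (Measure.pi m) (Measure.pi fun _ => μ) :=
  ⟨by fun_prop, map_restrict_class J hJ⟩

omit [IsProbabilityMeasure μ] in
lemma integral_class (J : Finset (Fin n)) (hJ : ∀ j ∈ J, m j = μ)
    {g : (Fin J.card → EuclideanSpace ℝ (Fin p)) → ℝ} (hg : Continuous g) :
    ∫ x : Fin n → EuclideanSpace ℝ (Fin p), g (fun j => x (J.equivFin.symm j)) ∂(Measure.pi m) =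
      ∫ y, g y ∂(Measure.pi fun _ => μ) := by
  have hmp := measurePreserving_class (m := m) J hJ
  have := integral_map (μ := Measure.pi m) (f := g) hmp.measurable.aemeasurable
    hg.aestronglyMeasurable
  rw [hmp.map_eq] at this
  exact this.symm

lemma ConcLaw.class_moments (h : ConcLaw μ q ε B K) (J : Finset (Fin n))
    (hJ : ∀ j ∈ J, m j = μ) :
    (Integrable (fun x => ‖∑ j ∈ J, (x j - ∫ y, y ∂μ)‖ ^ 2) (Measure.pi m) ∧
      ∫ x, ‖∑ j ∈ J, (x j - ∫ y, y ∂μ)‖ ^ 2 ∂(Measure.pi m) ≤ J.card * K * p) ∧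
    (Integrable (fun x => ‖∑ j ∈ J, (x j - ∫ y, y ∂μ)‖ ^ 4) (Measure.pi m) ∧
      ∫ x, ‖∑ j ∈ J, (x j - ∫ y, y ∂μ)‖ ^ 4 ∂(Measure.pi m) ≤
        8 * K ^ 2 * J.card ^ 2 * (1 + p) ^ 2) := by
  rcases Nat.eq_zero_or_pos J.card with hm | hm
  · rw [Finset.card_eq_zero] at hm; subst hm; simp
  · simp only [sum_class_eq J]
    have hmp := measurePreserving_class (m := m) J hJ
    refine ⟨⟨hmp.integrable_comp_of_integrable (h.integral_norm_sum_sq_le hm).1, ?_⟩,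
      ⟨hmp.integrable_comp_of_integrable (h.integral_norm_sum_pow_four_le hm).1, ?_⟩⟩
    · rw [integral_class (m := m) J hJ (g := fun y => ‖∑ j, (y j - ∫ y, y ∂μ)‖ ^ 2) (by fun_prop)]
      exact (h.integral_norm_sum_sq_le hm).2
    · rw [integral_class (m := m) J hJ (g := fun y => ‖∑ j, (y j - ∫ y, y ∂μ)‖ ^ 4) (by fun_prop)]
      exact (h.integral_norm_sum_pow_four_le hm).2

lemma ConcLaw.class_tail (h : ConcLaw μ q ε B K) (hq : 0 < q) (hε : 0 < ε) (hB : 1 ≤ B)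
    (J : Finset (Fin n)) (hJ : ∀ j ∈ J, m j = μ) {t : ℝ} (ht : 0 ≤ t) :
    (Measure.pi m).real {x | √J.card * (√(K * p) + t) < ‖∑ j ∈ J, (x j - ∫ y, y ∂μ)‖} ≤
      B * Real.exp (-(ε * t ^ q)) := by
  simp only [sum_class_eq J]
  have hmp := measurePreserving_class (m := m) J hJ
  have hs : MeasurableSet {y : Fin J.card → EuclideanSpace ℝ (Fin p) |
      √J.card * (√(K * p) + t) < ‖∑ j, (y j - ∫ y, y ∂μ)‖} :=
    measurableSet_lt measurable_const (Continuous.measurable (by fun_prop))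
  have := hmp.measureReal_preimage hs.nullMeasurableSet
  exact this.trans_le (h.measureReal_norm_sum_le hq hε hB ht)

end Product

end SampleCov

namespace SampleCov

/-! ### Expectations involving the leave-one-out resolvent -/

variable {p n : ℕ}

/-- The resolvent `Q_{-i}` of the sample deprived of the column `i`. -/
noncomputable def looRes (z : ℝ) (i : Fin n) (x : Fin n → EuclideanSpace ℝ (Fin p)) :
    EuclideanSpace ℝ (Fin p) →L[ℝ] EuclideanSpace ℝ (Fin p) :=
  covRes z (Function.update x i 0)

lemma looRes_update (z : ℝ) (i : Fin n) (x : Fin n → EuclideanSpace ℝ (Fin p))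
    (y : EuclideanSpace ℝ (Fin p)) : looRes z i (Function.update x i y) = looRes z i x := by
  simp [looRes]

lemma isGramResolvent_looRes {z : ℝ} (hz : 0 < z) (i : Fin n)
    (x : Fin n → EuclideanSpace ℝ (Fin p)) :
    IsGramResolvent (n : ℝ)⁻¹ z (Function.update x i 0) (looRes z i x) :=
  isGramResolvent_covRes hz _

lemma continuous_looRes {z : ℝ} (hz : 0 < z) (i : Fin n) :
    Continuous fun x : Fin n → EuclideanSpace ℝ (Fin p) => looRes z i x :=
  (continuous_covRes hz).comp (by fun_prop)

lemma measurable_integral_looRes {z : ℝ} (hz : 0 < z) (i : Fin n)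
    (μ : Measure (EuclideanSpace ℝ (Fin p))) [IsProbabilityMeasure μ]
    {f : EuclideanSpace ℝ (Fin p) × (EuclideanSpace ℝ (Fin p) →L[ℝ] EuclideanSpace ℝ (Fin p)) ×
      EuclideanSpace ℝ (Fin p) → ℝ} (hf : Continuous f) :
    Measurable fun x : Fin n → EuclideanSpace ℝ (Fin p) =>
      ∫ y, f (x i, looRes z i x, y) ∂μ := by
  have hc := continuous_looRes (p := p) hz i
  have : StronglyMeasurable fun q : (Fin n → EuclideanSpace ℝ (Fin p)) × EuclideanSpace ℝ (Fin p) =>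
      f (q.1 i, looRes z i q.1, q.2) := by
    refine Continuous.stronglyMeasurable (hf.comp ?_)
    exact Continuous.prodMk (by fun_prop) (Continuous.prodMk (hc.comp continuous_fst) continuous_snd)
  exact this.integral_prod_right.measurable

section

variable {m : Fin n → Measure (EuclideanSpace ℝ (Fin p))} [∀ i, IsProbabilityMeasure (m i)]
  {q ε B K z₀ z : ℝ} {i : Fin n}

lemma integrable_of_le_column (h : ColumnMoments (m i) K)
    {f : (Fin n → EuclideanSpace ℝ (Fin p)) → ℝ} (hf : Measurable f) {C : ℝ}
    (hC : ∀ x, |f x| ≤ C * (1 + ‖x i‖ ^ 8)) : Integrable f (Measure.pi m) := by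
  have h1 : Integrable (fun x : Fin n → EuclideanSpace ℝ (Fin p) => C * (1 + ‖x i‖ ^ 8))
      (Measure.pi m) :=
    (measurePreserving_eval m i).integrable_comp_of_integrable
      (g := fun y => C * (1 + ‖y‖ ^ 8))
      (((integrable_const 1).add (h.integrable_norm_pow le_rfl)).const_mul C)
  exact h1.mono' hf.aestronglyMeasurable (Filter.Eventually.of_forall hC)

variable {J : Finset (Fin n)}

lemma sum_update_class (hi : i ∉ J) (x : Fin n → EuclideanSpace ℝ (Fin p))
    (b : EuclideanSpace ℝ (Fin p)) :
    ∑ j ∈ J, (Function.update x i 0 j - b) = ∑ j ∈ J, (x j - b) :=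
  Finset.sum_congr rfl fun j hj => by
    rw [Function.update_of_ne (ne_of_mem_of_not_mem hj hi)]

omit [∀ i, IsProbabilityMeasure (m i)] in
/-- Pointwise control of the resolvent applied to the mean of a class. -/
lemma looRes_mean_sq_le (hn : 0 < n) (hz : 0 < z) (h : ColumnMoments (m i) K) (hi : i ∉ J)
    {u : EuclideanSpace ℝ (Fin p)} (hu : ‖u‖ ≤ 1) (x : Fin n → EuclideanSpace ℝ (Fin p)) :
    ((J.card : ℝ) + 1) ^ 2 * ⟪u, looRes z i x (∫ y, y ∂(m i))⟫ ^ 2 ≤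
      4 * (J.card * n) / z + 4 * ‖∑ j ∈ J, (x j - ∫ y, y ∂(m i))‖ ^ 2 / z ^ 2 +
        2 * (K * p) / z ^ 2 := by
  have hn' : (0 : ℝ) < n := by exact_mod_cast hn
  have hA := isGramResolvent_looRes hz i x
  set A := looRes z i x
  set b := ∫ y, y ∂(m i)
  have h1 := hA.card_sq_mul_inner_sq_le (by positivity) hz J b u
  rw [sum_update_class hi] at h1
  set W := ‖∑ j ∈ J, (x j - b)‖
  have hAu : ‖A u‖ ≤ 1 / z := (hA.norm_le (by positivity) hz u).trans (by gcongr)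
  have hAu2 : ‖A u‖ ^ 2 ≤ 1 / z ^ 2 := by
    rw [← one_div_pow]; exact pow_le_pow_left₀ (norm_nonneg _) hAu 2
  have huu : ⟪u, A u⟫ ≤ 1 / z := by
    refine (hA.inner_le (by positivity) hz u).trans ?_
    gcongr; nlinarith [norm_nonneg u]
  have h2 : ⟪u, A b⟫ ^ 2 ≤ K * p / z ^ 2 := by
    rw [← hA.symm]
    calc ⟪A u, b⟫ ^ 2 ≤ (‖A u‖ * ‖b‖) ^ 2 := by
          rw [← sq_abs]; exact pow_le_pow_left₀ (abs_nonneg _) (abs_real_inner_le_norm _ _) 2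
      _ = ‖A u‖ ^ 2 * ‖b‖ ^ 2 := by ring
      _ ≤ 1 / z ^ 2 * (K * p) := by
          have := h.mean
          gcongr
      _ = _ := by ring
  have h3 : (J.card : ℝ) / (n : ℝ)⁻¹ * ⟪u, A u⟫ ≤ J.card * n / z := by
    rw [div_inv_eq_mul, div_eq_mul_one_div _ z]; gcongr
  have h4 : W ^ 2 * ‖A u‖ ^ 2 ≤ W ^ 2 / z ^ 2 := by
    rw [div_eq_mul_one_div]; gcongr
  -- In the applications J is the class of i without i, and |J| + 1 is the class size. The trivial
  -- bound K p / z² pays for the extra 1 and covers the case of empty J.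
  have h5 : ((J.card : ℝ) + 1) ^ 2 ≤ 2 * (J.card : ℝ) ^ 2 + 2 := by
    nlinarith [sq_nonneg ((J.card : ℝ) - 1)]
  calc _ ≤ (2 * (J.card : ℝ) ^ 2 + 2) * ⟪u, A b⟫ ^ 2 := by gcongr
    _ ≤ 2 * (2 * (J.card * n / z) + 2 * (W ^ 2 / z ^ 2)) + 2 * (K * p / z ^ 2) := by linarith
    _ = _ := by ring

omit [∀ i, IsProbabilityMeasure (m i)] in
lemma looRes_mean_self_le (hn : 0 < n) (hz : 0 < z) (h : ColumnMoments (m i) K) (hi : i ∉ J)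
    (x : Fin n → EuclideanSpace ℝ (Fin p)) :
    ((J.card : ℝ) + 1) ^ 2 * ⟪∫ y, y ∂(m i), looRes z i x (∫ y, y ∂(m i))⟫ ≤
      4 * (J.card * n) + 4 * ‖∑ j ∈ J, (x j - ∫ y, y ∂(m i))‖ ^ 2 / z + 2 * (K * p) / z := by
  have hn' : (0 : ℝ) < n := by exact_mod_cast hn
  have hA := isGramResolvent_looRes hz i x
  set A := looRes z i x
  set b := ∫ y, y ∂(m i)
  have h1 := hA.card_sq_mul_inner_self_le (by positivity) hz J b
  rw [sum_update_class hi, div_inv_eq_mul] at h1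
  set W := ‖∑ j ∈ J, (x j - b)‖
  have h2 : ⟪b, A b⟫ ≤ K * p / z := (hA.inner_le (by positivity) hz b).trans (by
    have := h.mean
    gcongr)
  have h0 : 0 ≤ ⟪b, A b⟫ := hA.inner_nonneg (by positivity) hz b
  have h5 : ((J.card : ℝ) + 1) ^ 2 ≤ 2 * (J.card : ℝ) ^ 2 + 2 := by
    nlinarith [sq_nonneg ((J.card : ℝ) - 1)]
  calc _ ≤ (2 * (J.card : ℝ) ^ 2 + 2) * ⟪b, A b⟫ := by gcongr
    _ ≤ 2 * (2 * (J.card * n) + 2 * (W ^ 2 / z)) + 2 * (K * p / z) := by linarith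
    _ = _ := by ring

/-- As z₀ < 1, the various powers of 1/z can all be raised to the largest one present. -/
lemma inv_pow_le_of_le (hz₀ : 0 < z₀) (hz₁ : z₀ < 1) (hz : z₀ ≤ z) {j l : ℕ} (hjl : j ≤ l) :
    1 / z ^ j ≤ 1 / z₀ ^ l := by
  apply one_div_le_one_div_of_le (by positivity)
  calc z₀ ^ l ≤ z₀ ^ j := pow_le_pow_of_le_one hz₀.le hz₁.le hjl
    _ ≤ z ^ j := pow_le_pow_left₀ hz₀.le hz j

lemma integral_looRes_mean_sq_le (hn : 0 < n) (hz₀ : 0 < z₀) (hz₁ : z₀ < 1) (hz : z₀ ≤ z)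
    (h : ConcLaw (m i) q ε B K) (hi : i ∉ J) (hJ : ∀ j ∈ J, m j = m i)
    {u : EuclideanSpace ℝ (Fin p)} (hu : ‖u‖ ≤ 1) :
    ∫ x, ⟪u, looRes z i x (∫ y, y ∂(m i))⟫ ^ 2 ∂(Measure.pi m) ≤
      10 * K * (n / ((J.card : ℝ) + 1)) * (1 + p / n) / z₀ ^ 2 := by
  have hn' : (0 : ℝ) < n := by exact_mod_cast hn
  have hz' : 0 < z := hz₀.trans_le hz
  have hK := h.moments.one_le
  set b := ∫ y, y ∂(m i)
  set D : ℝ := (J.card : ℝ) + 1 with hD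
  have hD0 : 0 < D := by positivity
  have hD1 : 1 ≤ D := by rw [hD]; linarith [show (0 : ℝ) ≤ J.card by positivity]
  obtain ⟨⟨w1, w2⟩, -⟩ := h.class_moments J hJ
  have hpt : ∀ x : Fin n → EuclideanSpace ℝ (Fin p), ⟪u, looRes z i x b⟫ ^ 2 ≤
      (D ^ 2)⁻¹ * (4 * (J.card * n) / z + 4 / z ^ 2 * ‖∑ j ∈ J, (x j - b)‖ ^ 2 +
        2 * (K * p) / z ^ 2) := by
    intro x
    rw [le_inv_mul_iff₀ (by positivity)]
    exact (looRes_mean_sq_le hn hz' h.moments hi hu x).trans_eq (by ring)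
  have i1 : Integrable (fun x : Fin n → EuclideanSpace ℝ (Fin p) =>
      4 * (J.card * n) / z + 4 / z ^ 2 * ‖∑ j ∈ J, (x j - b)‖ ^ 2) (Measure.pi m) :=
    (integrable_const _).add (w1.const_mul _)
  have i2 : Integrable (fun x : Fin n → EuclideanSpace ℝ (Fin p) =>
      (D ^ 2)⁻¹ * (4 * (J.card * n) / z + 4 / z ^ 2 * ‖∑ j ∈ J, (x j - b)‖ ^ 2 +
        2 * (K * p) / z ^ 2)) (Measure.pi m) := (i1.add (integrable_const _)).const_mul _
  refine (integral_mono_of_nonneg (Filter.Eventually.of_forall fun x => sq_nonneg _) i2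
    (Filter.Eventually.of_forall hpt)).trans ?_
  rw [integral_const_mul, integral_add i1 (integrable_const _),
    integral_add (integrable_const _) (w1.const_mul _), integral_const_mul]
  simp only [integral_const, probReal_univ, smul_eq_mul, one_mul]
  have e1 := inv_pow_le_of_le hz₀ hz₁ hz (j := 1) (l := 2) (by norm_num)
  have e2 := inv_pow_le_of_le hz₀ hz₁ hz (j := 2) (l := 2) (by norm_num)
  rw [pow_one] at e1
  have hJD : (J.card : ℝ) ≤ D := by rw [hD]; linarith
  have hp : (0 : ℝ) ≤ p := by positivity
  rw [inv_mul_le_iff₀ (by positivity)]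
  have f1 : 4 * ((J.card : ℝ) * n) / z ≤ 4 * (D * n) * (1 / z₀ ^ 2) := by
    rw [div_eq_mul_one_div]; gcongr
  have f2 : 4 / z ^ 2 * ∫ x, ‖∑ j ∈ J, (x j - b)‖ ^ 2 ∂(Measure.pi m) ≤
      4 * (1 / z₀ ^ 2) * (D * K * p) := by
    rw [div_eq_mul_one_div]
    have : (J.card : ℝ) * K * p ≤ D * K * p := by gcongr
    have h0 : 0 ≤ ∫ x, ‖∑ j ∈ J, (x j - b)‖ ^ 2 ∂(Measure.pi m) :=
      integral_nonneg fun _ => by positivity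
    gcongr
    exact w2.trans this
  have f3 : 2 * (K * p) / z ^ 2 ≤ 2 * (D * K * p) * (1 / z₀ ^ 2) := by
    rw [div_eq_mul_one_div]
    have : K * p ≤ D * K * p := by
      rw [mul_assoc]; exact le_mul_of_one_le_left (by positivity) hD1
    gcongr
  have e : D ^ 2 * (10 * K * (n / D) * (1 + p / n) / z₀ ^ 2) =
      10 * K * D * (n + p) * (1 / z₀ ^ 2) := by field_simp
  rw [e]
  have g0 : 0 ≤ 1 / z₀ ^ 2 := by positivity
  have g1 : 4 * (D * n) + 4 * (D * K * p) + 2 * (D * K * p) ≤ 10 * K * D * (n + p) := by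
    have : D * n ≤ K * (D * n) := le_mul_of_one_le_left (by positivity) hK
    have t1 : 0 ≤ K * (D * n) := by positivity
    have t2 : 0 ≤ D * K * p := by positivity
    linarith
  nlinarith [mul_le_mul_of_nonneg_right g1 g0]

lemma integral_looRes_mean_self_sq_le (hn : 0 < n) (hz₀ : 0 < z₀) (hz₁ : z₀ < 1) (hz : z₀ ≤ z)
    (h : ConcLaw (m i) q ε B K) (hi : i ∉ J) (hJ : ∀ j ∈ J, m j = m i) :
    ∫ x, ⟪∫ y, y ∂(m i), looRes z i x (∫ y, y ∂(m i))⟫ ^ 2 ∂(Measure.pi m) ≤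
      444 * K ^ 2 * (n / ((J.card : ℝ) + 1)) ^ 2 * (1 + p / n) ^ 2 / z₀ ^ 2 := by
  have hn' : (0 : ℝ) < n := by exact_mod_cast hn
  have hn1 : (1 : ℝ) ≤ n := by exact_mod_cast hn
  have hz' : 0 < z := hz₀.trans_le hz
  have hK := h.moments.one_le
  set b := ∫ y, y ∂(m i)
  set D : ℝ := (J.card : ℝ) + 1 with hD
  have hD0 : 0 < D := by positivity
  have hD1 : 1 ≤ D := by rw [hD]; linarith [show (0 : ℝ) ≤ J.card by positivity]
  obtain ⟨-, w1, w2⟩ := h.class_moments J hJ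
  have hpt : ∀ x : Fin n → EuclideanSpace ℝ (Fin p), ⟪b, looRes z i x b⟫ ^ 2 ≤
      (D ^ 4)⁻¹ * (48 * (J.card * n) ^ 2 + 48 / z ^ 2 * ‖∑ j ∈ J, (x j - b)‖ ^ 4 +
        12 * (K * p) ^ 2 / z ^ 2) := by
    intro x
    rw [le_inv_mul_iff₀ (by positivity)]
    have h0 : 0 ≤ ⟪b, looRes z i x b⟫ :=
      (isGramResolvent_looRes hz' i x).inner_nonneg (by positivity) hz' b
    have h1 := looRes_mean_self_le hn hz' h.moments hi x
    have h2 := pow_le_pow_left₀ (by positivity) h1 2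
    have h3 : ∀ a b c : ℝ, (a + b + c) ^ 2 ≤ 3 * (a ^ 2 + b ^ 2 + c ^ 2) := fun a b c => by
      nlinarith [sq_nonneg (a - b), sq_nonneg (a - c), sq_nonneg (b - c)]
    calc _ = (D ^ 2 * ⟪b, looRes z i x b⟫) ^ 2 := by ring
      _ ≤ _ := h2.trans (h3 _ _ _)
      _ = _ := by ring
  have i1 : Integrable (fun x : Fin n → EuclideanSpace ℝ (Fin p) =>
      48 * (J.card * n : ℝ) ^ 2 + 48 / z ^ 2 * ‖∑ j ∈ J, (x j - b)‖ ^ 4) (Measure.pi m) :=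
    (integrable_const _).add (w1.const_mul _)
  have i2 : Integrable (fun x : Fin n → EuclideanSpace ℝ (Fin p) =>
      (D ^ 4)⁻¹ * (48 * (J.card * n) ^ 2 + 48 / z ^ 2 * ‖∑ j ∈ J, (x j - b)‖ ^ 4 +
        12 * (K * p) ^ 2 / z ^ 2)) (Measure.pi m) := (i1.add (integrable_const _)).const_mul _
  refine (integral_mono_of_nonneg (Filter.Eventually.of_forall fun x => sq_nonneg _) i2
    (Filter.Eventually.of_forall hpt)).trans ?_
  rw [integral_const_mul, integral_add i1 (integrable_const _),
    integral_add (integrable_const _) (w1.const_mul _), integral_const_mul (48 / z ^ 2)]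
  simp only [integral_const, probReal_univ, smul_eq_mul, one_mul]
  have e2 := inv_pow_le_of_le hz₀ hz₁ hz (j := 2) (l := 2) (by norm_num)
  have e0 := inv_pow_le_of_le hz₀ hz₁ hz (j := 0) (l := 2) (by norm_num)
  rw [pow_zero, div_one] at e0
  have hJD : (J.card : ℝ) ≤ D := by rw [hD]; linarith
  have hp : (0 : ℝ) ≤ p := by positivity
  rw [inv_mul_le_iff₀ (by positivity)]
  have f1 : 48 * ((J.card : ℝ) * n) ^ 2 ≤ 48 * (D * n) ^ 2 * (1 / z₀ ^ 2) := by
    calc 48 * ((J.card : ℝ) * n) ^ 2 ≤ 48 * (D * n) ^ 2 * 1 := by rw [mul_one]; gcongr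
      _ ≤ _ := by gcongr
  have f2 : 48 / z ^ 2 * ∫ x, ‖∑ j ∈ J, (x j - b)‖ ^ 4 ∂(Measure.pi m) ≤
      48 * (1 / z₀ ^ 2) * (8 * K ^ 2 * D ^ 2 * (1 + p) ^ 2) := by
    rw [div_eq_mul_one_div]
    have : 8 * K ^ 2 * (J.card : ℝ) ^ 2 * (1 + p) ^ 2 ≤ 8 * K ^ 2 * D ^ 2 * (1 + p) ^ 2 := by gcongr
    have h0 : 0 ≤ ∫ x, ‖∑ j ∈ J, (x j - b)‖ ^ 4 ∂(Measure.pi m) :=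
      integral_nonneg fun _ => by positivity
    gcongr
    exact w2.trans this
  have f3 : 12 * (K * p) ^ 2 / z ^ 2 ≤ 12 * (D ^ 2 * (K * p) ^ 2) * (1 / z₀ ^ 2) := by
    rw [div_eq_mul_one_div]
    have : (K * p) ^ 2 ≤ D ^ 2 * (K * p) ^ 2 :=
      le_mul_of_one_le_left (by positivity) (one_le_pow₀ hD1)
    gcongr
  have e : D ^ 4 * (444 * K ^ 2 * (n / D) ^ 2 * (1 + p / n) ^ 2 / z₀ ^ 2) =
      444 * K ^ 2 * D ^ 2 * (n + p) ^ 2 * (1 / z₀ ^ 2) := by field_simp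
  rw [e]
  have g0 : 0 ≤ 1 / z₀ ^ 2 := by positivity
  -- 444 = 48 + 48 · 8 + 12, all three terms being compared with K² D² (n + p)².
  have g1 : 48 * (D * n) ^ 2 + 48 * (8 * K ^ 2 * D ^ 2 * (1 + p) ^ 2) + 12 * (D ^ 2 * (K * p) ^ 2) ≤
      444 * K ^ 2 * D ^ 2 * (n + p) ^ 2 := by
    have hK2 : 1 ≤ K ^ 2 := one_le_pow₀ hK
    have t1 : (D * n) ^ 2 ≤ K ^ 2 * D ^ 2 * (n + p) ^ 2 := by
      calc (D * n) ^ 2 = D ^ 2 * n ^ 2 := by ring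
        _ ≤ K ^ 2 * D ^ 2 * (n + p) ^ 2 := by
          gcongr
          · exact le_mul_of_one_le_left (by positivity) hK2
          · linarith
    have t2 : K ^ 2 * D ^ 2 * (1 + p : ℝ) ^ 2 ≤ K ^ 2 * D ^ 2 * (n + p) ^ 2 := by gcongr
    have t3 : D ^ 2 * (K * p) ^ 2 ≤ K ^ 2 * D ^ 2 * (n + p) ^ 2 := by
      calc D ^ 2 * (K * p) ^ 2 = K ^ 2 * D ^ 2 * (p : ℝ) ^ 2 := by ring
        _ ≤ _ := by gcongr; linarith
    linarith
  nlinarith [mul_le_mul_of_nonneg_right g1 g0]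

lemma continuous_inner_looRes (hz : 0 < z) {f g : (Fin n → EuclideanSpace ℝ (Fin p)) →
    EuclideanSpace ℝ (Fin p)} (hf : Continuous f) (hg : Continuous g) :
    Continuous fun x => ⟪f x, looRes z i x (g x)⟫ :=
  hf.inner ((continuous_looRes hz i).clm_apply hg)

lemma norm_looRes_le (hz : 0 < z) (x : Fin n → EuclideanSpace ℝ (Fin p))
    (v : EuclideanSpace ℝ (Fin p)) : ‖looRes z i x v‖ ≤ ‖v‖ / z :=
  (isGramResolvent_looRes hz i x).norm_le (by positivity) hz v

lemma abs_inner_looRes_le (hz : 0 < z) (x : Fin n → EuclideanSpace ℝ (Fin p))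
    (u v : EuclideanSpace ℝ (Fin p)) : |⟪u, looRes z i x v⟫| ≤ ‖u‖ * ‖v‖ / z := by
  refine (abs_real_inner_le_norm _ _).trans ?_
  rw [mul_div_assoc]
  gcongr
  exact norm_looRes_le hz x v

lemma integrable_looRes_column_sq (hz : 0 < z) (h : ColumnMoments (m i) K)
    (u : EuclideanSpace ℝ (Fin p)) :
    Integrable (fun x => ⟪x i, looRes z i x u⟫ ^ 2) (Measure.pi m) := by
  refine integrable_of_le_column h
    ((continuous_inner_looRes hz (by fun_prop) continuous_const).pow 2).measurable
    (C := (‖u‖ / z) ^ 2) fun x => ?_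
  rw [abs_pow]
  calc _ ≤ (‖x i‖ * ‖u‖ / z) ^ 2 := by gcongr; exact abs_inner_looRes_le hz x _ _
    _ = (‖u‖ / z) ^ 2 * ‖x i‖ ^ 2 := by ring
    _ ≤ _ := by gcongr; exact ColumnMoments.pow_le_one_add _ (norm_nonneg _) (by norm_num)

/-- Second moment of `⟪u, Q_{-i} x_i⟫`. -/
lemma integral_looRes_column_sq_le (hn : 0 < n) (hz₀ : 0 < z₀) (hz₁ : z₀ < 1) (hz : z₀ ≤ z)
    (h : ConcLaw (m i) q ε B K) (hi : i ∉ J) (hJ : ∀ j ∈ J, m j = m i)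
    (hJn : (J.card : ℝ) + 1 ≤ n) {u : EuclideanSpace ℝ (Fin p)} (hu : ‖u‖ ≤ 1) :
    ∫ x, ⟪x i, looRes z i x u⟫ ^ 2 ∂(Measure.pi m) ≤
      11 * K * (n / ((J.card : ℝ) + 1)) * (1 + p / n) / z₀ ^ 2 := by
  have hn' : (0 : ℝ) < n := by exact_mod_cast hn
  have hz' : 0 < z := hz₀.trans_le hz
  have hK := h.moments.one_le
  set b := ∫ y, y ∂(m i) with hb
  set D : ℝ := (J.card : ℝ) + 1 with hD
  have hD0 : 0 < D := by positivity
  rw [← integral_condInt i (integrable_looRes_column_sq hz' h.moments u)]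
  -- Q_{-i} does not involve the column i, so integrating this column alone leaves a mean part,
  -- controlled through the class, and a variance at most K/z₀².
  have hpt : ∀ x, condInt m i (fun x => ⟪x i, looRes z i x u⟫ ^ 2) x ≤
      ⟪u, looRes z i x b⟫ ^ 2 + K / z₀ ^ 2 := by
    intro x
    have e : condInt m i (fun x => ⟪x i, looRes z i x u⟫ ^ 2) x =
        ∫ y, ⟪looRes z i x u, y⟫ ^ 2 ∂(m i) := by
      refine integral_congr_ae (Filter.Eventually.of_forall fun y => ?_)
      simp only [looRes_update, Function.update_self, real_inner_comm]
    rw [e]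
    refine (h.moments.integral_inner_sq_le _).trans ?_
    rw [← hb, (isGramResolvent_looRes hz' i x).symm]
    have h1 : ‖looRes z i x u‖ ^ 2 ≤ 1 / z₀ ^ 2 := by
      calc ‖looRes z i x u‖ ^ 2 ≤ (1 / z) ^ 2 := by
            gcongr
            exact (norm_looRes_le hz' x u).trans (by gcongr)
        _ = 1 / z ^ 2 := by rw [one_div_pow]
        _ ≤ _ := inv_pow_le_of_le hz₀ hz₁ hz le_rfl
    have : K * ‖looRes z i x u‖ ^ 2 ≤ K / z₀ ^ 2 := by
      rw [div_eq_mul_one_div K]; gcongr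
    linarith
  have hi1 : Integrable (fun x => ⟪u, looRes z i x b⟫ ^ 2) (Measure.pi m) := by
    refine integrable_of_le_column h.moments
      ((continuous_inner_looRes hz' continuous_const continuous_const).pow 2).measurable
      (C := (‖u‖ * ‖b‖ / z) ^ 2) fun x => ?_
    rw [abs_pow]
    have : (1 : ℝ) ≤ 1 + ‖x i‖ ^ 8 := by linarith [show 0 ≤ ‖x i‖ ^ 8 by positivity]
    calc _ ≤ (‖u‖ * ‖b‖ / z) ^ 2 * 1 := by
          rw [mul_one]; gcongr; exact abs_inner_looRes_le hz' x _ _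
      _ ≤ _ := by gcongr
  calc _ ≤ ∫ x, (⟪u, looRes z i x b⟫ ^ 2 + K / z₀ ^ 2) ∂(Measure.pi m) :=
        integral_mono (integrable_condInt i (integrable_looRes_column_sq hz' h.moments u))
          (hi1.add (integrable_const _)) hpt
    _ ≤ 10 * K * (n / D) * (1 + p / n) / z₀ ^ 2 + K / z₀ ^ 2 := by
        rw [integral_add hi1 (integrable_const _)]
        have := integral_looRes_mean_sq_le hn hz₀ hz₁ hz h hi hJ hu
        simpa using this
    _ ≤ _ := by
        have h1 : 1 ≤ n / D := by rwa [one_le_div hD0]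
        have h2 : (1 : ℝ) ≤ 1 + p / n := by
          linarith [show (0 : ℝ) ≤ p / n by positivity]
        have h3 : 1 ≤ (n / D) * (1 + p / n) := one_le_mul_of_one_le_of_one_le h1 h2
        rw [← add_div]
        gcongr
        nlinarith

end

end SampleCov

/-! ### Cauchy–Schwarz for integrals and the rank-one update of a quadratic form. -/

namespace SampleCov

lemma sq_integral_mul_le {α : Type*} [MeasurableSpace α] {ν : Measure α} {f g : α → ℝ}
    (hf : Integrable (fun x => f x ^ 2) ν) (hg : Integrable (fun x => g x ^ 2) ν)
    (hfg : Integrable (fun x => f x * g x) ν) :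
    (∫ x, f x * g x ∂ν) ^ 2 ≤ (∫ x, f x ^ 2 ∂ν) * ∫ x, g x ^ 2 ∂ν := by
  have key : ∀ t : ℝ, 0 ≤ (∫ x, g x ^ 2 ∂ν) * (t * t) + 2 * (∫ x, f x * g x ∂ν) * t +
      ∫ x, f x ^ 2 ∂ν := by
    intro t
    have h0 : 0 ≤ ∫ x, (f x + t * g x) ^ 2 ∂ν := integral_nonneg fun x => sq_nonneg _
    have i1 : Integrable (fun x => t ^ 2 * g x ^ 2 + 2 * t * (f x * g x)) ν :=
      (hg.const_mul _).add (hfg.const_mul _)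
    have e : ∀ x, (f x + t * g x) ^ 2 = t ^ 2 * g x ^ 2 + 2 * t * (f x * g x) + f x ^ 2 :=
      fun x => by ring
    simp only [e] at h0
    rw [integral_add i1 hf, integral_add (hg.const_mul _) (hfg.const_mul _), integral_const_mul,
      integral_const_mul] at h0
    linarith
  have := discrim_le_zero key
  unfold discrim at this
  linarith

lemma IsGramResolvent.inner_self_eq_update {ι V : Type*} [Fintype ι] [DecidableEq ι]
    [NormedAddCommGroup V] [InnerProductSpace ℝ V] {c z : ℝ} {x : ι → V} {A A' : V →L[ℝ] V}
    {i : ι} (h : IsGramResolvent c z x A)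
    (h' : IsGramResolvent c z (Function.update x i 0) A') (hc : 0 ≤ c) (hz : 0 < z) (v : V) :
    ⟪v, A v⟫ = ⟪v, A' v⟫ - c * ⟪x i, A' v⟫ ^ 2 / (1 + c * ⟪x i, A' (x i)⟫) := by
  have e : ⟪v, A' (x i)⟫ = ⟪x i, A' v⟫ := by rw [← h'.symm, real_inner_comm]
  rw [h.apply_eq h' hc hz v, inner_sub_right, inner_smul_right, e]
  ring

variable {p n : ℕ} {m : Fin n → Measure (EuclideanSpace ℝ (Fin p))}
  [∀ i, IsProbabilityMeasure (m i)] {q ε B K κ z₀ z : ℝ} {i : Fin n} {J : Finset (Fin n)}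

/-! ### Fluctuations of the normalised trace -/

lemma integrable_inner_apply_sub {μ : Measure (EuclideanSpace ℝ (Fin p))} [IsProbabilityMeasure μ]
    (h : ColumnMoments μ K) (A : EuclideanSpace ℝ (Fin p) →L[ℝ] EuclideanSpace ℝ (Fin p))
    (b : EuclideanSpace ℝ (Fin p)) : Integrable (fun y => ⟪y - b, A (y - b)⟫) μ := by
  have e : ∀ y, ⟪y - b, A (y - b)⟫ = ⟪y, A y⟫ - (⟪y, A b⟫ + ⟪b, A y⟫ - ⟪b, A b⟫) := fun y => by
    simp only [map_sub, inner_sub_left, inner_sub_right]; ring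
  simp only [e]
  have i1 : Integrable (fun y => ⟪y, A b⟫) μ := h.integrable_id.inner_const _
  have i2 : Integrable (fun y => ⟪b, A y⟫) μ := (A.integrable_comp h.integrable_id).const_inner b
  exact (h.integrable_inner_apply A).sub ((i1.add i2).sub (integrable_const _))

/-- Removing x_j changes the form at y − b by c⟨A' x_j, y − b⟩²/(1 + c s), with s = ⟨x_j, A' x_j⟩
and c = 1/n. The square integrates to at most K ‖A' x_j‖² ≤ K s/z, and c s/(1 + c s) ≤ 1, so the
size of x_j plays no role. Centring at b is essential, for only the covariance is bounded. -/
lemma abs_trace_update_le (hn : 0 < n) (hz : 0 < z) {μ : Measure (EuclideanSpace ℝ (Fin p))}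
    [IsProbabilityMeasure μ] (h : ColumnMoments μ K) (x : Fin n → EuclideanSpace ℝ (Fin p))
    (j : Fin n) :
    |∫ y, ⟪y - ∫ y, y ∂μ, covRes z x (y - ∫ y, y ∂μ)⟫ ∂μ -
      ∫ y, ⟪y - ∫ y, y ∂μ, covRes z (Function.update x j 0) (y - ∫ y, y ∂μ)⟫ ∂μ| ≤ K / z := by
  have hn' : (0 : ℝ) < n := by exact_mod_cast hn
  set b := ∫ y, y ∂μ with hb
  set A := covRes z x
  set A' := covRes z (Function.update x j 0)
  have hA : IsGramResolvent (n : ℝ)⁻¹ z x A := isGramResolvent_covRes hz x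
  have hA' : IsGramResolvent (n : ℝ)⁻¹ z (Function.update x j 0) A' := isGramResolvent_covRes hz _
  rw [← integral_sub (integrable_inner_apply_sub h A b) (integrable_inner_apply_sub h A' b)]
  set s := ⟪x j, A' (x j)⟫ with hs
  have hs0 : 0 ≤ s := hA'.inner_nonneg (by positivity) hz _
  have e : ∀ y, ⟪y - b, A (y - b)⟫ - ⟪y - b, A' (y - b)⟫ =
      -((n : ℝ)⁻¹ / (1 + (n : ℝ)⁻¹ * s)) * |⟪A' (x j), y⟫ - ⟪A' (x j), b⟫| ^ 2 := by
    intro y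
    rw [hA.inner_self_eq_update hA' (by positivity) hz, sq_abs, ← inner_sub_right, hA'.symm]
    ring
  simp only [e]
  rw [integral_const_mul, neg_mul, abs_neg, abs_of_nonneg (mul_nonneg (by positivity)
    (integral_nonneg fun _ => by positivity))]
  have h1 := (h.inner_moment (A' (x j)) (j := 2) (by norm_num) (by norm_num)).2
  rw [← hb] at h1
  have h2 : ‖A' (x j)‖ ^ 2 ≤ s / z := by
    rw [le_div_iff₀ hz, mul_comm]; exact hA'.norm_sq_le (by positivity) _
  have hK := h.pos
  calc _ ≤ (n : ℝ)⁻¹ / (1 + (n : ℝ)⁻¹ * s) * (K * (s / z)) := by gcongr; exact h1.trans (by gcongr)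
    _ = (((n : ℝ)⁻¹ * s) / (1 + (n : ℝ)⁻¹ * s)) * (K / z) := by ring
    _ ≤ 1 * (K / z) := by
        gcongr
        rw [div_le_one (by positivity)]; linarith
    _ = _ := one_mul _

/-- The conditional expectation `n⁻¹ tr(Σ Q_{-i})` of `n⁻¹ ⟪x_i, Q_{-i} x_i⟫`. -/
noncomputable def looTrace (m : Fin n → Measure (EuclideanSpace ℝ (Fin p))) (z : ℝ) (i : Fin n)
    (x : Fin n → EuclideanSpace ℝ (Fin p)) : ℝ :=
  (n : ℝ)⁻¹ * ∫ y, ⟪y, looRes z i x y⟫ ∂(m i)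

/-- The second moment is the covariance plus b bᵀ. The covariance part has bounded differences; the
other part is small in L² under the class-size condition, although ‖b‖ may be of order √p. -/
lemma looTrace_eq (h : ColumnMoments (m i) K) (x : Fin n → EuclideanSpace ℝ (Fin p)) :
    looTrace m z i x =
      (n : ℝ)⁻¹ * ∫ y, ⟪y - ∫ y, y ∂(m i), looRes z i x (y - ∫ y, y ∂(m i))⟫ ∂(m i) +
        (n : ℝ)⁻¹ * ⟪∫ y, y ∂(m i), looRes z i x (∫ y, y ∂(m i))⟫ := by
  rw [looTrace, ← mul_add]
  congr 1
  set b := ∫ y, y ∂(m i) with hb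
  set A := looRes z i x
  have e : ∀ y, ⟪y - b, A (y - b)⟫ = ⟪y, A y⟫ - (⟪y, A b⟫ + ⟪b, A y⟫ - ⟪b, A b⟫) := fun y => by
    simp only [map_sub, inner_sub_left, inner_sub_right]; ring
  have i1 : Integrable (fun y => ⟪y, A b⟫) (m i) := h.integrable_id.inner_const _
  have i2 : Integrable (fun y => ⟪b, A y⟫) (m i) :=
    (A.integrable_comp h.integrable_id).const_inner b
  have i3 : Integrable (fun y => ⟪y, A b⟫ + ⟪b, A y⟫) (m i) := i1.add i2
  have i4 : Integrable (fun y => ⟪y, A b⟫ + ⟪b, A y⟫ - ⟪b, A b⟫) (m i) :=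
    i3.sub (integrable_const _)
  have v1 : ∫ y, ⟪y, A b⟫ ∂(m i) = ⟪b, A b⟫ := by
    simp only [real_inner_comm (A b)]
    rw [_root_.integral_inner h.integrable_id]
  have v2 : ∫ y, ⟪b, A y⟫ ∂(m i) = ⟪b, A b⟫ := by
    rw [_root_.integral_inner (A.integrable_comp h.integrable_id),
      A.integral_comp_comm h.integrable_id]
  simp only [e]
  rw [integral_sub (h.integrable_inner_apply A) i4, integral_sub i3 (integrable_const _),
    integral_add i1 i2, v1, v2]
  simp

lemma bddMeas_looTrace (hz : 0 < z) (h : ColumnMoments (m i) K) : BddMeas (looTrace m z i) := by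
  refine ⟨(measurable_integral_looRes hz i (m i)
    (f := fun w => ⟪w.2.2, w.2.1 w.2.2⟫) (by fun_prop)).const_mul _,
    (n : ℝ)⁻¹ * (2 * K * p / z), fun x => ?_⟩
  have hA := isGramResolvent_looRes hz i x
  rw [looTrace, abs_of_nonneg (mul_nonneg (by positivity)
    (integral_nonneg fun y => hA.inner_nonneg (by positivity) hz y))]
  gcongr
  exact h.integral_inner_apply_le hA (by positivity) hz

lemma integral_sub_looTrace_sq_le (hn : 0 < n) (hz₀ : 0 < z₀) (hz₁ : z₀ < 1) (hz : z₀ ≤ z)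
    (h : ConcLaw (m i) q ε B K) (hi : i ∉ J) (hJ : ∀ j ∈ J, m j = m i) (hκ : 0 < κ)
    (hJκ : κ * √n ≤ (J.card : ℝ) + 1) :
    ∫ x, (looTrace m z i x - ∫ x, looTrace m z i x ∂(Measure.pi m)) ^ 2 ∂(Measure.pi m) ≤
      (8 * K ^ 2 + 888 * K ^ 2 / κ ^ 2) * (1 + p / n) ^ 2 / (n * z₀ ^ 2) := by
  have hn' : (0 : ℝ) < n := by exact_mod_cast hn
  have hz' : 0 < z := hz₀.trans_le hz
  have hK := h.moments.one_le
  have hmom := h.moments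
  set b := ∫ y, y ∂(m i) with hb
  set τ : (Fin n → EuclideanSpace ℝ (Fin p)) → ℝ := looTrace m z i with hτ
  set τ₁ : (Fin n → EuclideanSpace ℝ (Fin p)) → ℝ := fun x =>
    (n : ℝ)⁻¹ * ∫ y, ⟪y - b, looRes z i x (y - b)⟫ ∂(m i) with hτ₁
  set θ : (Fin n → EuclideanSpace ℝ (Fin p)) → ℝ := fun x =>
    (n : ℝ)⁻¹ * ⟪b, looRes z i x b⟫ with hθ
  have hsum : ∀ x, τ x = τ₁ x + θ x := looTrace_eq hmom
  have bτ : BddMeas τ := bddMeas_looTrace hz' hmom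
  have bθ : BddMeas θ := by
    refine BddMeas.const_mul ⟨(continuous_inner_looRes hz' continuous_const
      continuous_const).measurable, ‖b‖ * ‖b‖ / z, fun x => abs_inner_looRes_le hz' x b b⟩ _
  have bτ₁ : BddMeas τ₁ := by
    have : τ₁ = fun x => τ x - θ x := by ext x; rw [hsum]; ring
    rw [this]; exact bτ.sub bθ
  have hdiff0 : ∀ j x, |τ₁ x - τ₁ (Function.update x j 0)| ≤ K / (n * z) := by
    intro j x
    simp only [hτ₁]
    rw [← mul_sub, abs_mul, abs_of_pos (by positivity : (0 : ℝ) < (n : ℝ)⁻¹)]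
    have : |∫ y, ⟪y - b, looRes z i x (y - b)⟫ ∂(m i) -
        ∫ y, ⟪y - b, looRes z i (Function.update x j 0) (y - b)⟫ ∂(m i)| ≤ K / z := by
      by_cases hij : j = i
      · subst hij
        rw [looRes_update, sub_self, abs_zero]
        positivity
      · have := abs_trace_update_le hn hz' hmom (Function.update x i 0) j
        rw [Function.update_comm (Ne.symm hij)] at this
        exact this
    calc (n : ℝ)⁻¹ * _ ≤ (n : ℝ)⁻¹ * (K / z) := by gcongr
      _ = _ := by field_simp
  have hdiff : ∀ j x y, |τ₁ x - τ₁ (Function.update x j y)| ≤ 2 * (K / (n * z)) := by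
    intro j x y
    have h1 := hdiff0 j x
    have h2 := hdiff0 j (Function.update x j y)
    rw [Function.update_idem] at h2
    have := abs_sub_le (τ₁ x) (τ₁ (Function.update x j 0)) (τ₁ (Function.update x j y))
    rw [abs_sub_comm] at h2
    linarith
  -- Each of the n columns moves τ₁ by at most 2K/(n z), which yields a variance of order 1/n.
  have hES := integral_sub_sq_le (m := m) bτ₁ hdiff
  rw [Finset.sum_const, Finset.card_univ, Fintype.card_fin, nsmul_eq_mul] at hES
  have hθ2 := integral_looRes_mean_self_sq_le hn hz₀ hz₁ hz h hi hJ
  rw [← hb] at hθ2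
  set e₁ := ∫ x, τ₁ x ∂(Measure.pi m)
  set e₂ := ∫ x, θ x ∂(Measure.pi m) with he₂
  have hE : ∫ x, τ x ∂(Measure.pi m) = e₁ + e₂ := by
    simp only [hsum]; exact integral_add (bτ₁.integrable _) (bθ.integrable _)
  have hvθ : ∫ x, (θ x - e₂) ^ 2 ∂(Measure.pi m) ≤ ∫ x, θ x ^ 2 ∂(Measure.pi m) := by
    have e : ∀ x, (θ x - e₂) ^ 2 = θ x * θ x - (2 * e₂ * θ x - e₂ ^ 2) := fun x => by ring
    simp only [e, pow_two (θ _)]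
    rw [integral_sub ((bθ.mul bθ).integrable _)
      (((bθ.const_mul _).sub (BddMeas.const _)).integrable _),
      integral_sub ((bθ.const_mul _).integrable _) (integrable_const _), integral_const_mul, ← he₂]
    simp only [integral_const, probReal_univ, smul_eq_mul, one_mul]
    nlinarith [sq_nonneg e₂]
  have hpt : ∀ x, (τ x - ∫ x, τ x ∂(Measure.pi m)) ^ 2 ≤
      2 * (τ₁ x - e₁) ^ 2 + 2 * (θ x - e₂) ^ 2 := by
    intro x
    rw [hE, hsum]
    nlinarith [sq_nonneg ((τ₁ x - e₁) - (θ x - e₂))]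
  have bsq : ∀ {f : (Fin n → EuclideanSpace ℝ (Fin p)) → ℝ} (c : ℝ), BddMeas f →
      Integrable (fun x => (f x - c) ^ 2) (Measure.pi m) := fun c hf => by
    simp only [pow_two]
    exact ((hf.sub (BddMeas.const c)).mul (hf.sub (BddMeas.const c))).integrable _
  have h1 : ∫ x, (τ x - ∫ x, τ x ∂(Measure.pi m)) ^ 2 ∂(Measure.pi m) ≤
      2 * ∫ x, (τ₁ x - e₁) ^ 2 ∂(Measure.pi m) + 2 * ∫ x, (θ x - e₂) ^ 2 ∂(Measure.pi m) := by
    rw [← integral_const_mul, ← integral_const_mul,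
      ← integral_add ((bsq _ bτ₁).const_mul _) ((bsq _ bθ).const_mul _)]
    exact integral_mono (bsq _ bτ) (((bsq _ bτ₁).const_mul _).add ((bsq _ bθ).const_mul _)) hpt
  have hθ3 : ∫ x, θ x ^ 2 ∂(Measure.pi m) ≤
      444 * K ^ 2 / κ ^ 2 * (1 + p / n) ^ 2 / (n * z₀ ^ 2) := by
    simp only [hθ, mul_pow]
    rw [integral_const_mul]
    set D : ℝ := (J.card : ℝ) + 1
    have hD0 : 0 < D := by positivity
    -- The lower bound κ√n on the class size enters here: it makes the second moment of θ of order
    -- 1/n.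
    have hnD : (n / D) ^ 2 ≤ n / κ ^ 2 := by
      have : κ ^ 2 * n ≤ D ^ 2 := by
        calc κ ^ 2 * n = (κ * √n) ^ 2 := by rw [mul_pow, Real.sq_sqrt hn'.le]
          _ ≤ D ^ 2 := by gcongr
      rw [div_pow, div_le_div_iff₀ (by positivity) (by positivity)]
      nlinarith
    calc _ ≤ (n : ℝ)⁻¹ ^ 2 * (444 * K ^ 2 * (n / κ ^ 2) * (1 + p / n) ^ 2 / z₀ ^ 2) := by
          gcongr
          exact hθ2.trans (by gcongr)
      _ = _ := by field_simp
  have hz2 := inv_pow_le_of_le hz₀ hz₁ hz (j := 2) (l := 2) le_rfl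
  have hES2 : ∫ x, (τ₁ x - e₁) ^ 2 ∂(Measure.pi m) ≤ 4 * K ^ 2 * (1 + p / n) ^ 2 / (n * z₀ ^ 2) := by
    have h3 : (1 : ℝ) ≤ (1 + p / n) ^ 2 := one_le_pow₀ (by
      linarith [show (0 : ℝ) ≤ p / n by positivity])
    calc _ ≤ (n : ℝ) * (2 * (K / (n * z))) ^ 2 := hES
      _ = 4 * K ^ 2 * (1 / z ^ 2) / n := by field_simp; ring
      _ ≤ 4 * K ^ 2 * (1 / z₀ ^ 2) / n := by gcongr
      _ = 4 * K ^ 2 * 1 / (n * z₀ ^ 2) := by field_simp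
      _ ≤ _ := by gcongr
  calc _ ≤ 2 * (4 * K ^ 2 * (1 + p / n) ^ 2 / (n * z₀ ^ 2)) +
        2 * (444 * K ^ 2 / κ ^ 2 * (1 + p / n) ^ 2 / (n * z₀ ^ 2)) := by
        have := hvθ.trans hθ3
        linarith
    _ = _ := by ring

end SampleCov

namespace SampleCov

/-! ### The contribution of one column to the bias -/

/-- The deviation splits into the fluctuation d in y and the error e of the conditional mean, with
(d + e)² ≤ 2d² + 2e². The product ⟨g, y⟩² d² is separated by Young's inequality, whose free weight η
later balances the two fourth moments. -/
lemma ColumnMoments.integral_inner_sq_mul_quadratic_le {p : ℕ} {ι : Type*} [Fintype ι]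
    {μ : Measure (EuclideanSpace ℝ (Fin p))} [IsProbabilityMeasure μ] {K c z : ℝ}
    {x : ι → EuclideanSpace ℝ (Fin p)} {A : EuclideanSpace ℝ (Fin p) →L[ℝ] EuclideanSpace ℝ (Fin p)}
    (h : ColumnMoments μ K) (hA : IsGramResolvent c z x A) (hc : 0 ≤ c) (hz : 0 < z)
    (g : EuclideanSpace ℝ (Fin p)) (s δ : ℝ) {η : ℝ} (hη : 0 < η) :
    ∫ y, ⟪g, y⟫ ^ 2 * (s * ⟪y, A y⟫ - δ) ^ 2 ∂μ ≤
      η * (8 * (⟪g, ∫ y, y ∂μ⟫ ^ 4 + K * ‖g‖ ^ 4)) +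
        η⁻¹ * (s ^ 4 * (2000 * K ^ 4 * (1 + p) ^ 2 / z ^ 4)) +
        2 * (s * ∫ y, ⟪y, A y⟫ ∂μ - δ) ^ 2 * ∫ y, ⟪g, y⟫ ^ 2 ∂μ := by
  set τ := ∫ y, ⟪y, A y⟫ ∂μ
  have h4 := h.integral_inner_pow_four_le g
  have hq := h.integral_quadratic_pow_four_le hA hc hz
  have i1 : Integrable (fun y => η * ⟪g, y⟫ ^ 4 + η⁻¹ * s ^ 4 * (⟪y, A y⟫ - τ) ^ 4) μ :=
    (h4.1.const_mul _).add (hq.1.const_mul _)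
  have i2 : Integrable (fun y => 2 * (s * τ - δ) ^ 2 * ⟪g, y⟫ ^ 2) μ :=
    (h.integrable_inner_sq g).const_mul _
  calc _ ≤ ∫ y, (η * ⟪g, y⟫ ^ 4 + η⁻¹ * s ^ 4 * (⟪y, A y⟫ - τ) ^ 4 +
        2 * (s * τ - δ) ^ 2 * ⟪g, y⟫ ^ 2) ∂μ := by
        refine integral_mono_of_nonneg (.of_forall fun y => by positivity) (i1.add i2)
          (.of_forall fun y => ?_)
        set a := ⟪g, y⟫
        set d := s * (⟪y, A y⟫ - τ) with hd
        set e := s * τ - δ with he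
        have e1 : s * ⟪y, A y⟫ - δ = d + e := by rw [hd, he]; ring
        have e2 : η⁻¹ * s ^ 4 * (⟪y, A y⟫ - τ) ^ 4 = η⁻¹ * d ^ 4 := by rw [hd]; ring
        simp only [e1, e2]
        have h1 : 2 * (a ^ 2 * d ^ 2) ≤ η * a ^ 4 + η⁻¹ * d ^ 4 := by
          have : 0 ≤ η⁻¹ * (η * a ^ 2 - d ^ 2) ^ 2 := by positivity
          have e3 : η⁻¹ * (η * a ^ 2 - d ^ 2) ^ 2 =
              η * a ^ 4 + η⁻¹ * d ^ 4 - 2 * (a ^ 2 * d ^ 2) := by field_simp; ring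
          linarith
        nlinarith [mul_nonneg (sq_nonneg a) (sq_nonneg (d - e))]
    _ = η * ∫ y, ⟪g, y⟫ ^ 4 ∂μ + η⁻¹ * s ^ 4 * ∫ y, (⟪y, A y⟫ - τ) ^ 4 ∂μ +
        2 * (s * τ - δ) ^ 2 * ∫ y, ⟪g, y⟫ ^ 2 ∂μ := by
        rw [integral_add i1 i2, integral_add (h4.1.const_mul _) (hq.1.const_mul _),
          integral_const_mul, integral_const_mul, integral_const_mul]
    _ ≤ _ := by
        rw [mul_assoc η⁻¹]
        gcongr
        · exact h4.2
        · exact hq.2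

variable {p n : ℕ} {m : Fin n → Measure (EuclideanSpace ℝ (Fin p))}
  [∀ i, IsProbabilityMeasure (m i)] {q ε B K κ z₀ z : ℝ} {i : Fin n} {J : Finset (Fin n)}

lemma integrable_inner_sq_mul_quadratic (hz : 0 < z) (h : ColumnMoments (m i) K)
    (g : EuclideanSpace ℝ (Fin p)) (s δ : ℝ) :
    Integrable (fun x => ⟪g, x i⟫ ^ 2 * (s * ⟪x i, looRes z i x (x i)⟫ - δ) ^ 2)
      (Measure.pi m) := by
  refine integrable_of_le_column h (C := ‖g‖ ^ 2 * (2 * (|s| / z) ^ 2 + 2 * δ ^ 2) ) ?_ fun x => ?_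
  · have hi : Continuous fun x : Fin n → EuclideanSpace ℝ (Fin p) => x i := continuous_apply i
    have := continuous_inner_looRes (i := i) hz hi hi
    exact Continuous.measurable (by fun_prop)
  · have h1 := abs_inner_looRes_le (i := i) hz x (x i) (x i)
    have h2 := abs_real_inner_le_norm g (x i)
    have h3 : (s * ⟪x i, looRes z i x (x i)⟫ - δ) ^ 2 ≤
        2 * ((|s| / z) * ‖x i‖ ^ 2) ^ 2 + 2 * δ ^ 2 := by
      have : (s * ⟪x i, looRes z i x (x i)⟫) ^ 2 ≤ ((|s| / z) * ‖x i‖ ^ 2) ^ 2 := by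
        rw [← sq_abs, abs_mul]
        refine pow_le_pow_left₀ (by positivity) ?_ 2
        calc |s| * _ ≤ |s| * (‖x i‖ * ‖x i‖ / z) := by gcongr
          _ = _ := by ring
      nlinarith [sq_nonneg (s * ⟪x i, looRes z i x (x i)⟫ + δ)]
    have h4 : ⟪g, x i⟫ ^ 2 ≤ ‖g‖ ^ 2 * ‖x i‖ ^ 2 := by
      rw [← sq_abs, ← mul_pow]; gcongr
    rw [abs_of_nonneg (by positivity)]
    have h6 := ColumnMoments.pow_le_one_add ‖x i‖ (norm_nonneg _) (j := 6) (by norm_num)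
    have h7 := ColumnMoments.pow_le_one_add ‖x i‖ (norm_nonneg _) (j := 2) (by norm_num)
    calc _ ≤ ‖g‖ ^ 2 * ‖x i‖ ^ 2 * (2 * ((|s| / z) * ‖x i‖ ^ 2) ^ 2 + 2 * δ ^ 2) := by gcongr
      _ = ‖g‖ ^ 2 * (2 * (|s| / z) ^ 2 * ‖x i‖ ^ 6 + 2 * δ ^ 2 * ‖x i‖ ^ 2) := by ring
      _ ≤ ‖g‖ ^ 2 * (2 * (|s| / z) ^ 2 * (1 + ‖x i‖ ^ 8) + 2 * δ ^ 2 * (1 + ‖x i‖ ^ 8)) := by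
          gcongr
      _ = _ := by ring

/-- The constant of `integral_inner_sq_mul_sub_sq_le`. -/
noncomputable def fluctConst (K κ : ℝ) : ℝ :=
  8 * (1 + K) + 2000 * K ^ 4 + 2 * (8 * K ^ 2 + 888 * K ^ 2 / κ ^ 2)

/-- In the application g is the deterministic equivalent applied to v, and G = 1 + δ. The factor G²
is tracked because its root meets a factor (1 + δ)⁻¹ in the bias of a column. -/
lemma integral_inner_sq_mul_sub_sq_le (hn : 0 < n) (hz₀ : 0 < z₀) (hz₁ : z₀ < 1) (hz : z₀ ≤ z)
    (h : ConcLaw (m i) q ε B K) (hi : i ∉ J) (hJ : ∀ j ∈ J, m j = m i) (hκ : 0 < κ)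
    (hJκ : κ * √n ≤ (J.card : ℝ) + 1) (hJn : (J.card : ℝ) + 1 ≤ n) {G : ℝ} (hG : 1 ≤ G)
    {g : EuclideanSpace ℝ (Fin p)} (hg : ‖g‖ ≤ 1 / z₀)
    (hgV : ∫ y, ⟪g, y⟫ ^ 2 ∂(m i) ≤ G * (n / ((J.card : ℝ) + 1)) / z₀) {δ : ℝ}
    (hδ : δ = ∫ x, looTrace m z i x ∂(Measure.pi m)) :
    ∫ x, ⟪g, x i⟫ ^ 2 * ((n : ℝ)⁻¹ * ⟪x i, looRes z i x (x i)⟫ - δ) ^ 2 ∂(Measure.pi m) ≤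
      fluctConst K κ * (G ^ 2 * (n / ((J.card : ℝ) + 1)) / z₀ ^ 2) * (1 + p / n) ^ 2 /
        (n * z₀ ^ 2) := by
  have hn' : (0 : ℝ) < n := by exact_mod_cast hn
  have hz' : 0 < z := hz₀.trans_le hz
  have hK := h.moments.one_le
  set b := ∫ y, y ∂(m i) with hb
  set V := ∫ y, ⟪g, y⟫ ^ 2 ∂(m i) with hV
  set N := (n : ℝ) / ((J.card : ℝ) + 1) with hN
  have hN1 : 1 ≤ N := by rw [hN, one_le_div (by positivity)]; exact hJn
  set H := G ^ 2 * N / z₀ ^ 2 with hH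
  set γ := 1 + (p : ℝ) / n with hγ
  have hγ1 : 1 ≤ γ := by rw [hγ]; linarith [show (0 : ℝ) ≤ p / n by positivity]
  have hG0 : 0 < G := by linarith
  have hH0 : 0 < H := by positivity
  -- H dominates both ‖g‖² and the second moment of ⟨g, y⟩; this η brings both Young terms to the
  -- order H γ/(n z₀²).
  set η := γ / (n * z₀ ^ 2 * H) with hη
  have hη0 : 0 < η := by positivity
  have hV0 : 0 ≤ V := integral_nonneg fun y => by positivity
  have hbV : ⟪g, b⟫ ^ 2 ≤ V := by
    rw [hV, h.moments.integral_inner_sq]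
    have : 0 ≤ ∫ y, (⟪g, y⟫ - ⟪g, ∫ y, y ∂(m i)⟫) ^ 2 ∂(m i) :=
      integral_nonneg fun y => by positivity
    linarith
  have hint := integrable_inner_sq_mul_quadratic hz' h.moments g (n : ℝ)⁻¹ δ
  rw [← integral_condInt i hint]
  have hcond : ∀ x, condInt m i (fun x => ⟪g, x i⟫ ^ 2 *
      ((n : ℝ)⁻¹ * ⟪x i, looRes z i x (x i)⟫ - δ) ^ 2) x ≤
      η * (8 * (⟪g, b⟫ ^ 4 + K * ‖g‖ ^ 4)) +
        η⁻¹ * ((n : ℝ)⁻¹ ^ 4 * (2000 * K ^ 4 * (1 + p) ^ 2 / z ^ 4)) +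
        2 * V * (looTrace m z i x - δ) ^ 2 := by
    intro x
    simp only [condInt, Function.update_self, looRes_update]
    have := h.moments.integral_inner_sq_mul_quadratic_le (isGramResolvent_looRes hz' i x)
      (by positivity) hz' g (n : ℝ)⁻¹ δ hη0
    rw [looTrace]
    linarith
  have bτ : BddMeas fun x => (looTrace m z i x - δ) * (looTrace m z i x - δ) :=
    ((bddMeas_looTrace hz' h.moments).sub (BddMeas.const δ)).mul
      ((bddMeas_looTrace hz' h.moments).sub (BddMeas.const δ))
  have iτ : Integrable (fun x => (looTrace m z i x - δ) ^ 2) (Measure.pi m) := by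
    simp only [pow_two]; exact bτ.integrable _
  have hvar := integral_sub_looTrace_sq_le hn hz₀ hz₁ hz h hi hJ hκ hJκ
  rw [← hδ, ← hγ] at hvar
  have hstep := integral_mono (integrable_condInt i hint)
    ((integrable_const _).add (iτ.const_mul _)) hcond
  simp only [Pi.add_apply] at hstep
  rw [integral_add (integrable_const _) (iτ.const_mul _), integral_const_mul] at hstep
  simp only [integral_const, probReal_univ, smul_eq_mul, one_mul] at hstep
  refine hstep.trans ?_
  have hHz : 1 / z₀ ^ 2 ≤ H := by
    rw [hH]
    gcongr
    exact one_le_mul_of_one_le_of_one_le (one_le_pow₀ hG) hN1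
  have hNH : N ≤ H := by
    rw [hH, le_div_iff₀ (by positivity)]
    calc N * z₀ ^ 2 ≤ N * G ^ 2 := by gcongr; exact hz₁.le.trans hG
      _ = _ := mul_comm _ _
  have hVH : V ≤ H := by
    refine hgV.trans ?_
    rw [hH]
    gcongr
    · exact le_self_pow₀ hG (by norm_num)
    · exact pow_le_of_le_one hz₀.le hz₁.le (by norm_num)
  have hV2 : V ^ 2 ≤ H * N := by
    calc V ^ 2 ≤ (G * N / z₀) ^ 2 := by gcongr
      _ = H * N := by rw [hH]; field_simp
  set W := H * γ ^ 2 / (n * z₀ ^ 2) with hW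
  have hW0 : 0 ≤ W := by positivity
  have t1 : η * (8 * (⟪g, b⟫ ^ 4 + K * ‖g‖ ^ 4)) ≤ 8 * (1 + K) * W := by
    have e1 : ⟪g, b⟫ ^ 4 ≤ H ^ 2 := by
      calc ⟪g, b⟫ ^ 4 = (⟪g, b⟫ ^ 2) ^ 2 := by ring
        _ ≤ V ^ 2 := by gcongr
        _ ≤ H ^ 2 := by gcongr
    have e2 : ‖g‖ ^ 4 ≤ H ^ 2 := by
      calc ‖g‖ ^ 4 ≤ (1 / z₀) ^ 4 := by gcongr
        _ = (1 / z₀ ^ 2) ^ 2 := by ring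
        _ ≤ H ^ 2 := by gcongr
    calc _ ≤ η * (8 * (H ^ 2 + K * H ^ 2)) := by gcongr
      _ = 8 * (1 + K) * (H * γ ^ 1 / (n * z₀ ^ 2)) := by rw [hη]; field_simp
      _ ≤ _ := by rw [hW]; gcongr; norm_num
  have t2 : η⁻¹ * ((n : ℝ)⁻¹ ^ 4 * (2000 * K ^ 4 * (1 + p) ^ 2 / z ^ 4)) ≤ 2000 * K ^ 4 * W := by
    have e1 : (1 + (p : ℝ)) ^ 2 ≤ (n * γ) ^ 2 := by
      have : (1 : ℝ) ≤ n := by exact_mod_cast hn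
      have : n * γ = n + p := by rw [hγ]; field_simp
      rw [this]
      gcongr
    have e2 := inv_pow_le_of_le hz₀ hz₁ hz (j := 4) (l := 4) le_rfl
    calc _ = η⁻¹ * ((n : ℝ)⁻¹ ^ 4 * (2000 * K ^ 4 * (1 + p) ^ 2 * (1 / z ^ 4))) := by ring
      _ ≤ η⁻¹ * ((n : ℝ)⁻¹ ^ 4 * (2000 * K ^ 4 * (n * γ) ^ 2 * (1 / z₀ ^ 4))) := by gcongr
      _ = 2000 * K ^ 4 * (H * γ ^ 1 / (n * z₀ ^ 2)) := by rw [hη]; field_simp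
      _ ≤ _ := by rw [hW]; gcongr; norm_num
  have t3 : 2 * V * ∫ x, (looTrace m z i x - δ) ^ 2 ∂(Measure.pi m) ≤
      2 * (8 * K ^ 2 + 888 * K ^ 2 / κ ^ 2) * W := by
    calc _ ≤ 2 * H * ((8 * K ^ 2 + 888 * K ^ 2 / κ ^ 2) * γ ^ 2 / (n * z₀ ^ 2)) := by gcongr
      _ = _ := by rw [hW]; ring
  calc _ ≤ 8 * (1 + K) * W + 2000 * K ^ 4 * W + 2 * (8 * K ^ 2 + 888 * K ^ 2 / κ ^ 2) * W := by
        linarith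
    _ = _ := by rw [hW, fluctConst]; ring

end SampleCov

/-! ### The bias of one column: cross term and remainder. -/

namespace SampleCov

variable {p n : ℕ} {m : Fin n → Measure (EuclideanSpace ℝ (Fin p))}
  [∀ i, IsProbabilityMeasure (m i)] {q ε B K κ z₀ z : ℝ} {i : Fin n} {J : Finset (Fin n)}

lemma measurable_looRes_cross (hz : 0 < z) (g : EuclideanSpace ℝ (Fin p)) :
    Measurable fun x : Fin n → EuclideanSpace ℝ (Fin p) =>
      ∫ y, ⟪looRes z i x (x i), y⟫ * ⟪g, y⟫ ∂(m i) :=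
  measurable_integral_looRes hz i (m i) (f := fun w => ⟪w.2.1 w.1, w.2.2⟫ * ⟪g, w.2.2⟫)
    (by fun_prop)

lemma sq_looRes_cross_le (h : ColumnMoments (m i) K) (v g : EuclideanSpace ℝ (Fin p)) :
    (∫ y, ⟪v, y⟫ * ⟪g, y⟫ ∂(m i)) ^ 2 ≤
      (∫ y, ⟪v, y⟫ ^ 2 ∂(m i)) * ∫ y, ⟪g, y⟫ ^ 2 ∂(m i) :=
  sq_integral_mul_le (h.integrable_inner_sq v) (h.integrable_inner_sq g)
    (h.integrable_inner_mul v g)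

lemma ColumnMoments.integral_inner_sq_le_norm {μ : Measure (EuclideanSpace ℝ (Fin p))}
    [IsProbabilityMeasure μ] (h : ColumnMoments μ K) (v : EuclideanSpace ℝ (Fin p)) :
    ∫ y, ⟪v, y⟫ ^ 2 ∂μ ≤ ‖v‖ ^ 2 * (2 * K * p) := by
  calc _ ≤ ∫ y, ‖v‖ ^ 2 * ‖y‖ ^ 2 ∂μ := by
        refine integral_mono (h.integrable_inner_sq v)
          ((h.integrable_norm_pow (j := 2) (by norm_num)).const_mul _) fun y => ?_
        simp only
        rw [← sq_abs, ← mul_pow]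
        gcongr
        exact abs_real_inner_le_norm v y
    _ ≤ _ := by
        rw [integral_const_mul]
        gcongr
        exact h.integral_norm_sq_le

lemma integrable_looRes_cross_sq (hz : 0 < z) (h : ColumnMoments (m i) K)
    (g : EuclideanSpace ℝ (Fin p)) :
    Integrable (fun x => (∫ y, ⟪looRes z i x (x i), y⟫ * ⟪g, y⟫ ∂(m i)) ^ 2) (Measure.pi m) := by
  have hV0 : 0 ≤ ∫ y, ⟪g, y⟫ ^ 2 ∂(m i) := integral_nonneg fun y => by positivity
  have hK := h.pos
  refine integrable_of_le_column h (C := (1 / z) ^ 2 * (2 * K * p) * ∫ y, ⟪g, y⟫ ^ 2 ∂(m i))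
    ((measurable_looRes_cross hz g).pow_const 2) fun x => ?_
  rw [abs_of_nonneg (sq_nonneg _)]
  have h7 := ColumnMoments.pow_le_one_add ‖x i‖ (norm_nonneg _) (j := 2) (by norm_num)
  calc _ ≤ ‖looRes z i x (x i)‖ ^ 2 * (2 * K * p) * ∫ y, ⟪g, y⟫ ^ 2 ∂(m i) :=
        (sq_looRes_cross_le h _ g).trans (by gcongr; exact h.integral_inner_sq_le_norm _)
    _ ≤ (‖x i‖ / z) ^ 2 * (2 * K * p) * ∫ y, ⟪g, y⟫ ^ 2 ∂(m i) := by
        gcongr; exact norm_looRes_le hz x _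
    _ = (1 / z) ^ 2 * (2 * K * p) * (∫ y, ⟪g, y⟫ ^ 2 ∂(m i)) * ‖x i‖ ^ 2 := by ring
    _ ≤ _ := by gcongr

/-- Cauchy–Schwarz in y isolates the second moment of ⟨g, y⟩. What remains is the second moment of
⟨Q_{-i} x_i, y⟩ with y independent of the sample, where the class-size bound again makes the mean
part ⟨b, Q_{-i} b⟩² of order n. -/
lemma integral_looRes_cross_sq_le (hn : 0 < n) (hz₀ : 0 < z₀) (hz₁ : z₀ < 1) (hz : z₀ ≤ z)
    (h : ConcLaw (m i) q ε B K) (hi : i ∉ J) (hJ : ∀ j ∈ J, m j = m i) (hκ : 0 < κ)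
    (hJκ : κ * √n ≤ (J.card : ℝ) + 1) (g : EuclideanSpace ℝ (Fin p)) :
    ∫ x, (∫ y, ⟪looRes z i x (x i), y⟫ * ⟪g, y⟫ ∂(m i)) ^ 2 ∂(Measure.pi m) ≤
      (444 * K ^ 2 / κ ^ 2 + 3 * K ^ 2) * (n * (1 + p / n) ^ 2 / z₀ ^ 2) *
        ∫ y, ⟪g, y⟫ ^ 2 ∂(m i) := by
  have hn' : (0 : ℝ) < n := by exact_mod_cast hn
  have hz' : 0 < z := hz₀.trans_le hz
  have hK := h.moments.one_le
  set b := ∫ y, y ∂(m i) with hb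
  set V := ∫ y, ⟪g, y⟫ ^ 2 ∂(m i) with hV
  have hV0 : 0 ≤ V := integral_nonneg fun y => by positivity
  have hint := integrable_looRes_cross_sq hz' h.moments g
  rw [← integral_condInt i hint]
  have hcond : ∀ x, condInt m i (fun x => (∫ y, ⟪looRes z i x (x i), y⟫ * ⟪g, y⟫ ∂(m i)) ^ 2) x ≤
      V * (⟪b, looRes z i x b⟫ ^ 2 + 3 * K ^ 2 * p / z ^ 2) := by
    intro x
    simp only [condInt, Function.update_self, looRes_update]
    have h2 := h.moments.integral_integral_inner_sq_le (isGramResolvent_looRes hz' i x)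
      (by positivity) hz'
    calc _ ≤ ∫ y, V * ∫ y', ⟪looRes z i x y, y'⟫ ^ 2 ∂(m i) ∂(m i) := by
          refine integral_mono_of_nonneg (.of_forall fun y => by positivity) (h2.1.const_mul _)
            (.of_forall fun y => ?_)
          have := sq_looRes_cross_le h.moments (looRes z i x y) g
          simp only
          linarith
      _ ≤ _ := by
          rw [integral_const_mul]
          gcongr
          exact h2.2
  have iθ : Integrable (fun x => ⟪b, looRes z i x b⟫ ^ 2) (Measure.pi m) := by
    have : BddMeas fun x => ⟪b, looRes z i x b⟫ :=
      ⟨(continuous_inner_looRes hz' continuous_const continuous_const).measurable,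
        ‖b‖ * ‖b‖ / z, fun x => abs_inner_looRes_le hz' x b b⟩
    simp only [pow_two]
    exact (this.mul this).integrable _
  have hstep := integral_mono (integrable_condInt i hint)
    ((iθ.add (integrable_const _)).const_mul _) hcond
  simp only [Pi.add_apply] at hstep
  rw [integral_const_mul, integral_add iθ (integrable_const _)] at hstep
  simp only [integral_const, probReal_univ, smul_eq_mul, one_mul] at hstep
  have hθ2 := integral_looRes_mean_self_sq_le hn hz₀ hz₁ hz h hi hJ
  rw [← hb] at hθ2
  set D : ℝ := (J.card : ℝ) + 1
  have hD0 : 0 < D := by positivity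
  have hnD : (n / D) ^ 2 ≤ n / κ ^ 2 := by
    have : κ ^ 2 * n ≤ D ^ 2 := by
      calc κ ^ 2 * n = (κ * √n) ^ 2 := by rw [mul_pow, Real.sq_sqrt hn'.le]
        _ ≤ D ^ 2 := by gcongr
    rw [div_pow, div_le_div_iff₀ (by positivity) (by positivity)]
    nlinarith
  have hp : (p : ℝ) ≤ n * (1 + p / n) ^ 2 := by
    have e : (p : ℝ) = n * (p / n) := by field_simp
    have : (0 : ℝ) ≤ p / n := by positivity
    calc (p : ℝ) = n * (p / n) := e
      _ ≤ n * (1 + p / n) ^ 2 := by gcongr; nlinarith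
  have e2 := inv_pow_le_of_le hz₀ hz₁ hz (j := 2) (l := 2) le_rfl
  refine hstep.trans ?_
  rw [mul_comm _ V]
  gcongr
  calc _ ≤ 444 * K ^ 2 * (n / κ ^ 2) * (1 + p / n) ^ 2 / z₀ ^ 2 +
        3 * K ^ 2 * (n * (1 + p / n) ^ 2) * (1 / z₀ ^ 2) := by
        gcongr ?_ + ?_
        · exact hθ2.trans (by gcongr)
        · calc _ = 3 * K ^ 2 * p * (1 / z ^ 2) := by ring
            _ ≤ _ := by gcongr
    _ = _ := by field_simp

lemma covRes_apply_eq (hz : 0 < z) (x : Fin n → EuclideanSpace ℝ (Fin p))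
    (v : EuclideanSpace ℝ (Fin p)) :
    covRes z x v = looRes z i x v - ((n : ℝ)⁻¹ * (⟪x i, looRes z i x v⟫ /
      (1 + (n : ℝ)⁻¹ * ⟪x i, looRes z i x (x i)⟫))) • looRes z i x (x i) :=
  (isGramResolvent_covRes hz x).apply_eq (isGramResolvent_looRes hz i x) (by positivity) hz v

lemma inner_covRes_column (hz : 0 < z) (x : Fin n → EuclideanSpace ℝ (Fin p))
    (v : EuclideanSpace ℝ (Fin p)) :
    ⟪x i, covRes z x v⟫ = ⟪x i, looRes z i x v⟫ /
      (1 + (n : ℝ)⁻¹ * ⟪x i, looRes z i x (x i)⟫) :=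
  (isGramResolvent_covRes hz x).inner_apply_self (isGramResolvent_looRes hz i x)
    (by positivity) hz v

lemma integrable_mul_of_sq {α : Type*} [MeasurableSpace α] {ν : Measure α} {f g : α → ℝ}
    (hf : AEStronglyMeasurable f ν) (hg : AEStronglyMeasurable g ν)
    (hf2 : Integrable (fun x => f x ^ 2) ν) (hg2 : Integrable (fun x => g x ^ 2) ν) :
    Integrable (fun x => f x * g x) ν := by
  refine (hf2.add hg2).mono' (hf.mul hg) (.of_forall fun x => ?_)
  rw [Real.norm_eq_abs, abs_mul]
  simp only [Pi.add_apply]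
  nlinarith [sq_nonneg (|f x| - |g x|), sq_abs (f x), sq_abs (g x), sq_nonneg (f x),
    sq_nonneg (g x)]

/-- Cauchy–Schwarz followed by √(c d) ≤ (c + d)/2, which keeps the constants free of square roots.
-/
lemma integral_abs_mul_le {α : Type*} [MeasurableSpace α] {ν : Measure α} {f g : α → ℝ}
    (hf : AEStronglyMeasurable f ν) (hg : AEStronglyMeasurable g ν)
    (hf2 : Integrable (fun x => f x ^ 2) ν) (hg2 : Integrable (fun x => g x ^ 2) ν)
    {a b c d R : ℝ} (ha : ∫ x, f x ^ 2 ∂ν ≤ a) (hb : ∫ x, g x ^ 2 ∂ν ≤ b) (hc : 0 ≤ c) (hd : 0 ≤ d)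
    (hR : 0 ≤ R) (hab : a * b ≤ c * d * R ^ 2) :
    ∫ x, |f x| * |g x| ∂ν ≤ (c + d) / 2 * R := by
  have ha0 : 0 ≤ ∫ x, f x ^ 2 ∂ν := integral_nonneg fun x => sq_nonneg _
  have hb0 : 0 ≤ ∫ x, g x ^ 2 ∂ν := integral_nonneg fun x => sq_nonneg _
  have hi : Integrable (fun x => |f x| * |g x|) ν := by
    simpa only [abs_mul] using (integrable_mul_of_sq hf hg hf2 hg2).abs
  have h := sq_integral_mul_le (f := fun x => |f x|) (g := fun x => |g x|)
    (by simpa only [sq_abs] using hf2) (by simpa only [sq_abs] using hg2) hi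
  simp only [sq_abs] at h
  refine le_of_sq_le_sq ?_ (by positivity)
  calc _ ≤ _ := h
    _ ≤ a * b := mul_le_mul ha hb hb0 (ha0.trans ha)
    _ ≤ c * d * R ^ 2 := hab
    _ ≤ ((c + d) / 2 * R) ^ 2 := by
        rw [mul_pow]
        gcongr
        nlinarith [sq_nonneg (c - d)]

/-- The constant of `abs_integral_column_bias_le`. -/
noncomputable def biasConst (K κ : ℝ) : ℝ :=
  (11 * K + fluctConst K κ) / 2 + (11 * K + (444 * K ^ 2 / κ ^ 2 + 3 * K ^ 2)) / 2

/-- Sherman–Morrison gives ⟨x_i, Q u⟩ = a/(1 + Λ) with Λ = n⁻¹⟨x_i, Q_{-i} x_i⟩. Replacing Λ by δ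
leaves a⟨g, x_i⟩/(1 + δ), whose conditional mean is cancelled by the second term with Q_{-i} in
place of Q. The remainder R carries the fluctuation Λ − δ (in w) and the rank-one correction (in β);
both are estimated by Cauchy–Schwarz against a. -/
lemma abs_integral_column_bias_le (hn : 0 < n) (hz₀ : 0 < z₀) (hz₁ : z₀ < 1) (hz : z₀ ≤ z)
    (h : ConcLaw (m i) q ε B K) (hi : i ∉ J) (hJ : ∀ j ∈ J, m j = m i) (hκ : 0 < κ)
    (hJκ : κ * √n ≤ (J.card : ℝ) + 1) (hJn : (J.card : ℝ) + 1 ≤ n)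
    {u g : EuclideanSpace ℝ (Fin p)} (hu : ‖u‖ ≤ 1) (hg : ‖g‖ ≤ 1 / z₀) {δ : ℝ}
    (hδ : δ = ∫ x, looTrace m z i x ∂(Measure.pi m))
    (hgV : ∫ y, ⟪g, y⟫ ^ 2 ∂(m i) ≤ (1 + δ) * (n / ((J.card : ℝ) + 1)) / z₀) :
    Integrable (fun x => ⟪x i, covRes z x u⟫ * ⟪g, x i⟫ -
      (1 + δ)⁻¹ * ∫ y, ⟪covRes z x u, y⟫ * ⟪g, y⟫ ∂(m i)) (Measure.pi m) ∧
    |∫ x, (⟪x i, covRes z x u⟫ * ⟪g, x i⟫ -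
      (1 + δ)⁻¹ * ∫ y, ⟪covRes z x u, y⟫ * ⟪g, y⟫ ∂(m i)) ∂(Measure.pi m)| ≤
      biasConst K κ * ((n / ((J.card : ℝ) + 1)) * (1 + p / n) ^ 2 / (z₀ ^ 3 * √n)) := by
  have hn' : (0 : ℝ) < n := by exact_mod_cast hn
  have hz' : 0 < z := hz₀.trans_le hz
  have hK := h.moments.one_le
  have hmom := h.moments
  have hδ0 : 0 ≤ δ := by
    rw [hδ]
    exact integral_nonneg fun x => mul_nonneg (by positivity) (integral_nonneg fun y =>
      (isGramResolvent_looRes hz' i x).inner_nonneg (by positivity) hz' y)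
  have hcol : Continuous fun x : Fin n → EuclideanSpace ℝ (Fin p) => x i := continuous_apply i
  have hw2 := integral_inner_sq_mul_sub_sq_le hn hz₀ hz₁ hz h hi hJ hκ hJκ hJn
    (G := 1 + δ) (by linarith) hg hgV hδ
  have hβ2 := integral_looRes_cross_sq_le hn hz₀ hz₁ hz h hi hJ hκ hJκ g
  have ha2 := integral_looRes_column_sq_le hn hz₀ hz₁ hz h hi hJ hJn hu
  set V := ∫ y, ⟪g, y⟫ ^ 2 ∂(m i) with hV
  set N := (n : ℝ) / ((J.card : ℝ) + 1) with hN
  set γ := 1 + (p : ℝ) / n with hγ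
  have hγ1 : 1 ≤ γ := by rw [hγ]; linarith [show (0 : ℝ) ≤ p / n by positivity]
  have hN0 : 0 < N := by positivity
  set G := 1 + δ with hG
  have hG1 : 1 ≤ G := by linarith
  have hG0 : 0 < G := by linarith
  set a : (Fin n → EuclideanSpace ℝ (Fin p)) → ℝ := fun x => ⟪x i, looRes z i x u⟫ with ha
  set w : (Fin n → EuclideanSpace ℝ (Fin p)) → ℝ := fun x =>
    ⟪g, x i⟫ * ((n : ℝ)⁻¹ * ⟪x i, looRes z i x (x i)⟫ - δ) with hw
  set β : (Fin n → EuclideanSpace ℝ (Fin p)) → ℝ := fun x =>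
    ∫ y, ⟪looRes z i x (x i), y⟫ * ⟪g, y⟫ ∂(m i) with hβ
  have hΛ : Continuous fun x : Fin n → EuclideanSpace ℝ (Fin p) => ⟪x i, looRes z i x (x i)⟫ :=
    continuous_inner_looRes hz' hcol hcol
  have ma : Continuous a := continuous_inner_looRes hz' hcol continuous_const
  have mw : Continuous w := by fun_prop
  have mβ : Measurable β := measurable_looRes_cross hz' g
  have ia : Integrable (fun x => a x ^ 2) (Measure.pi m) := integrable_looRes_column_sq hz' hmom u
  have iw : Integrable (fun x => w x ^ 2) (Measure.pi m) := by
    simpa only [hw, mul_pow] using integrable_inner_sq_mul_quadratic hz' hmom g (n : ℝ)⁻¹ δ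
  have iβ : Integrable (fun x => β x ^ 2) (Measure.pi m) := integrable_looRes_cross_sq hz' hmom g
  have ib : Integrable (fun x : Fin n → EuclideanSpace ℝ (Fin p) => ⟪g, x i⟫ ^ 2)
      (Measure.pi m) := by
    refine integrable_of_le_column hmom (C := ‖g‖ ^ 2)
      (Continuous.measurable (by fun_prop)) fun x => ?_
    have h7 := ColumnMoments.pow_le_one_add ‖x i‖ (norm_nonneg _) (j := 2) (by norm_num)
    rw [abs_of_nonneg (sq_nonneg _), ← sq_abs]
    calc _ ≤ (‖g‖ * ‖x i‖) ^ 2 := by gcongr; exact abs_real_inner_le_norm _ _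
      _ = ‖g‖ ^ 2 * ‖x i‖ ^ 2 := by ring
      _ ≤ _ := by gcongr
  have iab : Integrable (fun x => a x * ⟪g, x i⟫) (Measure.pi m) :=
    integrable_mul_of_sq ma.aestronglyMeasurable
      (Continuous.aestronglyMeasurable (by fun_prop)) ia ib
  set S := condInt m i (fun x => a x * ⟪g, x i⟫) with hS
  have iS : Integrable S (Measure.pi m) := integrable_condInt i iab
  have eS : ∫ x, S x ∂(Measure.pi m) = ∫ x, a x * ⟪g, x i⟫ ∂(Measure.pi m) :=
    integral_condInt i iab
  set Λ : (Fin n → EuclideanSpace ℝ (Fin p)) → ℝ := fun x =>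
    (n : ℝ)⁻¹ * ⟪x i, looRes z i x (x i)⟫ with hΛdef
  have hΛ0 : ∀ x, 0 ≤ Λ x := fun x => mul_nonneg (by positivity)
    ((isGramResolvent_looRes hz' i x).inner_nonneg (by positivity) hz' _)
  have mΛ : Continuous Λ := by fun_prop
  set R : (Fin n → EuclideanSpace ℝ (Fin p)) → ℝ := fun x =>
    G⁻¹ * (1 + Λ x)⁻¹ * (-(a x * w x) + (n : ℝ)⁻¹ * (a x * β x)) with hR
  -- S is the partial integral of a⟨g, x_i⟩ over the column i, so the first term integrates to zero
  -- and only R contributes to the bias.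
  have key : ∀ x, ⟪x i, covRes z x u⟫ * ⟪g, x i⟫ -
      G⁻¹ * ∫ y, ⟪covRes z x u, y⟫ * ⟪g, y⟫ ∂(m i) =
      G⁻¹ * (a x * ⟪g, x i⟫ - S x) + R x := by
    intro x
    have h1 : (1 : ℝ) + Λ x ≠ 0 := by have := hΛ0 x; positivity
    have e1 : ∫ y, ⟪covRes z x u, y⟫ * ⟪g, y⟫ ∂(m i) =
        S x - (n : ℝ)⁻¹ * (a x / (1 + Λ x)) * β x := by
      have : ∀ y, ⟪covRes z x u, y⟫ * ⟪g, y⟫ = ⟪looRes z i x u, y⟫ * ⟪g, y⟫ -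
          (n : ℝ)⁻¹ * (a x / (1 + Λ x)) * (⟪looRes z i x (x i), y⟫ * ⟪g, y⟫) := by
        intro y
        rw [covRes_apply_eq (i := i) hz' x u, inner_sub_left, real_inner_smul_left]
        simp only [ha, hΛdef]
        ring
      simp only [this]
      rw [integral_sub (hmom.integrable_inner_mul _ _)
        ((hmom.integrable_inner_mul _ _).const_mul _),
        integral_const_mul ((n : ℝ)⁻¹ * (a x / (1 + Λ x)))]
      congr 1
      simp only [hS, condInt, ha, Function.update_self, looRes_update]
      congr 1 with y
      rw [real_inner_comm y]
    rw [e1, inner_covRes_column hz' x u]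
    change a x / (1 + Λ x) * _ - _ = _
    have e2 : w x = ⟪g, x i⟫ * (Λ x - δ) := rfl
    have e3 : δ = G - 1 := by rw [hG]; ring
    simp only [hR]
    rw [e2, e3]
    field_simp
    ring
  have maw : AEStronglyMeasurable a (Measure.pi m) := ma.aestronglyMeasurable
  have iaw : Integrable (fun x => a x * w x) (Measure.pi m) :=
    integrable_mul_of_sq maw mw.aestronglyMeasurable ia iw
  have iaβ : Integrable (fun x => a x * β x) (Measure.pi m) :=
    integrable_mul_of_sq maw mβ.aestronglyMeasurable ia iβ
  have iaw' : Integrable (fun x => |a x| * |w x|) (Measure.pi m) := by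
    simpa only [abs_mul] using iaw.abs
  have iaβ' : Integrable (fun x => |a x| * |β x|) (Measure.pi m) := by
    simpa only [abs_mul] using iaβ.abs
  have hRle : ∀ x, |R x| ≤ G⁻¹ * (|a x| * |w x|) + G⁻¹ * (n : ℝ)⁻¹ * (|a x| * |β x|) := by
    intro x
    have h1 : (1 + Λ x)⁻¹ ≤ 1 := inv_le_one_of_one_le₀ (by linarith [hΛ0 x])
    have h2 : 0 ≤ (1 + Λ x)⁻¹ := inv_nonneg.2 (by linarith [hΛ0 x])
    have h3 : |-(a x * w x) + (n : ℝ)⁻¹ * (a x * β x)| ≤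
        |a x| * |w x| + (n : ℝ)⁻¹ * (|a x| * |β x|) := by
      refine (abs_add_le _ _).trans (le_of_eq ?_)
      rw [abs_neg, abs_mul (a x) (w x), abs_mul (n : ℝ)⁻¹, abs_mul (a x), abs_of_pos (inv_pos.2 hn')]
    rw [hR, abs_mul, abs_mul, abs_of_pos (inv_pos.2 hG0), abs_of_nonneg h2]
    calc _ ≤ G⁻¹ * 1 * (|a x| * |w x| + (n : ℝ)⁻¹ * (|a x| * |β x|)) := by gcongr
      _ = _ := by ring
  have iB : Integrable (fun x => G⁻¹ * (|a x| * |w x|) + G⁻¹ * (n : ℝ)⁻¹ * (|a x| * |β x|))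
      (Measure.pi m) := (iaw'.const_mul _).add (iaβ'.const_mul _)
  have mR : AEStronglyMeasurable R (Measure.pi m) := by
    have := ma.measurable
    have := mw.measurable
    have := mΛ.measurable
    exact Measurable.aestronglyMeasurable (by fun_prop)
  have iR : Integrable R (Measure.pi m) := iB.mono' mR (.of_forall hRle)
  have i0 : Integrable (fun x => G⁻¹ * (a x * ⟪g, x i⟫ - S x)) (Measure.pi m) :=
    (iab.sub iS).const_mul _
  simp only [key]
  refine ⟨i0.add iR, ?_⟩
  rw [integral_add i0 iR, integral_const_mul, integral_sub iab iS, eS, sub_self, mul_zero,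
    zero_add]
  have hzz : 1 / z₀ ≤ 1 / z₀ ^ 2 := by
    gcongr
    exact pow_le_of_le_one hz₀.le hz₁.le (by norm_num)
  have hγ12 : γ ^ 3 ≤ γ ^ 4 := pow_le_pow_right₀ hγ1 (by norm_num)
  have hsn : √(n : ℝ) ^ 2 = n := Real.sq_sqrt hn'.le
  have hs0 : 0 < √(n : ℝ) := by positivity
  -- The target carries a factor G, to be cancelled by the prefactor G⁻¹ of R; the final bound is
  -- thereby free of δ.
  have b1 := integral_abs_mul_le maw mw.aestronglyMeasurable ia iw
    (c := 11 * K) (d := fluctConst K κ) (R := G * (N * γ ^ 2 / (z₀ ^ 3 * √n))) ha2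
    (by simpa only [hw, mul_pow] using hw2) (by positivity)
    (by unfold fluctConst; positivity) (by positivity) (by
      have hf : 0 ≤ fluctConst K κ := by unfold fluctConst; positivity
      calc _ = 11 * K * fluctConst K κ * (G ^ 2 * (N ^ 2 * γ ^ 3) / (z₀ ^ 6 * n)) := by
            field_simp
        _ ≤ 11 * K * fluctConst K κ * (G ^ 2 * (N ^ 2 * γ ^ 4) / (z₀ ^ 6 * n)) := by gcongr
        _ = _ := by
            nth_rewrite 1 [← hsn]
            field_simp)
  have b2 := integral_abs_mul_le maw mβ.aestronglyMeasurable ia iβ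
    (c := 11 * K) (d := 444 * K ^ 2 / κ ^ 2 + 3 * K ^ 2)
    (R := G * (N * γ ^ 2 * √n / z₀ ^ 3)) ha2 hβ2 (by positivity)
    (by positivity) (by positivity) (by
      calc _ ≤ 11 * K * N * γ / z₀ ^ 2 * ((444 * K ^ 2 / κ ^ 2 + 3 * K ^ 2) *
            (n * γ ^ 2 / z₀ ^ 2) * (G ^ 2 * N * (1 / z₀ ^ 2))) := by
            gcongr
            refine hgV.trans ?_
            rw [div_eq_mul_one_div]
            gcongr
            exact le_self_pow₀ hG1 (by norm_num)
        _ = 11 * K * (444 * K ^ 2 / κ ^ 2 + 3 * K ^ 2) *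
            (G ^ 2 * (N ^ 2 * γ ^ 3) * n / z₀ ^ 6) := by ring
        _ ≤ 11 * K * (444 * K ^ 2 / κ ^ 2 + 3 * K ^ 2) *
            (G ^ 2 * (N ^ 2 * γ ^ 4) * n / z₀ ^ 6) := by gcongr
        _ = _ := by
            nth_rewrite 1 [← hsn]
            ring)
  calc _ ≤ ∫ x, |R x| ∂(Measure.pi m) := abs_integral_le_integral_abs
    _ ≤ ∫ x, (G⁻¹ * (|a x| * |w x|) + G⁻¹ * (n : ℝ)⁻¹ * (|a x| * |β x|)) ∂(Measure.pi m) :=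
        integral_mono iR.abs iB hRle
    _ = G⁻¹ * ∫ x, |a x| * |w x| ∂(Measure.pi m) +
        G⁻¹ * (n : ℝ)⁻¹ * ∫ x, |a x| * |β x| ∂(Measure.pi m) := by
        rw [integral_add (iaw'.const_mul _) (iaβ'.const_mul _), integral_const_mul,
          integral_const_mul]
    _ ≤ G⁻¹ * ((11 * K + fluctConst K κ) / 2 * (G * (N * γ ^ 2 / (z₀ ^ 3 * √n)))) +
        G⁻¹ * (n : ℝ)⁻¹ * ((11 * K + (444 * K ^ 2 / κ ^ 2 + 3 * K ^ 2)) / 2 *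
          (G * (N * γ ^ 2 * √n / z₀ ^ 3))) := by gcongr
    _ = _ := by
        have e : (n : ℝ)⁻¹ * √n = 1 / √n := by
          nth_rewrite 1 [← hsn]
          field_simp
        rw [biasConst]
        calc _ = (11 * K + fluctConst K κ) / 2 * (G⁻¹ * G) * (N * γ ^ 2 / (z₀ ^ 3 * √n)) +
              (11 * K + (444 * K ^ 2 / κ ^ 2 + 3 * K ^ 2)) / 2 * (G⁻¹ * G) *
              (N * γ ^ 2 / z₀ ^ 3) * ((n : ℝ)⁻¹ * √n) := by ring
          _ = _ := by
              rw [e, inv_mul_cancel₀ hG0.ne']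
              field_simp

end SampleCov

namespace SampleCov

variable {p n k : ℕ}

/-! ### Exchangeability inside a class -/

lemma measurePreserving_comp_perm {m : Fin n → Measure (EuclideanSpace ℝ (Fin p))}
    [∀ i, IsProbabilityMeasure (m i)] (σ : Equiv.Perm (Fin n)) (hσ : ∀ i, m (σ i) = m i) :
    MeasurePreserving (fun x : Fin n → EuclideanSpace ℝ (Fin p) => x ∘ σ)
      (Measure.pi m) (Measure.pi m) :=
  measurePreserving_arrowCongr' m m σ.symm (MeasurableEquiv.refl _) fun i => by
    have : m (σ.symm i) = m i := by rw [← hσ (σ.symm i), Equiv.apply_symm_apply]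
    rw [this]
    exact MeasurePreserving.id _

lemma covRes_comp_perm (z : ℝ) (x : Fin n → EuclideanSpace ℝ (Fin p)) (σ : Equiv.Perm (Fin n)) :
    covRes z (x ∘ σ) = covRes z x := by
  have : sampleCov (x ∘ σ) = sampleCov x := by
    ext a b
    simp only [sampleCov, dataMatrix, Matrix.smul_apply, Matrix.mul_apply, Matrix.of_apply,
      Matrix.transpose_apply, Function.comp_apply]
    rw [Equiv.sum_comp σ fun i => x i a * x i b]
  rw [covRes, covRes, this]

lemma looRes_comp_perm (z : ℝ) (x : Fin n → EuclideanSpace ℝ (Fin p)) (σ : Equiv.Perm (Fin n))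
    (i : Fin n) : looRes z i (x ∘ σ) = looRes z (σ i) x := by
  rw [looRes, looRes, ← covRes_comp_perm z (Function.update x (σ i) 0) σ]
  congr 1
  rw [Function.update_comp_eq_of_injective x σ.injective]

/-- Swapping two columns of one class preserves the product law and exchanges their leave-one-out
resolvents. Hence δ does not depend on the representative of the class. -/
lemma integral_looTrace_eq {m : Fin n → Measure (EuclideanSpace ℝ (Fin p))}
    [∀ i, IsProbabilityMeasure (m i)] {z : ℝ} (hz : 0 < z) {i j : Fin n} (hij : m i = m j) :
    ∫ x, looTrace m z i x ∂(Measure.pi m) = ∫ x, looTrace m z j x ∂(Measure.pi m) := by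
  have hσ : ∀ l, m (Equiv.swap i j l) = m l := by
    intro l
    rw [Equiv.swap_apply_def]
    split_ifs with h1 h2
    · rw [h1, hij]
    · rw [h2, hij]
    · rfl
  have hP := measurePreserving_comp_perm (Equiv.swap i j) hσ
  have hm : Measurable (looTrace m z i) :=
    (measurable_integral_looRes hz i (m i)
      (f := fun w => ⟪w.2.2, w.2.1 w.2.2⟫) (by fun_prop)).const_mul _
  have h1 := integral_map (μ := Measure.pi m) hP.measurable.aemeasurable
    (f := looTrace m z i) hm.aestronglyMeasurable
  rw [hP.map_eq] at h1
  rw [h1]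
  congr 1 with x
  rw [looTrace, looTrace, looRes_comp_perm, Equiv.swap_apply_left, hij]

/-! ### Second moments and expectations as operators -/

lemma integral_sum_sum {α : Type*} [MeasurableSpace α] {ρ : Measure α} {F : Fin p → Fin p → α → ℝ}
    (hF : ∀ a b, Integrable (F a b) ρ) :
    ∫ y, ∑ a, ∑ b, F a b y ∂ρ = ∑ a, ∑ b, ∫ y, F a b y ∂ρ := by
  rw [integral_finsetSum _ fun a _ => integrable_finsetSum _ fun b _ => hF a b]
  exact Finset.sum_congr rfl fun a _ => integral_finsetSum _ fun b _ => hF a b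

lemma inner_matOp_secondMoment {μ : Measure (EuclideanSpace ℝ (Fin p))} [IsProbabilityMeasure μ]
    {K : ℝ} (h : ColumnMoments μ K) (u v : EuclideanSpace ℝ (Fin p)) :
    ⟪u, matOp (secondMoment μ) v⟫ = ∫ y, ⟪u, y⟫ * ⟪v, y⟫ ∂μ := by
  have hi : ∀ a b, Integrable (fun y : EuclideanSpace ℝ (Fin p) => y a * y b) μ := fun a b => by
    simpa [EuclideanSpace.inner_single_left] using
      h.integrable_inner_mul (EuclideanSpace.single a 1) (EuclideanSpace.single b 1)
  have e : ∀ y : EuclideanSpace ℝ (Fin p), ⟪u, y⟫ * ⟪v, y⟫ =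
      ∑ a, ∑ b, u a * v b * (y a * y b) := by
    intro y
    rw [PiLp.inner_apply, PiLp.inner_apply, Finset.sum_mul_sum]
    refine Finset.sum_congr rfl fun a _ => Finset.sum_congr rfl fun b _ => ?_
    simp only [RCLike.inner_apply, conj_trivial]
    ring
  simp only [e]
  rw [inner_matOp, integral_sum_sum fun a b => (hi a b).const_mul _]
  refine Finset.sum_congr rfl fun a _ => Finset.sum_congr rfl fun b _ => ?_
  rw [integral_const_mul, secondMoment, Matrix.of_apply]
  ring

lemma secondMoment_posSemidef {μ : Measure (EuclideanSpace ℝ (Fin p))} [IsProbabilityMeasure μ]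
    {K : ℝ} (h : ColumnMoments μ K) : (secondMoment μ).PosSemidef := by
  refine Matrix.PosSemidef.of_dotProduct_mulVec_nonneg ?_ fun v => ?_
  · ext a b
    simp only [Matrix.conjTranspose_apply, secondMoment, Matrix.of_apply, star_trivial]
    simp only [mul_comm]
  · have h1 := inner_matOp_secondMoment h (WithLp.toLp 2 v) (WithLp.toLp 2 v)
    rw [inner_matOp] at h1
    have h2 : star v ⬝ᵥ (secondMoment μ).mulVec v = ∑ a, ∑ b, v a * secondMoment μ a b * v b := by
      simp only [dotProduct, Matrix.mulVec, Finset.mul_sum, star_trivial, mul_assoc]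
    rw [h2]
    refine h1.ge.trans' (integral_nonneg fun y => mul_self_nonneg _)

lemma inner_matOp_matrixExpectation {Ω : Type*} [MeasurableSpace Ω] {P : Measure Ω}
    {M : Ω → Matrix (Fin p) (Fin p) ℝ} (hM : ∀ a b, Integrable (fun ω => M ω a b) P)
    (u v : EuclideanSpace ℝ (Fin p)) :
    ⟪u, matOp (matrixExpectation P M) v⟫ = ∫ ω, ⟪u, matOp (M ω) v⟫ ∂P := by
  simp only [inner_matOp]
  rw [integral_sum_sum fun a b => ((hM a b).const_mul _).mul_const _]
  refine Finset.sum_congr rfl fun a _ => Finset.sum_congr rfl fun b _ => ?_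
  rw [integral_mul_const, integral_const_mul, matrixExpectation, Matrix.of_apply]

lemma integral_inner_matOp_eq_trace {μ : Measure (EuclideanSpace ℝ (Fin p))}
    [IsProbabilityMeasure μ] {K : ℝ} (h : ColumnMoments μ K) (A : Matrix (Fin p) (Fin p) ℝ) :
    ∫ y, ⟪y, matOp A y⟫ ∂μ = (secondMoment μ * A).trace := by
  have hi : ∀ a b, Integrable (fun y : EuclideanSpace ℝ (Fin p) => y a * y b) μ := fun a b => by
    simpa [EuclideanSpace.inner_single_left] using
      h.integrable_inner_mul (EuclideanSpace.single a 1) (EuclideanSpace.single b 1)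
  have e : ∀ y : EuclideanSpace ℝ (Fin p), ⟪y, matOp A y⟫ =
      ∑ a, ∑ b, A a b * (y b * y a) := by
    intro y
    rw [inner_matOp]
    exact Finset.sum_congr rfl fun a _ => Finset.sum_congr rfl fun b _ => by ring
  simp only [e]
  refine (integral_sum_sum (F := fun a b (y : EuclideanSpace ℝ (Fin p)) => A a b * (y b * y a))
    fun a b => (hi b a).const_mul _).trans ?_
  rw [Matrix.trace, Finset.sum_comm]
  refine Finset.sum_congr rfl fun b _ => ?_
  rw [Matrix.diag_apply, Matrix.mul_apply]
  refine Finset.sum_congr rfl fun a _ => ?_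
  rw [integral_const_mul, secondMoment, Matrix.of_apply, mul_comm]

lemma abs_entry_le {M : Matrix (Fin p) (Fin p) ℝ} {C : ℝ}
    (h : ∀ v : EuclideanSpace ℝ (Fin p), ‖matOp M v‖ ≤ C * ‖v‖) (a b : Fin p) : |M a b| ≤ C := by
  have e : M a b = ⟪EuclideanSpace.single a (1 : ℝ), matOp M (EuclideanSpace.single b 1)⟫ := by
    rw [EuclideanSpace.inner_single_left, matOp_apply]
    simp
  rw [e]
  refine (abs_real_inner_le_norm _ _).trans ?_
  have := h (EuclideanSpace.single b 1)
  simpa using this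

lemma abs_resolvent_entry_le {z : ℝ} (hz : 0 < z) (x : Fin n → EuclideanSpace ℝ (Fin p))
    (a b : Fin p) : |resolvent (sampleCov x) z a b| ≤ 1 / z :=
  abs_entry_le (fun v => by
    have := (isGramResolvent_covRes hz x).norm_le (by positivity) hz v
    rw [one_div_mul_eq_div]
    exact this) a b

lemma bddMeas_resolvent_entry {z : ℝ} (hz : 0 < z) (a b : Fin p) :
    BddMeas fun x : Fin n → EuclideanSpace ℝ (Fin p) => resolvent (sampleCov x) z a b :=
  ⟨((continuous_resolvent_sampleCov hz).matrix_elem a b).measurable, 1 / z,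
    fun x => abs_resolvent_entry_le hz x a b⟩

lemma delta_pi_eq {μ : Fin k → Measure (EuclideanSpace ℝ (Fin p))}
    [∀ l, IsProbabilityMeasure (μ l)] {K z : ℝ} (hz : 0 < z) (h : ∀ l, ColumnMoments (μ l) K)
    (cls : Fin n → Fin k) (rep : Fin k → Fin n) (hrep : ∀ l, cls (rep l) = l) (l : Fin k) :
    delta (Measure.pi fun i => μ (cls i)) μ (fun i x => x i) rep z l =
      ∫ x, looTrace (fun i => μ (cls i)) z (rep l) x ∂(Measure.pi fun i => μ (cls i)) := by
  have e : ∀ x : Fin n → EuclideanSpace ℝ (Fin p), looTrace (fun i => μ (cls i)) z (rep l) x =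
      (n : ℝ)⁻¹ * (secondMoment (μ l) *
        resolvent (sampleCovWithout x (rep l)) z).trace := by
    intro x
    rw [looTrace, looRes, covRes, ← sampleCovWithout_eq, hrep, integral_inner_matOp_eq_trace (h l)]
  simp only [e]
  rw [integral_const_mul, delta]
  congr 1
  have hb : ∀ a b, Integrable (fun x : Fin n → EuclideanSpace ℝ (Fin p) =>
      resolvent (sampleCovWithout x (rep l)) z a b) (Measure.pi fun i => μ (cls i)) := by
    intro a b
    simp only [sampleCovWithout_eq]
    exact ((bddMeas_resolvent_entry hz a b).comp
      (Continuous.measurable (by fun_prop) : Measurable fun x : Fin n → EuclideanSpace ℝ (Fin p) =>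
        Function.update x (rep l) 0)).integrable _
  simp only [Matrix.trace, Matrix.diag_apply, Matrix.mul_apply, matrixExpectation,
    Matrix.of_apply]
  refine Eq.trans ?_ (integral_sum_sum (F := fun a b (x : Fin n → EuclideanSpace ℝ (Fin p)) =>
    secondMoment (μ l) a b * resolvent (sampleCovWithout x (rep l)) z b a)
    fun a b => (hb b a).const_mul _).symm
  exact Finset.sum_congr rfl fun a _ => Finset.sum_congr rfl fun b _ =>
    (integral_const_mul _ _).symm

/-! ### The deterministic equivalent -/

lemma weightedCov_posSemidef {μ : Fin k → Measure (EuclideanSpace ℝ (Fin p))}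
    [∀ l, IsProbabilityMeasure (μ l)] {K : ℝ} (h : ∀ l, ColumnMoments (μ l) K)
    (cls : Fin n → Fin k) {δ : Fin k → ℝ} (hδ : ∀ l, 0 ≤ δ l) :
    (weightedCov μ cls δ).PosSemidef := by
  refine Matrix.posSemidef_sum _ fun l _ => (secondMoment_posSemidef (h l)).smul ?_
  have := hδ l
  positivity

lemma inner_matOp_weightedCov {μ : Fin k → Measure (EuclideanSpace ℝ (Fin p))}
    [∀ l, IsProbabilityMeasure (μ l)] {K : ℝ} (h : ∀ l, ColumnMoments (μ l) K)
    (cls : Fin n → Fin k) (δ : Fin k → ℝ) (u v : EuclideanSpace ℝ (Fin p)) :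
    ⟪u, matOp (weightedCov μ cls δ) v⟫ =
      ∑ l, (classSize cls l : ℝ) / n / (1 + δ l) * ∫ y, ⟪u, y⟫ * ⟪v, y⟫ ∂(μ l) := by
  rw [weightedCov, matOp, map_sum, sum_apply, inner_sum]
  refine Finset.sum_congr rfl fun l _ => ?_
  rw [map_smul, smul_apply, inner_smul_right, inner_matOp_secondMoment (h l)]

lemma sum_classSize_mul (cls : Fin n → Fin k) (f : Fin k → ℝ) :
    ∑ l, (classSize cls l : ℝ) * f l = ∑ i, f (cls i) := by
  rw [← Finset.sum_fiberwise_of_maps_to (g := cls) (t := Finset.univ) (by simp)]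
  refine Finset.sum_congr rfl fun l _ => ?_
  rw [Finset.sum_congr rfl (g := fun _ => f l) (by simp +contextual), Finset.sum_const,
    nsmul_eq_mul, classSize]

end SampleCov

namespace SampleCov

/-! ### Distance from the expected resolvent to its deterministic equivalent -/

variable {p n k : ℕ} {μ : Fin k → Measure (EuclideanSpace ℝ (Fin p))}
  [∀ l, IsProbabilityMeasure (μ l)] {q ε B K κ z₀ z : ℝ}

lemma classSize_eq_card_erase (cls : Fin n → Fin k) (i : Fin n) :
    (classSize cls (cls i) : ℝ) =
      (((Finset.univ.filter fun j => cls j = cls i).erase i).card : ℝ) + 1 := by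
  rw [classSize, ← Finset.card_erase_add_one (a := i) (by simp)]
  push_cast
  rfl

lemma classSize_le (cls : Fin n → Fin k) (l : Fin k) : classSize cls l ≤ n := by
  simpa [classSize] using Finset.card_filter_le (Finset.univ : Finset (Fin n)) fun i => cls i = l

/-- Resolvent identity Q − Q̃ = Q (Σ_δ − XXᵀ/n) Q̃, where Σ_δ is spread over the columns so that the
difference becomes a sum of the one-column biases. A column of class l costs n/n_l, so a class costs
n; after division by n the number k of classes remains. -/
lemma abs_integral_inner_covRes_sub_le (hn : 0 < n) (hz₀ : 0 < z₀) (hz₁ : z₀ < 1) (hz : z₀ ≤ z)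
    (h : ∀ l, ConcLaw (μ l) q ε B K) (hκ : 0 < κ) (cls : Fin n → Fin k)
    (hcls : ∀ l, κ * √n ≤ classSize cls l) {δ : Fin k → ℝ}
    (hδ : ∀ i, δ (cls i) = ∫ x, looTrace (fun i => μ (cls i)) z i x
      ∂(Measure.pi fun i => μ (cls i))) (hδ0 : ∀ l, 0 ≤ δ l)
    {u v : EuclideanSpace ℝ (Fin p)} (hu : ‖u‖ ≤ 1) (hv : ‖v‖ ≤ 1) :
    |∫ x, ⟪u, covRes z x v⟫ ∂(Measure.pi fun i => μ (cls i)) -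
      ⟪u, matOp (resolvent (weightedCov μ cls δ) z) v⟫| ≤
      k * biasConst K κ * ((1 + p / n) ^ 2 / (z₀ ^ 3 * √n)) := by
  have hn' : (0 : ℝ) < n := by exact_mod_cast hn
  have hz' : 0 < z := hz₀.trans_le hz
  have hmom : ∀ l, ColumnMoments (μ l) K := fun l => (h l).moments
  set ν := Measure.pi fun i => μ (cls i) with hν
  set W := weightedCov μ cls δ with hW
  have hWp : W.PosSemidef := weightedCov_posSemidef hmom cls hδ0
  set g := matOp (resolvent W z) v with hg
  have hgv : matOp W g + z • g = v := matOp_resolvent hWp hz' v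
  have hN0 : ∀ l, 0 < (classSize cls l : ℝ) := fun l =>
    (by positivity : 0 < κ * √(n : ℝ)).trans_le (hcls l)
  have hw : ∀ l, 0 < (classSize cls l : ℝ) / n / (1 + δ l) := fun l => by
    have := hN0 l; have := hδ0 l; positivity
  have hq : ⟪g, matOp W g⟫ = ∑ l, (classSize cls l : ℝ) / n / (1 + δ l) *
      ∫ y, ⟪g, y⟫ ^ 2 ∂(μ l) := by
    rw [hW, inner_matOp_weightedCov hmom]
    simp only [← pow_two]
  have hV0 : ∀ l, 0 ≤ ∫ y, ⟪g, y⟫ ^ 2 ∂(μ l) := fun l => integral_nonneg fun y => sq_nonneg _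
  have hsum : ⟪g, matOp W g⟫ + z * ‖g‖ ^ 2 = ⟪g, v⟫ := by
    conv_rhs => rw [← hgv]
    rw [inner_add_right, inner_smul_right, real_inner_self_eq_norm_sq]
  have hgv' : ⟪g, v⟫ ≤ ‖g‖ := (real_inner_le_norm g v).trans
    (mul_le_of_le_one_right (norm_nonneg _) hv)
  have hq0 : 0 ≤ ⟪g, matOp W g⟫ := by
    rw [hq]
    exact Finset.sum_nonneg fun l _ => mul_nonneg (hw l).le (hV0 l)
  have hgz : ‖g‖ ≤ 1 / z := by
    rw [le_div_iff₀ hz']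
    rcases (norm_nonneg g).eq_or_lt with h0 | h0
    · rw [← h0, zero_mul]; norm_num
    · nlinarith
  have hgz₀ : ‖g‖ ≤ 1 / z₀ := hgz.trans (by gcongr)
  -- Energy estimate: ⟨g, W g⟩ + z‖g‖² = ⟨g, v⟩ ≤ 1/z₀, and ⟨g, W g⟩ is a sum of nonnegative terms,
  -- one for each class. This replaces a bound on ‖Σ_l‖, which may be of order p.
  have hgV : ∀ l, ∫ y, ⟪g, y⟫ ^ 2 ∂(μ l) ≤ (1 + δ l) * (n / classSize cls l) / z₀ := by
    intro l
    have h1 : (classSize cls l : ℝ) / n / (1 + δ l) * ∫ y, ⟪g, y⟫ ^ 2 ∂(μ l) ≤ 1 / z₀ := by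
      calc _ ≤ ∑ l, (classSize cls l : ℝ) / n / (1 + δ l) * ∫ y, ⟪g, y⟫ ^ 2 ∂(μ l) :=
            Finset.single_le_sum (f := fun l => (classSize cls l : ℝ) / n / (1 + δ l) *
              ∫ y, ⟪g, y⟫ ^ 2 ∂(μ l)) (fun l _ => mul_nonneg (hw l).le (hV0 l))
              (Finset.mem_univ l)
        _ ≤ 1 / z₀ := by rw [← hq]; nlinarith [sq_nonneg ‖g‖]
    have := hN0 l
    have := hδ0 l
    calc _ = ((1 + δ l) * (n / classSize cls l)) * ((classSize cls l : ℝ) / n / (1 + δ l) *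
          ∫ y, ⟪g, y⟫ ^ 2 ∂(μ l)) := by
          have : (1 : ℝ) + δ l ≠ 0 := by positivity
          field_simp
      _ ≤ ((1 + δ l) * (n / classSize cls l)) * (1 / z₀) := by gcongr
      _ = _ := by ring
  set T : Fin n → (Fin n → EuclideanSpace ℝ (Fin p)) → ℝ := fun i x =>
    ⟪x i, covRes z x u⟫ * ⟪g, x i⟫ -
      (1 + δ (cls i))⁻¹ * ∫ y, ⟪covRes z x u, y⟫ * ⟪g, y⟫ ∂(μ (cls i)) with hT
  have hTi : ∀ i, Integrable (T i) ν ∧ |∫ x, T i x ∂ν| ≤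
      biasConst K κ * ((n / classSize cls (cls i)) * (1 + p / n) ^ 2 / (z₀ ^ 3 * √n)) := by
    intro i
    rw [classSize_eq_card_erase]
    refine abs_integral_column_bias_le (m := fun i => μ (cls i)) hn hz₀ hz₁ hz (h (cls i))
      (by simp) (fun j hj => ?_) hκ ?_ ?_ hu hgz₀ (hδ i) ?_
    · simp only [Finset.mem_erase, Finset.mem_filter] at hj
      rw [hj.2.2]
    · rw [← classSize_eq_card_erase]; exact hcls _
    · rw [← classSize_eq_card_erase]; exact_mod_cast classSize_le _ _
    · rw [← classSize_eq_card_erase]; exact hgV _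
  have hid : ∀ x, ⟪u, covRes z x v⟫ - ⟪u, g⟫ = -((n : ℝ)⁻¹ * ∑ i, T i x) := by
    intro x
    have hA := isGramResolvent_covRes hz' x
    have e1 : ⟪u, covRes z x v⟫ = ⟪covRes z x u, matOp W g⟫ + z * ⟪covRes z x u, g⟫ := by
      rw [← hA.symm, ← inner_smul_right, ← inner_add_right, hgv]
    have e2 : ⟪u, g⟫ = (n : ℝ)⁻¹ * ∑ i, ⟪x i, covRes z x u⟫ * ⟪g, x i⟫ +
        z * ⟪covRes z x u, g⟫ := by
      conv_lhs => rw [← hA u]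
      rw [inner_add_left, real_inner_smul_left, real_inner_smul_left, sum_inner]
      simp only [real_inner_smul_left]
      simp only [real_inner_comm g]
    have e3 : ⟪covRes z x u, matOp W g⟫ = (n : ℝ)⁻¹ * ∑ i, (1 + δ (cls i))⁻¹ *
        ∫ y, ⟪covRes z x u, y⟫ * ⟪g, y⟫ ∂(μ (cls i)) := by
      rw [hW, inner_matOp_weightedCov hmom, ← sum_classSize_mul cls fun l => (1 + δ l)⁻¹ *
        ∫ y, ⟪covRes z x u, y⟫ * ⟪g, y⟫ ∂(μ l), Finset.mul_sum]
      exact Finset.sum_congr rfl fun l _ => by ring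
    rw [e1, e2, e3]
    simp only [hT, Finset.sum_sub_distrib]
    ring
  have bQ : Integrable (fun x => ⟪u, covRes z x v⟫) ν := by
    refine BddMeas.integrable ⟨Continuous.measurable ?_, ‖u‖ * (‖v‖ / z), fun x => ?_⟩ ν
    · have := continuous_covRes (p := p) (n := n) hz'
      fun_prop
    · refine (abs_real_inner_le_norm _ _).trans ?_
      gcongr
      exact (isGramResolvent_covRes hz' x).norm_le (by positivity) hz' v
  have e4 : ∫ x, ⟪u, covRes z x v⟫ ∂ν - ⟪u, g⟫ = -((n : ℝ)⁻¹ * ∑ i, ∫ x, T i x ∂ν) := by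
    rw [← integral_finsetSum _ fun i _ => (hTi i).1, ← integral_const_mul, ← integral_neg]
    simp only [← hid]
    rw [integral_sub bQ (integrable_const _)]
    simp
  rw [e4, abs_neg, abs_mul, abs_of_pos (inv_pos.2 hn')]
  calc _ ≤ (n : ℝ)⁻¹ * ∑ i, biasConst K κ *
        ((n / classSize cls (cls i)) * (1 + p / n) ^ 2 / (z₀ ^ 3 * √n)) := by
        gcongr
        exact (Finset.abs_sum_le_sum_abs _ _).trans (Finset.sum_le_sum fun i _ => (hTi i).2)
    _ = (n : ℝ)⁻¹ * ∑ l, (classSize cls l : ℝ) * (biasConst K κ *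
        ((n / classSize cls l) * (1 + p / n) ^ 2 / (z₀ ^ 3 * √n))) := by
        rw [sum_classSize_mul cls]
    _ = (n : ℝ)⁻¹ * ∑ l : Fin k, n * (biasConst K κ * ((1 + p / n) ^ 2 / (z₀ ^ 3 * √n))) := by
        congr 1
        refine Finset.sum_congr rfl fun l _ => ?_
        have := (hN0 l).ne'
        field_simp
    _ = _ := by
        rw [Finset.sum_const, Finset.card_univ, Fintype.card_fin, nsmul_eq_mul]
        field_simp

end SampleCov

namespace SampleCov

/-! ### Exponential moments of truncated martingale increments -/

section Truncation

variable {q s n D T κ : ℝ}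

/-- Write T² = T^q (T²)^{(2−q)/2}. The truncation bounds the second factor by a power of s√n, and
the powers that remain combine to s^{q/2} n^{−q/4} ≤ 1. -/
lemma rpow_mul_sq_le_of_sq_le (hq : 0 < q) (hq2 : q ≤ 2) (hs : 1 ≤ s) (hsn : s ≤ √n) (hT : 0 ≤ T)
    (hTs : T ^ 2 ≤ s * √n) : s ^ (q - 1) / √n * T ^ 2 ≤ T ^ q := by
  have hs0 : 0 < s := by linarith
  have hn0 : 0 < √n := by linarith
  rcases hT.eq_or_lt with h0 | h0
  · rw [← h0]; simp [Real.zero_rpow hq.ne']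
  have e1 : T ^ 2 = T ^ q * (T ^ 2) ^ ((2 - q) / 2) := by
    rw [← Real.rpow_natCast T 2, ← Real.rpow_mul hT, ← Real.rpow_add h0]
    congr 1; push_cast; ring
  have e2 : (T ^ 2) ^ ((2 - q) / 2) ≤ (s * √n) ^ ((2 - q) / 2) :=
    Real.rpow_le_rpow (by positivity) hTs (by linarith)
  have e3 : s ^ (q - 1) * (s * √n) ^ ((2 - q) / 2) ≤ √n := by
    rw [Real.mul_rpow hs0.le hn0.le, ← mul_assoc, ← Real.rpow_add hs0]
    calc s ^ (q - 1 + (2 - q) / 2) * √n ^ ((2 - q) / 2)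
        ≤ √n ^ (q - 1 + (2 - q) / 2) * √n ^ ((2 - q) / 2) := by
          gcongr
          linarith
      _ = √n := by
          rw [← Real.rpow_add hn0, show q - 1 + (2 - q) / 2 + (2 - q) / 2 = 1 by ring,
            Real.rpow_one]
  calc s ^ (q - 1) / √n * T ^ 2 = T ^ q * ((s ^ (q - 1) * (T ^ 2) ^ ((2 - q) / 2)) / √n) := by
        conv_lhs => rw [e1]
        ring
    _ ≤ T ^ q * ((s ^ (q - 1) * (s * √n) ^ ((2 - q) / 2)) / √n) := by gcongr
    _ ≤ T ^ q * 1 := by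
        gcongr
        rw [div_le_one hn0]
        exact e3
    _ = T ^ q := mul_one _

/-- For T ≤ s/√D the term s^q/D suffices. For larger T and q ≥ 1, the inequality s/√D < T itself
gives T^q, as q − 1 ≤ 1. For q < 1 the truncation is needed together with D ≥ κ√n, which costs 1/√κ.
-/
lemma rpow_mul_le_of_sq_le (hq : 0 < q) (hq2 : q ≤ 2) (hs : 1 ≤ s) (hsn : s ≤ √n) (hκ : 0 < κ)
    (hD : 1 ≤ D) (hDκ : κ * √n ≤ D) (hT : 0 ≤ T) (hTs : T ^ 2 ≤ s * √n) :
    s ^ (q - 1) / √D * T ≤ (1 + 1 / √κ) * T ^ q + s ^ q / D := by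
  have hs0 : 0 < s := by linarith
  have hn0 : 0 < √n := by linarith
  have hD0 : 0 < D := by linarith
  have hsD : 1 ≤ √D := Real.one_le_sqrt.2 hD
  have hDD : √D * √D = D := Real.mul_self_sqrt hD0.le
  have hTq : 0 ≤ T ^ q := Real.rpow_nonneg hT q
  have hκ' : 0 < √κ := Real.sqrt_pos.2 hκ
  rcases le_or_gt T (s / √D) with h | h
  · have : s ^ (q - 1) / √D * T ≤ s ^ q / D := by
      calc s ^ (q - 1) / √D * T ≤ s ^ (q - 1) / √D * (s / √D) := by gcongr
        _ = s ^ (q - 1) * s / (√D * √D) := by ring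
        _ = s ^ q / D := by rw [hDD, ← Real.rpow_add_one hs0.ne', sub_add_cancel]
    have : 0 ≤ (1 + 1 / √κ) * T ^ q := by positivity
    linarith
  · have hT0 : 0 < T := lt_trans (by positivity) h
    have hρ : 0 ≤ s ^ q / D := by positivity
    rcases le_or_gt 1 q with h1 | h1
    · have e1 : s ^ (q - 1) / √D ≤ T ^ (q - 1) := by
        calc s ^ (q - 1) / √D ≤ s ^ (q - 1) / √D ^ (q - 1) := by
              gcongr
              exact Real.rpow_le_self_of_one_le hsD (by linarith)
          _ = (s / √D) ^ (q - 1) := (Real.div_rpow hs0.le (by linarith) _).symm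
          _ ≤ T ^ (q - 1) := Real.rpow_le_rpow (by positivity) h.le (by linarith)
      have e2 : s ^ (q - 1) / √D * T ≤ T ^ q := by
        calc _ ≤ T ^ (q - 1) * T := by gcongr
          _ = T ^ q := by rw [← Real.rpow_add_one hT0.ne', sub_add_cancel]
      have : 0 ≤ 1 / √κ * T ^ q := by positivity
      linarith
    · have e1 : T = T ^ q * (T ^ 2) ^ ((1 - q) / 2) := by
        rw [← Real.rpow_natCast T 2, ← Real.rpow_mul hT, ← Real.rpow_add hT0,
          show q + (2 : ℕ) * ((1 - q) / 2) = 1 by push_cast; ring, Real.rpow_one]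
      have e2 : (T ^ 2) ^ ((1 - q) / 2) ≤ s ^ (1 - q) * √(√n) := by
        calc (T ^ 2) ^ ((1 - q) / 2) ≤ (s * √n) ^ ((1 - q) / 2) :=
              Real.rpow_le_rpow (by positivity) hTs (by linarith)
          _ = s ^ ((1 - q) / 2) * √n ^ ((1 - q) / 2) := Real.mul_rpow hs0.le hn0.le
          _ ≤ s ^ (1 - q) * √n ^ ((1 : ℝ) / 2) := by
              gcongr
              · linarith
              · linarith
              · linarith
          _ = _ := by rw [Real.sqrt_eq_rpow √n]
      have e3 : √(√n) / √D ≤ 1 / √κ := by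
        rw [div_le_div_iff₀ (by positivity) hκ', one_mul, ← Real.sqrt_mul hn0.le]
        exact Real.sqrt_le_sqrt (by linarith)
      have e4 : s ^ (q - 1) * s ^ (1 - q) = 1 := by
        rw [← Real.rpow_add hs0]; simp
      have e5 : s ^ (q - 1) / √D * T ≤ 1 / √κ * T ^ q := by
        calc s ^ (q - 1) / √D * T
            = s ^ (q - 1) / √D * (T ^ q * (T ^ 2) ^ ((1 - q) / 2)) := by rw [← e1]
          _ ≤ s ^ (q - 1) / √D * (T ^ q * (s ^ (1 - q) * √(√n))) := by gcongr
          _ = (s ^ (q - 1) * s ^ (1 - q)) * (√(√n) / √D) * T ^ q := by ring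
          _ ≤ 1 * (1 / √κ) * T ^ q := by rw [e4]; gcongr
          _ = _ := by ring
      linarith

/-- Size of the truncated increments in the exponential scale. -/
lemma truncated_increment_le (hq : 0 < q) (hq2 : q ≤ 2) (hs : 1 ≤ s) (hsn : s ≤ √n) (hκ : 0 < κ)
    (hD : 1 ≤ D) (hDn : D ≤ n) (hDκ : κ * √n ≤ D) (hT : 0 ≤ T) (hTs : T ^ 2 ≤ s * √n) {y : ℝ}
    (hy : |y| ≤ √(n / D) * T + T ^ 2) {c : ℝ} (hc : 0 < c) (hc1 : c ≤ 1) :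
    |c * (s ^ (q - 1) / √n) * y| ≤ c * (2 + 1 / √κ) * T ^ q + s ^ q / D ∧
      (c * (s ^ (q - 1) / √n) * y) ^ 2 ≤ s ^ q / D * (T + T ^ 2) ^ 2 := by
  have hs0 : 0 < s := by linarith
  have hn0 : 0 < √n := by linarith
  have hD0 : 0 < D := by linarith
  have hn : 0 < n := by linarith
  have hN : √(n / D) = √n / √D := Real.sqrt_div hn.le D
  have hN1 : 1 ≤ √(n / D) := Real.one_le_sqrt.2 ((one_le_div hD0).2 hDn)
  have hρ : 0 ≤ s ^ q / D := by positivity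
  have hl : 0 < s ^ (q - 1) / √n := by positivity
  have e0 : s ^ (q - 1) / √n * √(n / D) = s ^ (q - 1) / √D := by
    rw [hN]; field_simp
  have habs : |c * (s ^ (q - 1) / √n) * y| = c * (s ^ (q - 1) / √n) * |y| := by
    rw [abs_mul, abs_of_pos (by positivity)]
  refine ⟨?_, ?_⟩
  · rw [habs]
    have h1 := rpow_mul_sq_le_of_sq_le hq hq2 hs hsn hT hTs
    have h2 := rpow_mul_le_of_sq_le hq hq2 hs hsn hκ hD hDκ hT hTs
    calc _ ≤ c * (s ^ (q - 1) / √n) * (√(n / D) * T + T ^ 2) := by gcongr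
      _ = c * ((s ^ (q - 1) / √n * √(n / D)) * T + s ^ (q - 1) / √n * T ^ 2) := by ring
      _ ≤ c * (((1 + 1 / √κ) * T ^ q + s ^ q / D) + T ^ q) := by
          rw [e0]; gcongr
      _ = c * (2 + 1 / √κ) * T ^ q + c * (s ^ q / D) := by ring
      _ ≤ c * (2 + 1 / √κ) * T ^ q + 1 * (s ^ q / D) := by gcongr
      _ = _ := by ring
  · rw [← sq_abs, habs]
    have h1 : c * (s ^ (q - 1) / √n) * |y| ≤ s ^ (q - 1) / √D * (T + T ^ 2) := by
      calc _ ≤ 1 * (s ^ (q - 1) / √n) * (√(n / D) * T + √(n / D) * T ^ 2) := by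
            gcongr
            refine hy.trans ?_
            gcongr
            exact le_mul_of_one_le_left (by positivity) hN1
        _ = (s ^ (q - 1) / √n * √(n / D)) * (T + T ^ 2) := by ring
        _ = _ := by rw [e0]
    calc _ ≤ (s ^ (q - 1) / √D * (T + T ^ 2)) ^ 2 := by gcongr
      _ = s ^ (q - 1) * s ^ (q - 1) / (√D * √D) * (T + T ^ 2) ^ 2 := by ring
      _ ≤ s ^ q / D * (T + T ^ 2) ^ 2 := by
          rw [Real.mul_self_sqrt hD0.le, ← Real.rpow_add hs0]
          gcongr
          linarith

end Truncation

lemma exp_le_one_add_add_sq_mul (w : ℝ) : Real.exp w ≤ 1 + w + w ^ 2 * Real.exp |w| := by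
  have h1 : 1 ≤ Real.exp |w| := Real.one_le_exp (abs_nonneg w)
  rcases le_or_gt |w| 1 with h | h
  · have := (abs_le.1 (Real.abs_exp_sub_one_sub_id_le h)).2
    nlinarith [sq_nonneg w]
  · have hw : 1 ≤ w ^ 2 := by rw [← sq_abs]; nlinarith
    rcases le_or_gt 0 w with h0 | h0
    · rw [abs_of_nonneg h0] at *
      nlinarith [Real.exp_pos w]
    · have h2 : Real.exp w ≤ 1 := Real.exp_le_one_iff.2 h0.le
      rw [abs_of_neg h0] at h
      nlinarith [sq_nonneg w]

/-- A centred exponential moment bound of Bernstein type. -/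
lemma exists_integral_exp_sub_le {ε q : ℝ} (hε : 0 < ε) (hq : 0 < q) (B : ℝ) (hB : 1 ≤ B) :
    ∃ C : ℝ, 0 ≤ C ∧ ∀ {α : Type} [MeasurableSpace α] (ρ : Measure α) [IsProbabilityMeasure ρ]
      (T W : α → ℝ) (r : ℝ), (∀ y, 0 ≤ T y) → 0 ≤ r →
      Integrable (fun y => Real.exp (ε * T y ^ q)) ρ → ∫ y, Real.exp (ε * T y ^ q) ∂ρ ≤ B →
      AEStronglyMeasurable W ρ → (∀ y, |W y| ≤ ε / 2 * T y ^ q + r) →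
      (∀ y, W y ^ 2 ≤ r * (T y + T y ^ 2) ^ 2) →
      ∫ y, Real.exp (W y - ∫ y, W y ∂ρ) ∂ρ ≤ Real.exp (C * r) := by
  obtain ⟨D, hD1, hD⟩ := exists_pow_le_exp_rpow_uniform (half_pos hε) hq
  refine ⟨2 + 2 * B + 4 * D * Real.exp 1 * B, by positivity, ?_⟩
  intro α _ ρ _ T W r hT hr hi hTB hW hW1 hW2
  have hTq : ∀ y, 0 ≤ T y ^ q := fun y => Real.rpow_nonneg (hT y) q
  have hle1 : ∀ y, ε * T y ^ q ≤ Real.exp (ε * T y ^ q) := fun y => by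
    have := Real.add_one_le_exp (ε * T y ^ q); linarith
  have hWle : ∀ y, |W y| ≤ 1 / 2 * Real.exp (ε * T y ^ q) + r := fun y => by
    have := hW1 y; have := hle1 y; linarith
  have iB : Integrable (fun y => 1 / 2 * Real.exp (ε * T y ^ q) + r) ρ :=
    (hi.const_mul _).add (integrable_const _)
  have iW : Integrable W ρ := iB.mono' hW (.of_forall hWle)
  have eB : ∫ y, (1 / 2 * Real.exp (ε * T y ^ q) + r) ∂ρ ≤ 1 / 2 * B + r := by
    rw [integral_add (hi.const_mul _) (integrable_const _), integral_const_mul]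
    simp only [integral_const, probReal_univ, smul_eq_mul, one_mul]
    linarith
  have hEW : |∫ y, W y ∂ρ| ≤ 1 / 2 * B + r :=
    abs_integral_le_integral_abs.trans ((integral_mono iW.abs iB hWle).trans eB)
  have hexpW : ∀ y, Real.exp (W y) ≤ Real.exp r * Real.exp (ε * T y ^ q) := fun y => by
    rw [← Real.exp_add]
    refine Real.exp_le_exp.2 ?_
    have := (le_abs_self _).trans (hW1 y)
    nlinarith [hTq y]
  have iE : Integrable (fun y => Real.exp (W y)) ρ :=
    (hi.const_mul (Real.exp r)).mono' (Real.continuous_exp.comp_aestronglyMeasurable hW)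
      (.of_forall fun y => by rw [Real.norm_eq_abs, abs_of_pos (Real.exp_pos _)]; exact hexpW y)
  have e1 : ∫ y, Real.exp (W y - ∫ y, W y ∂ρ) ∂ρ =
      Real.exp (-∫ y, W y ∂ρ) * ∫ y, Real.exp (W y) ∂ρ := by
    rw [← integral_const_mul]
    congr 1 with y
    rw [← Real.exp_add]; congr 1; ring
  rw [e1]
  set w := ∫ y, W y ∂ρ
  -- For r ≤ 1 the second-order expansion gives E exp W ≤ 1 + E W + O(r), and the centring removes E
  -- W. For r > 1 a crude bound is enough, since constants are absorbed into exp(C r).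
  rcases le_or_gt r 1 with h | h
  · have hpt : ∀ y, Real.exp (W y) ≤
        1 + W y + 4 * D * Real.exp 1 * r * Real.exp (ε * T y ^ q) := by
      intro y
      have h1 := exp_le_one_add_add_sq_mul (W y)
      have h2 : (T y + T y ^ 2) ^ 2 ≤ 4 * D * Real.exp (ε / 2 * T y ^ q) := by
        have h3 := hD 2 (by norm_num) (T y) (hT y)
        have h4 := hD 4 (by norm_num) (T y) (hT y)
        nlinarith [sq_nonneg (T y - T y ^ 2)]
      have h5 : Real.exp |W y| ≤ Real.exp (ε / 2 * T y ^ q) * Real.exp 1 := by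
        rw [← Real.exp_add]
        exact Real.exp_le_exp.2 ((hW1 y).trans (by linarith))
      have h6 : W y ^ 2 * Real.exp |W y| ≤
          (r * (4 * D * Real.exp (ε / 2 * T y ^ q))) *
            (Real.exp (ε / 2 * T y ^ q) * Real.exp 1) := by
        refine mul_le_mul ((hW2 y).trans ?_) h5 (Real.exp_pos _).le (by positivity)
        gcongr
      have h7 : Real.exp (ε * T y ^ q) =
          Real.exp (ε / 2 * T y ^ q) * Real.exp (ε / 2 * T y ^ q) := by
        rw [← Real.exp_add]; congr 1; ring
      rw [h7]
      linarith
    have i1 : Integrable (fun y => 1 + W y) ρ := (integrable_const _).add iW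
    have i2 : Integrable (fun y => 4 * D * Real.exp 1 * r * Real.exp (ε * T y ^ q)) ρ :=
      hi.const_mul _
    have h8 := integral_mono iE (i1.add i2) hpt
    simp only [Pi.add_apply] at h8
    rw [integral_add i1 i2, integral_add (integrable_const _) iW, integral_const_mul] at h8
    simp only [integral_const, probReal_univ, smul_eq_mul, one_mul] at h8
    have h9 : 4 * D * Real.exp 1 * r * ∫ y, Real.exp (ε * T y ^ q) ∂ρ ≤
        4 * D * Real.exp 1 * r * B := by gcongr
    have h10 : ∫ y, Real.exp (W y) ∂ρ ≤ Real.exp (w + 4 * D * Real.exp 1 * B * r) := by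
      refine le_trans ?_ (Real.add_one_le_exp _)
      linarith
    calc _ ≤ Real.exp (-w) * Real.exp (w + 4 * D * Real.exp 1 * B * r) := by gcongr
      _ = Real.exp (4 * D * Real.exp 1 * B * r) := by rw [← Real.exp_add]; congr 1; ring
      _ ≤ _ := Real.exp_le_exp.2 (by nlinarith)
  · have h1 : ∫ y, Real.exp (W y) ∂ρ ≤ Real.exp r * B := by
      refine (integral_mono iE (hi.const_mul _) hexpW).trans ?_
      rw [integral_const_mul]
      gcongr
    have h2 : B ≤ Real.exp B := by have := Real.add_one_le_exp B; linarith
    have h3 : -w ≤ 1 / 2 * B + r := by linarith [(abs_le.1 hEW).1]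
    calc _ ≤ Real.exp (1 / 2 * B + r) * (Real.exp r * Real.exp B) := by
          gcongr
          exact h1.trans (by gcongr)
      _ = Real.exp (2 * r + 3 / 2 * B) := by
          rw [← Real.exp_add, ← Real.exp_add]; congr 1; ring
      _ ≤ _ := by
          refine Real.exp_le_exp.2 ?_
          have : 0 ≤ 4 * D * Real.exp 1 * B * r := by positivity
          nlinarith

end SampleCov

namespace SampleCov

/-! ### The increment of a quadratic form of the resolvent due to one column -/

/-- The denominators are written with roots R, P because it is the roots that concentrate; R ↦ 1/(1
+ R²) is Lipschitz since R + P ≤ (1 + R²)(1 + P²). In the application N = √(n/n_l) and sn = √n: of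
the factor N² in m², one N is compensated by the smallness of R − P, and one remains. -/
lemma abs_sq_div_sub_le {a m R P M N T z z₀ sn : ℝ} (hz₀ : 0 < z₀) (hz₁ : z₀ < 1) (hz : z₀ ≤ z)
    (hM : 1 ≤ M) (hN : 1 ≤ N) (hNn : N ≤ sn) (hT : 0 ≤ T) (hR : 0 ≤ R) (hP : 0 ≤ P)
    (ha : z * |a - m| ≤ T) (hRP : √z * (sn * |R - P|) ≤ T) (hm : m ^ 2 ≤ M * N ^ 2) :
    |a ^ 2 / (1 + R ^ 2) - m ^ 2 / (1 + P ^ 2)| ≤ 3 * M / z₀ ^ 2 * (N * T + T ^ 2) := by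
  have hz' : 0 < z := hz₀.trans_le hz
  have hsn : 0 < sn := by linarith
  have hsz : z₀ ≤ √z := by
    rw [Real.le_sqrt hz₀.le hz'.le]
    nlinarith
  have hmN : |m| ≤ M * N := by
    refine abs_le_of_sq_le_sq ?_ (by positivity)
    calc m ^ 2 ≤ M * N ^ 2 := hm
      _ ≤ M ^ 2 * N ^ 2 := by gcongr; exact le_self_pow₀ hM (by norm_num)
      _ = _ := by ring
  have ha' : |a - m| ≤ T / z₀ := by
    rw [le_div_iff₀ hz₀, mul_comm]
    exact (mul_le_mul_of_nonneg_right hz (abs_nonneg _)).trans ha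
  have hRP' : N * |R - P| ≤ T / z₀ := by
    rw [le_div_iff₀ hz₀, mul_comm]
    refine le_trans ?_ hRP
    gcongr
  have e1 : |a ^ 2 - m ^ 2| ≤ T ^ 2 / z₀ ^ 2 + 2 * (M * N) * (T / z₀) := by
    have : a ^ 2 - m ^ 2 = (a - m) ^ 2 + 2 * m * (a - m) := by ring
    rw [this]
    refine (abs_add_le _ _).trans ?_
    rw [abs_mul, abs_mul, abs_two, abs_of_nonneg (sq_nonneg _), ← sq_abs, ← div_pow]
    gcongr
  have e2 : |P ^ 2 - R ^ 2| ≤ |R - P| * ((1 + R ^ 2) * (1 + P ^ 2)) := by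
    have : P ^ 2 - R ^ 2 = -((R - P) * (R + P)) := by ring
    rw [this, abs_neg, abs_mul, abs_of_nonneg (by positivity : 0 ≤ R + P)]
    gcongr
    nlinarith [sq_nonneg (R - 1), sq_nonneg (P - 1), mul_nonneg (sq_nonneg R) (sq_nonneg P)]
  have e3 : a ^ 2 / (1 + R ^ 2) - m ^ 2 / (1 + P ^ 2) =
      (a ^ 2 - m ^ 2) / (1 + R ^ 2) + m ^ 2 * ((P ^ 2 - R ^ 2) / ((1 + R ^ 2) * (1 + P ^ 2))) := by
    have h1 : (1 : ℝ) + R ^ 2 ≠ 0 := by positivity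
    have h2 : (1 : ℝ) + P ^ 2 ≠ 0 := by positivity
    field_simp
    ring
  rw [e3]
  refine (abs_add_le _ _).trans ?_
  rw [abs_div, abs_mul, abs_div, abs_of_nonneg (by positivity : 0 ≤ 1 + R ^ 2),
    abs_of_nonneg (by positivity : 0 ≤ (1 + R ^ 2) * (1 + P ^ 2)), abs_of_nonneg (sq_nonneg m)]
  have f1 : |a ^ 2 - m ^ 2| / (1 + R ^ 2) ≤ |a ^ 2 - m ^ 2| :=
    div_le_self (abs_nonneg _) (by nlinarith [sq_nonneg R])
  have f2 : |P ^ 2 - R ^ 2| / ((1 + R ^ 2) * (1 + P ^ 2)) ≤ |R - P| := by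
    rw [div_le_iff₀ (by positivity)]; exact e2
  have f3 : m ^ 2 * (|P ^ 2 - R ^ 2| / ((1 + R ^ 2) * (1 + P ^ 2))) ≤ M * N * (T / z₀) := by
    calc _ ≤ M * N ^ 2 * |R - P| := by gcongr
      _ = M * N * (N * |R - P|) := by ring
      _ ≤ _ := by gcongr
  have hzz : 1 / z₀ ≤ 1 / z₀ ^ 2 := by
    gcongr
    exact pow_le_of_le_one hz₀.le hz₁.le (by norm_num)
  calc _ ≤ (1 / z₀ ^ 2) * T ^ 2 + 3 * (M * N * T) * (1 / z₀) := by
        have : T ^ 2 / z₀ ^ 2 = (1 / z₀ ^ 2) * T ^ 2 := by ring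
        have : M * N * (T / z₀) = M * N * T * (1 / z₀) := by ring
        linarith
    _ ≤ (3 * M * (1 / z₀ ^ 2)) * T ^ 2 + 3 * (M * N * T) * (1 / z₀ ^ 2) := by
        gcongr ?_ * _ + _ * ?_
        exact le_mul_of_one_le_left (by positivity) (by linarith)
    _ = _ := by ring

variable {p n : ℕ} {m : Fin n → Measure (EuclideanSpace ℝ (Fin p))}
  [∀ i, IsProbabilityMeasure (m i)] {q ε B K κ z₀ z s : ℝ} {i : Fin n} {J : Finset (Fin n)}
  {u : EuclideanSpace ℝ (Fin p)}

/-- The mean of `√⟪y, Q_{-i} y⟫`. -/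
noncomputable def rootMean (m : Fin n → Measure (EuclideanSpace ℝ (Fin p))) (z : ℝ) (i : Fin n)
    (x : Fin n → EuclideanSpace ℝ (Fin p)) : ℝ :=
  ∫ y, √⟪y, looRes z i x y⟫ ∂(m i)

/-- The decrease of `⟪u, Q u⟫` when the column `i` is added to the sample. -/
noncomputable def colDrop (z : ℝ) (i : Fin n) (u : EuclideanSpace ℝ (Fin p))
    (x : Fin n → EuclideanSpace ℝ (Fin p)) : ℝ :=
  (n : ℝ)⁻¹ * (⟪x i, looRes z i x u⟫ ^ 2 / (1 + (√((n : ℝ)⁻¹) * √⟪x i, looRes z i x (x i)⟫) ^ 2))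

/-- The value of `colDrop` when the column is replaced by typical values. -/
noncomputable def typDrop (m : Fin n → Measure (EuclideanSpace ℝ (Fin p))) (z : ℝ) (i : Fin n)
    (u : EuclideanSpace ℝ (Fin p)) (x : Fin n → EuclideanSpace ℝ (Fin p)) : ℝ :=
  (n : ℝ)⁻¹ * (⟪∫ y, y ∂(m i), looRes z i x u⟫ ^ 2 /
    (1 + (√((n : ℝ)⁻¹) * rootMean m z i x) ^ 2))

/-- The deviation of the column `i` from its typical values. -/
noncomputable def colDev (m : Fin n → Measure (EuclideanSpace ℝ (Fin p))) (z : ℝ) (i : Fin n)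
    (u : EuclideanSpace ℝ (Fin p)) (x : Fin n → EuclideanSpace ℝ (Fin p)) : ℝ :=
  max (z * |⟪x i, looRes z i x u⟫ - ⟪∫ y, y ∂(m i), looRes z i x u⟫|)
    (√z * |√⟪x i, looRes z i x (x i)⟫ - rootMean m z i x|)

omit [∀ i, IsProbabilityMeasure (m i)] in
lemma colDev_nonneg (hz : 0 < z) (x : Fin n → EuclideanSpace ℝ (Fin p)) : 0 ≤ colDev m z i u x :=
  le_max_of_le_left (by positivity)

lemma measurable_rootMean (hz : 0 < z) : Measurable (rootMean m z i) :=
  measurable_integral_looRes hz i (m i) (f := fun w => √⟪w.2.2, w.2.1 w.2.2⟫) (by fun_prop)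

lemma continuous_colDrop_aux (hz : 0 < z) :
    (Continuous fun x : Fin n → EuclideanSpace ℝ (Fin p) => ⟪x i, looRes z i x u⟫) ∧
    Continuous fun x : Fin n → EuclideanSpace ℝ (Fin p) => ⟪x i, looRes z i x (x i)⟫ :=
  have hcol : Continuous fun x : Fin n → EuclideanSpace ℝ (Fin p) => x i := continuous_apply i
  ⟨continuous_inner_looRes hz hcol continuous_const, continuous_inner_looRes hz hcol hcol⟩

lemma measurable_colDrop (hz : 0 < z) :
    Measurable (colDrop z i u : (Fin n → EuclideanSpace ℝ (Fin p)) → ℝ) := by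
  have h1 := (continuous_colDrop_aux (p := p) (n := n) (i := i) (u := u) hz).1.measurable
  have h2 := (continuous_colDrop_aux (p := p) (n := n) (i := i) (u := u) hz).2.measurable
  exact ((h1.pow_const 2).div ((((h2.sqrt).const_mul _).pow_const 2).const_add 1)).const_mul _

lemma measurable_inner_mean (hz : 0 < z) (b : EuclideanSpace ℝ (Fin p)) :
    Measurable fun x : Fin n → EuclideanSpace ℝ (Fin p) => ⟪b, looRes z i x u⟫ :=
  (continuous_inner_looRes hz continuous_const continuous_const).measurable

lemma measurable_typDrop (hz : 0 < z) : Measurable (typDrop m z i u) :=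
  (((measurable_inner_mean hz _).pow_const 2).div
    ((((measurable_rootMean hz).const_mul _).pow_const 2).const_add 1)).const_mul _

lemma measurable_colDev (hz : 0 < z) : Measurable (colDev m z i u) := by
  have h1 := (continuous_colDrop_aux (p := p) (n := n) (i := i) (u := u) hz).1.measurable
  have h2 := (continuous_colDrop_aux (p := p) (n := n) (i := i) (u := u) hz).2.measurable
  have h3 := measurable_inner_mean (p := p) (n := n) (i := i) (u := u) hz (∫ y, y ∂(m i))
  have h4 := measurable_rootMean (m := m) (i := i) hz
  refine Measurable.max (Measurable.const_mul ?_ _) (Measurable.const_mul ?_ _)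
  · exact measurable_norm.comp (h1.sub h3)
  · exact measurable_norm.comp (h2.sqrt.sub h4)

lemma inner_covRes_self_eq (hz : 0 < z) (x : Fin n → EuclideanSpace ℝ (Fin p)) :
    ⟪u, covRes z x u⟫ = ⟪u, looRes z i x u⟫ - colDrop z i u x := by
  have hA := isGramResolvent_looRes hz i x
  have h0 := hA.inner_nonneg (by positivity) hz (x i)
  rw [(isGramResolvent_covRes hz x).inner_self_eq_update hA (by positivity) hz u, colDrop,
    mul_pow, Real.sq_sqrt h0, Real.sq_sqrt (by positivity)]
  ring

lemma colDrop_nonneg (x : Fin n → EuclideanSpace ℝ (Fin p)) : 0 ≤ colDrop z i u x := by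
  unfold colDrop; positivity

omit [∀ i, IsProbabilityMeasure (m i)] in
lemma typDrop_nonneg (x : Fin n → EuclideanSpace ℝ (Fin p)) : 0 ≤ typDrop m z i u x := by
  unfold typDrop; positivity

lemma colDrop_le (hz : 0 < z) (hu : ‖u‖ ≤ 1) (x : Fin n → EuclideanSpace ℝ (Fin p)) :
    colDrop z i u x ≤ 1 / z := by
  have h1 := inner_covRes_self_eq (i := i) (u := u) hz x
  have h2 := (isGramResolvent_covRes hz x).inner_nonneg (by positivity) hz u
  have h3 := (isGramResolvent_looRes hz i x).inner_le (by positivity) hz u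
  have h4 : ‖u‖ ^ 2 / z ≤ 1 / z := by
    gcongr
    exact pow_le_one₀ (norm_nonneg _) hu
  linarith

omit [∀ i, IsProbabilityMeasure (m i)] in
lemma typDrop_update (x : Fin n → EuclideanSpace ℝ (Fin p)) (y : EuclideanSpace ℝ (Fin p)) :
    typDrop m z i u (Function.update x i y) = typDrop m z i u x := by
  simp only [typDrop, rootMean, looRes_update]

/-- Given the other columns, both entries of the maximum are deviations of convex 1-Lipschitz
observables of the column, a linear form and a root. The exponential of a maximum is at most the sum
of the exponentials, whence 2 B. -/
lemma integral_exp_colDev_le (hz : 0 < z) (hu : ‖u‖ ≤ 1)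
    (h : ConcLaw (m i) q ε B K) (x : Fin n → EuclideanSpace ℝ (Fin p)) :
    Integrable (fun y => Real.exp (ε * colDev m z i u (Function.update x i y) ^ q)) (m i) ∧
    ∫ y, Real.exp (ε * colDev m z i u (Function.update x i y) ^ q) ∂(m i) ≤ 2 * B := by
  set A := looRes z i x with hA
  have hG : IsGramResolvent (n : ℝ)⁻¹ z (Function.update x i 0) A := isGramResolvent_looRes hz i x
  have hc : (0 : ℝ) ≤ (n : ℝ)⁻¹ := by positivity
  have hsz : 0 < √z := Real.sqrt_pos.2 hz
  have h1 := (h.conc 1).single (f := fun y => ⟪y, A u⟫) (L := z⁻¹) (by positivity)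
    (fun y y' => by
      rw [← inner_sub_left, mul_comm]
      refine (abs_real_inner_le_norm _ _).trans ?_
      gcongr
      refine (hG.norm_le hc hz u).trans ?_
      rw [div_eq_mul_inv]
      exact mul_le_of_le_one_left (by positivity) hu)
    (by
      have := (innerₗ (EuclideanSpace ℝ (Fin p)) (A u)).convexOn (s := Set.univ) convex_univ
      refine this.congr fun y _ => ?_
      simp [real_inner_comm])
  have h2 := (h.conc 1).single (f := fun y => √⟪y, A y⟫) (L := (√z)⁻¹) (by positivity)
    (hG.sqrt_lipschitz hc hz) (hG.sqrt_convexOn hc hz)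
  simp only [inv_inv] at h1 h2
  obtain ⟨-, i1, b1⟩ := h1
  obtain ⟨-, i2, b2⟩ := h2
  have v1 : ∫ y, z * ⟪y, A u⟫ ∂(m i) = z * ⟪∫ y, y ∂(m i), A u⟫ := by
    rw [integral_const_mul]
    congr 1
    simp only [real_inner_comm (A u)]
    rw [_root_.integral_inner h.moments.integrable_id]
  have v2 : ∫ y, √z * √⟪y, A y⟫ ∂(m i) = √z * rootMean m z i x := integral_const_mul _ _
  rw [v1] at i1 b1
  rw [v2] at i2 b2
  simp only [← mul_sub, abs_mul, abs_of_pos hz, abs_of_pos hsz] at i1 b1 i2 b2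
  have hle : ∀ y, Real.exp (ε * colDev m z i u (Function.update x i y) ^ q) ≤
      Real.exp (ε * (z * |⟪y, A u⟫ - ⟪∫ y, y ∂(m i), A u⟫|) ^ q) +
      Real.exp (ε * (√z * |√⟪y, A y⟫ - rootMean m z i x|) ^ q) := by
    intro y
    simp only [colDev, Function.update_self, looRes_update, rootMean]
    rcases max_choice (z * |⟪y, A u⟫ - ⟪∫ y, y ∂(m i), A u⟫|)
      (√z * |√⟪y, A y⟫ - ∫ y, √⟪y, A y⟫ ∂(m i)|) with h | h
    · rw [h]; exact le_add_of_nonneg_right (Real.exp_pos _).le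
    · rw [h]; exact le_add_of_nonneg_left (Real.exp_pos _).le
  have hmeas : Measurable fun y => Real.exp (ε * colDev m z i u (Function.update x i y) ^ q) :=
    ((((measurable_colDev hz).comp (measurable_update x)).pow_const q).const_mul ε).exp
  have hi : Integrable (fun y => Real.exp (ε * colDev m z i u (Function.update x i y) ^ q)) (m i) :=
    (i1.add i2).mono' hmeas.aestronglyMeasurable (.of_forall fun y => by
      rw [Real.norm_eq_abs, abs_of_pos (Real.exp_pos _)]; exact hle y)
  refine ⟨hi, (integral_mono hi (i1.add i2) hle).trans ?_⟩
  simp only [Pi.add_apply]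
  rw [integral_add i1 i2]
  linarith

omit [∀ i, IsProbabilityMeasure (m i)] in
/-- Outside of an exceptional event, `colDrop` is close to its typical value. -/
lemma abs_colDrop_sub_typDrop_le (hn : 0 < n) (hz₀ : 0 < z₀) (hz₁ : z₀ < 1) (hz : z₀ ≤ z)
    (h : ConcLaw (m i) q ε B K) (hi : i ∉ J) (hJn : (J.card : ℝ) + 1 ≤ n) (hu : ‖u‖ ≤ 1)
    {x : Fin n → EuclideanSpace ℝ (Fin p)}
    (hx : ‖∑ j ∈ J, (x j - ∫ y, y ∂(m i))‖ ≤ √J.card * (√(K * p) + √n)) :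
    n * |colDrop z i u x - typDrop m z i u x| ≤ 36 * K * (1 + p / n) / z₀ ^ 4 *
      (√(n / ((J.card : ℝ) + 1)) * colDev m z i u x + colDev m z i u x ^ 2) := by
  have hn' : (0 : ℝ) < n := by exact_mod_cast hn
  have hz' : 0 < z := hz₀.trans_le hz
  have hK := h.moments.one_le
  set D : ℝ := (J.card : ℝ) + 1 with hD
  have hD1 : 1 ≤ D := by rw [hD]; linarith [(Nat.cast_nonneg J.card : (0 : ℝ) ≤ J.card)]
  set γ := 1 + (p : ℝ) / n with hγ
  have hγ1 : 1 ≤ γ := by rw [hγ]; linarith [show (0 : ℝ) ≤ p / n by positivity]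
  have hsn : 0 < √(n : ℝ) := Real.sqrt_pos.2 hn'
  have hss : √(n : ℝ) * √((n : ℝ)⁻¹) = 1 := by
    rw [← Real.sqrt_mul hn'.le, mul_inv_cancel₀ hn'.ne', Real.sqrt_one]
  have hnp : (n : ℝ) + p = n * γ := by rw [hγ]; field_simp
  have hm : ⟪∫ y, y ∂(m i), looRes z i x u⟫ ^ 2 ≤ 12 * K * γ / z₀ ^ 2 * √(n / D) ^ 2 := by
    have h1 := looRes_mean_sq_le hn hz' h.moments hi hu x
    have e : ⟪u, looRes z i x (∫ y, y ∂(m i))⟫ = ⟪∫ y, y ∂(m i), looRes z i x u⟫ := by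
      rw [← (isGramResolvent_looRes hz' i x).symm, real_inner_comm]
    rw [e, ← hD] at h1
    have h2 : ‖∑ j ∈ J, (x j - ∫ y, y ∂(m i))‖ ^ 2 ≤ D * (2 * (K * p + n)) := by
      calc _ ≤ (√J.card * (√(K * p) + √n)) ^ 2 := by gcongr
        _ = √J.card ^ 2 * (√(K * p) + √n) ^ 2 := mul_pow _ _ _
        _ ≤ J.card * (2 * (√(K * p) ^ 2 + √n ^ 2)) := by
            rw [Real.sq_sqrt (Nat.cast_nonneg _)]
            gcongr
            nlinarith [sq_nonneg (√(K * p) - √n)]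
        _ = J.card * (2 * (K * p + n)) := by
            rw [Real.sq_sqrt (by positivity), Real.sq_sqrt hn'.le]
        _ ≤ _ := by gcongr; linarith
    have hJD : (J.card : ℝ) ≤ D := by linarith
    have h3 := inv_pow_le_of_le hz₀ hz₁ hz (j := 1) (l := 2) (by norm_num)
    have h4 := inv_pow_le_of_le hz₀ hz₁ hz (j := 2) (l := 2) le_rfl
    rw [pow_one] at h3
    have h5 : D ^ 2 * ⟪∫ y, y ∂(m i), looRes z i x u⟫ ^ 2 ≤
        12 * K * γ * (D * n) * (1 / z₀ ^ 2) := by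
      calc _ ≤ _ := h1
        _ = 4 * (J.card * n) * (1 / z) + 4 * ‖∑ j ∈ J, (x j - ∫ y, y ∂(m i))‖ ^ 2 * (1 / z ^ 2) +
            2 * (K * p) * (1 / z ^ 2) := by ring
        _ ≤ 4 * (D * n) * (1 / z₀ ^ 2) + 4 * (D * (2 * (K * p + n))) * (1 / z₀ ^ 2) +
            2 * (D * (K * p)) * (1 / z₀ ^ 2) := by
            gcongr ?_ + ?_ + 2 * ?_ * ?_
            · gcongr
            · gcongr
            · exact le_mul_of_one_le_left (by positivity) hD1
        _ = (12 * n + 10 * (K * p)) * D * (1 / z₀ ^ 2) := by ring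
        _ ≤ (12 * (K * n) + 12 * (K * p)) * D * (1 / z₀ ^ 2) := by
            gcongr
            · exact le_mul_of_one_le_left hn'.le hK
            · norm_num
        _ = 12 * K * (n + p) * D * (1 / z₀ ^ 2) := by ring
        _ = _ := by rw [hnp]; ring
    rw [Real.sq_sqrt (by positivity)]
    have hD0 : 0 < D := by linarith
    calc _ = (D ^ 2 * ⟪∫ y, y ∂(m i), looRes z i x u⟫ ^ 2) / D ^ 2 := by field_simp
      _ ≤ (12 * K * γ * (D * n) * (1 / z₀ ^ 2)) / D ^ 2 := by gcongr
      _ = _ := by field_simp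
  have hz2 : 1 ≤ 1 / z₀ ^ 2 := by
    rw [one_le_div (by positivity)]; exact pow_le_one₀ hz₀.le hz₁.le
  have hN1 : 1 ≤ √(n / D) := Real.one_le_sqrt.2 ((one_le_div (by linarith)).2 hJn)
  have hNn : √(n / D) ≤ √(n : ℝ) := Real.sqrt_le_sqrt (div_le_self hn'.le hD1)
  have hKγ : 1 ≤ K * γ := one_le_mul_of_one_le_of_one_le hK hγ1
  -- With M = 12 K γ/z₀² the constant 3 M/z₀² equals 36 K γ/z₀⁴: this is the origin of the power z₀⁴
  -- in the concentration rate.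
  have key := abs_sq_div_sub_le (a := ⟪x i, looRes z i x u⟫)
    (m := ⟪∫ y, y ∂(m i), looRes z i x u⟫) (R := √((n : ℝ)⁻¹) * √⟪x i, looRes z i x (x i)⟫)
    (P := √((n : ℝ)⁻¹) * rootMean m z i x) (M := 12 * K * γ / z₀ ^ 2) (N := √(n / D))
    (T := colDev m z i u x) (sn := √n) hz₀ hz₁ hz
    (by
      calc (1 : ℝ) ≤ 12 * (K * γ) * (1 / z₀ ^ 2) :=
            one_le_mul_of_one_le_of_one_le (by linarith) hz2
        _ = _ := by ring)
    hN1 hNn (colDev_nonneg hz' x) (by positivity)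
    (mul_nonneg (by positivity) (integral_nonneg fun y => Real.sqrt_nonneg _))
    (le_max_left _ _)
    (by
      rw [← mul_sub, abs_mul, abs_of_nonneg (Real.sqrt_nonneg _), ← mul_assoc √(n : ℝ), hss,
        one_mul]
      exact le_max_right _ _) hm
  rw [colDrop, typDrop, ← mul_sub, abs_mul, abs_of_pos (inv_pos.2 hn'), ← mul_assoc,
    mul_inv_cancel₀ hn'.ne', one_mul]
  refine key.trans (le_of_eq ?_)
  field_simp
  ring

end SampleCov

namespace SampleCov

/-! ### Truncation of the increments -/

section TruncatedIncrements

variable {p n : ℕ} {m : Fin n → Measure (EuclideanSpace ℝ (Fin p))}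
  [∀ i, IsProbabilityMeasure (m i)] {q ε B K κ z₀ z s : ℝ} {i : Fin n} {J : Finset (Fin n)}
  {u : EuclideanSpace ℝ (Fin p)}

/-- `colDrop`, up to a quantity which does not depend on the column `i`. -/
noncomputable def relDrop (m : Fin n → Measure (EuclideanSpace ℝ (Fin p))) (z : ℝ) (i : Fin n)
    (u : EuclideanSpace ℝ (Fin p)) (x : Fin n → EuclideanSpace ℝ (Fin p)) : ℝ :=
  colDrop z i u x - min (typDrop m z i u x) (1 / z)

/-- The event on which the columns of the class of `i` and the column `i` itself are typical. -/
def typicalSet (m : Fin n → Measure (EuclideanSpace ℝ (Fin p))) (z : ℝ) (i : Fin n)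
    (u : EuclideanSpace ℝ (Fin p)) (J : Finset (Fin n)) (K a : ℝ) :
    Set (Fin n → EuclideanSpace ℝ (Fin p)) :=
  {x | ‖∑ j ∈ J, (x j - ∫ y, y ∂(m i))‖ ≤ √J.card * (√(K * p) + √n)} ∩
    {x | colDev m z i u x ^ 2 ≤ a}

lemma measurableSet_typicalSet (hz : 0 < z) (a : ℝ) :
    MeasurableSet (typicalSet m z i u J K a) :=
  (measurableSet_le (Continuous.measurable (by fun_prop)) measurable_const).inter
    (measurableSet_le ((measurable_colDev hz).pow_const 2) measurable_const)

omit [∀ i, IsProbabilityMeasure (m i)] in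
lemma abs_relDrop_le (hz : 0 < z) (hu : ‖u‖ ≤ 1) (x : Fin n → EuclideanSpace ℝ (Fin p)) :
    |relDrop m z i u x| ≤ 1 / z := by
  have h1 := colDrop_nonneg (z := z) (i := i) (u := u) x
  have h2 := colDrop_le (i := i) hz hu x
  have h3 : 0 ≤ min (typDrop m z i u x) (1 / z) := le_min (typDrop_nonneg x) (by positivity)
  have h4 : min (typDrop m z i u x) (1 / z) ≤ 1 / z := min_le_right _ _
  rw [relDrop, abs_le]
  constructor <;> linarith

omit [∀ i, IsProbabilityMeasure (m i)] in
-- The actual drop is at most 1/z, so capping its typical value at 1/z only brings the two closer.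
-- The cap keeps the difference bounded off the typical event as well.
lemma abs_relDrop_le_sub (hz : 0 < z) (hu : ‖u‖ ≤ 1) (x : Fin n → EuclideanSpace ℝ (Fin p)) :
    |relDrop m z i u x| ≤ |colDrop z i u x - typDrop m z i u x| := by
  have h2 := colDrop_le (i := i) hz hu x
  rw [relDrop]
  rcases le_total (typDrop m z i u x) (1 / z) with h | h
  · rw [min_eq_left h]
  · rw [min_eq_right h, abs_sub_comm, abs_sub_comm (colDrop z i u x), abs_of_nonneg (by linarith),
      abs_of_nonneg (by linarith)]
    linarith

lemma bddMeas_relDrop (hz : 0 < z) (hu : ‖u‖ ≤ 1) : BddMeas (relDrop m z i u) :=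
  ⟨(measurable_colDrop hz).sub ((measurable_typDrop hz).min measurable_const), 1 / z,
    fun x => abs_relDrop_le hz hu x⟩

lemma bddMeas_indicator {α : Type*} [MeasurableSpace α] {f : α → ℝ} (hf : BddMeas f) {S : Set α}
    (hS : MeasurableSet S) : BddMeas (S.indicator f) := by
  obtain ⟨hm, C, hC⟩ := hf
  refine ⟨hm.indicator hS, C, fun x => ?_⟩
  by_cases hx : x ∈ S
  · rw [Set.indicator_of_mem hx]; exact hC x
  · rw [Set.indicator_of_notMem hx, abs_zero]; exact (abs_nonneg _).trans (hC x)

lemma bddMeas_inner_covRes (hz : 0 < z) (v : EuclideanSpace ℝ (Fin p)) :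
    BddMeas fun x : Fin n → EuclideanSpace ℝ (Fin p) => ⟪v, covRes z x v⟫ := by
  refine ⟨Continuous.measurable ?_, ‖v‖ * (‖v‖ / z), fun x => ?_⟩
  · have := continuous_covRes (p := p) (n := n) hz
    fun_prop
  · refine (abs_real_inner_le_norm _ _).trans ?_
    gcongr
    exact (isGramResolvent_covRes hz x).norm_le (by positivity) hz v

/-- Neither ⟨u, Q_{-i} u⟩ nor the capped typical drop involves the column i, so both cancel in a
martingale increment. -/
lemma inner_covRes_sub_condInt (hz : 0 < z) (hu : ‖u‖ ≤ 1)
    (x : Fin n → EuclideanSpace ℝ (Fin p)) :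
    ⟪u, covRes z x u⟫ - condInt m i (fun x => ⟪u, covRes z x u⟫) x =
      -(relDrop m z i u x - condInt m i (relDrop m z i u) x) := by
  have e : ∀ x : Fin n → EuclideanSpace ℝ (Fin p), ⟪u, covRes z x u⟫ =
      (⟪u, looRes z i x u⟫ - min (typDrop m z i u x) (1 / z)) - relDrop m z i u x := fun x => by
    rw [inner_covRes_self_eq (i := i) hz x, relDrop]; ring
  simp only [e, condInt, looRes_update, typDrop_update]
  rw [integral_sub (integrable_const _) (((bddMeas_relDrop hz hu).update x i).integrable _)]
  simp only [integral_const, probReal_univ, smul_eq_mul, one_mul]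
  ring

lemma measureReal_colDev_gt_le (hz : 0 < z) (hq : 0 < q) (hε : 0 < ε) (hu : ‖u‖ ≤ 1)
    (h : ConcLaw (m i) q ε B K) {a : ℝ} (ha : 0 ≤ a) :
    (Measure.pi m).real {x | a < colDev m z i u x ^ 2} ≤
      2 * B * Real.exp (-(ε * a ^ (q / 2))) := by
  set S := {x | a < colDev m z i u x ^ 2} with hS
  have hSm : MeasurableSet S := measurableSet_lt measurable_const
    ((measurable_colDev hz).pow_const 2)
  have hb : BddMeas (S.indicator fun _ => (1 : ℝ)) := bddMeas_indicator (BddMeas.const 1) hSm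
  have e : (Measure.pi m).real S = ∫ x, S.indicator (fun _ => (1 : ℝ)) x ∂(Measure.pi m) := by
    rw [integral_indicator hSm]; simp
  rw [e, ← integral_condInt i (hb.integrable _)]
  have hpt : ∀ x, S.indicator (fun _ => (1 : ℝ)) x ≤
      Real.exp (-(ε * a ^ (q / 2))) * Real.exp (ε * colDev m z i u x ^ q) := by
    intro x
    rw [← Real.exp_add]
    by_cases hx : x ∈ S
    · rw [Set.indicator_of_mem hx]
      refine Real.one_le_exp ?_
      have h1 : a ^ (q / 2) ≤ colDev m z i u x ^ q := by
        calc a ^ (q / 2) ≤ (colDev m z i u x ^ 2) ^ (q / 2) :=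
              Real.rpow_le_rpow ha (le_of_lt hx) (by positivity)
          _ = _ := by
              rw [← Real.rpow_natCast, ← Real.rpow_mul (colDev_nonneg hz x)]
              congr 1; push_cast; ring
      nlinarith
    · rw [Set.indicator_of_notMem hx]; positivity
  have hc : ∀ x, condInt m i (S.indicator fun _ => (1 : ℝ)) x ≤
      2 * B * Real.exp (-(ε * a ^ (q / 2))) := by
    intro x
    have h2 := integral_exp_colDev_le hz hu h x
    calc _ ≤ ∫ y, Real.exp (-(ε * a ^ (q / 2))) *
          Real.exp (ε * colDev m z i u (Function.update x i y) ^ q) ∂(m i) :=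
          integral_mono ((hb.update x i).integrable _) (h2.1.const_mul _) fun y => hpt _
      _ ≤ Real.exp (-(ε * a ^ (q / 2))) * (2 * B) := by
          rw [integral_const_mul]
          gcongr
          exact h2.2
      _ = _ := mul_comm _ _
  calc _ ≤ ∫ x, 2 * B * Real.exp (-(ε * a ^ (q / 2))) ∂(Measure.pi m) :=
        integral_mono (integrable_condInt i (hb.integrable _)) (integrable_const _) hc
    _ = _ := by simp

/-- Off the typical event the integrand is at most 1/z. The tail of the class sum costs B and that
of the column deviation 2 B; since s ≤ √n, the first decays at least as fast as the second. -/
lemma integral_abs_relDrop_sub_indicator_le (hn : 0 < n) (hz : 0 < z) (hq : 0 < q) (hε : 0 < ε)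
    (hB : 1 ≤ B) (hu : ‖u‖ ≤ 1) (h : ConcLaw (m i) q ε B K) (hJ : ∀ j ∈ J, m j = m i)
    (hs : 1 ≤ s) (hsn : s ≤ √n) :
    ∫ x, |relDrop m z i u x -
      (typicalSet m z i u J K (s * √n)).indicator (relDrop m z i u) x| ∂(Measure.pi m) ≤
      3 * B / z * Real.exp (-(ε * (s * √n) ^ (q / 2))) := by
  have hn' : (0 : ℝ) < n := by exact_mod_cast hn
  set S₁ := {x : Fin n → EuclideanSpace ℝ (Fin p) |
    √J.card * (√(K * p) + √n) < ‖∑ j ∈ J, (x j - ∫ y, y ∂(m i))‖} with hS₁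
  set S₂ := {x | s * √n < colDev m z i u x ^ 2} with hS₂
  have m₁ : MeasurableSet S₁ :=
    measurableSet_lt measurable_const (Continuous.measurable (by fun_prop))
  have m₂ : MeasurableSet S₂ := measurableSet_lt measurable_const
    ((measurable_colDev hz).pow_const 2)
  have p₁ : (Measure.pi m).real S₁ ≤ B * Real.exp (-(ε * (s * √n) ^ (q / 2))) := by
    refine (h.class_tail hq hε hB J hJ (Real.sqrt_nonneg n)).trans ?_
    gcongr
    have : (√(n : ℝ)) ^ q = (√n * √n) ^ (q / 2) := by
      rw [Real.mul_rpow (Real.sqrt_nonneg _) (Real.sqrt_nonneg _),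
        ← Real.rpow_add (Real.sqrt_pos.2 hn')]
      congr 1; ring
    rw [this]
    gcongr
  have p₂ := measureReal_colDev_gt_le (i := i) (u := u) hz hq hε hu h (a := s * √n)
    (by positivity)
  have b₁ : BddMeas (S₁.indicator fun _ => (1 / z)) := bddMeas_indicator (BddMeas.const _) m₁
  have b₂ : BddMeas (S₂.indicator fun _ => (1 / z)) := bddMeas_indicator (BddMeas.const _) m₂
  have bR : BddMeas (relDrop m z i u) := bddMeas_relDrop hz hu
  have hle : ∀ x, |relDrop m z i u x -
      (typicalSet m z i u J K (s * √n)).indicator (relDrop m z i u) x| ≤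
      S₁.indicator (fun _ => (1 / z)) x + S₂.indicator (fun _ => (1 / z)) x := by
    intro x
    have hz1 : 0 ≤ 1 / z := by positivity
    have i1 : 0 ≤ S₁.indicator (fun _ => (1 / z)) x := Set.indicator_nonneg (fun _ _ => hz1) x
    have i2 : 0 ≤ S₂.indicator (fun _ => (1 / z)) x := Set.indicator_nonneg (fun _ _ => hz1) x
    by_cases hx : x ∈ typicalSet m z i u J K (s * √n)
    · rw [Set.indicator_of_mem hx, sub_self, abs_zero]
      positivity
    · rw [Set.indicator_of_notMem hx, sub_zero]
      have hR := abs_relDrop_le (m := m) (i := i) hz hu x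
      rw [typicalSet, Set.mem_inter_iff, not_and_or] at hx
      rcases hx with hx | hx
      · have : x ∈ S₁ := by simpa only [hS₁, Set.mem_ofPred_eq, not_le] using hx
        rw [Set.indicator_of_mem this]
        linarith
      · have : x ∈ S₂ := by simpa only [hS₂, Set.mem_ofPred_eq, not_le] using hx
        rw [Set.indicator_of_mem this (f := fun _ => 1 / z)]
        linarith
  calc _ ≤ ∫ x, (S₁.indicator (fun _ => (1 / z)) x + S₂.indicator (fun _ => (1 / z)) x)
        ∂(Measure.pi m) :=
        integral_mono ((bR.sub (bddMeas_indicator bR (measurableSet_typicalSet hz _))).abs.integrable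
          _) ((b₁.add b₂).integrable _) hle
    _ = (Measure.pi m).real S₁ * (1 / z) + (Measure.pi m).real S₂ * (1 / z) := by
        rw [integral_add (b₁.integrable _) (b₂.integrable _), integral_indicator m₁,
          integral_indicator m₂]
        simp
    _ ≤ (B * Real.exp (-(ε * (s * √n) ^ (q / 2)))) * (1 / z) +
        (2 * B * Real.exp (-(ε * (s * √n) ^ (q / 2)))) * (1 / z) := by gcongr
    _ = _ := by ring

end TruncatedIncrements

/-- Exponential moments of the truncated increments. -/
lemma exists_integral_exp_increment_le {ε q B κ : ℝ} (hε : 0 < ε) (hq : 0 < q) (hq2 : q ≤ 2)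
    (hB : 1 ≤ B) (hκ : 0 < κ) :
    ∃ c C : ℝ, 0 < c ∧ c ≤ 1 ∧ 0 ≤ C ∧ ∀ {p n : ℕ} (m : Fin n → Measure (EuclideanSpace ℝ (Fin p)))
      [∀ i, IsProbabilityMeasure (m i)] (K z₀ z s θ : ℝ) (i : Fin n) (J : Finset (Fin n))
      (u : EuclideanSpace ℝ (Fin p)), 0 < n → 0 < z₀ → z₀ < 1 → z₀ ≤ z → ConcLaw (m i) q ε B K →
      i ∉ J → (J.card : ℝ) + 1 ≤ n → κ * √n ≤ (J.card : ℝ) + 1 → ‖u‖ ≤ 1 → 1 ≤ s → s ≤ √n →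
      |θ| = c * (s ^ (q - 1) / √n) * (n / (36 * K * (1 + p / n) / z₀ ^ 4)) →
      ∀ x, ∫ y, Real.exp (θ * ((typicalSet m z i u J K (s * √n)).indicator (relDrop m z i u)
          (Function.update x i y) - condInt m i
          ((typicalSet m z i u J K (s * √n)).indicator (relDrop m z i u)) x)) ∂(m i) ≤
        Real.exp (C * (s ^ q / ((J.card : ℝ) + 1))) := by
  obtain ⟨C, hC, H⟩ := exists_integral_exp_sub_le hε hq (2 * B) (by linarith)
  have hκ' : 0 < √κ := Real.sqrt_pos.2 hκ
  -- Chosen so that c (2 + 1/√κ) ≤ ε/2, the half rate that `exists_integral_exp_sub_le` allows.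
  set c₁ := ε / 2 / (2 + 1 / √κ) with hc₁
  have hc₁0 : 0 < c₁ := by positivity
  refine ⟨min 1 c₁, C, lt_min one_pos hc₁0, min_le_left _ _, hC, ?_⟩
  intro p n m _ K z₀ z s θ i J u hn hz₀ hz₁ hz h hi hJn hJκ hu hs hsn hθ x
  have hn' : (0 : ℝ) < n := by exact_mod_cast hn
  have hz' : 0 < z := hz₀.trans_le hz
  set c := min 1 c₁ with hc
  have hc0 : 0 < c := lt_min one_pos hc₁0
  have hK := h.moments.one_le
  set D : ℝ := (J.card : ℝ) + 1 with hD
  have hD1 : 1 ≤ D := by rw [hD]; linarith [(Nat.cast_nonneg J.card : (0 : ℝ) ≤ J.card)]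
  set B₀ := 36 * K * (1 + p / n) / z₀ ^ 4 with hB₀
  have hB₀0 : 0 < B₀ := by positivity
  have hs0 : 0 < s := by linarith
  have hr : 0 ≤ s ^ q / D := by positivity
  set S := typicalSet m z i u J K (s * √n) with hS
  set f := S.indicator (relDrop m z i u) with hf
  have bf : BddMeas f := bddMeas_indicator (bddMeas_relDrop hz' hu) (measurableSet_typicalSet hz' _)
  have hT := integral_exp_colDev_le hz' hu h x
  have hbound : ∀ x, |θ * f x| ≤ ε / 2 * colDev m z i u x ^ q + s ^ q / D ∧
      (θ * f x) ^ 2 ≤ s ^ q / D * (colDev m z i u x + colDev m z i u x ^ 2) ^ 2 := by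
    intro x
    have hT0 : 0 ≤ colDev m z i u x := colDev_nonneg hz' x
    have hTq : 0 ≤ colDev m z i u x ^ q := Real.rpow_nonneg hT0 q
    by_cases hx : x ∈ S
    · rw [hf, Set.indicator_of_mem hx]
      have h1 : n * |relDrop m z i u x| ≤ B₀ * (√(n / D) * colDev m z i u x +
          colDev m z i u x ^ 2) :=
        (mul_le_mul_of_nonneg_left (abs_relDrop_le_sub hz' hu x) hn'.le).trans
          (abs_colDrop_sub_typDrop_le hn hz₀ hz₁ hz h hi hJn hu hx.1)
      have h2 : |n / B₀ * relDrop m z i u x| ≤ √(n / D) * colDev m z i u x +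
          colDev m z i u x ^ 2 := by
        rw [abs_mul, abs_of_pos (by positivity), div_mul_eq_mul_div, div_le_iff₀ hB₀0]
        linarith
      have h3 := truncated_increment_le hq hq2 hs hsn hκ hD1 hJn hJκ hT0 hx.2 h2 hc0
        (min_le_left _ _)
      have e : |θ * relDrop m z i u x| =
          |c * (s ^ (q - 1) / √n) * (n / B₀ * relDrop m z i u x)| := by
        rw [abs_mul, hθ, ← mul_assoc, abs_mul, abs_of_nonneg (a := c * _ * _) (by positivity)]
      have e2 : (θ * relDrop m z i u x) ^ 2 =
          (c * (s ^ (q - 1) / √n) * (n / B₀ * relDrop m z i u x)) ^ 2 := by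
        rw [← sq_abs, e, sq_abs]
      rw [e, e2]
      refine ⟨h3.1.trans ?_, h3.2⟩
      gcongr
      calc c * (2 + 1 / √κ) ≤ c₁ * (2 + 1 / √κ) := by gcongr; exact min_le_right _ _
        _ = ε / 2 := by rw [hc₁]; field_simp
    · rw [hf, Set.indicator_of_notMem hx, mul_zero]
      constructor
      · rw [abs_zero]; positivity
      · rw [zero_pow (by norm_num)]; positivity
  have key := H (m i) (fun y => colDev m z i u (Function.update x i y))
    (fun y => θ * f (Function.update x i y)) (s ^ q / D) (fun y => colDev_nonneg hz' _) hr hT.1 hT.2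
    (((bf.update x i).const_mul θ).1.aestronglyMeasurable) (fun y => (hbound _).1)
    (fun y => (hbound _).2)
  rw [integral_const_mul] at key
  simpa only [condInt, mul_sub] using key

end SampleCov

namespace SampleCov

/-! ### Concentration of quadratic forms of the resolvent -/

lemma telescope_const_mul {ι V : Type*} [DecidableEq ι] [MeasurableSpace V] {m : ι → Measure V}
    (h : ι → (ι → V) → ℝ) (c : ℝ) (l : List ι) (x : ι → V) :
    telescope m (fun i x => c * h i x) l x = c * telescope m h l x := by
  induction l generalizing x with
  | nil => simp [telescope]
  | cons i l ih => simp only [telescope, condInt, ih, integral_const_mul]; ring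

/-- `f` is the sum of a part with exponential moments and a small remainder. -/
def ExpApprox {α : Type*} [MeasurableSpace α] (ν : Measure α) (f : α → ℝ) (θ b r : ℝ) : Prop :=
  ∃ D : α → ℝ, BddMeas D ∧ ∫ x, Real.exp (θ * D x) ∂ν ≤ b ∧ ∫ x, Real.exp (-θ * D x) ∂ν ≤ b ∧
    ∫ x, |f x - D x| ∂ν ≤ r

section ExpApprox

variable {α : Type*} [MeasurableSpace α] {ν : Measure α} [IsProbabilityMeasure ν] {θ b r : ℝ}

/-- Convexity of exp, with the missing weight 1 − ∑ |w j| placed at 0; a negative weight exchanges θ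
and −θ. The number of terms does not enter. -/
lemma integral_exp_sum_mul_le {ι : Type*} [Fintype ι] {D : ι → α → ℝ} (hD : ∀ j, BddMeas (D j))
    (hb : 1 ≤ b) (h1 : ∀ j, ∫ x, Real.exp (θ * D j x) ∂ν ≤ b)
    (h2 : ∀ j, ∫ x, Real.exp (-θ * D j x) ∂ν ≤ b) {w : ι → ℝ} (hw : ∑ j, |w j| ≤ 1) :
    ∫ x, Real.exp (θ * ∑ j, w j * D j x) ∂ν ≤ b := by
  set σ : ι → ℝ := fun j => if 0 ≤ w j then θ else -θ with hσ
  have hσ' : ∀ j, ∫ x, Real.exp (σ j * D j x) ∂ν ≤ b := by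
    intro j
    by_cases h : 0 ≤ w j
    · simpa only [hσ, if_pos h] using h1 j
    · simpa only [hσ, if_neg h] using h2 j
  have hi : ∀ j, Integrable (fun x => Real.exp (σ j * D j x)) ν := fun j =>
    ((hD j).const_mul _).exp.integrable ν
  have hpt : ∀ x, Real.exp (θ * ∑ j, w j * D j x) ≤
      (1 - ∑ j, |w j|) + ∑ j, |w j| * Real.exp (σ j * D j x) := by
    intro x
    have := convexOn_exp.map_add_sum_le (t := Finset.univ) (w := fun j => |w j|)
      (p := fun j => σ j * D j x) (v := 1 - ∑ j, |w j|) (q := 0) (fun j _ => abs_nonneg _)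
      (by ring) (fun j _ => Set.mem_univ _) (by linarith) (Set.mem_univ _)
    simp only [smul_eq_mul, mul_zero, zero_add, Real.exp_zero, mul_one] at this
    refine le_trans (le_of_eq ?_) this
    rw [Finset.mul_sum]
    congr 1
    refine Finset.sum_congr rfl fun j _ => ?_
    by_cases h : 0 ≤ w j
    · simp only [hσ, if_pos h, abs_of_nonneg h]; ring
    · simp only [hσ, if_neg h, abs_of_neg (not_le.1 h)]; ring
  have bS : BddMeas fun x => θ * ∑ j, w j * D j x := by
    refine BddMeas.const_mul ?_ θ
    choose hm C hC using hD
    refine ⟨Finset.measurable_sum _ fun j _ => (hm j).const_mul _, ∑ j, |w j| * C j, fun x => ?_⟩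
    refine (Finset.abs_sum_le_sum_abs _ _).trans (Finset.sum_le_sum fun j _ => ?_)
    rw [abs_mul]
    gcongr
    exact hC j x
  have i2 : Integrable (fun x => ∑ j, |w j| * Real.exp (σ j * D j x)) ν :=
    integrable_finsetSum _ fun j _ => (hi j).const_mul _
  calc _ ≤ ∫ x, ((1 - ∑ j, |w j|) + ∑ j, |w j| * Real.exp (σ j * D j x)) ∂ν :=
        integral_mono (bS.exp.integrable ν) ((integrable_const _).add i2) hpt
    _ = (1 - ∑ j, |w j|) + ∑ j, |w j| * ∫ x, Real.exp (σ j * D j x) ∂ν := by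
        rw [integral_add (integrable_const _) i2,
          integral_finsetSum _ fun j _ => (hi j).const_mul _]
        simp [integral_const_mul]
    _ ≤ (1 - ∑ j, |w j|) * b + ∑ j, |w j| * b := by
        refine add_le_add (le_mul_of_one_le_right (by linarith) hb)
          (Finset.sum_le_sum fun j _ => ?_)
        exact mul_le_mul_of_nonneg_left (hσ' j) (abs_nonneg _)
    _ = b := by rw [← Finset.sum_mul]; ring

lemma BddMeas.sum_mul {ι : Type*} [Fintype ι] {D : ι → α → ℝ} (hD : ∀ j, BddMeas (D j))
    (w : ι → ℝ) : BddMeas fun x => ∑ j, w j * D j x := by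
  choose hm C hC using hD
  refine ⟨Finset.measurable_sum _ fun j _ => (hm j).const_mul _, ∑ j, |w j| * C j, fun x => ?_⟩
  refine (Finset.abs_sum_le_sum_abs _ _).trans (Finset.sum_le_sum fun j _ => ?_)
  rw [abs_mul]
  gcongr
  exact hC j x

lemma ExpApprox.sum {ι : Type*} [Fintype ι] {f : ι → α → ℝ} (hf : ∀ j, BddMeas (f j))
    (h : ∀ j, ExpApprox ν (f j) θ b r) (hb : 1 ≤ b) (hr : 0 ≤ r) {w : ι → ℝ}
    (hw : ∑ j, |w j| ≤ 1) : ExpApprox ν (fun x => ∑ j, w j * f j x) θ b r := by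
  choose D hD h1 h2 h3 using h
  refine ⟨fun x => ∑ j, w j * D j x, BddMeas.sum_mul hD w,
    integral_exp_sum_mul_le hD hb h1 h2 hw,
    integral_exp_sum_mul_le hD hb h2 (by simpa only [neg_neg] using h1) hw, ?_⟩
  have hi : ∀ j, Integrable (fun x => |w j| * |f j x - D j x|) ν := fun j =>
    (((hf j).sub (hD j)).abs.integrable ν).const_mul _
  calc _ ≤ ∫ x, ∑ j, |w j| * |f j x - D j x| ∂ν := by
        refine integral_mono (((BddMeas.sum_mul hf w).sub (BddMeas.sum_mul hD w)).abs.integrable ν)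
          (integrable_finsetSum _ fun j _ => hi j) fun x => ?_
        simp only
        rw [← Finset.sum_sub_distrib]
        refine (Finset.abs_sum_le_sum_abs _ _).trans (Finset.sum_le_sum fun j _ => ?_)
        rw [← mul_sub, abs_mul]
    _ = ∑ j, |w j| * ∫ x, |f j x - D j x| ∂ν := by
        rw [integral_finsetSum _ fun j _ => hi j]
        simp only [integral_const_mul]
    _ ≤ ∑ j, |w j| * r := Finset.sum_le_sum fun j _ =>
        mul_le_mul_of_nonneg_left (h3 j) (abs_nonneg _)
    _ = (∑ j, |w j|) * r := (Finset.sum_mul _ _ _).symm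
    _ ≤ r := mul_le_of_le_one_left hr hw

/-- If |f| ≥ t, then either |D| ≥ t/2, handled by Chernoff, or |f − D| ≥ t/2, handled by Markov. -/
lemma ExpApprox.tail {f : α → ℝ} (hf : BddMeas f) (h : ExpApprox ν f θ b r) (hθ : 0 < θ) {t : ℝ}
    (ht : 0 < t) : ν.real {x | t ≤ |f x|} ≤ 2 * b * Real.exp (-(θ * t / 2)) + 2 * r / t := by
  obtain ⟨D, hD, h1, h2, h3⟩ := h
  have hpt : ∀ x, {x | t ≤ |f x|}.indicator (fun _ => (1 : ℝ)) x ≤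
      Real.exp (-(θ * t / 2)) * Real.exp (θ * D x) +
        Real.exp (-(θ * t / 2)) * Real.exp (-θ * D x) + 2 / t * |f x - D x| := by
    intro x
    by_cases hx : t ≤ |f x|
    · rw [Set.indicator_of_mem (by simpa using hx)]
      rw [← Real.exp_add, ← Real.exp_add]
      have a1 := Real.exp_pos (-(θ * t / 2) + θ * D x)
      have a2 := Real.exp_pos (-(θ * t / 2) + -θ * D x)
      have a3 : 0 ≤ 2 / t * |f x - D x| := by positivity
      by_cases h4 : t / 2 ≤ |f x - D x|
      · have : 1 ≤ 2 / t * |f x - D x| := by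
          calc (1 : ℝ) = 2 / t * (t / 2) := by field_simp
            _ ≤ _ := by gcongr
        linarith
      · have h5 : t / 2 ≤ |D x| := by
          have := abs_sub_abs_le_abs_sub (f x) (D x)
          linarith
        rcases le_abs.1 h5 with h6 | h6
        · have : 1 ≤ Real.exp (-(θ * t / 2) + θ * D x) := Real.one_le_exp (by nlinarith)
          linarith
        · have : 1 ≤ Real.exp (-(θ * t / 2) + -θ * D x) := Real.one_le_exp (by nlinarith)
          linarith
    · rw [Set.indicator_of_notMem (by simpa using hx)]
      positivity
  have hS : MeasurableSet {x | t ≤ |f x|} :=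
    measurableSet_le measurable_const (measurable_norm.comp hf.1)
  have e : ν.real {x | t ≤ |f x|} = ∫ x, {x | t ≤ |f x|}.indicator (fun _ => (1 : ℝ)) x ∂ν := by
    rw [integral_indicator hS]; simp
  have i1 : Integrable (fun x => Real.exp (-(θ * t / 2)) * Real.exp (θ * D x)) ν :=
    ((hD.const_mul θ).exp.integrable ν).const_mul _
  have i2 : Integrable (fun x => Real.exp (-(θ * t / 2)) * Real.exp (-θ * D x)) ν :=
    ((hD.const_mul (-θ)).exp.integrable ν).const_mul _
  have i3 : Integrable (fun x => 2 / t * |f x - D x|) ν :=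
    ((hf.sub hD).abs.integrable ν).const_mul _
  have i12 : Integrable (fun x => Real.exp (-(θ * t / 2)) * Real.exp (θ * D x) +
      Real.exp (-(θ * t / 2)) * Real.exp (-θ * D x)) ν := i1.add i2
  rw [e]
  calc _ ≤ _ := integral_mono ((bddMeas_indicator (BddMeas.const 1) hS).integrable ν)
        (i12.add i3) hpt
    _ = Real.exp (-(θ * t / 2)) * ∫ x, Real.exp (θ * D x) ∂ν +
        Real.exp (-(θ * t / 2)) * ∫ x, Real.exp (-θ * D x) ∂ν + 2 / t * ∫ x, |f x - D x| ∂ν := by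
        simp only [Pi.add_apply]
        rw [integral_add i12 i3, integral_add i1 i2, integral_const_mul, integral_const_mul,
          integral_const_mul]
    _ ≤ Real.exp (-(θ * t / 2)) * b + Real.exp (-(θ * t / 2)) * b + 2 / t * r := by gcongr
    _ = _ := by ring

end ExpApprox

/-- The main part is the telescope of the truncated increments. A column of class l costs s^q/n_l,
hence a class costs s^q and the total is k s^q. The discarded part of an increment is counted twice
in L¹, once for itself and once for its partial integral, whence 6 = 2 · 3. -/
lemma exists_expApprox {ε q B κ : ℝ} (hε : 0 < ε) (hq : 0 < q) (hq2 : q ≤ 2)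
    (hB : 1 ≤ B) (hκ : 0 < κ) :
    ∃ c C : ℝ, 0 < c ∧ 0 ≤ C ∧ ∀ {p n k : ℕ} (μ : Fin k → Measure (EuclideanSpace ℝ (Fin p)))
      [∀ l, IsProbabilityMeasure (μ l)] (K z₀ z s : ℝ) (cls : Fin n → Fin k)
      (u : EuclideanSpace ℝ (Fin p)), 0 < n → 0 < z₀ → z₀ < 1 → z₀ ≤ z →
      (∀ l, ConcLaw (μ l) q ε B K) → (∀ l, κ * √n ≤ classSize cls l) → ‖u‖ ≤ 1 → 1 ≤ s → s ≤ √n →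
      ExpApprox (Measure.pi fun i => μ (cls i))
        (fun x => ⟪u, covRes z x u⟫ - ∫ x, ⟪u, covRes z x u⟫ ∂(Measure.pi fun i => μ (cls i)))
        (c * (s ^ (q - 1) / √n) * (n / (36 * K * (1 + p / n) / z₀ ^ 4)))
        (Real.exp (C * (k * s ^ q))) (n * (6 * B / z * Real.exp (-(ε * (s * √n) ^ (q / 2))))) := by
  obtain ⟨c, C, hc, hc1, hC, H⟩ := exists_integral_exp_increment_le hε hq hq2 hB hκ
  refine ⟨c, C, hc, hC, ?_⟩
  intro p n k μ _ K z₀ z s cls u hn hz₀ hz₁ hz h hcls hu hs hsn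
  have hn' : (0 : ℝ) < n := by exact_mod_cast hn
  have hz' : 0 < z := hz₀.trans_le hz
  set m : Fin n → Measure (EuclideanSpace ℝ (Fin p)) := fun i => μ (cls i) with hm
  set ν := Measure.pi m with hν
  set θ := c * (s ^ (q - 1) / √n) * (n / (36 * K * (1 + p / n) / z₀ ^ 4)) with hθ
  have hN0 : ∀ l, 0 < (classSize cls l : ℝ) := fun l =>
    (by positivity : 0 < κ * √(n : ℝ)).trans_le (hcls l)
  set J : Fin n → Finset (Fin n) := fun i =>
    (Finset.univ.filter fun j => cls j = cls i).erase i with hJ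
  have hJc : ∀ i, ((J i).card : ℝ) + 1 = classSize cls (cls i) := fun i =>
    (classSize_eq_card_erase cls i).symm
  have hJm : ∀ i, ∀ j ∈ J i, m j = m i := by
    intro i j hj
    simp only [hJ, Finset.mem_erase, Finset.mem_filter] at hj
    simp only [hm, hj.2.2]
  set f : Fin n → (Fin n → EuclideanSpace ℝ (Fin p)) → ℝ := fun i =>
    (typicalSet m z i u (J i) K (s * √n)).indicator (relDrop m z i u) with hf
  have bf : ∀ i, BddMeas (f i) := fun i =>
    bddMeas_indicator (bddMeas_relDrop hz' hu) (measurableSet_typicalSet hz' _)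
  have bR : ∀ i, BddMeas (relDrop m z i u) := fun i => bddMeas_relDrop hz' hu
  set g : Fin n → (Fin n → EuclideanSpace ℝ (Fin p)) → ℝ := fun i x =>
    -1 * (f i x - condInt m i (f i) x) with hg
  have bg : ∀ i, BddMeas (g i) := fun i => ((bf i).sub ((bf i).condInt i)).const_mul _
  have hexp : ∀ θ' : ℝ, |θ'| = θ →
      ∫ x, Real.exp (θ' * telescope m g Finset.univ.toList x) ∂ν ≤
        Real.exp (C * (k * s ^ q)) := by
    intro θ' hθ'
    have h1 := integral_exp_telescope_le (m := m) (h := fun i x => θ' * g i x)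
      (c := fun i => C * (s ^ q / (((J i).card : ℝ) + 1))) (fun i => (bg i).const_mul θ')
      (fun i x => by
        have h2 := H m K z₀ z s (-θ') i (J i) u hn hz₀ hz₁ hz (h (cls i)) (by simp [hJ])
          (by rw [hJc]; exact_mod_cast classSize_le _ _) (by rw [hJc]; exact hcls _) hu hs hsn
          (by rw [abs_neg, hθ']) x
        refine le_trans (le_of_eq ?_) h2
        congr 1 with y
        have e : condInt m i (f i) (Function.update x i y) = condInt m i (f i) x := by
          simp only [condInt, Function.update_idem]
        simp only [hg, e]
        congr 1
        ring) Finset.univ.toList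
    simp only [telescope_const_mul] at h1
    refine h1.trans (le_of_eq ?_)
    congr 1
    rw [Finset.sum_map_toList]
    simp only [hJc]
    rw [← sum_classSize_mul cls fun l => C * (s ^ q / classSize cls l)]
    have : ∀ l, (classSize cls l : ℝ) * (C * (s ^ q / classSize cls l)) = C * s ^ q := fun l => by
      have := (hN0 l).ne'
      field_simp
    simp only [this, Finset.sum_const, Finset.card_univ, Fintype.card_fin, nsmul_eq_mul]
    ring
  have hK := (h (cls ⟨0, hn⟩)).moments.one_le
  have hθ0 : 0 ≤ θ := by
    have hs0 : 0 < s := by linarith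
    positivity
  refine ⟨telescope m g Finset.univ.toList, BddMeas.telescope bg _, hexp θ (abs_of_nonneg hθ0),
    hexp (-θ) (by rw [abs_neg, abs_of_nonneg hθ0]), ?_⟩
  have bZ : BddMeas fun x : Fin n → EuclideanSpace ℝ (Fin p) => ⟪u, covRes z x u⟫ :=
    bddMeas_inner_covRes hz' u
  set d : Fin n → (Fin n → EuclideanSpace ℝ (Fin p)) → ℝ := fun i x =>
    relDrop m z i u x - f i x with hd
  have bd : ∀ i, BddMeas (d i) := fun i => (bR i).sub (bf i)
  set g' : Fin n → (Fin n → EuclideanSpace ℝ (Fin p)) → ℝ := fun i x =>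
    -1 * (d i x - condInt m i (d i) x) with hg'
  have bg' : ∀ i, BddMeas (g' i) := fun i => ((bd i).sub ((bd i).condInt i)).const_mul _
  have hdec : ∀ x, ⟪u, covRes z x u⟫ - ∫ x, ⟪u, covRes z x u⟫ ∂ν -
      telescope m g Finset.univ.toList x = telescope m g' Finset.univ.toList x := by
    intro x
    rw [sub_integral_eq_telescope bZ x, sub_eq_iff_eq_add, ← telescope_add bg' bg]
    congr 1
    ext i x
    rw [inner_covRes_sub_condInt hz' hu]
    have e : condInt m i (d i) x = condInt m i (relDrop m z i u) x - condInt m i (f i) x := by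
      simp only [condInt, hd]
      rw [integral_sub (((bR i).update x i).integrable _) (((bf i).update x i).integrable _)]
    simp only [hg', hg]
    rw [e]
    simp only [hd]
    ring
  simp only [hdec]
  refine (integral_abs_telescope_le bg' _).trans ?_
  rw [Finset.sum_map_toList]
  have hterm : ∀ i, ∫ x, |g' i x| ∂ν ≤ 6 * B / z * Real.exp (-(ε * (s * √n) ^ (q / 2))) := by
    intro i
    have h1 := integral_abs_relDrop_sub_indicator_le (u := u) hn hz' hq hε hB hu (h (cls i))
      (hJm i) hs hsn
    have ia : Integrable (fun x => |d i x|) ν := (bd i).abs.integrable ν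
    calc ∫ x, |g' i x| ∂ν ≤ ∫ x, (|d i x| + condInt m i (fun x => |d i x|) x) ∂ν := by
          refine integral_mono ((bg' i).abs.integrable ν) (ia.add (integrable_condInt i ia))
            fun x => ?_
          simp only [hg', abs_mul, abs_neg, abs_one, one_mul]
          refine (abs_sub _ _).trans ?_
          gcongr
          exact condInt_abs_le i (d i) x
      _ = ∫ x, |d i x| ∂ν + ∫ x, |d i x| ∂ν := by
          rw [integral_add ia (integrable_condInt i ia), integral_condInt i ia]
      _ ≤ _ := by
          have e : 6 * B / z * Real.exp (-(ε * (s * √n) ^ (q / 2))) =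
              3 * B / z * Real.exp (-(ε * (s * √n) ^ (q / 2))) +
              3 * B / z * Real.exp (-(ε * (s * √n) ^ (q / 2))) := by ring
          rw [e]
          exact add_le_add h1 h1
  calc _ ≤ ∑ _i : Fin n, 6 * B / z * Real.exp (-(ε * (s * √n) ^ (q / 2))) :=
        Finset.sum_le_sum fun i _ => hterm i
    _ = _ := by simp

end SampleCov

namespace SampleCov

/-! ### Tails of weighted sums of quadratic forms -/

/-- The remainder of `exists_expApprox` is exponentially small. -/
lemma exists_mul_exp_neg_le {ε q : ℝ} (hε : 0 < ε) (hq : 0 < q) :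
    ∃ D : ℝ, 1 ≤ D ∧ ∀ n s : ℝ, 1 ≤ s → s ≤ √n →
      n ^ 2 * Real.exp (-(ε * (s * √n) ^ (q / 2))) ≤ D * Real.exp (-(ε / 2 * s ^ q)) := by
  obtain ⟨D, hD1, hD⟩ := exists_pow_le_exp_rpow 4 (half_pos hε) (half_pos hq)
  refine ⟨D, hD1, fun n s hs hsn => ?_⟩
  have hsn0 : 0 < √n := by linarith
  have hn : 0 ≤ n := (Real.sqrt_pos.1 hsn0).le
  have h1 := hD √n hsn0.le
  have h2 : n ^ 2 = √n ^ 4 := by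
    rw [show √n ^ 4 = (√n ^ 2) ^ 2 by ring, Real.sq_sqrt hn]
  -- (s√n)^{q/2} dominates both √n^{q/2} and s^q: one half of the rate absorbs n², the other half
  -- leaves exp(−(ε/2) s^q).
  have h3 : √n ^ (q / 2) ≤ (s * √n) ^ (q / 2) :=
    Real.rpow_le_rpow hsn0.le (le_mul_of_one_le_left hsn0.le hs) (by linarith)
  have h4 : s ^ q ≤ (s * √n) ^ (q / 2) := by
    calc s ^ q = (s * s) ^ (q / 2) := by
          rw [← pow_two, ← Real.rpow_natCast, ← Real.rpow_mul (by linarith)]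
          congr 1; push_cast; ring
      _ ≤ _ := Real.rpow_le_rpow (by nlinarith) (by gcongr) (by linarith)
  rw [h2]
  calc _ ≤ D * Real.exp (ε / 2 * √n ^ (q / 2)) * Real.exp (-(ε * (s * √n) ^ (q / 2))) := by gcongr
    _ = D * Real.exp (ε / 2 * √n ^ (q / 2) + -(ε * (s * √n) ^ (q / 2))) := by
        rw [mul_assoc, ← Real.exp_add]
    _ ≤ D * Real.exp (-(ε / 2 * s ^ q)) := by
        gcongr
        nlinarith

/-- The truncation scale s is taken proportional to z₀⁴ √n t/γ². For s ≤ 1 the bound exceeds one;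
for s > √n the event is empty, the weighted sum being at most 2/z₀; in between, the tail bound of
`ExpApprox` applies. -/
lemma exists_weighted_tail_le {ε q B κ K : ℝ} (hε : 0 < ε) (hq : 0 < q) (hq2 : q ≤ 2)
    (hB : 1 ≤ B) (hκ : 0 < κ) (hK : 1 ≤ K) (N : ℕ) :
    ∃ C c : ℝ, 0 ≤ C ∧ 0 < c ∧ ∀ {p n k : ℕ} (μ : Fin k → Measure (EuclideanSpace ℝ (Fin p)))
      [∀ l, IsProbabilityMeasure (μ l)] (z₀ z : ℝ) (cls : Fin n → Fin k), 0 < n → k ≤ N →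
      0 < z₀ → z₀ < 1 → z₀ ≤ z → (∀ l, ConcLaw (μ l) q ε B K) →
      (∀ l, κ * √n ≤ classSize cls l) →
      ∀ {ι : Type} [Fintype ι] (e : ι → EuclideanSpace ℝ (Fin p)) (w : ι → ℝ),
      (∀ j, ‖e j‖ ≤ 1) → ∑ j, |w j| ≤ 1 → ∀ t : ℝ, 0 < t →
      (Measure.pi fun i => μ (cls i)).real {x | t ≤ |∑ j, w j * (⟪e j, covRes z x (e j)⟫ -
        ∫ x, ⟪e j, covRes z x (e j)⟫ ∂(Measure.pi fun i => μ (cls i)))|} ≤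
      C * Real.exp (-((z₀ ^ 4 * √n * t / (1 + p / n) ^ 2) ^ q / c)) := by
  obtain ⟨c, C, hc, hC, H⟩ := exists_expApprox hε hq hq2 hB hκ
  obtain ⟨D, hD1, hD⟩ := exists_mul_exp_neg_le hε hq
  -- The second summand makes θ t/2 at least (C N + 1) s^q, which beats the exponential moment exp(C
  -- k s^q) and leaves exp(−s^q). The 3 ensures t > 2/z₀ once s > √n.
  set A : ℝ := 3 + 72 * K * (C * N + 1) / c with hA
  have hA3 : 3 ≤ A := by
    rw [hA]; exact le_add_of_nonneg_right (by positivity)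
  have hA0 : 0 < A := by linarith
  set b := min 1 (ε / 2) with hb
  have hb0 : 0 < b := lt_min one_pos (half_pos hε)
  refine ⟨max (Real.exp b) (2 + 12 * B * D), A ^ q / b, by positivity, by positivity, ?_⟩
  intro p n k μ _ z₀ z cls hn hkN hz₀ hz₁ hz h hcls ι _ e w he hw t ht
  have hn' : (0 : ℝ) < n := by exact_mod_cast hn
  have hz' : 0 < z := hz₀.trans_le hz
  have hsn : 0 < √(n : ℝ) := Real.sqrt_pos.2 hn'
  set γ := 1 + (p : ℝ) / n with hγ
  have hγ1 : 1 ≤ γ := by rw [hγ]; linarith [show (0 : ℝ) ≤ p / n by positivity]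
  set ν := Measure.pi fun i => μ (cls i) with hν
  set s := z₀ ^ 4 * √n * t / γ ^ 2 / A with hs
  have hs0 : 0 < s := by positivity
  have hv : z₀ ^ 4 * √n * t / γ ^ 2 = A * s := by rw [hs]; field_simp
  have hexp : (z₀ ^ 4 * √n * t / γ ^ 2) ^ q / (A ^ q / b) = b * s ^ q := by
    rw [hv, Real.mul_rpow hA0.le hs0.le]
    have : A ^ q ≠ 0 := (Real.rpow_pos_of_pos hA0 q).ne'
    field_simp
  rw [hexp]
  have ht' : t = A * s * γ ^ 2 / (z₀ ^ 4 * √n) := by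
    rw [eq_div_iff (by positivity), ← hv]; field_simp
  set Z : ι → (Fin n → EuclideanSpace ℝ (Fin p)) → ℝ := fun j x => ⟪e j, covRes z x (e j)⟫ -
    ∫ x, ⟪e j, covRes z x (e j)⟫ ∂ν with hZ
  have bZ : ∀ j, BddMeas (Z j) := fun j => (bddMeas_inner_covRes hz' (e j)).sub (BddMeas.const _)
  rcases le_or_gt s 1 with hs1 | hs1
  · have h1 : s ^ q ≤ 1 := Real.rpow_le_one hs0.le hs1 hq.le
    calc _ ≤ 1 := measureReal_le_one
      _ ≤ Real.exp b * Real.exp (-(b * s ^ q)) := by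
          rw [← Real.exp_add]
          refine Real.one_le_exp ?_
          nlinarith
      _ ≤ _ := by gcongr; exact le_max_left _ _
  rcases le_or_gt s √n with hs2 | hs2
  · have happ : ∀ j, ExpApprox ν (Z j) _ _ _ := fun j =>
      H μ K z₀ z s cls (e j) hn hz₀ hz₁ hz h hcls (he j) hs1.le hs2
    have hB₀ : 0 < 36 * K * γ / z₀ ^ 4 := by positivity
    have hsum := ExpApprox.sum bZ happ (Real.one_le_exp (by positivity)) (by positivity) hw
    have htail := hsum.tail (BddMeas.sum_mul bZ w) (by positivity) ht
    refine htail.trans ?_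
    rw [← hγ]
    have hsq : 0 ≤ s ^ q := by positivity
    have e1 : (C * (k * s ^ q)) + -(c * (s ^ (q - 1) / √n) * (n / (36 * K * γ / z₀ ^ 4)) * t / 2) ≤
        -(s ^ q) := by
      have hss : s ^ (q - 1) * s = s ^ q := by
        rw [← Real.rpow_add_one hs0.ne', sub_add_cancel]
      have hnn : √(n : ℝ) * √n = n := Real.mul_self_sqrt hn'.le
      have e2 : c * (s ^ (q - 1) / √n) * (n / (36 * K * γ / z₀ ^ 4)) * t / 2 =
          c * A * γ * s ^ q / (72 * K) := by
        rw [ht', ← hss]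
        nth_rewrite 2 [← hnn]
        field_simp
        norm_num
      have e3 : c * A ≥ 72 * K * (C * N + 1) := by
        have : c * A = 3 * c + 72 * K * (C * N + 1) := by rw [hA]; field_simp
        linarith
      have e4 : (C * N + 1) * s ^ q ≤ c * A * γ * s ^ q / (72 * K) := by
        rw [le_div_iff₀ (by positivity)]
        calc (C * N + 1) * s ^ q * (72 * K) = 72 * K * (C * N + 1) * 1 * s ^ q := by ring
          _ ≤ c * A * γ * s ^ q := by gcongr
      rw [e2]
      have e5 : C * (k * s ^ q) ≤ C * (N * s ^ q) := by gcongr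
      linarith
    have e6 : 2 * Real.exp (C * (k * s ^ q)) *
        Real.exp (-(c * (s ^ (q - 1) / √n) * (n / (36 * K * γ / z₀ ^ 4)) * t / 2)) ≤
        2 * Real.exp (-(b * s ^ q)) := by
      rw [mul_assoc, ← Real.exp_add]
      gcongr
      refine e1.trans ?_
      have : b ≤ 1 := min_le_left _ _
      nlinarith
    have e7 : 2 * (n * (6 * B / z * Real.exp (-(ε * (s * √n) ^ (q / 2))))) / t ≤
        12 * B * D * Real.exp (-(b * s ^ q)) := by
      -- The factor 1/t from Markov's inequality: its z₀ cancels 1/z ≤ 1/z₀, and its n yields the n²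
      -- absorbed by `exists_mul_exp_neg_le`.
      have htz : 1 / t ≤ z₀ * n := by
        rw [div_le_iff₀ ht, ht']
        have hA1 : 1 ≤ A * s * γ ^ 2 := by
          have : 1 ≤ γ ^ 2 := one_le_pow₀ hγ1
          exact one_le_mul_of_one_le_of_one_le
            (one_le_mul_of_one_le_of_one_le (by linarith) hs1.le) this
        have hn1 : (1 : ℝ) ≤ √n := by
          rw [Real.one_le_sqrt]; exact_mod_cast hn
        have hz3 : z₀ ^ 3 ≤ 1 := pow_le_one₀ hz₀.le hz₁.le
        have hnn : √(n : ℝ) * √n = n := Real.mul_self_sqrt hn'.le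
        have : z₀ * n * (A * s * γ ^ 2 / (z₀ ^ 4 * √n)) = √n * (A * s * γ ^ 2) / z₀ ^ 3 := by
          calc _ = z₀ * (√n * √n) * (A * s * γ ^ 2 / (z₀ ^ 4 * √n)) := by rw [hnn]
            _ = _ := by field_simp
        rw [this, le_div_iff₀ (by positivity), one_mul]
        exact hz3.trans (one_le_mul_of_one_le_of_one_le hn1 hA1)
      have h3 := hD n s hs1.le hs2
      have hE : Real.exp (-(ε / 2 * s ^ q)) ≤ Real.exp (-(b * s ^ q)) := by
        have : b ≤ ε / 2 := min_le_right _ _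
        gcongr
      calc _ = 12 * B * (n * (1 / z) * Real.exp (-(ε * (s * √n) ^ (q / 2)))) * (1 / t) := by ring
        _ ≤ 12 * B * (n * (1 / z₀) * Real.exp (-(ε * (s * √n) ^ (q / 2)))) * (z₀ * n) := by
            gcongr
        _ = 12 * B * ((n : ℝ) ^ 2 * Real.exp (-(ε * (s * √n) ^ (q / 2)))) := by field_simp
        _ ≤ 12 * B * (D * Real.exp (-(b * s ^ q))) := by
            gcongr ?_ * ?_
            exact h3.trans (by gcongr)
        _ = _ := by ring
    calc _ ≤ 2 * Real.exp (-(b * s ^ q)) + 12 * B * D * Real.exp (-(b * s ^ q)) := add_le_add e6 e7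
      _ = (2 + 12 * B * D) * Real.exp (-(b * s ^ q)) := by ring
      _ ≤ _ := by gcongr; exact le_max_right _ _
  · have hbd : ∀ x, |∑ j, w j * Z j x| ≤ 2 / z₀ := by
      intro x
      have hone : ∀ j (x : Fin n → EuclideanSpace ℝ (Fin p)), |⟪e j, covRes z x (e j)⟫| ≤ 1 / z₀ := by
        intro j x
        have hG := isGramResolvent_covRes hz' x
        rw [abs_of_nonneg (hG.inner_nonneg (by positivity) hz' _)]
        calc _ ≤ ‖e j‖ ^ 2 / z := hG.inner_le (by positivity) hz' _
          _ ≤ 1 / z₀ := by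
            gcongr
            exact pow_le_one₀ (norm_nonneg _) (he j)
      have hZb : ∀ j, |Z j x| ≤ 2 / z₀ := by
        intro j
        have h1 : |∫ x, ⟪e j, covRes z x (e j)⟫ ∂ν| ≤ 1 / z₀ := by
          have := norm_integral_le_of_norm_le_const (μ := ν) (f := fun x =>
            ⟪e j, covRes z x (e j)⟫) (.of_forall (hone j))
          simpa using this
        refine (abs_sub _ _).trans ?_
        have h2 := hone j x
        have : 2 / z₀ = 1 / z₀ + 1 / z₀ := by ring
        linarith
      calc _ ≤ ∑ j, |w j| * (2 / z₀) :=
            (Finset.abs_sum_le_sum_abs _ _).trans (Finset.sum_le_sum fun j _ => by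
              rw [abs_mul]; gcongr; exact hZb j)
        _ = (∑ j, |w j|) * (2 / z₀) := (Finset.sum_mul _ _ _).symm
        _ ≤ 2 / z₀ := mul_le_of_le_one_left (by positivity) hw
    have htb : 2 / z₀ < t := by
      rw [ht', div_lt_div_iff₀ hz₀ (by positivity)]
      have hz3 : z₀ ^ 3 ≤ 1 := pow_le_one₀ hz₀.le hz₁.le
      have h1 : √(n : ℝ) * z₀ ^ 3 ≤ √n := mul_le_of_le_one_right hsn.le hz3
      have h2 : 3 * s ≤ A * s * γ ^ 2 := by
        have : 1 ≤ γ ^ 2 := one_le_pow₀ hγ1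
        calc 3 * s = 3 * s * 1 := (mul_one _).symm
          _ ≤ A * s * γ ^ 2 := by gcongr
      have h3 : 2 * (√(n : ℝ) * z₀ ^ 3) < A * s * γ ^ 2 := by linarith
      calc 2 * (z₀ ^ 4 * √n) = 2 * (√(n : ℝ) * z₀ ^ 3) * z₀ := by ring
        _ < _ := by gcongr
    have hempty : {x | t ≤ |∑ j, w j * Z j x|} = ∅ := by
      ext x
      simp only [Set.mem_ofPred_eq, Set.mem_empty_iff_false, iff_false, not_le]
      exact (hbd x).trans_lt htb
    rw [hempty, measureReal_empty]
    positivity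

end SampleCov

namespace SampleCov

/-! ### Super-Gaussian concentration forces degenerate columns -/

/-- A form of Young's inequality, by comparing √m with ε x^{q−1}. The exponent a = (1 + 1/(q − 1))/2
is below 1 because q > 2. -/
lemma exists_mul_le_rpow_add {ε q : ℝ} (hε : 0 < ε) (hq : 2 < q) :
    ∃ C a : ℝ, 0 ≤ C ∧ 0 ≤ a ∧ a < 1 ∧ ∀ m x : ℝ, 0 < m → 0 ≤ x →
      √m * x ≤ ε * x ^ q + C * m ^ a := by
  refine ⟨ε⁻¹ ^ (1 / (q - 1)), 1 / 2 + 1 / 2 * (1 / (q - 1)), by positivity, ?_, ?_, ?_⟩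
  · have : 0 < q - 1 := by linarith
    positivity
  · have : 1 / (q - 1) < 1 := by rw [div_lt_one (by linarith)]; linarith
    linarith
  intro m x hm hx
  have hq1 : 0 < q - 1 := by linarith
  have hsm : 0 < √m := Real.sqrt_pos.2 hm
  rcases le_or_gt √m (ε * x ^ (q - 1)) with h | h
  · have hxq : x ^ (q - 1) * x = x ^ q := by
      rcases hx.eq_or_lt with h0 | h0
      · rw [← h0, mul_zero, Real.zero_rpow (by linarith)]
      · rw [← Real.rpow_add_one h0.ne', sub_add_cancel]
    have h1 : √m * x ≤ ε * x ^ q := by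
      rw [← hxq, ← mul_assoc]; gcongr
    have : 0 ≤ ε⁻¹ ^ (1 / (q - 1)) * m ^ (1 / 2 + 1 / 2 * (1 / (q - 1))) := by positivity
    linarith
  · have h1 : x ≤ (ε⁻¹ * √m) ^ (1 / (q - 1)) := by
      have : x ^ (q - 1) ≤ ε⁻¹ * √m := by
        rw [le_inv_mul_iff₀ hε]; exact h.le
      calc x = (x ^ (q - 1)) ^ (1 / (q - 1)) := by
            rw [← Real.rpow_mul hx, mul_one_div_cancel hq1.ne', Real.rpow_one]
        _ ≤ _ := Real.rpow_le_rpow (Real.rpow_nonneg hx _) this (by positivity)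
    have h2 : √m * (ε⁻¹ * √m) ^ (1 / (q - 1)) =
        ε⁻¹ ^ (1 / (q - 1)) * m ^ (1 / 2 + 1 / 2 * (1 / (q - 1))) := by
      rw [Real.mul_rpow (by positivity) hsm.le, Real.sqrt_eq_rpow, ← Real.rpow_mul hm.le,
        Real.rpow_add hm]
      ring
    have h3 : 0 ≤ ε * x ^ q := by positivity
    calc √m * x ≤ √m * (ε⁻¹ * √m) ^ (1 / (q - 1)) := by gcongr
      _ ≤ _ := by rw [h2]; linarith

lemma one_add_add_sq_le_exp (x : ℝ) : 1 + x + (max x 0) ^ 2 / 2 ≤ Real.exp x := by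
  rcases le_total 0 x with h | h
  · rw [max_eq_left h]; exact Real.quadratic_le_exp_of_nonneg h
  · rw [max_eq_right h]; have := Real.add_one_le_exp x; linarith

/-- Powers larger than one grow faster than `exp (C m^a)` with `a < 1`. -/
lemma eq_zero_of_forall_pow_le {v B C a : ℝ} (hv : 0 ≤ v) (ha : a < 1)
    (h : ∀ m : ℕ, 0 < m → (1 + v) ^ m ≤ B * Real.exp (C * (m : ℝ) ^ a)) : v = 0 := by
  by_contra hne
  have hv0 : 0 < v := lt_of_le_of_ne hv (Ne.symm hne)
  set L := Real.log (1 + v) with hL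
  have hL0 : 0 < L := Real.log_pos (by linarith)
  have hB : 0 < B := by
    have h1 := h 1 one_pos
    by_contra hB
    have h2 : (0 : ℝ) < (1 + v) ^ 1 := by positivity
    have := mul_nonpos_of_nonpos_of_nonneg (not_lt.1 hB) (Real.exp_pos (C * ((1 : ℕ) : ℝ) ^ a)).le
    linarith
  have hlog : ∀ m : ℕ, 0 < m → m * L ≤ Real.log B + C * (m : ℝ) ^ a := by
    intro m hm
    have h1 := Real.log_le_log (by positivity) (h m hm)
    rwa [Real.log_pow, Real.log_mul hB.ne' (Real.exp_pos _).ne', Real.log_exp] at h1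
  have hlim : Filter.Tendsto (fun m : ℕ => Real.log B / m + C * (m : ℝ) ^ (a - 1)) Filter.atTop
      (nhds (0 + C * 0)) := by
    refine Filter.Tendsto.add (tendsto_const_div_atTop_nhds_zero_nat _) (Filter.Tendsto.const_mul C ?_)
    have := (tendsto_rpow_neg_atTop (y := 1 - a) (by linarith)).comp
      (tendsto_natCast_atTop_atTop (R := ℝ))
    refine this.congr fun m => ?_
    simp
  have hge : ∀ᶠ m : ℕ in Filter.atTop, L ≤ Real.log B / m + C * (m : ℝ) ^ (a - 1) := by
    filter_upwards [Filter.eventually_gt_atTop 0] with m hm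
    have hm' : (0 : ℝ) < m := by exact_mod_cast hm
    rw [Real.rpow_sub_one hm'.ne', ← mul_div_assoc, ← add_div, le_div_iff₀ hm', mul_comm]
    exact hlog m hm
  have := ge_of_tendsto hlim hge
  simp at this
  linarith

variable {p : ℕ} {μ : Measure (EuclideanSpace ℝ (Fin p))} [IsProbabilityMeasure μ] {q ε B K : ℝ}

/-- For the centred X = ⟨w, y − b⟩, independence gives E exp(∑ Xⱼ) = (E exp X)^m, while
concentration at scale √m with exponent q > 2 bounds this by B exp(C m^a) with a < 1. Hence E exp X
≤ 1, and since E X = 0, the inequality 1 + X + X₊²/2 ≤ exp X forces X₊ = 0 almost surely. -/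
lemma ConcLaw.inner_ae_le (h : ConcLaw μ q ε B K) (hε : 0 < ε) (hq : 2 < q)
    {w : EuclideanSpace ℝ (Fin p)} (hw : ‖w‖ ≤ 1) :
    ∀ᵐ y ∂μ, ⟪w, y⟫ ≤ ⟪w, ∫ y, y ∂μ⟫ := by
  set b := ∫ y, y ∂μ with hb
  obtain ⟨C, a, hC, ha0, ha1, hCa⟩ := exists_mul_le_rpow_add hε hq
  have hiw : Integrable (fun y => ⟪w, y⟫) μ := h.moments.integrable_inner w
  set X : EuclideanSpace ℝ (Fin p) → ℝ := fun y => ⟪w, y⟫ - ⟪w, b⟫ with hX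
  have iX : Integrable X μ := hiw.sub (integrable_const _)
  have eX : ∫ y, X y ∂μ = 0 := by
    rw [hX, integral_sub hiw (integrable_const _), h.moments.integral_inner w]
    simp [hb]
  have hconc : ∀ m : ℕ, 0 < m →
      Integrable (fun y : Fin m → EuclideanSpace ℝ (Fin p) => Real.exp (∑ j, X (y j)))
        (Measure.pi fun _ => μ) ∧
      ∫ y : Fin m → EuclideanSpace ℝ (Fin p), Real.exp (∑ j, X (y j)) ∂(Measure.pi fun _ => μ) ≤
        B * Real.exp (C * (m : ℝ) ^ a) := by
    intro m hm
    have hm' : (0 : ℝ) < m := by exact_mod_cast hm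
    have hsm : 0 < √(m : ℝ) := Real.sqrt_pos.2 hm'
    have hlip : ∀ y y' : Fin m → EuclideanSpace ℝ (Fin p),
        |∑ j, ⟪w, y j⟫ - ∑ j, ⟪w, y' j⟫| ≤ √m * √(∑ j, ‖y j - y' j‖ ^ 2) := by
      intro y y'
      have h1 := norm_sum_sub_le 0 y y'
      simp only [sub_zero] at h1
      rw [← inner_sum, ← inner_sum, ← inner_sub_right]
      refine (abs_real_inner_le_norm _ _).trans ?_
      exact (mul_le_of_le_one_left (norm_nonneg _) hw).trans h1
    have hcvx : ConvexOn ℝ Set.univ fun y : Fin m → EuclideanSpace ℝ (Fin p) =>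
        ∑ j, ⟪w, y j⟫ := by
      refine ⟨convex_univ, fun y _ y' _ s t _ _ _ => le_of_eq ?_⟩
      simp only [Pi.add_apply, Pi.smul_apply, inner_add_right, inner_smul_right,
        Finset.sum_add_distrib, ← Finset.mul_sum, smul_eq_mul]
    obtain ⟨-, i1, b1⟩ := (h.conc m).scaled hsm hlip hcvx
    have hij : ∀ j : Fin m, Integrable (fun y : Fin m → EuclideanSpace ℝ (Fin p) => ⟪w, y j⟫)
        (Measure.pi fun _ => μ) := fun j =>
      (measurePreserving_eval (fun _ : Fin m => μ) j).integrable_comp_of_integrable hiw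
    have hev : ∀ j : Fin m, ∫ y : Fin m → EuclideanSpace ℝ (Fin p), ⟪w, y j⟫
        ∂(Measure.pi fun _ => μ) = ⟪w, b⟫ := by
      intro j
      rw [hb, ← h.moments.integral_inner w]
      exact integral_comp_eval (μ := fun _ : Fin m => μ) (f := fun y => ⟪w, y⟫)
        hiw.aestronglyMeasurable
    have hmean : ∫ y : Fin m → EuclideanSpace ℝ (Fin p), (√m)⁻¹ * ∑ j, ⟪w, y j⟫
        ∂(Measure.pi fun _ => μ) = (√m)⁻¹ * ∑ _j : Fin m, ⟪w, b⟫ := by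
      rw [integral_const_mul, integral_finsetSum _ fun j _ => hij j]
      simp only [hev]
    rw [hmean] at i1 b1
    have hdiff : ∀ y : Fin m → EuclideanSpace ℝ (Fin p), (√m)⁻¹ * ∑ j, ⟪w, y j⟫ -
        (√m)⁻¹ * ∑ _j : Fin m, ⟪w, b⟫ = (√m)⁻¹ * ∑ j, X (y j) := by
      intro y
      rw [← mul_sub, ← Finset.sum_sub_distrib]
    simp only [hdiff] at i1 b1
    have hle : ∀ y : Fin m → EuclideanSpace ℝ (Fin p), Real.exp (∑ j, X (y j)) ≤
        Real.exp (C * (m : ℝ) ^ a) * Real.exp (ε * |(√m)⁻¹ * ∑ j, X (y j)| ^ q) := by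
      intro y
      rw [← Real.exp_add]
      refine Real.exp_le_exp.2 ?_
      have h3 := hCa m |(√m)⁻¹ * ∑ j, X (y j)| hm' (abs_nonneg _)
      have h4 : √m * |(√m)⁻¹ * ∑ j, X (y j)| = |∑ j, X (y j)| := by
        rw [abs_mul, abs_of_pos (inv_pos.2 hsm), ← mul_assoc, mul_inv_cancel₀ hsm.ne', one_mul]
      have := le_abs_self (∑ j, X (y j))
      linarith
    have hi : Integrable (fun y : Fin m → EuclideanSpace ℝ (Fin p) => Real.exp (∑ j, X (y j)))
        (Measure.pi fun _ => μ) :=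
      (i1.const_mul _).mono' (Continuous.aestronglyMeasurable (by fun_prop))
        (.of_forall fun y => by
          rw [Real.norm_eq_abs, abs_of_pos (Real.exp_pos _)]; exact hle y)
    refine ⟨hi, (integral_mono hi (i1.const_mul _) hle).trans ?_⟩
    rw [integral_const_mul, mul_comm]
    gcongr
  have iE : Integrable (fun y => Real.exp (X y)) μ := by
    have h1 := (hconc 1 one_pos).1
    simp only [Finset.univ_unique, Finset.sum_singleton, Fin.default_eq_zero] at h1
    have h2 := measurePreserving_eval (fun _ : Fin 1 => μ) 0
    rw [← h2.map_eq]
    refine (integrable_map_measure (Continuous.aestronglyMeasurable (by fun_prop))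
      h2.measurable.aemeasurable).2 h1
  have hXc : Continuous X := by fun_prop
  have hsq : Integrable (fun y => (max (X y) 0) ^ 2 / 2) μ := by
    refine (iE.sub ((integrable_const 1).add iX)).mono'
      (Continuous.aestronglyMeasurable (by fun_prop)) (.of_forall fun y => ?_)
    rw [Real.norm_eq_abs, abs_of_nonneg (by positivity)]
    have := one_add_add_sq_le_exp (X y)
    simp only [Pi.sub_apply, Pi.add_apply]
    linarith
  set v := ∫ y, (max (X y) 0) ^ 2 / 2 ∂μ with hv
  have hv0 : 0 ≤ v := integral_nonneg fun y => by positivity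
  have hM : 1 + v ≤ ∫ y, Real.exp (X y) ∂μ := by
    have i1 : Integrable (fun y => 1 + X y) μ := (integrable_const 1).add iX
    have h1 := integral_mono (i1.add hsq) iE fun y => one_add_add_sq_le_exp (X y)
    simp only [Pi.add_apply] at h1
    rw [integral_add i1 hsq, integral_add (integrable_const 1) iX, eX] at h1
    simpa using h1
  have hzero : v = 0 := eq_zero_of_forall_pow_le hv0 ha1 fun m hm => by
    refine le_trans ?_ (hconc m hm).2
    simp only [Real.exp_sum]
    rw [integral_fintype_prod_eq_pow (fun y => Real.exp (X y)), Fintype.card_fin]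
    gcongr
  have hae := (integral_eq_zero_iff_of_nonneg (fun y => by positivity) hsq).1 hzero
  filter_upwards [hae] with y hy
  simp only [Pi.zero_apply] at hy
  have h1 : max (X y) 0 = 0 := by
    have : (max (X y) 0) ^ 2 = 0 := by linarith
    exact pow_eq_zero_iff (by norm_num) |>.1 this
  have h2 : X y ≤ 0 := max_eq_right_iff.1 h1
  simp only [hX] at h2
  linarith

/-- With an exponent larger than two the columns are almost surely constant. -/
lemma ConcLaw.ae_eq_mean (h : ConcLaw μ q ε B K) (hε : 0 < ε) (hq : 2 < q) :
    ∀ᵐ y ∂μ, y = ∫ y, y ∂μ := by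
  set b := ∫ y, y ∂μ with hb
  have h1 : ∀ᵐ y ∂μ, ∀ a : Fin p, ⟪EuclideanSpace.single a (1 : ℝ), y⟫ ≤
      ⟪EuclideanSpace.single a (1 : ℝ), b⟫ :=
    ae_all_iff.2 fun a => h.inner_ae_le hε hq (by simp)
  have h2 : ∀ᵐ y ∂μ, ∀ a : Fin p, ⟪-EuclideanSpace.single a (1 : ℝ), y⟫ ≤
      ⟪-EuclideanSpace.single a (1 : ℝ), b⟫ :=
    ae_all_iff.2 fun a => h.inner_ae_le hε hq (by simp)
  filter_upwards [h1, h2] with y hy1 hy2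
  ext a
  have e1 := hy1 a
  have e2 := hy2 a
  simp only [EuclideanSpace.inner_single_left, inner_neg_left, map_one, one_mul] at e1 e2
  linarith

end SampleCov

/-! ### Concentration of weighted quadratic forms for every exponent q. -/

namespace SampleCov

/-- All columns are almost surely equal to their means, so the resolvent is almost surely constant
and coincides with its expectation. -/
lemma measureReal_weighted_eq_zero {p n k : ℕ} {ε q B K : ℝ} (hε : 0 < ε) (hq : 2 < q)
    (μ : Fin k → Measure (EuclideanSpace ℝ (Fin p))) [∀ l, IsProbabilityMeasure (μ l)]
    (h : ∀ l, ConcLaw (μ l) q ε B K) (cls : Fin n → Fin k) (z : ℝ) {ι : Type} [Fintype ι]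
    (e : ι → EuclideanSpace ℝ (Fin p)) (w : ι → ℝ) {t : ℝ} (ht : 0 < t) :
    (Measure.pi fun i => μ (cls i)).real {x | t ≤ |∑ j, w j * (⟪e j, covRes z x (e j)⟫ -
      ∫ x, ⟪e j, covRes z x (e j)⟫ ∂(Measure.pi fun i => μ (cls i)))|} = 0 := by
  set ν := Measure.pi fun i => μ (cls i) with hν
  set x₀ : Fin n → EuclideanSpace ℝ (Fin p) := fun i => ∫ y, y ∂(μ (cls i))
  have hae : ∀ᵐ x ∂ν, x = x₀ := by
    have : ∀ᵐ x ∂ν, ∀ i, x i = ∫ y, y ∂(μ (cls i)) := ae_all_iff.2 fun i =>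
      (measurePreserving_eval (fun i => μ (cls i)) i).quasiMeasurePreserving.ae
        ((h (cls i)).ae_eq_mean hε hq)
    filter_upwards [this] with x hx
    exact funext hx
  have hint : ∀ f : (Fin n → EuclideanSpace ℝ (Fin p)) → ℝ, ∫ x, f x ∂ν = f x₀ := by
    intro f
    rw [integral_congr_ae (g := fun _ => f x₀) (hae.mono fun x hx => by simp only [hx])]
    simp
  have h0 : ν {x | t ≤ |∑ j, w j * (⟪e j, covRes z x (e j)⟫ -
      ∫ x, ⟪e j, covRes z x (e j)⟫ ∂ν)|} = 0 := by
    refine measure_mono_null (t := {x | ¬ x = x₀}) (fun x hx hx0 => ?_) (ae_iff.1 hae)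
    simp only [Set.mem_ofPred_eq, hint, hx0, sub_self, mul_zero, Finset.sum_const_zero,
      abs_zero] at hx
    linarith
  rw [measureReal_def, h0, ENNReal.toReal_zero]

/-- Concentration of the weighted sums of quadratic forms, for every exponent. -/
lemma exists_weighted_tail_le_of_pos {ε q B κ K : ℝ} (hε : 0 < ε) (hq : 0 < q)
    (hB : 1 ≤ B) (hκ : 0 < κ) (hK : 1 ≤ K) (N : ℕ) :
    ∃ C c : ℝ, 0 ≤ C ∧ 0 < c ∧ ∀ {p n k : ℕ} (μ : Fin k → Measure (EuclideanSpace ℝ (Fin p)))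
      [∀ l, IsProbabilityMeasure (μ l)] (z₀ z : ℝ) (cls : Fin n → Fin k), 0 < n → k ≤ N →
      0 < z₀ → z₀ < 1 → z₀ ≤ z → (∀ l, ConcLaw (μ l) q ε B K) →
      (∀ l, κ * √n ≤ classSize cls l) →
      ∀ {ι : Type} [Fintype ι] (e : ι → EuclideanSpace ℝ (Fin p)) (w : ι → ℝ),
      (∀ j, ‖e j‖ ≤ 1) → ∑ j, |w j| ≤ 1 → ∀ t : ℝ, 0 < t →
      (Measure.pi fun i => μ (cls i)).real {x | t ≤ |∑ j, w j * (⟪e j, covRes z x (e j)⟫ -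
        ∫ x, ⟪e j, covRes z x (e j)⟫ ∂(Measure.pi fun i => μ (cls i)))|} ≤
      C * Real.exp (-((z₀ ^ 4 * √n * t / (1 + p / n) ^ 2) ^ q / c)) := by
  rcases le_or_gt q 2 with hq2 | hq2
  · exact exists_weighted_tail_le hε hq hq2 hB hκ hK N
  · refine ⟨0, 1, le_rfl, one_pos, ?_⟩
    intro p n k μ _ z₀ z cls _ _ _ _ _ h _ ι _ e w _ _ t ht
    rw [measureReal_weighted_eq_zero hε hq2 μ h cls z e w ht, zero_mul]

/-! ### Linear forms on symmetric matrices -/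

variable {p : ℕ}

lemma norm_le_of_inner_matOp_le {M : Matrix (Fin p) (Fin p) ℝ} {C : ℝ} (hC : 0 ≤ C)
    (h : ∀ u v : EuclideanSpace ℝ (Fin p), ‖u‖ ≤ 1 → ‖v‖ ≤ 1 → |⟪u, matOp M v⟫| ≤ C) :
    ‖M‖ ≤ C := by
  have e : ‖M‖ = ‖matOp M‖ := rfl
  rw [e]
  refine ContinuousLinearMap.opNorm_le_of_unit_norm hC fun v hv => ?_
  rcases (norm_nonneg (matOp M v)).eq_or_lt with h0 | h0
  · rw [← h0]; exact hC
  have h1 := h (‖matOp M v‖⁻¹ • matOp M v) v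
    (by rw [norm_smul, norm_inv, norm_norm, inv_mul_cancel₀ h0.ne']) hv.le
  rw [real_inner_smul_left, real_inner_self_eq_norm_sq, pow_two, ← mul_assoc,
    inv_mul_cancel₀ h0.ne', one_mul] at h1
  exact (le_abs_self _).trans h1

lemma inner_single_matOp_single (M : Matrix (Fin p) (Fin p) ℝ) (a b : Fin p) :
    ⟪EuclideanSpace.single a (1 : ℝ), matOp M (EuclideanSpace.single b 1)⟫ = M a b := by
  rw [EuclideanSpace.inner_single_left, matOp_apply]
  simp

/-- The matrix `∑ⱼ sⱼ eⱼ eⱼᵀ`. -/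
noncomputable def rankOneSum (e : Fin p → EuclideanSpace ℝ (Fin p)) (s : Fin p → ℝ) :
    Matrix (Fin p) (Fin p) ℝ :=
  Matrix.of fun a b => ∑ j, s j * (e j a * e j b)

lemma inner_matOp_rankOneSum (e : Fin p → EuclideanSpace ℝ (Fin p)) (s : Fin p → ℝ)
    (u v : EuclideanSpace ℝ (Fin p)) :
    ⟪u, matOp (rankOneSum e s) v⟫ = ∑ j, s j * (⟪u, e j⟫ * ⟪e j, v⟫) := by
  rw [inner_matOp]
  have hR : ∀ j, ⟪u, e j⟫ * ⟪e j, v⟫ = ∑ a, ∑ b, u a * e j a * (e j b * v b) := fun j => by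
    rw [real_inner_comm (e j) u, real_inner_comm v (e j)]
    simp only [PiLp.inner_apply, RCLike.inner_apply, conj_trivial, Finset.sum_mul_sum]
  simp only [hR]
  simp only [rankOneSum, Matrix.of_apply, Finset.mul_sum, Finset.sum_mul]
  rw [Finset.sum_congr rfl fun a _ => Finset.sum_comm, Finset.sum_comm]
  refine Finset.sum_congr rfl fun j _ => Finset.sum_congr rfl fun a _ =>
    Finset.sum_congr rfl fun b _ => ?_
  ring

lemma matrix_eq_of_inner {M N : Matrix (Fin p) (Fin p) ℝ}
    (h : ∀ u v : EuclideanSpace ℝ (Fin p), ⟪u, matOp M v⟫ = ⟪u, matOp N v⟫) : M = N := by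
  ext a b
  rw [← inner_single_matOp_single M, ← inner_single_matOp_single N, h]

lemma isHermitian_eq_rankOneSum {U : Matrix (Fin p) (Fin p) ℝ} (hU : U.IsHermitian) :
    U = rankOneSum (fun j => hU.eigenvectorBasis j) hU.eigenvalues := by
  refine matrix_eq_of_inner fun u v => ?_
  rw [inner_matOp_rankOneSum]
  conv_lhs => rw [← hU.eigenvectorBasis.sum_repr' v]
  rw [map_sum, inner_sum]
  refine Finset.sum_congr rfl fun j _ => ?_
  have e : matOp U (hU.eigenvectorBasis j) = hU.eigenvalues j • hU.eigenvectorBasis j := by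
    have h1 := hU.mulVec_eigenvectorBasis j
    ext a
    rw [matOp_apply]
    have h2 := congrFun h1 a
    simpa [Matrix.mulVec, dotProduct] using h2
  rw [map_smul, e, inner_smul_right, inner_smul_right]
  ring

lemma norm_rankOneSum_le (b : OrthonormalBasis (Fin p) ℝ (EuclideanSpace ℝ (Fin p)))
    {s : Fin p → ℝ} (hs : ∀ j, |s j| ≤ 1) : ‖rankOneSum (fun j => b j) s‖ ≤ 1 := by
  refine norm_le_of_inner_matOp_le zero_le_one fun u v hu hv => ?_
  rw [inner_matOp_rankOneSum]
  have hP : ∀ w : EuclideanSpace ℝ (Fin p), ∑ j, ⟪b j, w⟫ ^ 2 = ‖w‖ ^ 2 := fun w => by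
    have := b.sum_sq_norm_inner_right w
    simpa using this
  calc _ ≤ ∑ j, (⟪b j, u⟫ ^ 2 + ⟪b j, v⟫ ^ 2) / 2 := by
        refine (Finset.abs_sum_le_sum_abs _ _).trans (Finset.sum_le_sum fun j _ => ?_)
        rw [abs_mul, abs_mul, real_inner_comm]
        have h1 : |s j| * (|⟪b j, u⟫| * |⟪b j, v⟫|) ≤ 1 * (|⟪b j, u⟫| * |⟪b j, v⟫|) := by
          gcongr; exact hs j
        nlinarith [sq_nonneg (|⟪b j, u⟫| - |⟪b j, v⟫|), sq_abs ⟪b j, u⟫, sq_abs ⟪b j, v⟫]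
    _ = (‖u‖ ^ 2 + ‖v‖ ^ 2) / 2 := by
        rw [← Finset.sum_div, Finset.sum_add_distrib, hP, hP]
    _ ≤ 1 := by
        have h1 : ‖u‖ ^ 2 ≤ 1 := pow_le_one₀ (norm_nonneg _) hu
        have h2 : ‖v‖ ^ 2 ≤ 1 := pow_le_one₀ (norm_nonneg _) hv
        linarith

lemma linear_form_eq_sum (u : Matrix (Fin p) (Fin p) ℝ →L[ℝ] ℝ) (M : Matrix (Fin p) (Fin p) ℝ) :
    u M = ∑ a, ∑ b, M a b * u (Matrix.single a b 1) := by
  conv_lhs => rw [Matrix.matrix_eq_sum_single M]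
  simp only [map_sum]
  refine Finset.sum_congr rfl fun a _ => Finset.sum_congr rfl fun b _ => ?_
  have : Matrix.single a b (M a b) = M a b • Matrix.single a b (1 : ℝ) := by
    rw [Matrix.smul_single, smul_eq_mul, mul_one]
  rw [this, map_smul, smul_eq_mul]

/-- On symmetric matrices, a linear form of norm at most one for the spectral norm is a combination
of quadratic forms at unit vectors, of total weight at most one. -/
lemma exists_linear_form_eq_sum_inner (u : Matrix (Fin p) (Fin p) ℝ →L[ℝ] ℝ) (hu : ‖u‖ ≤ 1) :
    ∃ (e : Fin p → EuclideanSpace ℝ (Fin p)) (w : Fin p → ℝ), (∀ j, ‖e j‖ ≤ 1) ∧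
      ∑ j, |w j| ≤ 1 ∧ ∀ M : Matrix (Fin p) (Fin p) ℝ, (∀ a b, M a b = M b a) →
        u M = ∑ j, w j * ⟪e j, matOp M (e j)⟫ := by
  -- On symmetric matrices u is the trace form of its symmetrised coefficient matrix, which can be
  -- diagonalised; the weights are its eigenvalues.
  set U : Matrix (Fin p) (Fin p) ℝ := Matrix.of fun a b =>
    (u (Matrix.single a b 1) + u (Matrix.single b a 1)) / 2 with hUdef
  have hU : U.IsHermitian := by
    ext a b
    simp only [Matrix.conjTranspose_apply, hUdef, Matrix.of_apply, star_trivial]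
    ring
  have hrep : ∀ M : Matrix (Fin p) (Fin p) ℝ, (∀ a b, M a b = M b a) →
      u M = ∑ j, hU.eigenvalues j * ⟪hU.eigenvectorBasis j, matOp M (hU.eigenvectorBasis j)⟫ := by
    intro M hM
    have h1 : u M = ∑ a, ∑ b, M a b * U a b := by
      have h2 := linear_form_eq_sum u M
      have h3 : u M = ∑ a, ∑ b, M a b * u (Matrix.single b a 1) := by
        rw [h2, Finset.sum_comm]
        exact Finset.sum_congr rfl fun a _ => Finset.sum_congr rfl fun b _ => by rw [hM]
      have h4 : u M = (u M + u M) / 2 := by ring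
      rw [h4]
      nth_rewrite 1 [h2]
      rw [h3, ← Finset.sum_add_distrib, Finset.sum_div]
      refine Finset.sum_congr rfl fun a _ => ?_
      rw [← Finset.sum_add_distrib, Finset.sum_div]
      refine Finset.sum_congr rfl fun b _ => ?_
      simp only [hUdef, Matrix.of_apply]
      ring
    have h5 : ∀ a b, U a b = ∑ j, hU.eigenvalues j *
        (hU.eigenvectorBasis j a * hU.eigenvectorBasis j b) := fun a b => by
      have := congrFun (congrFun (isHermitian_eq_rankOneSum hU) a) b
      simpa only [rankOneSum, Matrix.of_apply] using this
    rw [h1]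
    simp only [inner_matOp, h5, Finset.mul_sum]
    rw [Finset.sum_congr rfl fun a _ => Finset.sum_comm, Finset.sum_comm]
    refine Finset.sum_congr rfl fun j _ => Finset.sum_congr rfl fun a _ =>
      Finset.sum_congr rfl fun b _ => ?_
    ring
  refine ⟨fun j => hU.eigenvectorBasis j, hU.eigenvalues, fun j => by simp, ?_, hrep⟩
  -- Duality of trace and spectral norms: the sign matrix S of U has spectral norm at most one, and
  -- u S is the sum of the absolute eigenvalues.
  set s : Fin p → ℝ := fun j => if 0 ≤ hU.eigenvalues j then 1 else -1 with hs
  have hs1 : ∀ j, |s j| ≤ 1 := fun j => by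
    simp only [hs]; split_ifs <;> simp
  set S := rankOneSum (fun j => hU.eigenvectorBasis j) s with hS
  have hSsym : ∀ a b, S a b = S b a := fun a b => by
    simp only [hS, rankOneSum, Matrix.of_apply]
    exact Finset.sum_congr rfl fun j _ => by ring
  have h1 : ∀ j, ⟪hU.eigenvectorBasis j, matOp S (hU.eigenvectorBasis j)⟫ = s j := by
    intro j
    rw [hS, inner_matOp_rankOneSum, Finset.sum_eq_single j]
    · rw [real_inner_self_eq_norm_sq]; simp
    · intro l _ hl
      rw [hU.eigenvectorBasis.orthonormal.2 hl, mul_zero, mul_zero]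
    · simp
  have h2 : ∑ j, |hU.eigenvalues j| = u S := by
    rw [hrep S hSsym]
    refine Finset.sum_congr rfl fun j _ => ?_
    rw [h1]
    simp only [hs]
    split_ifs with h
    · rw [abs_of_nonneg h, mul_one]
    · rw [abs_of_neg (not_le.1 h)]; ring
  rw [h2]
  calc u S ≤ ‖u S‖ := le_abs_self _
    _ ≤ ‖u‖ * ‖S‖ := u.le_opNorm S
    _ ≤ 1 * 1 := mul_le_mul hu (norm_rankOneSum_le _ hs1) (norm_nonneg _) zero_le_one
    _ = 1 := one_mul 1

end SampleCov

/-! ### From the product space to the given probability space. -/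

namespace SampleCov

lemma looTrace_nonneg {p n : ℕ} {m : Fin n → Measure (EuclideanSpace ℝ (Fin p))} {z : ℝ}
    (hz : 0 < z) (i : Fin n) (x : Fin n → EuclideanSpace ℝ (Fin p)) : 0 ≤ looTrace m z i x :=
  mul_nonneg (by positivity) (integral_nonneg fun y =>
    (isGramResolvent_covRes hz (Function.update x i 0)).inner_nonneg (by positivity) hz y)

lemma resolvent_sampleCov_symm {p n : ℕ} {z : ℝ} (hz : 0 < z)
    (x : Fin n → EuclideanSpace ℝ (Fin p)) (a b : Fin p) :
    resolvent (sampleCov x) z a b = resolvent (sampleCov x) z b a := by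
  rw [← inner_single_matOp_single (resolvent (sampleCov x) z),
    ← inner_single_matOp_single (resolvent (sampleCov x) z)]
  exact ((isGramResolvent_covRes hz x).symm _ _).symm.trans (real_inner_comm _ _)

lemma exists_concLaw_const {C₀ c₀ q : ℝ} (M : ℝ) (hC₀ : 0 ≤ C₀) (hc₀ : 0 < c₀) (hq : 0 < q) :
    ∃ ε B K : ℝ, 0 < ε ∧ 1 ≤ B ∧ 1 ≤ K ∧ ∀ {p : ℕ} (μ : Measure (EuclideanSpace ℝ (Fin p)))
      [IsProbabilityMeasure μ], (∀ m : ℕ, ConvexlyConcentrated (iidMatrixLaw μ m)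
        (fun t => C₀ * Real.exp (-(t ^ q / c₀)))) → ‖∫ y, y ∂μ‖ ≤ M * √p → ConcLaw μ q ε B K := by
  obtain ⟨ε, B, hε, hB, H⟩ := exists_columnConc_const hC₀ hc₀ hq
  obtain ⟨D, hD1, hD⟩ := exists_pow_le_exp_rpow_uniform hε hq
  have hDB : 0 ≤ D * B := by positivity
  -- D B serves the centred moments, M² the squared norm of the mean, and 1 the normalisation K ≥ 1.
  refine ⟨ε, B, D * B + M ^ 2 + 1, hε, hB, by nlinarith [sq_nonneg M], fun {p} μ _ h hM => ?_⟩
  have hDK : D * B ≤ D * B + M ^ 2 + 1 := by nlinarith [sq_nonneg M]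
  refine ⟨(H μ 1 (h 1)).columnMoments hD1 hD (by nlinarith [sq_nonneg M]) hDK ?_,
    fun m => H μ m (h m), D, by linarith, hD, hDK⟩
  calc _ ≤ (M * √p) ^ 2 := by gcongr
    _ = M ^ 2 * p := by rw [mul_pow, Real.sq_sqrt (Nat.cast_nonneg _)]
    _ ≤ _ := by gcongr; linarith

section Law

variable {p n k : ℕ} {Ω : Type*} [MeasurableSpace Ω] {P : Measure Ω}
  {x : Fin n → Ω → EuclideanSpace ℝ (Fin p)}

lemma matrixExpectation_comp {ν : Measure (Fin n → EuclideanSpace ℝ (Fin p))}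
    (hx : ∀ i, Measurable (x i)) (hν : P.map (fun ω i => x i ω) = ν)
    {f : (Fin n → EuclideanSpace ℝ (Fin p)) → Matrix (Fin p) (Fin p) ℝ}
    (hf : ∀ a b, Measurable fun x => f x a b) :
    matrixExpectation P (fun ω => f fun i => x i ω) = matrixExpectation ν f := by
  ext a b
  rw [matrixExpectation, matrixExpectation, Matrix.of_apply, Matrix.of_apply, ← hν,
    integral_map (measurable_pi_lambda _ hx).aemeasurable (hf a b).aestronglyMeasurable]

lemma delta_comp {ν : Measure (Fin n → EuclideanSpace ℝ (Fin p))}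
    (hx : ∀ i, Measurable (x i)) (hν : P.map (fun ω i => x i ω) = ν) {z : ℝ} (hz : 0 < z)
    (μ : Fin k → Measure (EuclideanSpace ℝ (Fin p))) (rep : Fin k → Fin n) :
    delta P μ x rep z = delta ν μ (fun i x => x i) rep z := by
  funext l
  rw [delta, delta]
  congr 3
  refine matrixExpectation_comp hx hν (f := fun x => resolvent (sampleCovWithout x (rep l)) z)
    fun a b => ?_
  simp only [sampleCovWithout_eq]
  exact (bddMeas_resolvent_entry hz a b).1.comp (measurable_update_left (a := rep l) (x := 0))

lemma map_eq_pi {μ : Fin n → Measure (EuclideanSpace ℝ (Fin p))} [IsProbabilityMeasure P]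
    (hx : ∀ i, Measurable (x i)) (hind : iIndepFun x P) (hlaw : ∀ i, P.map (x i) = μ i) :
    P.map (fun ω i => x i ω) = Measure.pi μ := by
  rw [(iIndepFun_iff_map_fun_eq_pi_map fun i => (hx i).aemeasurable).1 hind]
  simp only [hlaw]

end Law

section Product

variable {p n k : ℕ} {μ : Fin k → Measure (EuclideanSpace ℝ (Fin p))}
  [∀ l, IsProbabilityMeasure (μ l)] {q ε B K κ z₀ z : ℝ}

lemma norm_matrixExpectation_sub_le (hn : 0 < n) (hz₀ : 0 < z₀) (hz₁ : z₀ < 1) (hz : z₀ ≤ z)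
    (h : ∀ l, ConcLaw (μ l) q ε B K) (hκ : 0 < κ) {N : ℕ} (hk : k ≤ N) (cls : Fin n → Fin k)
    (hcls : ∀ l, κ * √n ≤ classSize cls l) (rep : Fin k → Fin n) (hrep : ∀ l, cls (rep l) = l) :
    ‖matrixExpectation (Measure.pi fun i => μ (cls i)) (fun x => resolvent (sampleCov x) z) -
      resolvent (weightedCov μ cls
        (delta (Measure.pi fun i => μ (cls i)) μ (fun i x => x i) rep z)) z‖ ≤
      N * |biasConst K κ| * (1 + (p : ℝ) / n) ^ 2 / (z₀ ^ 4 * √n) := by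
  have hz' : 0 < z := hz₀.trans_le hz
  have hn' : (0 : ℝ) < n := by exact_mod_cast hn
  have hs : 0 < √(n : ℝ) := Real.sqrt_pos.2 hn'
  set δ := delta (Measure.pi fun i => μ (cls i)) μ (fun i x => x i) rep z with hδdef
  have hδl : ∀ l, δ l = _ := delta_pi_eq hz' (fun l => (h l).moments) cls rep hrep
  have hδ0 : ∀ l, 0 ≤ δ l := fun l => by
    rw [hδl]; exact integral_nonneg fun x => looTrace_nonneg hz' _ x
  have hδ : ∀ i, δ (cls i) = ∫ x, looTrace (fun i => μ (cls i)) z i x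
      ∂(Measure.pi fun i => μ (cls i)) := fun i => by
    rw [hδl]; exact integral_looTrace_eq hz' (by simp only [hrep])
  refine norm_le_of_inner_matOp_le (by positivity) fun u v hu hv => ?_
  have e : ⟪u, matOp (matrixExpectation (Measure.pi fun i => μ (cls i))
      (fun x => resolvent (sampleCov x) z) - resolvent (weightedCov μ cls δ) z) v⟫ =
      ∫ x, ⟪u, covRes z x v⟫ ∂(Measure.pi fun i => μ (cls i)) -
        ⟪u, matOp (resolvent (weightedCov μ cls δ) z) v⟫ := by
    have h1 := inner_matOp_matrixExpectation (P := Measure.pi fun i => μ (cls i))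
      (M := fun x => resolvent (sampleCov x) z)
      (fun a b => (bddMeas_resolvent_entry hz' a b).integrable _) u v
    simp only [covRes]
    rw [← h1, ← inner_sub_right]
    congr 1
    ext a
    simp only [PiLp.sub_apply, matOp_apply, Matrix.sub_apply, sub_mul, Finset.sum_sub_distrib]
  rw [e]
  refine (abs_integral_inner_covRes_sub_le hn hz₀ hz₁ hz h hκ cls hcls hδ hδ0 hu hv).trans ?_
  -- The bias bound has only z₀³ in the denominator; one power is given away to match the
  -- concentration rate.
  have h3 : z₀ ^ 4 ≤ z₀ ^ 3 := pow_le_pow_of_le_one hz₀.le hz₁.le (by norm_num)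
  have hkN : (k : ℝ) ≤ N := by exact_mod_cast hk
  rw [mul_div_assoc]
  have h4 : k * biasConst K κ ≤ N * |biasConst K κ| :=
    (mul_le_mul_of_nonneg_left (le_abs_self _) (Nat.cast_nonneg k)).trans (by gcongr)
  gcongr

lemma abs_form_sub_le {u : Matrix (Fin p) (Fin p) ℝ →L[ℝ] ℝ} (hu : ‖u‖ ≤ 1)
    (A B : Matrix (Fin p) (Fin p) ℝ) : |u A - u B| ≤ ‖A - B‖ := by
  rw [← map_sub, ← Real.norm_eq_abs]
  exact (u.le_of_opNorm_le hu _).trans_eq (one_mul _)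

lemma form_sub_form_matrixExpectation {u : Matrix (Fin p) (Fin p) ℝ →L[ℝ] ℝ}
    {ρ : Measure (Fin n → EuclideanSpace ℝ (Fin p))} [IsProbabilityMeasure ρ] (hz : 0 < z)
    {e : Fin p → EuclideanSpace ℝ (Fin p)} {w : Fin p → ℝ}
    (hu : ∀ M : Matrix (Fin p) (Fin p) ℝ, (∀ a b, M a b = M b a) →
      u M = ∑ j, w j * ⟪e j, matOp M (e j)⟫) (x : Fin n → EuclideanSpace ℝ (Fin p)) :
    u (resolvent (sampleCov x) z) -
        u (matrixExpectation ρ fun x => resolvent (sampleCov x) z) =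
      ∑ j, w j * (⟪e j, covRes z x (e j)⟫ - ∫ x, ⟪e j, covRes z x (e j)⟫ ∂ρ) := by
  rw [hu _ (resolvent_sampleCov_symm hz x), hu _ fun a b => by
    simp only [matrixExpectation, Matrix.of_apply, resolvent_sampleCov_symm hz _ a b],
    ← Finset.sum_sub_distrib]
  refine Finset.sum_congr rfl fun j _ => ?_
  rw [inner_matOp_matrixExpectation fun a b => (bddMeas_resolvent_entry hz a b).integrable _]
  simp only [covRes]
  ring

end Product

/-- As long as s t ≤ 2 Cb the constant C makes the right side at least one. Beyond that, t exceeds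
twice the bias, so t/2 is left for the deviation from the expectation; this halving costs 2^q in the
rate. -/
lemma le_exp_bound {Cb Ct ct q : ℝ} (hq : 0 < q) (hct : 0 < ct) {s t m : ℝ}
    (hs : 0 ≤ s) (ht : 0 ≤ t) (hm1 : m ≤ 1)
    (hm : 2 * Cb < s * t → m ≤ Ct * Real.exp (-((s * (t / 2)) ^ q / ct))) {C : ℝ} (hC : Ct ≤ C)
    (hC' : Real.exp ((2 * Cb) ^ q / (2 ^ q * ct)) ≤ C) :
    m ≤ C * Real.exp (-((s * t) ^ q / (2 ^ q * ct))) := by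
  have h2 : (0 : ℝ) < 2 ^ q := by positivity
  have hC0 : 0 ≤ C := (Real.exp_pos _).le.trans hC'
  rcases le_or_gt (s * t) (2 * Cb) with h | h
  · refine hm1.trans ?_
    calc (1 : ℝ) = Real.exp ((2 * Cb) ^ q / (2 ^ q * ct)) *
          Real.exp (-((2 * Cb) ^ q / (2 ^ q * ct))) := by rw [← Real.exp_add]; simp
      _ ≤ _ := by
        have : (s * t) ^ q ≤ (2 * Cb) ^ q := Real.rpow_le_rpow (by positivity) h hq.le
        gcongr
  · refine (hm h).trans ?_
    have e : (s * (t / 2)) ^ q / ct = (s * t) ^ q / (2 ^ q * ct) := by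
      rw [← mul_div_assoc, Real.div_rpow (by positivity) (by norm_num), div_div]
    rw [e]
    gcongr

end SampleCov

theorem mainTheorem3 (C₀ c₀ q M κ : ℝ) (K : ℕ)
    (hC₀ : Real.exp 1 ≤ C₀) (hc₀ : 0 < c₀) (hq : 0 < q) (hκ : 0 < κ) :
    ∃ C c : ℝ, Real.exp 1 ≤ C ∧ 0 < c ∧
      ∀ (p n k : ℕ), 0 < n → k ≤ K →
      ∀ (μ : Fin k → Measure (EuclideanSpace ℝ (Fin p))), (∀ l, IsProbabilityMeasure (μ l)) →
      (∀ (m : ℕ) (l : Fin k), SampleCov.ConvexlyConcentrated (SampleCov.iidMatrixLaw (μ l) m)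
        fun t => C₀ * Real.exp (-(t ^ q / c₀))) →
      ((∀ l, ∫ y, ‖y‖ ∂(μ l) ≤ M * √(p : ℝ)) ∨
        (2 ≤ q ∧ ∀ l, ‖∫ y, y ∂(μ l)‖ ≤ M * √(p : ℝ))) →
      ∀ (cls : Fin n → Fin k), (∀ l, κ * √(n : ℝ) ≤ (SampleCov.classSize cls l : ℝ)) →
      ∀ (rep : Fin k → Fin n), (∀ l, cls (rep l) = l) →
      ∀ {Ω : Type*} [MeasurableSpace Ω] (P : Measure Ω) [IsProbabilityMeasure P]
        (x : Fin n → Ω → EuclideanSpace ℝ (Fin p)), (∀ i, Measurable (x i)) →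
        iIndepFun x P → (∀ i, P.map (x i) = μ (cls i)) →
      ∀ z₀ z : ℝ, 0 < z₀ → z₀ < 1 → z₀ ≤ z →
        let Q : Ω → Matrix (Fin p) (Fin p) ℝ := fun ω =>
          SampleCov.resolvent (SampleCov.sampleCov fun i => x i ω) z
        let Qδ : Matrix (Fin p) (Fin p) ℝ :=
          SampleCov.resolvent
            (SampleCov.weightedCov μ cls (SampleCov.delta P μ x rep z)) z
        let γbar : ℝ := 1 + (p : ℝ) / n
        ‖SampleCov.matrixExpectation P Q - Qδ‖ ≤ C * γbar ^ 2 / (z₀ ^ 4 * √(n : ℝ)) ∧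
        SampleCov.LinearlyConcentrated P Q Qδ fun t =>
          C * Real.exp (-((z₀ ^ 4 * √(n : ℝ) * t / γbar ^ 2) ^ q / c)) := by
  have hC₀' : 0 ≤ C₀ := (Real.exp_pos _).le.trans hC₀
  obtain ⟨ε, B, K', hε, hB, hK', hconc⟩ := SampleCov.exists_concLaw_const M hC₀' hc₀ hq
  obtain ⟨Ct, ct, hCt, hct, htail⟩ :=
    SampleCov.exists_weighted_tail_le_of_pos hε hq hB hκ hK' K
  set Cb : ℝ := K * |SampleCov.biasConst K' κ|
  have hCb : 0 ≤ Cb := by positivity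
  set C : ℝ := Real.exp 1 + Cb + Ct + Real.exp ((2 * Cb) ^ q / (2 ^ q * ct)) with hCdef
  have h1 := Real.exp_pos 1
  have h2 := Real.exp_pos ((2 * Cb) ^ q / (2 ^ q * ct))
  refine ⟨C, 2 ^ q * ct, by linarith, by positivity, ?_⟩
  intro p n k hn hk μ hμ hconv hmean cls hcls rep hrep Ω _ P _ x hx hind hlaw z₀ z hz₀ hz₁ hz
  have hz' : 0 < z := hz₀.trans_le hz
  have hn' : (0 : ℝ) < n := by exact_mod_cast hn
  have hs : 0 < √(n : ℝ) := Real.sqrt_pos.2 hn'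
  -- Either alternative of the hypothesis yields ‖E y‖ ≤ M√p, the first one because the norm of an
  -- integral is at most the integral of the norm.
  have hμ' : ∀ l, SampleCov.ConcLaw (μ l) q ε B K' := fun l =>
    hconc (μ l) (fun m => hconv m l) <| hmean.elim
      (fun h => (norm_integral_le_integral_norm _).trans (h l)) fun h => h.2 l
  have hν := SampleCov.map_eq_pi (μ := fun i => μ (cls i)) hx hind hlaw
  intro Q Qδ γbar
  have hγ : 0 < γbar := by positivity
  have hEQ : SampleCov.matrixExpectation P Q = _ :=
    SampleCov.matrixExpectation_comp hx hν
      (f := fun x => SampleCov.resolvent (SampleCov.sampleCov x) z)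
      fun a b => (SampleCov.bddMeas_resolvent_entry hz' a b).1
  have hbias := SampleCov.norm_matrixExpectation_sub_le hn hz₀ hz₁ hz hμ' hκ hk cls hcls rep hrep
  rw [← hEQ, ← SampleCov.delta_comp hx hν hz'] at hbias
  refine ⟨hbias.trans ?_, fun u hu t ht => ?_⟩
  · have hCbC : Cb ≤ C := by linarith
    gcongr
  obtain ⟨e, w, he, hw, hsum⟩ := SampleCov.exists_linear_form_eq_sum_inner u hu
  have hmeas : Measurable fun y : Fin n → EuclideanSpace ℝ (Fin p) =>
      u (SampleCov.resolvent (SampleCov.sampleCov y) z) :=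
    (u.continuous.comp (SampleCov.continuous_resolvent_sampleCov hz')).measurable
  have hset : P {ω | t ≤ |u (Q ω) - u Qδ|} = (Measure.pi fun i => μ (cls i))
      {y | t ≤ |u (SampleCov.resolvent (SampleCov.sampleCov y) z) - u Qδ|} := by
    have hS : MeasurableSet
        {y | t ≤ |u (SampleCov.resolvent (SampleCov.sampleCov y) z) - u Qδ|} :=
      measurableSet_le measurable_const (hmeas.sub_const _).norm
    rw [← hν, Measure.map_apply (measurable_pi_lambda _ hx) hS]
    rfl
  rw [hset, ← ofReal_measureReal]
  refine ENNReal.ofReal_le_ofReal ?_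
  have hst : ∀ t : ℝ, z₀ ^ 4 * √(n : ℝ) * t / γbar ^ 2 = z₀ ^ 4 * √(n : ℝ) / γbar ^ 2 * t :=
    fun t => by ring
  beta_reduce
  rw [hst]
  refine SampleCov.le_exp_bound (Cb := Cb) (Ct := Ct) hq hct (by positivity) ht.le
    measureReal_le_one (fun hlt => ?_) (by linarith) (by linarith)
  rw [← hst]
  refine le_trans (measureReal_mono fun y hy => ?_)
    (htail μ z₀ z cls hn hk hz₀ hz₁ hz hμ' hcls e w he hw (t / 2) (by linarith))
  rw [Set.mem_ofPred_eq] at hy ⊢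
  rw [← SampleCov.form_sub_form_matrixExpectation hz' hsum, ← hEQ]
  have h3 := (SampleCov.abs_form_sub_le hu _ _).trans hbias
  -- Past the threshold of `le_exp_bound` the bias uses at most half of t.
  have h4 : Cb * γbar ^ 2 / (z₀ ^ 4 * √(n : ℝ)) ≤ t / 2 := by
    rw [div_mul_eq_mul_div, lt_div_iff₀ (by positivity)] at hlt
    rw [div_le_div_iff₀ (by positivity) (by norm_num)]
    linarith
  have h5 := abs_sub_le (u (SampleCov.resolvent (SampleCov.sampleCov y) z))
    (u (SampleCov.matrixExpectation P Q)) (u Qδ)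
  linarith
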